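/- Let $n\ge 1$, let $D\subset\mathbb C^n$ be a bounded domain with $C^k$ boundary $bD$, $k\ge 3$, and let $\varphi$ be a $C^k$ defining function for $D$ on a neighborhood $U$ of $bD$, that is, $D\cap U=\{z\in U:\varphi(z)<0\}$ and $d\varphi\neq 0$ on $bD$. Assume that $D$ is (Levi) pseudoconvex: for all $\zeta\in bD$, $\sum_{j,l}\frac{\partial^2\varphi}{\partial\zeta_j\partial\bar\zeta_l}(\zeta)t_j\bar t_l\ge 0$ for all $t\in\mathbb C^n$ with $\sum_j\frac{\partial\varphi}{\partial\zeta_j}(\zeta)t_j=0$. For $C,K,\varepsilon>0$ and a $C^\infty$ function $\chi:\mathbb R\to[0,1]$ with $\chi(t)=1$ for $t\le\varepsilon/2$ and $\chi(t)=0$ for $t\ge\frac34\varepsilon$, put $r(z)=\varphi(z)e^{-C|z|^2}$, $$F(\zeta,z)=\sum_j\frac{\partial r}{\partial\zeta_j}(\zeta)(\zeta_j-z_j)-\frac12\sum_{j,l}\frac{\partial^2 r}{\partial\zeta_j\partial\zeta_l}(\zeta)(\zeta_j-z_j)(\zeta_l-z_l),$$ $$\Phi_K(\zeta,z)=F(\zeta,z)-r(\zeta)+K|\zeta-z|^3,$$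 $$g_j(\zeta,z)=\frac{\partial r}{\partial\zeta_j}(\zeta)-\frac12\sum_l\frac{\partial^2 r}{\partial\zeta_j\partial\zeta_l}(\zeta)(\zeta_l-z_l)+K|\zeta-z|\,\overline{(\zeta_j-z_j)},$$ and, with $\chi=\chi(|\zeta-z|)$, $$S=\chi\,\Phi_K+(1-\chi)|\zeta-z|^2,\qquad s_j=\chi\, g_j+(1-\chi)\overline{(\zeta_j-z_j)},\qquad W^S=\frac{\sum_j s_j\,d\zeta_j}{S}.$$ For a generating form $W=\sum_j w_j(\zeta,z)\,d\zeta_j$ let $\Omega_0(W)=(2\pi i)^{-n}\,W\wedge(\bar\partial_\zeta W)^{n-1}$. Set $T^S(f)(z)=\int_{bD}f(\zeta)\,\Omega_0(W^S)(\zeta,z)$ for $z\in D$, where $bD$ carries the boundary orientation. Let $|f|_0=\sup_{bD}|f|$ and $|\bar\partial u|^2=\sum_j|\partial u/\partial\bar z_j|^2$. Then for all sufficiently large $C$ (depending on $D$, $\varphi$), all sufficiently large $K$ (depending also on $C$), all sufficiently small $\varepsilon>0$ (depending also on $K$), and all $\chi$ as above: (a) $S(\zeta,z)\ne0$ for all $\zeta\in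 bD$ and $z\in\overline D$ with $z\neq\zeta$; (b) for every $f$ continuous on $bD$, the integral defining $T^S(f)(z)$ converges absolutely for every $z\in D$, and $T^S(f)\in C^\infty(D)$; (c) for every real $\delta<2/3$ there is a constant $C_\delta$ such that for all $f$ continuous on $bD$ and all $z\in D$ $$|\bar\partial_z T^S(f)(z)|\le C_\delta\,|f|_0\,\operatorname{dist}(z,bD)^{\delta-1}.$$ In contrast, let $T^{BM}$ be the operator defined in the same way from the Bochner–Martinelli generating form $\sum_j\overline{(\zeta_j-z_j)}\,d\zeta_j/|\zeta-z|^2$. Then the estimate in (c) with $T^{BM}$ in place of $T^S$ holds for $\delta=0$, and if $n\ge2$ it holds for no $\delta>0$ (with any constant). -/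

import Mathlib

open scoped ContDiff MeasureTheory

noncomputable section

namespace CauchyFantappie

/-- Complex Euclidean space `ℂⁿ` of dimension `n = m + 1`, with the Euclidean norm. -/
abbrev Cn (m : ℕ) : Type := EuclideanSpace ℂ (Fin (m + 1))

variable {m : ℕ}

/-! ### Wirtinger derivatives and the Levi form -/

/-- `∂f/∂z_j = (1/2)(∂f/∂x_j - i ∂f/∂y_j)`. -/
def wirt (j : Fin (m + 1)) (f : Cn m → ℂ) (z : Cn m) : ℂ :=
  (1 / 2) * (fderiv ℝ f z (EuclideanSpace.single j 1)
    - Complex.I * fderiv ℝ f z (EuclideanSpace.single j Complex.I))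

/-- `∂f/∂z̄_j = (1/2)(∂f/∂x_j + i ∂f/∂y_j)`. -/
def wirtBar (j : Fin (m + 1)) (f : Cn m → ℂ) (z : Cn m) : ℂ :=
  (1 / 2) * (fderiv ℝ f z (EuclideanSpace.single j 1)
    + Complex.I * fderiv ℝ f z (EuclideanSpace.single j Complex.I))

/-- The `(0,1)`-form `∂̄f = ∑ (∂f/∂z̄_k) dz̄_k` at `z`, evaluated on the vector `v`. -/
def dbar (f : Cn m → ℂ) (z v : Cn m) : ℂ :=
  ∑ k, wirtBar k f z * (starRingEnd ℂ) (v k)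

/-- The pointwise norm `|∂̄f(z)| = (∑ |∂f/∂z̄_k (z)|²)^{1/2}`. -/
def dbarNorm (f : Cn m → ℂ) (z : Cn m) : ℝ :=
  Real.sqrt (∑ k, ‖wirtBar k f z‖ ^ 2)

/-- A real function regarded as a complex-valued one. -/
def cplx (ρ : Cn m → ℝ) : Cn m → ℂ := fun z => (ρ z : ℂ)

/-- The Levi form `∑ (∂²ρ/∂ζ_j∂ζ̄_k)(ζ) t_j t̄_k` (a real number for `ρ` real of class `C²`). -/
def leviForm (ρ : Cn m → ℝ) (ζ t : Cn m) : ℝ :=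
  (∑ j, ∑ k, wirt j (wirtBar k (cplx ρ)) ζ * t j * (starRingEnd ℂ) (t k)).re

/-- `φ` is a `C^k` defining function, on the neighborhood `U` of `bD`, for the open set `D`. -/
structure IsDefiningFunction (k : ℕ∞) (D U : Set (Cn m)) (φ : Cn m → ℝ) : Prop where
  isOpen : IsOpen U
  frontier_subset : frontier D ⊆ U
  contDiffOn : ContDiffOn ℝ k φ U
  inter_eq : D ∩ U = {z ∈ U | φ z < 0}
  fderiv_ne_zero : ∀ ζ ∈ frontier D, fderiv ℝ φ ζ ≠ 0

/-- (Levi) pseudoconvexity of `D`, in terms of a defining function `φ`: at each boundary point the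
Levi form is positive semidefinite on the complex tangent space. -/
def IsLeviPseudoconvex (D : Set (Cn m)) (φ : Cn m → ℝ) : Prop :=
  ∀ ζ ∈ frontier D, ∀ t : Cn m,
    ∑ j, wirt j (cplx φ) ζ * t j = 0 → 0 ≤ leviForm φ ζ t

/-! ### Cauchy–Fantappiè forms and their integrals over the boundary -/

/-- The `(1,0)`-form `∑ a_j dζ_j` evaluated on `v`. -/
def oneForm (a : Fin (m + 1) → ℂ) (v : Cn m) : ℂ := ∑ j, a j * v j

/-- For `W = ∑ w_j dζ_j`, the two-form `∂̄W = ∑ ∂̄w_j ∧ dζ_j` at `ζ`, evaluated on `(u, v)`. -/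
def dbarForm (w : Cn m → Fin (m + 1) → ℂ) (ζ u v : Cn m) : ℂ :=
  ∑ j, (dbar (fun η => w η j) ζ u * v j - dbar (fun η => w η j) ζ v * u j)

/-- `α ∧ β ∧ ⋯ ∧ β` (`m` factors `β`) for a one-form `α` and an alternating two-form `β`, evaluated
on `2m + 1` vectors; `(dx ∧ dy)(u, v) = dx(u) dy(v) - dx(v) dy(u)`. -/
def wedgePow (α : Cn m → ℂ) (β : Cn m → Cn m → ℂ) (v : Fin (2 * m + 1) → Cn m) : ℂ :=
  (1 / 2 ^ m) * ∑ σ : Equiv.Perm (Fin (2 * m + 1)),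
    ((Equiv.Perm.sign σ : ℤ) : ℂ) * α (v (σ ⟨0, by omega⟩)) *
      ∏ i : Fin m, β (v (σ ⟨2 * i + 1, by omega⟩)) (v (σ ⟨2 * i + 2, by omega⟩))

/-- The kernel `Ω₀(W) = (2πi)^{-n} W ∧ (∂̄_ζ W)^{n-1}`, `n = m + 1`, of `W = ∑ w_j dζ_j`, at `ζ`. -/
def omegaZero (w : Cn m → Fin (m + 1) → ℂ) (ζ : Cn m) (v : Fin (2 * m + 1) → Cn m) : ℂ :=
  (1 / (2 * Real.pi * Complex.I) ^ (m + 1)) * wedgePow (oneForm (w ζ)) (dbarForm w ζ) v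

/-- The positively oriented real orthonormal basis `∂/∂x_1, ∂/∂y_1, …, ∂/∂x_n, ∂/∂y_n`. -/
def realBasis (i : Fin (2 * m + 2)) : Cn m :=
  EuclideanSpace.single ⟨i / 2, by omega⟩ (if (i : ℕ) % 2 = 0 then 1 else Complex.I)

/-- The outward unit conormal `dφ / |dφ|` at `ζ`, evaluated on `v`. -/
def conormal (φ : Cn m → ℝ) (ζ v : Cn m) : ℝ := fderiv ℝ φ ζ v / ‖fderiv ℝ φ ζ‖

/-- The density `h`, with respect to surface measure, of the pull-back to `bD` of a `(2n-1)`-covector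
`θ` at `ζ ∈ bD`: `(dφ/|dφ|) ∧ θ = h dx_1 ∧ dy_1 ∧ ⋯ ∧ dx_n ∧ dy_n`. Equivalently, `h` is the value of
`θ` on an orthonormal basis of the tangent space of `bD` which is positive for the boundary
orientation. -/
def boundaryDensity (φ : Cn m → ℝ) (ζ : Cn m) (θ : (Fin (2 * m + 1) → Cn m) → ℂ) : ℂ :=
  ∑ i : Fin (2 * m + 2), (-1) ^ (i : ℕ) * (conormal φ ζ (realBasis i) : ℂ) *
    θ (fun l => realBasis (i.succAbove l))

/-- The integrand of `∫_{bD} f Ω₀(W(·, z))` with respect to surface measure. -/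
def cfIntegrand (φ : Cn m → ℝ) (w : Cn m → Cn m → Fin (m + 1) → ℂ) (f : Cn m → ℂ)
    (z ζ : Cn m) : ℂ :=
  f ζ * boundaryDensity φ ζ (omegaZero (fun η => w η z) ζ)

/-- `T(f)(z) = ∫_{bD} f(ζ) Ω₀(W)(ζ, z)` for `W(ζ, z) = ∑ w_j(ζ, z) dζ_j`. -/
def cfOperator (D : Set (Cn m)) (φ : Cn m → ℝ) (w : Cn m → Cn m → Fin (m + 1) → ℂ)
    (f : Cn m → ℂ) (z : Cn m) : ℂ :=
  ∫ ζ in frontier D, cfIntegrand φ w f z ζ ∂(μHE[2 * m + 1])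

/-- The supremum norm of `f` over `bD`. -/
def supNorm (D : Set (Cn m)) (f : Cn m → ℂ) : ℝ := sSup ((fun ζ => ‖f ζ‖) '' frontier D)

/-- There is a constant `C` such that `|∂̄ T(f)(z)| ≤ C |f|₀ dist(z, bD)^{δ - 1}` for all `f`
continuous on `bD` and all `z ∈ D`. -/
def DbarEstimate (D : Set (Cn m)) (T : (Cn m → ℂ) → Cn m → ℂ) (δ : ℝ) : Prop :=
  ∃ C : ℝ, ∀ f : Cn m → ℂ, ContinuousOn f (frontier D) → ∀ z ∈ D,
    dbarNorm (T f) z ≤ C * supNorm D f * Metric.infDist z (frontier D) ^ (δ - 1)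

/-! ### The generating form `W^S = s / S` -/

/-- The modified defining function `r(z) = φ(z) exp(-C|z|²)`. -/
def modDef (φ : Cn m → ℝ) (C : ℝ) (z : Cn m) : ℝ := φ z * Real.exp (-C * ‖z‖ ^ 2)

/-- The Levi polynomial `F^{(r)}(ζ, z)`. -/
def leviPoly (r : Cn m → ℝ) (ζ z : Cn m) : ℂ :=
  ∑ j, wirt j (cplx r) ζ * (ζ j - z j)
    - (1 / 2) * ∑ j, ∑ k, wirt j (wirt k (cplx r)) ζ * (ζ j - z j) * (ζ k - z k)

/-- `Φ_K(ζ, z) = F^{(r)}(ζ, z) - r(ζ) + K|ζ - z|³`. -/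
def suppFun (r : Cn m → ℝ) (K : ℝ) (ζ z : Cn m) : ℂ :=
  leviPoly r ζ z - (r ζ : ℂ) + ((K * ‖ζ - z‖ ^ 3 : ℝ) : ℂ)

/-- The coefficients `g_j` of the decomposition `Φ_K + r(ζ) = ∑ g_j (ζ_j - z_j)`. -/
def gCoeff (r : Cn m → ℝ) (K : ℝ) (ζ z : Cn m) (j : Fin (m + 1)) : ℂ :=
  wirt j (cplx r) ζ - (1 / 2) * ∑ k, wirt j (wirt k (cplx r)) ζ * (ζ k - z k)
    + ((K * ‖ζ - z‖ : ℝ) : ℂ) * (starRingEnd ℂ) (ζ j - z j)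

/-- The admissible cut-off functions `χ`. -/
structure IsCutoff (ε : ℝ) (χ : ℝ → ℝ) : Prop where
  contDiff : ContDiff ℝ ∞ χ
  mem_Icc : ∀ t, χ t ∈ Set.Icc (0 : ℝ) 1
  eq_one : ∀ t, t ≤ ε / 2 → χ t = 1
  eq_zero : ∀ t, 3 / 4 * ε ≤ t → χ t = 0

/-- `S(ζ, z) = χ(|ζ - z|) Φ_K(ζ, z) + (1 - χ(|ζ - z|)) |ζ - z|²`. -/
def bigS (r : Cn m → ℝ) (K : ℝ) (χ : ℝ → ℝ) (ζ z : Cn m) : ℂ :=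
  (χ ‖ζ - z‖ : ℂ) * suppFun r K ζ z + (1 - (χ ‖ζ - z‖ : ℂ)) * (‖ζ - z‖ : ℂ) ^ 2

/-- `s_j(ζ, z) = χ(|ζ - z|) g_j(ζ, z) + (1 - χ(|ζ - z|)) conj(ζ_j - z_j)`. -/
def smallS (r : Cn m → ℝ) (K : ℝ) (χ : ℝ → ℝ) (ζ z : Cn m) (j : Fin (m + 1)) : ℂ :=
  (χ ‖ζ - z‖ : ℂ) * gCoeff r K ζ z j
    + (1 - (χ ‖ζ - z‖ : ℂ)) * (starRingEnd ℂ) (ζ j - z j)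

/-- The coefficients `s_j / S` of the generating form `W^S`. -/
def genW (r : Cn m → ℝ) (K : ℝ) (χ : ℝ → ℝ) (ζ z : Cn m) (j : Fin (m + 1)) : ℂ :=
  smallS r K χ ζ z j / bigS r K χ ζ z

/-- The coefficients `conj(ζ_j - z_j) / |ζ - z|²` of the Bochner–Martinelli generating form, whose
Cauchy–Fantappiè kernel is the Bochner–Martinelli kernel. -/
def genBM (ζ z : Cn m) (j : Fin (m + 1)) : ℂ :=
  (starRingEnd ℂ) (ζ j - z j) / (‖ζ - z‖ : ℂ) ^ 2

end CauchyFantappie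

end

open CauchyFantappie

/-! Write n = m + 1, t = ζ - z, τ = |t|, d = dist(z, bD), σ = |Φ_K(ζ, z)|. Close to the diagonal W^S
= g / Φ_K, and every part of ∂̄W proportional to g drops out of W ∧ (∂̄W)^m. The kernel is therefore
Φ_K^{-n} times the coefficient of ν ∧ g ∧ (∂̄g)^m, where ν is the conormal
(`boundaryDensity_omegaZero_div`). This coefficient is a top degree form, so it may be computed in
any basis at the price of a determinant. The basis used is a unitary one at the boundary point p
nearest to z: e_0 is the complex normal and e_1, …, e_m diagonalise the Levi form at p, with
eigenvalues l_j ≥ 0 (`exists_adapted_unitary_basis`). Put t_j = ⟨e_j, t⟩.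

Lower bound. Taylor's formula gives 2 Re Φ_K ≥ -r(z) + ∑ l_j |t_j|² + τ³ up to a small multiple of σ
(`UniformBounds.two_re_suppFun_ge`). The mixed normal and tangential terms of the Levi form are
harmless because t_0 is itself O(σ + τ²), and cubic errors are swallowed by K τ³. Hence S vanishes
only on the diagonal, and σ dominates d, l_j |t_j|² and τ³, so that (d + |t_j|)² (l_j + τ) = O(σ).

Upper bound. The pair e_j, i e_j contributes to (∂̄g)^m at most a factor of size l_j + τ, which is
exchanged for σ (d + |t_j|)^{-2}. Assigning a weight to each basis vector makes this exchange
automatic (`norm_topSum_le`), and the kernel becomes O(σ^{-1} ∏ (d + |t_j|)^{-2}). Since F is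
holomorphic in z, ∂̄_z sees only the terms with K; in particular ∂̄_z Φ_K = O(τ²), and τ =
O(σ^{1/3}). One ∂̄_z thus costs only σ^{-1/3}, and the bound is σ^{-4/3} ∏ (d + |t_j|)^{-2}
(`UniformBounds.exists_dbar_nearKernel_bound`).

Integration. On bD near p, Im Φ_K together with the real and imaginary parts of the t_j are
antilipschitz coordinates (`UniformBounds.antilipschitz_coordMap`), and σ dominates d + |Im Φ_K|.
Integrating (d + |x|)^{-4/3} in the first coordinate yields d^{-1/3}; each of the other 2m
coordinates yields a logarithm, estimated by d^{-η}. This gives every δ < 2/3. Away from the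
diagonal the kernel is a smooth function of z and of continuous data in ζ (`IsSmoothKernel`), which
gives bounded ∂̄-derivatives there and also part (b).

Bochner–Martinelli. The ∂̄-derivative of this kernel is homogeneous of degree -2n, and integration
over a surface of dimension 2n - 1 gives d^{-1}, that is δ = 0. At the unit normal the derivative is
a nonzero multiple of n - 1 (`bmDbar_self`, `bmTop_normal_ne_zero`), so for n ≥ 2 tent functions of
radius comparable to d really produce d^{-1}, and no δ > 0 is possible. -/

noncomputable section

namespace CauchyFantappie

open MeasureTheory Set

/-! ### Surface measure against Lebesgue measure in coordinates. -/

section Hausdorff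

variable {X : Type*} [MetricSpace X] [MeasurableSpace X] [BorelSpace X]
  {ι : Type*} [Fintype ι]

/-- The constant relating `μHE[d]` to `μH[d]`. -/
def hausdorffFactor (d : ℕ) : NNReal :=
  Measure.addHaarScalarFactor (volume : Measure (EuclideanSpace ℝ (Fin d))) μH[d]

theorem euclideanHausdorffMeasure_apply (d : ℕ) (s : Set X) :
    μHE[d] s = hausdorffFactor d * μH[d] s := by
  rw [Measure.euclideanHausdorffMeasure_def]; rfl

theorem hausdorffFactor_ne_zero (d : ℕ) : hausdorffFactor d ≠ 0 :=
  Measure.addHaarScalarFactor_volume_hausdorffMeasure_ne_zero d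

/-- A set with antilipschitz coordinates has Hausdorff measure controlled by Lebesgue measure of
the image. -/
theorem euclideanHausdorffMeasure_le_volume_image {d : ℕ} (hd : Fintype.card ι = d) {s : Set X}
    {π : X → ι → ℝ} {L : NNReal} (hL : ∀ x ∈ s, ∀ y ∈ s, dist x y ≤ L * dist (π x) (π y)) :
    μHE[d] s ≤ hausdorffFactor d * (L : ENNReal) ^ d * volume (π '' s) := by
  classical
  rcases s.eq_empty_or_nonempty with rfl | ⟨x0, hx0⟩
  · simp
  -- The inverse of `π` on `π '' s`, which is `L`-Lipschitz there; `x0` is a filler value off the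
  -- image.
  set g : (ι → ℝ) → X := fun y => if h : ∃ x ∈ s, π x = y then h.choose else x0 with hg
  have hgx : ∀ x ∈ s, g (π x) = x := by
    intro x hx
    have h : ∃ x' ∈ s, π x' = π x := ⟨x, hx, rfl⟩
    have h1 : g (π x) = h.choose := by simp only [hg]; exact dif_pos h
    have h2 := h.choose_spec
    have h3 := hL _ h2.1 _ hx
    rw [h2.2, dist_self, mul_zero] at h3
    rw [h1]
    exact dist_le_zero.1 h3
  have hlip : LipschitzOnWith L g (π '' s) := by
    refine LipschitzOnWith.of_dist_le_mul ?_
    rintro _ ⟨x, hx, rfl⟩ _ ⟨y, hy, rfl⟩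
    rw [hgx x hx, hgx y hy]
    exact hL x hx y hy
  have himg : g '' (π '' s) = s := by
    ext x
    constructor
    · rintro ⟨_, ⟨x', hx', rfl⟩, rfl⟩
      rwa [hgx x' hx']
    · intro hx
      exact ⟨_, ⟨x, hx, rfl⟩, hgx x hx⟩
  have h1 := hlip.hausdorffMeasure_image_le (d := d) (by positivity)
  rw [himg] at h1
  have h2 : (μH[(d : ℝ)] : Measure (ι → ℝ)) = volume := by
    rw [← hd]; exact hausdorffMeasure_pi_real
  rw [h2, ENNReal.rpow_natCast] at h1
  rw [euclideanHausdorffMeasure_apply, mul_assoc]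
  gcongr

/-- The antilipschitz bound passes to every preimage, so the push-forward of surface measure under
`π` is dominated by a multiple of Lebesgue measure. This replaces the area formula: the boundary is
never written as a graph. -/
theorem setLIntegral_comp_le_of_antilipschitz {d : ℕ} (hd : Fintype.card ι = d) {s : Set X}
    (hs : MeasurableSet s) {π : X → ι → ℝ} (hπ : ContinuousOn π s) {L : NNReal}
    (hL : ∀ x ∈ s, ∀ y ∈ s, dist x y ≤ L * dist (π x) (π y))
    {g : (ι → ℝ) → ENNReal} (hg : Measurable g) :
    ∫⁻ x in s, g (π x) ∂(μHE[d]) ≤ hausdorffFactor d * (L : ENNReal) ^ d * ∫⁻ y, g y := by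
  have hm : AEMeasurable π ((μHE[d]).restrict s) := hπ.aemeasurable hs
  have hle : ((μHE[d]).restrict s).map π ≤
      ((hausdorffFactor d : ENNReal) * (L : ENNReal) ^ d) • (volume : Measure (ι → ℝ)) := by
    refine Measure.le_iff.2 fun B hB => ?_
    rw [Measure.map_apply_of_aemeasurable hm hB, Measure.restrict_apply' hs]
    refine (euclideanHausdorffMeasure_le_volume_image hd (s := π ⁻¹' B ∩ s) (π := π)
      (fun x hx y hy => hL x hx.2 y hy.2)).trans ?_
    rw [Measure.smul_apply, smul_eq_mul]
    gcongr
    rintro _ ⟨x, hx, rfl⟩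
    exact hx.1
  rw [← lintegral_map' hg.aemeasurable hm]
  refine (lintegral_mono' hle le_rfl).trans ?_
  rw [lintegral_smul_measure, smul_eq_mul]

/-- The comparison in the opposite direction, needed only for sharpness: with the projection to the
tangent space it bounds the measure of small boundary balls from below. -/
theorem volume_image_le_euclideanHausdorffMeasure {d : ℕ} (hd : Fintype.card ι = d) {s : Set X}
    {π : X → ι → ℝ} (hπ : LipschitzOnWith 1 π s) :
    hausdorffFactor d * volume (π '' s) ≤ μHE[d] s := by
  have h1 := hπ.hausdorffMeasure_image_le (d := d) (by positivity)
  have h2 : (μH[(d : ℝ)] : Measure (ι → ℝ)) = volume := by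
    rw [← hd]; exact hausdorffMeasure_pi_real
  rw [h2] at h1
  rw [euclideanHausdorffMeasure_apply]
  gcongr
  simpa using h1

end Hausdorff

/-! ### Integrals of products of one-dimensional powers. -/

theorem add_abs_rpow_eq {d q : ℝ} (hd : 0 < d) (x : ℝ) :
    (d + |x|) ^ (-q) = d ^ (-q) * (1 + ‖x / d‖) ^ (-q) := by
  have h1 : d + |x| = d * (1 + ‖x / d‖) := by
    rw [Real.norm_eq_abs, abs_div, abs_of_pos hd]; field_simp
  rw [h1, Real.mul_rpow hd.le (by positivity)]

theorem integrable_add_abs_rpow {d q : ℝ} (hd : 0 < d) (hq : 1 < q) :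
    Integrable (fun x : ℝ => (d + |x|) ^ (-q)) := by
  have h : Integrable (fun x : ℝ => (1 + ‖x‖) ^ (-q)) :=
    integrable_one_add_norm (by simpa using hq)
  have h2 := (h.comp_div hd.ne').const_mul (d ^ (-q))
  exact h2.congr (Filter.Eventually.of_forall fun x => (add_abs_rpow_eq hd x).symm)

theorem integral_add_abs_rpow {d q : ℝ} (hd : 0 < d) :
    ∫ x : ℝ, (d + |x|) ^ (-q) = (∫ x : ℝ, (1 + ‖x‖) ^ (-q)) * d ^ (1 - q) := by
  simp_rw [add_abs_rpow_eq hd]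
  rw [integral_const_mul, Measure.integral_comp_div (fun x : ℝ => (1 + ‖x‖) ^ (-q)) d,
    smul_eq_mul, abs_of_pos hd, sub_eq_add_neg, Real.rpow_add hd, Real.rpow_one]
  ring

section Coordinates

variable {X : Type*} [MetricSpace X] [MeasurableSpace X] [BorelSpace X]
  {ι : Type*} [Fintype ι]

/-- Integrals of products of powers `(d + |x_i|)^{-q_i}` in antilipschitz coordinates. -/
theorem exists_setLIntegral_prod_rpow_le {N : ℕ} (hN : Fintype.card ι = N) (L : NNReal)
    (q : ι → ℝ) (hq : ∀ i, 1 < q i) :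
    ∃ C : ℝ, 0 ≤ C ∧ ∀ (s : Set X), MeasurableSet s → ∀ (π : X → ι → ℝ), ContinuousOn π s →
      (∀ x ∈ s, ∀ y ∈ s, dist x y ≤ L * dist (π x) (π y)) → ∀ d : ℝ, 0 < d →
      ∫⁻ x in s, ENNReal.ofReal (∏ i, (d + |π x i|) ^ (-(q i))) ∂(μHE[N]) ≤
        ENNReal.ofReal (C * d ^ (∑ i, (1 - q i))) := by
  refine ⟨hausdorffFactor N * (L : ℝ) ^ N * ∏ i, ∫ x : ℝ, (1 + ‖x‖) ^ (-(q i)), ?_, ?_⟩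
  · refine mul_nonneg (by positivity) (Finset.prod_nonneg fun i _ => ?_)
    exact integral_nonneg fun x => by positivity
  intro s hs π hπ hL d hd
  have hmeas : Measurable (fun y : ι → ℝ => ENNReal.ofReal (∏ i, (d + |y i|) ^ (-(q i)))) := by
    refine ENNReal.measurable_ofReal.comp ?_
    refine Finset.measurable_prod _ fun i _ => ?_
    have : Measurable (fun x : ℝ => (d + |x|) ^ (-(q i))) := by
      refine Continuous.measurable ?_
      refine Continuous.rpow_const (by fun_prop) fun x => Or.inl (by positivity)
    exact this.comp (measurable_pi_apply i)
  refine (setLIntegral_comp_le_of_antilipschitz hN hs hπ hL hmeas).trans ?_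
  -- In coordinates the integral splits by Fubini; rescaling by `d` shows that the `i`-th factor
  -- contributes `d ^ (1 - q i)`.
  have hint : Integrable (fun y : ι → ℝ => ∏ i, (d + |y i|) ^ (-(q i))) :=
    Integrable.fintype_prod (f := fun i (x : ℝ) => (d + |x|) ^ (-(q i)))
      fun i => integrable_add_abs_rpow hd (hq i)
  rw [← ofReal_integral_eq_lintegral_ofReal hint
    (Filter.Eventually.of_forall fun y => Finset.prod_nonneg fun i _ => by positivity),
    integral_fintype_prod_volume_eq_prod (fun i (x : ℝ) => (d + |x|) ^ (-(q i)))]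
  simp_rw [integral_add_abs_rpow hd]
  rw [Finset.prod_mul_distrib, ← Real.rpow_sum_of_pos hd]
  rw [← ENNReal.ofReal_coe_nnreal, ← ENNReal.ofReal_coe_nnreal (p := L),
    ← ENNReal.ofReal_pow (by positivity), ← ENNReal.ofReal_mul (by positivity),
    ← ENNReal.ofReal_mul (by positivity)]
  refine ENNReal.ofReal_le_ofReal (le_of_eq ?_)
  ring

end Coordinates

end CauchyFantappie

end

noncomputable section

namespace CauchyFantappie

open MeasureTheory Set

set_option linter.unusedSectionVars false

/-! ### Differentiation under the integral sign. -/

section Parametric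

variable {X V E F : Type} [MetricSpace X] [MeasurableSpace X] [BorelSpace X]
  [NormedAddCommGroup V] [NormedSpace ℝ V] [NormedAddCommGroup E] [NormedSpace ℝ E]
  [FiniteDimensional ℝ E] [NormedAddCommGroup F] [NormedSpace ℝ F] [CompleteSpace F]

/-- The partial derivative in the second variable. -/
def partialSnd (G : V × E → F) (q : V × E) : E →L[ℝ] F :=
  (fderiv ℝ G q).comp (ContinuousLinearMap.inr ℝ V E)

theorem contDiffOn_partialSnd {G : V × E → F} {O : Set (V × E)} (hO : IsOpen O)
    (hG : ContDiffOn ℝ ∞ G O) : ContDiffOn ℝ ∞ (partialSnd G) O := by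
  have h : ContDiffOn ℝ ∞ (fderiv ℝ G) O := hG.fderiv_of_isOpen hO (by simp)
  exact h.clm_comp contDiffOn_const

theorem hasFDerivAt_partialSnd {G : V × E → F} {O : Set (V × E)} (hO : IsOpen O)
    (hG : ContDiffOn ℝ ∞ G O) {v : V} {z : E} (h : (v, z) ∈ O) :
    HasFDerivAt (fun z => G (v, z)) (partialSnd G (v, z)) z := by
  have h1 : HasFDerivAt G (fderiv ℝ G (v, z)) (v, z) :=
    ((hG.differentiableOn (by simp)).differentiableAt (hO.mem_nhds h)).hasFDerivAt
  have h2 : HasFDerivAt (fun z : E => (v, z)) (ContinuousLinearMap.inr ℝ V E) z :=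
    hasFDerivAt_prodMk_right v z
  exact h1.comp z h2

theorem continuousOn_comp_param {s : Set X} {P : X → V} (hP : ContinuousOn P s)
    {O : Set (V × E)} {G : V × E → F} (hG : ContinuousOn G O) {z : E}
    (h : ∀ x ∈ s, (P x, z) ∈ O) : ContinuousOn (fun x => G (P x, z)) s :=
  hG.comp (hP.prodMk continuousOn_const) h

theorem exists_bound_param {s : Set X} {P : X → V} (hP : ContinuousOn P s)
    {O : Set (V × E)} {G : V × E → F} (hG : ContinuousOn G O) {T : Set (X × E)}
    (hT : IsCompact T) (hTs : ∀ q ∈ T, q.1 ∈ s) (h : ∀ q ∈ T, (P q.1, q.2) ∈ O) :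
    ∃ C : ℝ, 0 ≤ C ∧ ∀ q ∈ T, ‖G (P q.1, q.2)‖ ≤ C := by
  have hc : ContinuousOn (fun q : X × E => G (P q.1, q.2)) T :=
    hG.comp ((hP.comp continuousOn_fst hTs).prodMk continuousOn_snd) h
  obtain ⟨C, hC⟩ := hT.exists_bound_of_continuousOn hc
  exact ⟨max C 0, le_max_right _ _, fun q hq => (hC q hq).trans (le_max_left _ _)⟩

/-- The variable `x` enters only through the continuous map `P`. On the compact product of `s` with
a closed ball about `z` the partial derivative is therefore bounded, and a constant dominates
because `μ s` is finite. -/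
theorem hasFDerivAt_setIntegral_param {μ : Measure X} {s : Set X} (hs : IsCompact s)
    (hμ : μ s ≠ ⊤) {P : X → V} (hP : ContinuousOn P s) {O : Set (V × E)} (hO : IsOpen O)
    {G : V × E → F} (hG : ContDiffOn ℝ ∞ G O) {D : Set E} (hD : IsOpen D)
    (hPO : ∀ x ∈ s, ∀ z ∈ D, (P x, z) ∈ O) {z : E} (hz : z ∈ D) :
    HasFDerivAt (fun z => ∫ x in s, G (P x, z) ∂μ) (∫ x in s, partialSnd G (P x, z) ∂μ) z := by
  have hsm : MeasurableSet s := hs.isClosed.measurableSet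
  obtain ⟨ε, hε, hεD⟩ := Metric.nhds_basis_closedBall.mem_iff.1 (hD.mem_nhds hz)
  have hG' := contDiffOn_partialSnd hO hG
  obtain ⟨C, -, hC⟩ := exists_bound_param hP hG'.continuousOn
    (hs.prod (isCompact_closedBall z ε)) (fun q hq => hq.1)
    (fun q hq => hPO q.1 hq.1 q.2 (hεD hq.2))
  have : IsFiniteMeasure (μ.restrict s) := ⟨by simpa using hμ.lt_top⟩
  have hint : ∀ z' ∈ D, AEStronglyMeasurable (fun x => G (P x, z')) (μ.restrict s) :=
    fun z' hz' => (continuousOn_comp_param hP hG.continuousOn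
      (fun x hx => hPO x hx z' hz')).aestronglyMeasurable_of_isCompact hs hsm
  refine hasFDerivAt_integral_of_dominated_of_fderiv_le (bound := fun _ => C)
    (F' := fun z x => partialSnd G (P x, z)) (Metric.ball_mem_nhds z hε) ?_ ?_ ?_ ?_ ?_ ?_
  · filter_upwards [hD.mem_nhds hz] with z' hz' using hint z' hz'
  · exact (continuousOn_comp_param hP hG.continuousOn
      (fun x hx => hPO x hx z hz)).integrableOn_of_subset_isCompact hs hsm subset_rfl hμ
  · exact (continuousOn_comp_param hP hG'.continuousOn
      (fun x hx => hPO x hx z hz)).aestronglyMeasurable_of_isCompact hs hsm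
  · filter_upwards [ae_restrict_mem hsm] with x hx z' hz'
    exact hC (x, z') ⟨hx, Metric.ball_subset_closedBall hz'⟩
  · exact integrable_const C
  · filter_upwards [ae_restrict_mem hsm] with x hx z' hz'
    exact hasFDerivAt_partialSnd hO hG (hPO x hx z' (hεD (Metric.ball_subset_closedBall hz')))

end Parametric

section ParametricSmooth

variable {X V E : Type} [MetricSpace X] [MeasurableSpace X] [BorelSpace X]
  [NormedAddCommGroup V] [NormedSpace ℝ V] [NormedAddCommGroup E] [NormedSpace ℝ E]
  [FiniteDimensional ℝ E]

/-- The derivative is an integral of the same kind with values in `E →L[ℝ] F`. The induction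
hypothesis must therefore hold for all target spaces, which is why `F` is quantified after `n`. -/
theorem contDiffOn_setIntegral_param_nat {μ : Measure X} {s : Set X} (hs : IsCompact s)
    (hμ : μ s ≠ ⊤) {P : X → V} (hP : ContinuousOn P s) {O : Set (V × E)} (hO : IsOpen O)
    {D : Set E} (hD : IsOpen D) (hPO : ∀ x ∈ s, ∀ z ∈ D, (P x, z) ∈ O) (n : ℕ) :
    ∀ {F : Type} [NormedAddCommGroup F] [NormedSpace ℝ F] [CompleteSpace F]
    {G : V × E → F}, ContDiffOn ℝ ∞ G O →
    ContDiffOn ℝ n (fun z => ∫ x in s, G (P x, z) ∂μ) D := by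
  induction n with
  | zero =>
    intro F _ _ _ G hG
    refine contDiffOn_zero.2 fun z hz => ?_
    exact (hasFDerivAt_setIntegral_param hs hμ hP hO hG hD hPO hz).continuousAt.continuousWithinAt
  | succ n ih =>
    intro F _ _ _ G hG
    refine (contDiffOn_succ_iff_fderiv_of_isOpen (n := (n : ℕ∞ω)) hD).2 ⟨?_, by simp, ?_⟩
    · intro z hz
      exact (hasFDerivAt_setIntegral_param hs hμ hP hO hG hD
        hPO hz).differentiableAt.differentiableWithinAt
    · refine (ih (contDiffOn_partialSnd hO hG)).congr fun z hz => ?_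
      exact (hasFDerivAt_setIntegral_param hs hμ hP hO hG hD hPO hz).fderiv

theorem contDiffOn_setIntegral_param {F : Type} [NormedAddCommGroup F] [NormedSpace ℝ F]
    [CompleteSpace F] {μ : Measure X} {s : Set X} (hs : IsCompact s)
    (hμ : μ s ≠ ⊤) {P : X → V} (hP : ContinuousOn P s) {O : Set (V × E)} (hO : IsOpen O)
    {D : Set E} (hD : IsOpen D) (hPO : ∀ x ∈ s, ∀ z ∈ D, (P x, z) ∈ O)
    {G : V × E → F} (hG : ContDiffOn ℝ ∞ G O) :
    ContDiffOn ℝ ∞ (fun z => ∫ x in s, G (P x, z) ∂μ) D :=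
  contDiffOn_infty.2 fun n => contDiffOn_setIntegral_param_nat hs hμ hP hO hD hPO n hG

end ParametricSmooth

end CauchyFantappie

end

noncomputable section

namespace CauchyFantappie

open MeasureTheory Set Complex

variable {m : ℕ}

/-! ### The `∂̄`-calculus -/

theorem single_I_eq (j : Fin (m + 1)) :
    (EuclideanSpace.single j I : Cn m) = I • EuclideanSpace.single j (1 : ℂ) := by
  ext k
  by_cases h : k = j <;> simp [h]

theorem eq_sum_smul_single (v : Cn m) : v = ∑ k, v k • EuclideanSpace.single k (1 : ℂ) := by
  ext j
  simp [Pi.single_apply]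

theorem map_real_smul {F : Type*} [AddCommGroup F] [Module ℝ F] [TopologicalSpace F]
    (T : Cn m →L[ℝ] F) (a b : ℝ) (v : Cn m) :
    T ((⟨a, b⟩ : ℂ) • v) = a • T v + b • T (I • v) := by
  have : (⟨a, b⟩ : ℂ) • v = a • v + b • (I • v) := by
    rw [← Complex.coe_smul, ← Complex.coe_smul, smul_smul, ← add_smul]
    congr 1
    apply Complex.ext <;> simp
  rw [this, map_add, map_smul, map_smul]

theorem I_smul_I_smul (v : Cn m) : I • I • v = -v := by
  rw [smul_smul, I_mul_I, neg_one_smul]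

/-- The conjugate linear part of a real linear map. -/
def conjPart (T : Cn m →L[ℝ] ℂ) (v : Cn m) : ℂ := (1 / 2) * (T v + I * T (I • v))

theorem conjPart_add (T : Cn m →L[ℝ] ℂ) (u v : Cn m) :
    conjPart T (u + v) = conjPart T u + conjPart T v := by
  simp only [conjPart, smul_add, map_add]; ring

theorem conjPart_smul (T : Cn m →L[ℝ] ℂ) (c : ℂ) (v : Cn m) :
    conjPart T (c • v) = (starRingEnd ℂ) c * conjPart T v := by
  obtain ⟨a, b⟩ := c
  have h2 : I • (⟨a, b⟩ : ℂ) • v = (⟨a, b⟩ : ℂ) • (I • v) := smul_comm _ _ _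
  have h3 : (starRingEnd ℂ) (⟨a, b⟩ : ℂ) = a - b * I := by
    apply Complex.ext <;> simp
  simp only [conjPart, h2, map_real_smul, I_smul_I_smul, map_neg, h3, real_smul]
  linear_combination (1 / 2) * b * T (I • v) * I_mul_I

/-- Both sides are conjugate linear in `v` and agree on the standard basis. This frees ∂̄ from
coordinates, so that it can be evaluated on any unitary basis. -/
theorem dbar_eq_conjPart (f : Cn m → ℂ) (z v : Cn m) : dbar f z v = conjPart (fderiv ℝ f z) v := by
  have h : conjPart (fderiv ℝ f z) v
      = ∑ k, (starRingEnd ℂ) (v k) * conjPart (fderiv ℝ f z) (EuclideanSpace.single k (1 : ℂ)) := by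
    conv_lhs => rw [eq_sum_smul_single v]
    have : ∀ s : Finset (Fin (m + 1)), conjPart (fderiv ℝ f z)
        (∑ k ∈ s, v k • EuclideanSpace.single k (1 : ℂ)) = ∑ k ∈ s, (starRingEnd ℂ) (v k) *
          conjPart (fderiv ℝ f z) (EuclideanSpace.single k (1 : ℂ)) := by
      intro s
      classical
      induction s using Finset.induction_on with
      | empty => simp [conjPart]
      | insert a s ha ih => rw [Finset.sum_insert ha, Finset.sum_insert ha, conjPart_add, ih,
          conjPart_smul]
    exact this _
  rw [h, dbar]
  refine Finset.sum_congr rfl fun k _ => ?_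
  rw [wirtBar, conjPart, single_I_eq, mul_comm]

theorem wirtBar_eq_dbar (k : Fin (m + 1)) (f : Cn m → ℂ) (z : Cn m) :
    wirtBar k f z = dbar f z (EuclideanSpace.single k 1) := by
  rw [dbar_eq_conjPart, wirtBar, conjPart, single_I_eq]

/-- `f` is real differentiable at `z`, with `∂̄f(z) = d`. -/
def HasDbarAt (f : Cn m → ℂ) (d : Cn m → ℂ) (z : Cn m) : Prop :=
  ∃ T : Cn m →L[ℝ] ℂ, HasFDerivAt f T z ∧ ∀ w, d w = conjPart T w

namespace HasDbarAt

variable {f g : Cn m → ℂ} {d e : Cn m → ℂ} {z : Cn m}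

theorem dbar_eq (h : HasDbarAt f d z) (w : Cn m) : dbar f z w = d w := by
  obtain ⟨T, hT, hd⟩ := h
  rw [dbar_eq_conjPart, hT.fderiv, hd]

theorem differentiableAt (h : HasDbarAt f d z) : DifferentiableAt ℝ f z := by
  obtain ⟨T, hT, -⟩ := h
  exact hT.differentiableAt

theorem of_differentiableAt (h : DifferentiableAt ℝ f z) : HasDbarAt f (dbar f z) z :=
  ⟨_, h.hasFDerivAt, dbar_eq_conjPart f z⟩

theorem congr_deriv (h : HasDbarAt f d z) (hd : ∀ w, d w = e w) : HasDbarAt f e z := by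
  obtain ⟨T, hT, h⟩ := h
  exact ⟨T, hT, fun w => (hd w).symm.trans (h w)⟩

theorem congr_of_eventuallyEq (h : HasDbarAt f d z) (hg : g =ᶠ[nhds z] f) : HasDbarAt g d z := by
  obtain ⟨T, hT, h⟩ := h
  exact ⟨T, hT.congr_of_eventuallyEq hg, h⟩

protected theorem const (c : ℂ) : HasDbarAt (fun _ : Cn m => c) (fun _ => 0) z :=
  ⟨0, hasFDerivAt_const c z, fun w => by simp [conjPart]⟩

protected theorem add (hf : HasDbarAt f d z) (hg : HasDbarAt g e z) :
    HasDbarAt (fun x => f x + g x) (fun w => d w + e w) z := by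
  obtain ⟨T, hT, hd⟩ := hf
  obtain ⟨S, hS, he⟩ := hg
  exact ⟨T + S, hT.add hS, fun w => by
    simp only [hd, he, conjPart, add_apply]; ring⟩

protected theorem mul (hf : HasDbarAt f d z) (hg : HasDbarAt g e z) :
    HasDbarAt (fun x => f x * g x) (fun w => d w * g z + f z * e w) z := by
  obtain ⟨T, hT, hd⟩ := hf
  obtain ⟨S, hS, he⟩ := hg
  refine ⟨_, hT.mul hS, fun w => ?_⟩
  simp only [hd, he, conjPart, add_apply, smul_apply,
    smul_eq_mul]
  ring

theorem const_mul (c : ℂ) (hf : HasDbarAt f d z) :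
    HasDbarAt (fun x => c * f x) (fun w => c * d w) z :=
  ((HasDbarAt.const c).mul hf).congr_deriv fun w => by simp

protected theorem sub (hf : HasDbarAt f d z) (hg : HasDbarAt g e z) :
    HasDbarAt (fun x => f x - g x) (fun w => d w - e w) z := by
  have := hf.add (hg.const_mul (-1))
  simpa [sub_eq_add_neg] using this

protected theorem sum {ι : Type*} (s : Finset ι) {f : ι → Cn m → ℂ} {d : ι → Cn m → ℂ}
    (h : ∀ i ∈ s, HasDbarAt (f i) (d i) z) :
    HasDbarAt (fun x => ∑ i ∈ s, f i x) (fun w => ∑ i ∈ s, d i w) z := by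
  classical
  induction s using Finset.induction_on with
  | empty => simpa using HasDbarAt.const (z := z) 0
  | insert a s ha ih =>
    simp only [Finset.sum_insert ha]
    exact (h a (by simp)).add (ih fun i hi => h i (Finset.mem_insert_of_mem hi))

protected theorem prod {ι : Type*} [DecidableEq ι] (s : Finset ι) {f : ι → Cn m → ℂ}
    {d : ι → Cn m → ℂ} (h : ∀ i ∈ s, HasDbarAt (f i) (d i) z) :
    HasDbarAt (fun x => ∏ i ∈ s, f i x) (fun w => ∑ i ∈ s, (∏ j ∈ s.erase i, f j z) * d i w) z := by
  induction s using Finset.induction_on with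
  | empty => simpa using HasDbarAt.const (z := z) 1
  | insert a s ha ih =>
    simp only [Finset.prod_insert ha]
    refine ((h a (by simp)).mul (ih fun i hi => h i (Finset.mem_insert_of_mem hi))).congr_deriv
      fun w => ?_
    rw [Finset.sum_insert ha, Finset.erase_insert ha, Finset.mul_sum, mul_comm]
    congr 1
    refine Finset.sum_congr rfl fun i hi => ?_
    have hai : a ≠ i := fun h => ha (h ▸ hi)
    rw [Finset.erase_insert_of_ne hai, Finset.prod_insert (by simp [ha])]
    ring

protected theorem inv (hf : HasDbarAt f d z) (h0 : f z ≠ 0) :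
    HasDbarAt (fun x => (f x)⁻¹) (fun w => -(f z ^ 2)⁻¹ * d w) z := by
  obtain ⟨T, hT, hd⟩ := hf
  have h1 : HasDerivAt (fun y : ℂ => y⁻¹) (-(f z ^ 2)⁻¹) (f z) := hasDerivAt_inv h0
  have h2 := (h1.hasFDerivAt.restrictScalars ℝ).comp z hT
  refine ⟨_, h2, fun w => ?_⟩
  simp only [hd, conjPart, ContinuousLinearMap.comp_apply, ContinuousLinearMap.coe_restrictScalars',
    ContinuousLinearMap.toSpanSingleton_apply, smul_eq_mul]
  ring

protected theorem pow (n : ℕ) (hf : HasDbarAt f d z) :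
    HasDbarAt (fun x => f x ^ (n + 1)) (fun w => (n + 1) * f z ^ n * d w) z := by
  induction n with
  | zero => simpa using hf
  | succ n ih =>
    have := (ih.mul hf)
    simp only [pow_succ _ (n + 1)]
    refine this.congr_deriv fun w => ?_
    push_cast
    ring

theorem of_real_comp {g : Cn m → ℝ} {h : ℝ → ℝ} {h' : ℝ}
    (hg : HasDbarAt (fun x => (g x : ℂ)) d z) (hh : HasDerivAt h h' (g z)) :
    HasDbarAt (fun x => (h (g x) : ℂ)) (fun w => h' * d w) z := by
  obtain ⟨T, hT, hd⟩ := hg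
  have h1 : HasFDerivAt g (reCLM.comp T) z := by
    have := reCLM.hasFDerivAt.comp z hT
    simpa [Function.comp_def] using this
  -- Since `g` is real valued, so is its derivative; this is what allows the real factor `h'` to be
  -- pulled out of the conjugate linear part.
  have hT' : T = ofRealCLM.comp (reCLM.comp T) := hT.unique (ofRealCLM.hasFDerivAt.comp z h1)
  have h2 := ofRealCLM.hasFDerivAt.comp z (hh.comp_hasFDerivAt z h1)
  refine ⟨_, h2, fun w => ?_⟩
  have hTw : ∀ v, T v = ((T v).re : ℂ) := fun v => by
    conv_lhs => rw [hT']
    rfl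
  simp only [hd, conjPart, ContinuousLinearMap.comp_apply, smul_apply,
    reCLM_apply, ofRealCLM_apply, smul_eq_mul, ofReal_mul]
  rw [hTw w, hTw (I • w)]
  simp only [ofReal_re]
  ring

/-- Complex linear functions of `z` are holomorphic. -/
theorem of_linear (L : Cn m →ₗ[ℂ] ℂ) (ζ : Cn m) :
    HasDbarAt (fun x => L (ζ - x)) (fun _ => 0) z := by
  have h1 : HasFDerivAt (fun x => L.toContinuousLinearMap (ζ - x))
      (L.toContinuousLinearMap.comp (-ContinuousLinearMap.id ℂ (Cn m))) z :=
    L.toContinuousLinearMap.hasFDerivAt.comp z ((hasFDerivAt_id z).const_sub ζ)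
  refine ⟨_, h1.restrictScalars ℝ, fun w => ?_⟩
  have : ∀ v, ((L.toContinuousLinearMap.comp (-ContinuousLinearMap.id ℂ (Cn m))).restrictScalars ℝ) v
    = -L v := fun v => by simp
  simp only [conjPart, this, map_smul, smul_eq_mul]
  linear_combination (1 / 2) * (L w) * I_mul_I

theorem inner_sub_left (ζ v : Cn m) :
    HasDbarAt (fun x => inner ℂ (ζ - x) v) (fun w => -inner ℂ w v) z := by
  have h1 : HasFDerivAt (fun x => ((innerSL ℂ v).restrictScalars ℝ) (ζ - x))
      (((innerSL ℂ v).restrictScalars ℝ).comp (-ContinuousLinearMap.id ℝ (Cn m))) z :=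
    ((innerSL ℂ v).restrictScalars ℝ).hasFDerivAt.comp z ((hasFDerivAt_id z).const_sub ζ)
  have h2 := conjCLE.toContinuousLinearMap.hasFDerivAt.comp z h1
  refine ⟨_, h2.congr_of_eventuallyEq (Filter.Eventually.of_forall fun x => ?_), fun w => ?_⟩
  · simp [_root_.inner_sub_left]
  · simp [conjPart]
    linear_combination -(1 / 2) * (inner ℂ w v) * I_mul_I

theorem inner_sub_right (x₀ v : Cn m) :
    HasDbarAt (fun x => inner ℂ (x - x₀) v) (fun w => inner ℂ w v) z := by
  have := (inner_sub_left (z := z) x₀ v).const_mul (-1)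
  refine (this.congr_deriv (e := fun w => inner ℂ w v) (by simp)).congr_of_eventuallyEq
    (Filter.Eventually.of_forall fun x => ?_)
  simp only
  rw [← neg_sub x₀ x, inner_neg_left, neg_one_mul]

/-- Each summand of |ζ - x|² is a conjugate linear function of ζ - x times a complex linear one. The
latter is holomorphic in x, so ∂̄ differentiates the former alone. -/
theorem norm_sub_sq (ζ : Cn m) :
    HasDbarAt (fun x => ((‖ζ - x‖ ^ 2 : ℝ) : ℂ)) (fun w => -inner ℂ w (ζ - z)) z := by
  have h : ∀ x : Cn m, ((‖ζ - x‖ ^ 2 : ℝ) : ℂ) = ∑ k, inner ℂ (ζ - x) (EuclideanSpace.single k (1:ℂ))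
      * (EuclideanSpace.proj (𝕜 := ℂ) k).toLinearMap (ζ - x) := fun x => by
    rw [EuclideanSpace.norm_sq_eq, ofReal_sum]
    refine Finset.sum_congr rfl fun k _ => ?_
    rw [EuclideanSpace.inner_single_right, one_mul, ofReal_pow]
    exact (Complex.conj_mul' _).symm
  simp only [h]
  refine (HasDbarAt.sum _ fun k _ => (inner_sub_left ζ _).mul (of_linear _ ζ)).congr_deriv
    fun w => ?_
  simp only [mul_zero, add_zero, PiLp.inner_apply]
  rw [← Finset.sum_neg_distrib]
  refine Finset.sum_congr rfl fun k _ => ?_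
  simp [mul_comm, apply_ite]

theorem norm_sub {ζ : Cn m} (h : z ≠ ζ) :
    HasDbarAt (fun x => (‖ζ - x‖ : ℂ)) (fun w => -inner ℂ w (ζ - z) / (2 * ‖ζ - z‖)) z := by
  have h0 : 0 < ‖ζ - z‖ := norm_pos_iff.2 (sub_ne_zero.2 h.symm)
  have h1 := (norm_sub_sq (z := z) ζ).of_real_comp (Real.hasDerivAt_sqrt (by positivity))
  simp only [Real.sqrt_sq (norm_nonneg _)] at h1
  refine h1.congr_deriv fun w => ?_
  push_cast
  ring

theorem norm_sub_right {x₀ : Cn m} (h : z ≠ x₀) :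
    HasDbarAt (fun x => (‖x - x₀‖ : ℂ)) (fun w => inner ℂ w (z - x₀) / (2 * ‖z - x₀‖)) z := by
  have := norm_sub h
  simp only [norm_sub_rev x₀] at this
  refine this.congr_deriv fun w => ?_
  rw [← neg_sub z x₀, inner_neg_right, neg_neg]

end HasDbarAt

end CauchyFantappie

end

noncomputable section

namespace CauchyFantappie

open MeasureTheory Set Complex

variable {m : ℕ}

instance instNormedAddCommGroupBilin : NormedAddCommGroup (Cn m →L[ℝ] Cn m →L[ℝ] ℝ) := inferInstance

instance instNormedSpaceBilin : NormedSpace ℝ (Cn m →L[ℝ] Cn m →L[ℝ] ℝ) := inferInstance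

/-! ### First and second order Wirtinger forms of a real function -/

/-- The complex linear part `∂T` of a real covector `T`. -/
def del (T : Cn m →L[ℝ] ℝ) (v : Cn m) : ℂ := (1 / 2) * (T v - I * T (I • v))

/-- The complex bilinear part of a real bilinear form. -/
def holPart (B : Cn m →L[ℝ] Cn m →L[ℝ] ℝ) (u v : Cn m) : ℂ :=
  (1 / 4) * ((B u v - B (I • u) (I • v)) - I * (B (I • u) v + B u (I • v)))

/-- The sesquilinear part (linear in the first variable) of a real bilinear form. -/
def hermPart (B : Cn m →L[ℝ] Cn m →L[ℝ] ℝ) (u v : Cn m) : ℂ :=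
  (1 / 4) * ((B u v + B (I • u) (I • v)) - I * (B (I • u) v - B u (I • v)))

theorem del_add (T : Cn m →L[ℝ] ℝ) (u v : Cn m) : del T (u + v) = del T u + del T v := by
  simp only [del, smul_add, map_add]; push_cast; ring

theorem del_smul (T : Cn m →L[ℝ] ℝ) (c : ℂ) (v : Cn m) : del T (c • v) = c * del T v := by
  obtain ⟨a, b⟩ := c
  have h2 : I • (⟨a, b⟩ : ℂ) • v = (⟨a, b⟩ : ℂ) • (I • v) := smul_comm _ _ _
  have h3 : (⟨a, b⟩ : ℂ) = a + b * I := by apply Complex.ext <;> simp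
  simp only [del, h2, map_real_smul, I_smul_I_smul, map_neg, smul_eq_mul]
  rw [h3]; push_cast
  linear_combination (1 / 2) * b * (T (I • v)) * I_mul_I

theorem del_sub_left (T S : Cn m →L[ℝ] ℝ) (v : Cn m) : del (T - S) v = del T v - del S v := by
  simp only [del, sub_apply]; push_cast; ring

theorem holPart_add_right (B : Cn m →L[ℝ] Cn m →L[ℝ] ℝ) (u v w : Cn m) :
    holPart B u (v + w) = holPart B u v + holPart B u w := by
  simp only [holPart, smul_add, map_add]; push_cast; ring

theorem holPart_add_left (B : Cn m →L[ℝ] Cn m →L[ℝ] ℝ) (u v w : Cn m) :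
    holPart B (u + v) w = holPart B u w + holPart B v w := by
  simp only [holPart, smul_add, map_add, add_apply]; push_cast; ring

theorem holPart_smul_right (B : Cn m →L[ℝ] Cn m →L[ℝ] ℝ) (u v : Cn m) (c : ℂ) :
    holPart B u (c • v) = c * holPart B u v := by
  obtain ⟨a, b⟩ := c
  have h2 : I • (⟨a, b⟩ : ℂ) • v = (⟨a, b⟩ : ℂ) • (I • v) := smul_comm _ _ _
  have h3 : (⟨a, b⟩ : ℂ) = a + b * I := by apply Complex.ext <;> simp
  simp only [holPart, h2, map_real_smul, I_smul_I_smul, map_neg, smul_eq_mul]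
  rw [h3]; push_cast
  linear_combination (1 / 4) * b * (B (I • u) v + B u (I • v)) * I_mul_I

theorem holPart_smul_left (B : Cn m →L[ℝ] Cn m →L[ℝ] ℝ) (u v : Cn m) (c : ℂ) :
    holPart B (c • u) v = c * holPart B u v := by
  obtain ⟨a, b⟩ := c
  have h2 : I • (⟨a, b⟩ : ℂ) • u = (⟨a, b⟩ : ℂ) • (I • u) := smul_comm _ _ _
  have h3 : (⟨a, b⟩ : ℂ) = a + b * I := by apply Complex.ext <;> simp
  simp only [holPart, h2, map_real_smul, I_smul_I_smul, map_neg, smul_eq_mul, add_apply, smul_apply,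
    neg_apply]
  rw [h3]; push_cast
  linear_combination (1 / 4) * b * (B (I • u) v + B u (I • v)) * I_mul_I

theorem hermPart_add_left (B : Cn m →L[ℝ] Cn m →L[ℝ] ℝ) (u v w : Cn m) :
    hermPart B (u + v) w = hermPart B u w + hermPart B v w := by
  simp only [hermPart, smul_add, map_add, add_apply]; push_cast; ring

theorem hermPart_add_right (B : Cn m →L[ℝ] Cn m →L[ℝ] ℝ) (u v w : Cn m) :
    hermPart B u (v + w) = hermPart B u v + hermPart B u w := by
  simp only [hermPart, smul_add, map_add]; push_cast; ring

theorem hermPart_smul_left (B : Cn m →L[ℝ] Cn m →L[ℝ] ℝ) (u v : Cn m) (c : ℂ) :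
    hermPart B (c • u) v = c * hermPart B u v := by
  obtain ⟨a, b⟩ := c
  have h2 : I • (⟨a, b⟩ : ℂ) • u = (⟨a, b⟩ : ℂ) • (I • u) := smul_comm _ _ _
  have h3 : (⟨a, b⟩ : ℂ) = a + b * I := by apply Complex.ext <;> simp
  simp only [hermPart, h2, map_real_smul, I_smul_I_smul, map_neg, smul_eq_mul, add_apply, smul_apply,
    neg_apply]
  rw [h3]; push_cast
  linear_combination (1 / 4) * b * (B (I • u) v - B u (I • v)) * I_mul_I

theorem hermPart_smul_right (B : Cn m →L[ℝ] Cn m →L[ℝ] ℝ) (u v : Cn m) (c : ℂ) :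
    hermPart B u (c • v) = (starRingEnd ℂ) c * hermPart B u v := by
  obtain ⟨a, b⟩ := c
  have h2 : I • (⟨a, b⟩ : ℂ) • v = (⟨a, b⟩ : ℂ) • (I • v) := smul_comm _ _ _
  have h3 : (starRingEnd ℂ) (⟨a, b⟩ : ℂ) = a - b * I := by apply Complex.ext <;> simp
  simp only [hermPart, h2, map_real_smul, I_smul_I_smul, map_neg, smul_eq_mul]
  rw [h3]; push_cast
  linear_combination (1 / 4) * b * (B u (I • v) - B (I • u) v) * I_mul_I

theorem hermPart_conj_symm {B : Cn m →L[ℝ] Cn m →L[ℝ] ℝ} (hB : ∀ u v, B u v = B v u)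
    (u v : Cn m) : (starRingEnd ℂ) (hermPart B u v) = hermPart B v u := by
  simp only [hermPart, map_mul, map_sub, map_add, conj_ofReal, conj_I, map_div₀, map_one,
    map_ofNat]
  rw [hB u v, hB (I • u) (I • v), hB (I • u) v, hB u (I • v)]
  ring

/-- `∂T` as a linear map. -/
def delLM (T : Cn m →L[ℝ] ℝ) : Cn m →ₗ[ℂ] ℂ where
  toFun := del T
  map_add' := del_add T
  map_smul' c v := by simpa using del_smul T c v

/-- `holPart B u` as a linear map. -/
def holLM (B : Cn m →L[ℝ] Cn m →L[ℝ] ℝ) (u : Cn m) : Cn m →ₗ[ℂ] ℂ where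
  toFun := holPart B u
  map_add' := holPart_add_right B u
  map_smul' c v := by simpa using holPart_smul_right B u v c

/-- `holPart B · v` as a linear map. -/
def holLMLeft (B : Cn m →L[ℝ] Cn m →L[ℝ] ℝ) (v : Cn m) : Cn m →ₗ[ℂ] ℂ where
  toFun := fun u => holPart B u v
  map_add' := fun u w => holPart_add_left B u w v
  map_smul' c u := by simpa using holPart_smul_left B u v c

theorem linearMap_eq_sum (L : Cn m →ₗ[ℂ] ℂ) (v : Cn m) :
    L v = ∑ k, L (EuclideanSpace.single k 1) * v k := by
  conv_lhs => rw [eq_sum_smul_single v]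
  rw [map_sum]
  exact Finset.sum_congr rfl fun k _ => by rw [map_smul, smul_eq_mul, mul_comm]

theorem del_eq_sum (T : Cn m →L[ℝ] ℝ) (v : Cn m) :
    del T v = ∑ k, del T (EuclideanSpace.single k 1) * v k := linearMap_eq_sum (delLM T) v

theorem holPart_eq_sum (B : Cn m →L[ℝ] Cn m →L[ℝ] ℝ) (u v : Cn m) :
    holPart B u v = ∑ k, holPart B u (EuclideanSpace.single k 1) * v k :=
  linearMap_eq_sum (holLM B u) v

theorem holPart_eq_sum_left (B : Cn m →L[ℝ] Cn m →L[ℝ] ℝ) (u v : Cn m) :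
    holPart B u v = ∑ k, holPart B (EuclideanSpace.single k 1) v * u k :=
  linearMap_eq_sum (holLMLeft B v) u

theorem hermPart_sum_left {ι : Type*} (s : Finset ι) (B : Cn m →L[ℝ] Cn m →L[ℝ] ℝ)
    (c : ι → ℂ) (e : ι → Cn m) (v : Cn m) :
    hermPart B (∑ k ∈ s, c k • e k) v = ∑ k ∈ s, c k * hermPart B (e k) v := by
  classical
  induction s using Finset.induction_on with
  | empty => simp [hermPart]
  | insert a s ha ih => rw [Finset.sum_insert ha, Finset.sum_insert ha, hermPart_add_left, ih,
      hermPart_smul_left]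

theorem hermPart_sum_right {ι : Type*} (s : Finset ι) (B : Cn m →L[ℝ] Cn m →L[ℝ] ℝ)
    (c : ι → ℂ) (e : ι → Cn m) (u : Cn m) :
    hermPart B u (∑ k ∈ s, c k • e k) = ∑ k ∈ s, (starRingEnd ℂ) (c k) * hermPart B u (e k) := by
  classical
  induction s using Finset.induction_on with
  | empty => simp [hermPart]
  | insert a s ha ih => rw [Finset.sum_insert ha, Finset.sum_insert ha, hermPart_add_right, ih,
      hermPart_smul_right]

theorem norm_I_smul (v : Cn m) : ‖I • v‖ = ‖v‖ := by rw [norm_smul, norm_I, one_mul]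

theorem norm_del_le (T : Cn m →L[ℝ] ℝ) (v : Cn m) : ‖del T v‖ ≤ ‖T‖ * ‖v‖ := by
  have h1 : ‖(T v : ℂ)‖ ≤ ‖T‖ * ‖v‖ := by rw [norm_real]; exact T.le_opNorm v
  have h2 : ‖I * (T (I • v) : ℂ)‖ ≤ ‖T‖ * ‖v‖ := by
    rw [norm_mul, norm_I, one_mul, norm_real, ← norm_I_smul v]; exact T.le_opNorm _
  rw [del, norm_mul]
  have := norm_sub_le (T v : ℂ) (I * (T (I • v) : ℂ))
  norm_num
  linarith

theorem norm_bilin_le (B : Cn m →L[ℝ] Cn m →L[ℝ] ℝ) {u v : Cn m} {a b : ℝ} (hu : ‖u‖ = a)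
    (hv : ‖v‖ = b) : ‖(B u v : ℂ)‖ ≤ ‖B‖ * a * b := by
  rw [norm_real, ← hu, ← hv]; exact B.le_opNorm₂ u v

theorem norm_holPart_le (B : Cn m →L[ℝ] Cn m →L[ℝ] ℝ) (u v : Cn m) :
    ‖holPart B u v‖ ≤ ‖B‖ * ‖u‖ * ‖v‖ := by
  have h1 := norm_bilin_le B (u := u) (v := v) rfl rfl
  have h2 := norm_bilin_le B (norm_I_smul u) (norm_I_smul v)
  have h3 := norm_bilin_le B (norm_I_smul u) (v := v) rfl
  have h4 := norm_bilin_le B (u := u) rfl (norm_I_smul v)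
  rw [holPart, norm_mul]
  have h5 := norm_sub_le ((B u v : ℂ) - B (I • u) (I • v)) (I * (B (I • u) v + B u (I • v)))
  have h6 := norm_sub_le (B u v : ℂ) (B (I • u) (I • v))
  have h7 := norm_add_le (B (I • u) v : ℂ) (B u (I • v))
  rw [norm_mul I, norm_I, one_mul] at h5
  norm_num
  linarith

theorem norm_hermPart_le (B : Cn m →L[ℝ] Cn m →L[ℝ] ℝ) (u v : Cn m) :
    ‖hermPart B u v‖ ≤ ‖B‖ * ‖u‖ * ‖v‖ := by
  have h1 := norm_bilin_le B (u := u) (v := v) rfl rfl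
  have h2 := norm_bilin_le B (norm_I_smul u) (norm_I_smul v)
  have h3 := norm_bilin_le B (norm_I_smul u) (v := v) rfl
  have h4 := norm_bilin_le B (u := u) rfl (norm_I_smul v)
  rw [hermPart, norm_mul]
  have h5 := norm_sub_le ((B u v : ℂ) + B (I • u) (I • v)) (I * (B (I • u) v - B u (I • v)))
  have h6 := norm_add_le (B u v : ℂ) (B (I • u) (I • v))
  have h7 := norm_sub_le (B (I • u) v : ℂ) (B u (I • v))
  rw [norm_mul I, norm_I, one_mul] at h5
  norm_num
  linarith

theorem holPart_sub (B B' : Cn m →L[ℝ] Cn m →L[ℝ] ℝ) (u v : Cn m) :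
    holPart (B - B') u v = holPart B u v - holPart B' u v := by
  simp only [holPart, sub_apply]; push_cast; ring

theorem hermPart_sub (B B' : Cn m →L[ℝ] Cn m →L[ℝ] ℝ) (u v : Cn m) :
    hermPart (B - B') u v = hermPart B u v - hermPart B' u v := by
  simp only [hermPart, sub_apply]; push_cast; ring

/-- A real symmetric quadratic form is twice the sum of the real part of its holomorphic part and
its hermitian part. -/
theorem bilin_self_eq {B : Cn m →L[ℝ] Cn m →L[ℝ] ℝ} (v : Cn m) :
    B v v = 2 * (holPart B v v).re + 2 * (hermPart B v v).re := by
  have h1 : (holPart B v v).re = (1 / 4) * (B v v - B (I • v) (I • v)) := by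
    simp [holPart]
  have h2 : (hermPart B v v).re = (1 / 4) * (B v v + B (I • v) (I • v)) := by
    simp [hermPart]
  rw [h1, h2]; ring

theorem two_re_del (T : Cn m →L[ℝ] ℝ) (v : Cn m) : 2 * (del T v).re = T v := by
  simp [del]

/-! ### Wirtinger derivatives in terms of Fréchet derivatives -/

theorem hasFDerivAt_cplx {r : Cn m → ℝ} {ζ : Cn m} (h : DifferentiableAt ℝ r ζ) :
    HasFDerivAt (cplx r) (ofRealCLM.comp (fderiv ℝ r ζ)) ζ :=
  ofRealCLM.hasFDerivAt.comp ζ h.hasFDerivAt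

theorem wirt_cplx {r : Cn m → ℝ} {ζ : Cn m} (h : DifferentiableAt ℝ r ζ) (j : Fin (m + 1)) :
    wirt j (cplx r) ζ = del (fderiv ℝ r ζ) (EuclideanSpace.single j 1) := by
  rw [wirt, (hasFDerivAt_cplx h).fderiv, del, single_I_eq]; rfl

theorem wirtBar_cplx {r : Cn m → ℝ} {ζ : Cn m} (h : DifferentiableAt ℝ r ζ) (j : Fin (m + 1)) :
    wirtBar j (cplx r) ζ = (1 / 2) * (fderiv ℝ r ζ (EuclideanSpace.single j 1)
      + I * fderiv ℝ r ζ (I • EuclideanSpace.single j 1)) := by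
  rw [wirtBar, (hasFDerivAt_cplx h).fderiv, single_I_eq]; rfl

/-- The derivative of `η ↦ T(η) v` for a differentiable family of covectors. -/
theorem hasFDerivAt_ofReal_apply {T : Cn m → Cn m →L[ℝ] ℝ} {ζ : Cn m}
    (h : DifferentiableAt ℝ T ζ) (v : Cn m) :
    HasFDerivAt (fun η => (T η v : ℂ)) (ofRealCLM.comp ((fderiv ℝ T ζ).flip v)) ζ := by
  have := h.hasFDerivAt.clm_apply (hasFDerivAt_const v ζ)
  refine (ofRealCLM.hasFDerivAt.comp ζ this).congr_fderiv ?_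
  ext w; simp

theorem hasFDerivAt_del {T : Cn m → Cn m →L[ℝ] ℝ} {ζ : Cn m}
    (h : DifferentiableAt ℝ T ζ) (v : Cn m) :
    ∃ L : Cn m →L[ℝ] ℂ, HasFDerivAt (fun η => del (T η) v) L ζ ∧
      ∀ u, L u = del (fderiv ℝ T ζ u) v := by
  have h1 := ((hasFDerivAt_ofReal_apply h v).sub
    ((hasFDerivAt_ofReal_apply h (I • v)).const_mul I)).const_mul (1 / 2)
  exact ⟨_, h1, fun u => by simp [del]⟩

theorem wirt_wirt_cplx {r : Cn m → ℝ} {ζ : Cn m} (h : ∀ᶠ η in nhds ζ, DifferentiableAt ℝ r η)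
    (h2 : DifferentiableAt ℝ (fderiv ℝ r) ζ) (j k : Fin (m + 1)) :
    wirt j (wirt k (cplx r)) ζ = holPart (fderiv ℝ (fderiv ℝ r) ζ) (EuclideanSpace.single j 1)
      (EuclideanSpace.single k 1) := by
  obtain ⟨L, hL, hLu⟩ := hasFDerivAt_del h2 (EuclideanSpace.single k 1)
  have he : wirt k (cplx r) =ᶠ[nhds ζ] fun η => del (fderiv ℝ r η) (EuclideanSpace.single k 1) := by
    filter_upwards [h] with η hη using wirt_cplx hη k
  rw [wirt, (hL.congr_of_eventuallyEq he).fderiv, hLu, hLu, single_I_eq]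
  simp only [del, holPart]
  linear_combination (1 / 4) * ((fderiv ℝ (fderiv ℝ r) ζ (I • EuclideanSpace.single j 1)
    (I • EuclideanSpace.single k 1) : ℝ) : ℂ) * I_mul_I

theorem wirt_wirtBar_cplx {r : Cn m → ℝ} {ζ : Cn m} (h : ∀ᶠ η in nhds ζ, DifferentiableAt ℝ r η)
    (h2 : DifferentiableAt ℝ (fderiv ℝ r) ζ) (j k : Fin (m + 1)) :
    wirt j (wirtBar k (cplx r)) ζ = hermPart (fderiv ℝ (fderiv ℝ r) ζ) (EuclideanSpace.single j 1)
      (EuclideanSpace.single k 1) := by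
  have hL := ((hasFDerivAt_ofReal_apply h2 (EuclideanSpace.single k 1)).add
    ((hasFDerivAt_ofReal_apply h2 (I • EuclideanSpace.single k 1)).const_mul I)).const_mul (1 / 2)
  have he : wirtBar k (cplx r) =ᶠ[nhds ζ] fun η => (1 / 2) *
      ((fderiv ℝ r η (EuclideanSpace.single k 1) : ℂ)
      + I * fderiv ℝ r η (I • EuclideanSpace.single k 1)) := by
    filter_upwards [h] with η hη using wirtBar_cplx hη k
  rw [wirt, (hL.congr_of_eventuallyEq he).fderiv, single_I_eq]
  simp [hermPart]
  linear_combination -(1 / 4) * ((fderiv ℝ (fderiv ℝ r) ζ (I • EuclideanSpace.single j 1)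
    (I • EuclideanSpace.single k 1) : ℝ) : ℂ) * I_mul_I

/-- The Levi form is sesquilinear, hence determined by its values on the standard basis. In this
coordinate-free shape it can be diagonalised by an arbitrary unitary basis. -/
theorem leviForm_eq {r : Cn m → ℝ} {ζ : Cn m} (h : ∀ᶠ η in nhds ζ, DifferentiableAt ℝ r η)
    (h2 : DifferentiableAt ℝ (fderiv ℝ r) ζ) (t : Cn m) :
    leviForm r ζ t = (hermPart (fderiv ℝ (fderiv ℝ r) ζ) t t).re := by
  rw [leviForm]
  congr 1
  simp only [wirt_wirtBar_cplx h h2]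
  have h1 := hermPart_sum_left Finset.univ (fderiv ℝ (fderiv ℝ r) ζ) (fun k => t k)
    (fun k => EuclideanSpace.single k (1 : ℂ)) t
  rw [← eq_sum_smul_single t] at h1
  rw [h1]
  refine Finset.sum_congr rfl fun j _ => ?_
  have h3 := hermPart_sum_right Finset.univ (fderiv ℝ (fderiv ℝ r) ζ) (fun k => t k)
    (fun k => EuclideanSpace.single k (1 : ℂ)) (EuclideanSpace.single j 1)
  rw [← eq_sum_smul_single t] at h3
  rw [h3, Finset.mul_sum]
  exact Finset.sum_congr rfl fun k _ => by ring

theorem sum_wirt_cplx {r : Cn m → ℝ} {ζ : Cn m} (h : DifferentiableAt ℝ r ζ) (t : Cn m) :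
    ∑ j, wirt j (cplx r) ζ * t j = del (fderiv ℝ r ζ) t := by
  rw [del_eq_sum]
  simp only [wirt_cplx h]

theorem leviPoly_eq {r : Cn m → ℝ} {ζ : Cn m} (h : ∀ᶠ η in nhds ζ, DifferentiableAt ℝ r η)
    (h2 : DifferentiableAt ℝ (fderiv ℝ r) ζ) (z : Cn m) :
    leviPoly r ζ z = del (fderiv ℝ r ζ) (ζ - z)
      - (1 / 2) * holPart (fderiv ℝ (fderiv ℝ r) ζ) (ζ - z) (ζ - z) := by
  rw [leviPoly, ← sum_wirt_cplx h.self_of_nhds, holPart_eq_sum_left]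
  simp only [wirt_wirt_cplx h h2]
  congr 2
  refine Finset.sum_congr rfl fun j _ => ?_
  rw [holPart_eq_sum, Finset.sum_mul]
  refine Finset.sum_congr rfl fun k _ => ?_
  simp only [PiLp.sub_apply]
  ring

/-- Expresses g without coordinates, so that it can be estimated separately on normal and tangential
vectors; the term with K becomes a hermitian product. -/
theorem oneForm_gCoeff_eq {r : Cn m → ℝ} {ζ : Cn m} (h : ∀ᶠ η in nhds ζ, DifferentiableAt ℝ r η)
    (h2 : DifferentiableAt ℝ (fderiv ℝ r) ζ) (K : ℝ) (z v : Cn m) :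
    oneForm (gCoeff r K ζ z) v = del (fderiv ℝ r ζ) v
      - (1 / 2) * holPart (fderiv ℝ (fderiv ℝ r) ζ) v (ζ - z)
      + ((K * ‖ζ - z‖ : ℝ) : ℂ) * inner ℂ (ζ - z) v := by
  rw [oneForm, ← sum_wirt_cplx h.self_of_nhds, holPart_eq_sum_left]
  simp only [gCoeff, wirt_wirt_cplx h h2, PiLp.inner_apply]
  rw [Finset.mul_sum, Finset.mul_sum, ← Finset.sum_sub_distrib, ← Finset.sum_add_distrib]
  refine Finset.sum_congr rfl fun j _ => ?_
  rw [holPart_eq_sum]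
  simp only [PiLp.sub_apply, RCLike.inner_apply]
  ring

end CauchyFantappie

end

noncomputable section

namespace CauchyFantappie

open MeasureTheory Set Complex

variable {m : ℕ}

/-! ### The `∂̄`-derivatives of the forms `g` and of the support function -/

theorem eventually_differentiableAt_of_contDiffAt {r : Cn m → ℝ} {ζ : Cn m}
    (h : ContDiffAt ℝ 3 r ζ) : ∀ᶠ η in nhds ζ, DifferentiableAt ℝ r η :=
  (h.eventually (by simp)).mono fun _ hη => hη.differentiableAt (by simp)

theorem contDiffAt_fderiv {r : Cn m → ℝ} {ζ : Cn m} (h : ContDiffAt ℝ 3 r ζ) :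
    ContDiffAt ℝ 2 (fderiv ℝ r) ζ := h.fderiv_right (by norm_num)

theorem contDiffAt_fderiv_fderiv {r : Cn m → ℝ} {ζ : Cn m} (h : ContDiffAt ℝ 3 r ζ) :
    ContDiffAt ℝ 1 (fderiv ℝ (fderiv ℝ r)) ζ := (contDiffAt_fderiv h).fderiv_right (by norm_num)

theorem eventually_differentiableAt_fderiv {r : Cn m → ℝ} {ζ : Cn m}
    (h : ContDiffAt ℝ 3 r ζ) : ∀ᶠ η in nhds ζ, DifferentiableAt ℝ (fderiv ℝ r) η :=
  ((contDiffAt_fderiv h).eventually (by simp)).mono fun _ hη => hη.differentiableAt (by simp)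

theorem fderiv_fderiv_symm {r : Cn m → ℝ} {ζ : Cn m} (h : ContDiffAt ℝ 3 r ζ) (u v : Cn m) :
    fderiv ℝ (fderiv ℝ r) ζ u v = fderiv ℝ (fderiv ℝ r) ζ v u :=
  (h.isSymmSndFDerivAt (by simp; norm_num)) u v

/-- The `∂̄`-derivative of the holomorphic second order part. -/
def thirdPart (A : Cn m →L[ℝ] Cn m →L[ℝ] Cn m →L[ℝ] ℝ) (u v t : Cn m) : ℂ :=
  (1 / 2) * (holPart (A u) v t + I * holPart (A (I • u)) v t)

/-- `thirdPart A u v` as a linear map. -/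
def thirdLM (A : Cn m →L[ℝ] Cn m →L[ℝ] Cn m →L[ℝ] ℝ) (u v : Cn m) : Cn m →ₗ[ℂ] ℂ :=
  (1 / 2 : ℂ) • (holLM (A u) v + I • holLM (A (I • u)) v)

theorem thirdLM_apply (A : Cn m →L[ℝ] Cn m →L[ℝ] Cn m →L[ℝ] ℝ) (u v t : Cn m) :
    thirdLM A u v t = thirdPart A u v t := rfl

theorem norm_thirdPart_le (A : Cn m →L[ℝ] Cn m →L[ℝ] Cn m →L[ℝ] ℝ) (u v t : Cn m) :
    ‖thirdPart A u v t‖ ≤ ‖A‖ * ‖u‖ * ‖v‖ * ‖t‖ := by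
  have h1 : ‖holPart (A u) v t‖ ≤ ‖A‖ * ‖u‖ * ‖v‖ * ‖t‖ :=
    (norm_holPart_le _ _ _).trans (by gcongr; exact A.le_opNorm u)
  have h2 : ‖holPart (A (I • u)) v t‖ ≤ ‖A‖ * ‖u‖ * ‖v‖ * ‖t‖ := by
    refine (norm_holPart_le _ _ _).trans ?_
    gcongr
    rw [← norm_I_smul u]
    exact A.le_opNorm _
  rw [thirdPart, norm_mul]
  have h3 := norm_add_le (holPart (A u) v t) (I * holPart (A (I • u)) v t)
  rw [norm_mul I, norm_I, one_mul] at h3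
  have h4 : ‖(1 / 2 : ℂ)‖ = 1 / 2 := by norm_num
  rw [h4]
  linarith

/-- The coefficient `∂̄_ζ(g(v))(u)` of `∂̄_ζ g`. -/
def gDbar (r : Cn m → ℝ) (K : ℝ) (ζ z u v : Cn m) : ℂ :=
  hermPart (fderiv ℝ (fderiv ℝ r) ζ) v u
    - (1 / 2) * thirdPart (fderiv ℝ (fderiv ℝ (fderiv ℝ r)) ζ) u v (ζ - z)
    + K * (‖ζ - z‖ * inner ℂ u v + inner ℂ u (ζ - z) * inner ℂ (ζ - z) v / (2 * ‖ζ - z‖))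

theorem hasDbarAt_del {r : Cn m → ℝ} {ζ : Cn m} (h : ContDiffAt ℝ 3 r ζ) (v : Cn m) :
    HasDbarAt (fun η => del (fderiv ℝ r η) v) (fun u => hermPart (fderiv ℝ (fderiv ℝ r) ζ) v u) ζ := by
  obtain ⟨L, hL, hLu⟩ := hasFDerivAt_del
    (eventually_differentiableAt_fderiv h).self_of_nhds v
  refine ⟨L, hL, fun u => ?_⟩
  simp only [conjPart, hLu, del, hermPart]
  rw [fderiv_fderiv_symm h v u, fderiv_fderiv_symm h v (I • u), fderiv_fderiv_symm h (I • v) u,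
    fderiv_fderiv_symm h (I • v) (I • u)]
  linear_combination (1 / 4) * ((fderiv ℝ (fderiv ℝ r) ζ (I • u) (I • v) : ℝ) : ℂ) * I_mul_I

theorem hasDbarAt_holPart {r : Cn m → ℝ} {ζ : Cn m} (h : ContDiffAt ℝ 3 r ζ) (z v : Cn m) :
    HasDbarAt (fun η => holPart (fderiv ℝ (fderiv ℝ r) η) v (η - z))
      (fun u => thirdPart (fderiv ℝ (fderiv ℝ (fderiv ℝ r)) ζ) u v (ζ - z)) ζ := by
  set B := fderiv ℝ (fderiv ℝ r) with hB
  have hd : HasFDerivAt B (fderiv ℝ B ζ) ζ :=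
    ((contDiffAt_fderiv_fderiv h).differentiableAt (by simp)).hasFDerivAt
  have key : ∀ a c : Cn m, HasFDerivAt (fun η => (B η a c : ℂ))
      (ofRealCLM.comp (((fderiv ℝ B ζ).flip a).flip c)) ζ := by
    intro a c
    have h1 := (hd.clm_apply (hasFDerivAt_const a ζ)).clm_apply (hasFDerivAt_const c ζ)
    refine (ofRealCLM.hasFDerivAt.comp ζ h1).congr_fderiv ?_
    ext w; simp
  have h2 : ∀ c : Cn m, HasDbarAt (fun η => holPart (B η) v c)
      (fun u => thirdPart (fderiv ℝ B ζ) u v c) ζ := by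
    intro c
    refine ⟨_, (((key v c).sub (key (I • v) (I • c))).sub
      (((key (I • v) c).add (key v (I • c))).const_mul I)).const_mul (1 / 4), fun u => ?_⟩
    simp only [conjPart, thirdPart, holPart, smul_apply, sub_apply, add_apply,
      ContinuousLinearMap.comp_apply, ContinuousLinearMap.flip_apply, ofRealCLM_apply, smul_eq_mul]
  -- The expansion separates the coefficients, which depend on the second derivatives of `r`, from
  -- the coordinates of `η - z`, which are holomorphic in `η`. Only the former are hit by ∂̄, and
  -- this is how third derivatives of `r` enter.
  have h3 : ∀ η, holPart (B η) v (η - z) = ∑ k, holPart (B η) v (EuclideanSpace.single k 1)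
      * (-(EuclideanSpace.proj (𝕜 := ℂ) k).toLinearMap (z - η)) := by
    intro η
    rw [holPart_eq_sum]
    refine Finset.sum_congr rfl fun k _ => ?_
    have : (EuclideanSpace.proj (𝕜 := ℂ) k).toLinearMap (z - η) = (z - η) k := rfl
    rw [this]; simp
  simp only [h3]
  have h4 : ∀ k : Fin (m + 1), HasDbarAt
      (fun η => -(EuclideanSpace.proj (𝕜 := ℂ) k).toLinearMap (z - η)) (fun _ => 0) ζ := fun k =>
    (HasDbarAt.of_linear (-(EuclideanSpace.proj (𝕜 := ℂ) k).toLinearMap) z)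
  refine (HasDbarAt.sum _ fun k _ => (h2 (EuclideanSpace.single k 1)).mul (h4 k)).congr_deriv
    fun u => ?_
  rw [← thirdLM_apply, linearMap_eq_sum]
  refine Finset.sum_congr rfl fun k _ => ?_
  have : (EuclideanSpace.proj (𝕜 := ℂ) k).toLinearMap (z - ζ) = (z - ζ) k := rfl
  rw [this, thirdLM_apply]; simp

theorem hasDbarAt_oneForm_gCoeff {r : Cn m → ℝ} {ζ : Cn m} (h : ContDiffAt ℝ 3 r ζ) (K : ℝ)
    {z : Cn m} (hz : ζ ≠ z) (v : Cn m) :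
    HasDbarAt (fun η => oneForm (gCoeff r K η z) v) (fun u => gDbar r K ζ z u v) ζ := by
  have he : (fun η => oneForm (gCoeff r K η z) v) =ᶠ[nhds ζ] fun η => del (fderiv ℝ r η) v
      - (1 / 2) * holPart (fderiv ℝ (fderiv ℝ r) η) v (η - z)
      + K * (‖η - z‖ * inner ℂ (η - z) v) := by
    filter_upwards [(eventually_differentiableAt_of_contDiffAt h).eventually_nhds,
      eventually_differentiableAt_fderiv h] with η h1 h2
    rw [oneForm_gCoeff_eq h1 h2]
    push_cast
    ring
  refine HasDbarAt.congr_of_eventuallyEq ?_ he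
  refine (((hasDbarAt_del h v).sub ((hasDbarAt_holPart h z v).const_mul (1 / 2))).add
    (((HasDbarAt.norm_sub_right hz).mul (HasDbarAt.inner_sub_right z v)).const_mul K)).congr_deriv
    fun u => ?_
  simp only [gDbar]
  ring

theorem oneForm_single (a : Fin (m + 1) → ℂ) (j : Fin (m + 1)) :
    oneForm a (EuclideanSpace.single j 1) = a j := by
  simp [oneForm]

theorem dbar_oneForm {w : Cn m → Fin (m + 1) → ℂ} {ζ : Cn m}
    (hw : ∀ j, DifferentiableAt ℝ (fun η => w η j) ζ) (u v : Cn m) :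
    dbar (fun η => oneForm (w η) v) ζ u = ∑ j, dbar (fun η => w η j) ζ u * v j := by
  have := HasDbarAt.sum Finset.univ (fun j _ =>
    (HasDbarAt.of_differentiableAt (hw j)).mul (HasDbarAt.const (z := ζ) (v j)))
  refine (this.dbar_eq u).trans ?_
  simp

theorem dbarForm_eq {w : Cn m → Fin (m + 1) → ℂ} {ζ : Cn m}
    (hw : ∀ j, DifferentiableAt ℝ (fun η => w η j) ζ) (u v : Cn m) :
    dbarForm w ζ u v = dbar (fun η => oneForm (w η) v) ζ u - dbar (fun η => oneForm (w η) u) ζ v := by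
  rw [dbar_oneForm hw, dbar_oneForm hw, dbarForm, Finset.sum_sub_distrib]

theorem differentiableAt_gCoeff {r : Cn m → ℝ} {ζ : Cn m} (h : ContDiffAt ℝ 3 r ζ) (K : ℝ)
    {z : Cn m} (hz : ζ ≠ z) (j : Fin (m + 1)) :
    DifferentiableAt ℝ (fun η => gCoeff r K η z j) ζ := by
  have := (hasDbarAt_oneForm_gCoeff h K hz (EuclideanSpace.single j 1)).differentiableAt
  simpa only [oneForm_single] using this

theorem dbarForm_gCoeff {r : Cn m → ℝ} {ζ : Cn m} (h : ContDiffAt ℝ 3 r ζ) (K : ℝ)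
    {z : Cn m} (hz : ζ ≠ z) (u v : Cn m) :
    dbarForm (fun η => gCoeff r K η z) ζ u v = gDbar r K ζ z u v - gDbar r K ζ z v u := by
  rw [dbarForm_eq (differentiableAt_gCoeff h K hz),
    (hasDbarAt_oneForm_gCoeff h K hz v).dbar_eq, (hasDbarAt_oneForm_gCoeff h K hz u).dbar_eq]

/-! ### `∂̄` in the variable `z` -/

theorem norm_inner_le (u v : Cn m) : ‖inner ℂ u v‖ ≤ ‖u‖ * ‖v‖ := norm_inner_le_norm u v

/-- The part of g coming from the Levi polynomial is affine and holomorphic in z. Only K |ζ - z|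
times a conjugate linear term contributes, and its derivative is of first order in |ζ - z|. -/
theorem exists_hasDbarAt_oneForm_gCoeff {r : Cn m → ℝ} {ζ : Cn m} (h : ContDiffAt ℝ 3 r ζ) (K : ℝ)
    {z : Cn m} (hz : z ≠ ζ) (v : Cn m) :
    ∃ d : Cn m → ℂ, HasDbarAt (fun z => oneForm (gCoeff r K ζ z) v) d z ∧
      ∀ w, ‖d w‖ ≤ 2 * |K| * ‖ζ - z‖ * ‖v‖ * ‖w‖ := by
  have h0 : 0 < ‖ζ - z‖ := norm_pos_iff.2 (sub_ne_zero.2 hz.symm)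
  have he : ∀ z, oneForm (gCoeff r K ζ z) v = del (fderiv ℝ r ζ) v
      - (1 / 2) * holLM (fderiv ℝ (fderiv ℝ r) ζ) v (ζ - z)
      + K * (‖ζ - z‖ * inner ℂ (ζ - z) v) := by
    intro z
    rw [oneForm_gCoeff_eq (eventually_differentiableAt_of_contDiffAt h)
      (eventually_differentiableAt_fderiv h).self_of_nhds]
    push_cast
    rw [mul_assoc]; rfl
  simp only [he]
  refine ⟨_, ((HasDbarAt.const (del (fderiv ℝ r ζ) v)).sub
    ((HasDbarAt.of_linear (holLM (fderiv ℝ (fderiv ℝ r) ζ) v) ζ).const_mul (1 / 2))).add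
    (((HasDbarAt.norm_sub hz).mul (HasDbarAt.inner_sub_left ζ v)).const_mul K), fun w => ?_⟩
  simp only [mul_zero, sub_zero, zero_add]
  rw [norm_mul, norm_real, Real.norm_eq_abs]
  have h1 : ‖-inner ℂ w (ζ - z) / (2 * ‖ζ - z‖) * inner ℂ (ζ - z) v‖ ≤ ‖ζ - z‖ * ‖v‖ * ‖w‖ := by
    rw [norm_mul, norm_div, norm_neg, norm_mul, norm_real, norm_norm]
    have h2 := norm_inner_le w (ζ - z)
    have h3 := norm_inner_le (ζ - z) v
    calc _ ≤ (‖w‖ * ‖ζ - z‖) / (‖(2 : ℂ)‖ * ‖ζ - z‖) * (‖ζ - z‖ * ‖v‖) := by gcongr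
      _ = (1 / 2) * (‖ζ - z‖ * ‖v‖ * ‖w‖) := by norm_num; field_simp
      _ ≤ _ := by
        have : 0 ≤ ‖ζ - z‖ * ‖v‖ * ‖w‖ := by positivity
        linarith
  have h2 : ‖(‖ζ - z‖ : ℂ) * -inner ℂ w v‖ ≤ ‖ζ - z‖ * ‖v‖ * ‖w‖ := by
    rw [norm_mul, norm_neg, norm_real, norm_norm]
    have h2 := norm_inner_le w v
    calc _ ≤ ‖ζ - z‖ * (‖w‖ * ‖v‖) := by gcongr
      _ = _ := by ring
  calc _ ≤ |K| * (‖ζ - z‖ * ‖v‖ * ‖w‖ + ‖ζ - z‖ * ‖v‖ * ‖w‖) := by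
        gcongr
        exact (norm_add_le _ _).trans (add_le_add h1 h2)
    _ = _ := by ring

/-- Again only the terms with K depend on z non-holomorphically. They are homogeneous of degree one
in ζ - z, so the derivative is merely bounded and does not become small near the diagonal. -/
theorem exists_hasDbarAt_gDbar {r : Cn m → ℝ} {ζ : Cn m} (K : ℝ)
    {z : Cn m} (hz : z ≠ ζ) (u v : Cn m) :
    ∃ d : Cn m → ℂ, HasDbarAt (fun z => gDbar r K ζ z u v) d z ∧
      ∀ w, ‖d w‖ ≤ 2 * |K| * ‖u‖ * ‖v‖ * ‖w‖ := by
  have h0 : 0 < ‖ζ - z‖ := norm_pos_iff.2 (sub_ne_zero.2 hz.symm)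
  have h0' : (‖ζ - z‖ : ℂ) ≠ 0 := by exact_mod_cast h0.ne'
  have he : ∀ z, gDbar r K ζ z u v = hermPart (fderiv ℝ (fderiv ℝ r) ζ) v u
    - (1 / 2) * thirdLM (fderiv ℝ (fderiv ℝ (fderiv ℝ r)) ζ) u v (ζ - z)
    + K * (‖ζ - z‖ * inner ℂ u v
      + (1 / 2) * (((innerSL ℂ u).toLinearMap (ζ - z) * inner ℂ (ζ - z) v) * (‖ζ - z‖ : ℂ)⁻¹)) := by
    intro z
    rw [gDbar, thirdLM_apply]
    have : (innerSL ℂ u).toLinearMap (ζ - z) = inner ℂ u (ζ - z) := rfl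
    rw [this, div_eq_mul_inv (inner ℂ u (ζ - z) * inner ℂ (ζ - z) v), mul_inv]
    ring
  simp only [he]
  refine ⟨_, ((HasDbarAt.const (hermPart (fderiv ℝ (fderiv ℝ r) ζ) v u)).sub
    ((HasDbarAt.of_linear (thirdLM (fderiv ℝ (fderiv ℝ (fderiv ℝ r)) ζ) u v) ζ).const_mul
      (1 / 2))).add ((((HasDbarAt.norm_sub hz).mul (HasDbarAt.const (inner ℂ u v))).add
      ((((HasDbarAt.of_linear (innerSL ℂ u).toLinearMap ζ).mul (HasDbarAt.inner_sub_left ζ v)).mul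
        ((HasDbarAt.norm_sub hz).inv h0')).const_mul (1 / 2))).const_mul K), fun w => ?_⟩
  have hu : (innerSL ℂ u).toLinearMap (ζ - z) = inner ℂ u (ζ - z) := rfl
  simp only [mul_zero, sub_zero, zero_add, add_zero, zero_mul, hu]
  rw [norm_mul, norm_real, Real.norm_eq_abs]
  have h1 : ‖-inner ℂ w (ζ - z) / (2 * ‖ζ - z‖) * inner ℂ u v‖ ≤ (1 / 2) * (‖u‖ * ‖v‖ * ‖w‖) := by
    rw [norm_mul, norm_div, norm_neg, norm_mul, norm_real, norm_norm]
    have h2 := norm_inner_le w (ζ - z)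
    have h3 := norm_inner_le u v
    calc _ ≤ (‖w‖ * ‖ζ - z‖) / (‖(2 : ℂ)‖ * ‖ζ - z‖) * (‖u‖ * ‖v‖) := by gcongr
      _ = _ := by norm_num; field_simp
  have h2 : ‖inner ℂ u (ζ - z) * -inner ℂ w v * (‖ζ - z‖ : ℂ)⁻¹‖ ≤ ‖u‖ * ‖v‖ * ‖w‖ := by
    rw [norm_mul, norm_mul, norm_neg, norm_inv, norm_real, norm_norm]
    have h2 := norm_inner_le u (ζ - z)
    have h3 := norm_inner_le w v
    calc _ ≤ (‖u‖ * ‖ζ - z‖) * (‖w‖ * ‖v‖) * ‖ζ - z‖⁻¹ := by gcongr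
      _ = _ := by field_simp
  have h3 : ‖inner ℂ u (ζ - z) * inner ℂ (ζ - z) v *
      (-((‖ζ - z‖ : ℂ) ^ 2)⁻¹ * (-inner ℂ w (ζ - z) / (2 * ‖ζ - z‖)))‖ ≤ ‖u‖ * ‖v‖ * ‖w‖ := by
    simp only [norm_mul, norm_neg, norm_inv, norm_div, norm_pow, norm_real, norm_norm]
    have h2 := norm_inner_le u (ζ - z)
    have h3 := norm_inner_le (ζ - z) v
    have h4 := norm_inner_le w (ζ - z)
    calc _ ≤ (‖u‖ * ‖ζ - z‖) * (‖ζ - z‖ * ‖v‖) *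
          ((‖ζ - z‖ ^ 2)⁻¹ * ((‖w‖ * ‖ζ - z‖) / (‖(2 : ℂ)‖ * ‖ζ - z‖))) := by gcongr
      _ = (1 / 2) * (‖u‖ * ‖v‖ * ‖w‖) := by norm_num; field_simp
      _ ≤ _ := by
        have : 0 ≤ ‖u‖ * ‖v‖ * ‖w‖ := by positivity
        linarith
  calc _ ≤ |K| * ((1 / 2) * (‖u‖ * ‖v‖ * ‖w‖) + (1 / 2) * (‖u‖ * ‖v‖ * ‖w‖ + ‖u‖ * ‖v‖ * ‖w‖)) := by
        gcongr
        refine (norm_add_le _ _).trans (add_le_add h1 ?_)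
        rw [norm_mul]
        have : ‖(1 / 2 : ℂ)‖ = 1 / 2 := by norm_num
        rw [this]
        gcongr
        exact (norm_add_le _ _).trans (add_le_add h2 h3)
    _ ≤ _ := by
      have : 0 ≤ |K| * (‖u‖ * ‖v‖ * ‖w‖) := by positivity
      linarith

/-- F is a holomorphic polynomial in z, so only K |ζ - z|³ is differentiated. The resulting second
order smallness, against a cubic lower bound for |Φ_K|, is the origin of the exponent 2/3. -/
theorem exists_hasDbarAt_suppFun (r : Cn m → ℝ) (ζ : Cn m) (K : ℝ) {z : Cn m} (hz : z ≠ ζ) :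
    ∃ d : Cn m → ℂ, HasDbarAt (fun z => suppFun r K ζ z) d z ∧
      ∀ w, ‖d w‖ ≤ 2 * |K| * ‖ζ - z‖ ^ 2 * ‖w‖ := by
  have hp : ∀ j, HasDbarAt (fun z : Cn m => ζ j - z j) (fun _ => 0) z := fun j =>
    HasDbarAt.of_linear (EuclideanSpace.proj (𝕜 := ℂ) j).toLinearMap ζ
  have h0 : 0 < ‖ζ - z‖ := norm_pos_iff.2 (sub_ne_zero.2 hz.symm)
  have h1 : HasDbarAt (fun z => leviPoly r ζ z) (fun _ => 0) z := by
    have := (HasDbarAt.sum Finset.univ fun j _ => (hp j).const_mul (wirt j (cplx r) ζ)).sub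
      ((HasDbarAt.sum Finset.univ fun j _ => HasDbarAt.sum Finset.univ fun k _ =>
        (((hp j).const_mul (wirt j (wirt k (cplx r)) ζ)).mul (hp k))).const_mul (1 / 2))
    refine this.congr_deriv fun w => ?_
    simp
  have h2 : HasDbarAt (fun z => ((K * ‖ζ - z‖ ^ 3 : ℝ) : ℂ))
      (fun w => K * (3 * ‖ζ - z‖ ^ 2 * (-inner ℂ w (ζ - z) / (2 * ‖ζ - z‖)))) z := by
    have := ((HasDbarAt.norm_sub hz).pow 2).const_mul K
    push_cast
    refine this.congr_deriv fun w => ?_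
    push_cast
    ring
  refine ⟨_, (h1.sub (HasDbarAt.const (r ζ : ℂ))).add h2, fun w => ?_⟩
  simp only [sub_zero, zero_add, norm_mul, norm_neg, norm_div, norm_pow, norm_real, norm_norm]
  rw [Real.norm_eq_abs]
  have h4 := norm_inner_le w (ζ - z)
  calc _ ≤ |K| * (‖(3 : ℂ)‖ * ‖ζ - z‖ ^ 2 * ((‖w‖ * ‖ζ - z‖) / (‖(2 : ℂ)‖ * ‖ζ - z‖))) := by
        gcongr
    _ = (3 / 2) * (|K| * ‖ζ - z‖ ^ 2 * ‖w‖) := by norm_num; field_simp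
    _ ≤ _ := by
      have : 0 ≤ |K| * ‖ζ - z‖ ^ 2 * ‖w‖ := by positivity
      linarith

end CauchyFantappie

end

noncomputable section

namespace CauchyFantappie

open MeasureTheory Set Complex Equiv

variable {m : ℕ}

/-! ### Exterior algebra in top degree -/

/-- Laplace expansion along the first slot. `Perm.decomposeFin` describes a permutation by its value
`i` at 0 and a permutation of the rest, but fills the rest through `swap 0 i`; composing with
`Fin.cycleRange` turns this into `succAbove` and produces the sign of the expansion. -/
theorem sum_perm_succ {n : ℕ} (F : (Fin (n + 1) → Fin (n + 1)) → ℂ) :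
    ∑ τ : Perm (Fin (n + 1)), ((Perm.sign τ : ℤ) : ℂ) * F τ =
      ∑ i : Fin (n + 1), (-1) ^ (i : ℕ) * ∑ σ : Perm (Fin n), ((Perm.sign σ : ℤ) : ℂ) *
        F (Fin.cons i fun l => i.succAbove (σ l)) := by
  rw [Finset.univ_perm_fin_succ, ← Finset.univ_product_univ]
  simp only [Finset.sum_map, Equiv.toEmbedding_apply, Finset.sum_product]
  have hcons : ∀ (i : Fin (n + 1)) (σ : Perm (Fin n)), (⇑(Perm.decomposeFin.symm (i, σ)) :
      Fin (n + 1) → Fin (n + 1)) = Fin.cons i fun l => swap 0 i (σ l).succ := by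
    intro i σ
    funext l
    refine Fin.cases ?_ (fun l => ?_) l
    · simp
    · simp
  refine Finset.sum_congr rfl fun i _ => Fin.cases ?_ (fun i => ?_) i
  · simp only [hcons, Perm.decomposeFin.symm_sign, if_true, one_mul, Fin.val_zero, pow_zero,
      swap_self, Equiv.refl_apply, Fin.succAbove_zero]
  · have h1 : (-1 : ℂ) ^ (i : ℕ) = ((Perm.sign i.cycleRange : ℤ) : ℂ) := by
      simp [Fin.sign_cycleRange]
    rw [Fin.val_succ, pow_succ, h1, Finset.mul_sum]
    symm
    rw [← Equiv.sum_comp (Equiv.mulLeft i.cycleRange)]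
    refine Finset.sum_congr rfl fun σ _ => ?_
    have hs : (((Perm.sign i.cycleRange : ℤ) : ℂ)) * ((Perm.sign i.cycleRange : ℤ) : ℂ) = 1 := by
      rw [← Int.cast_mul, ← Units.val_mul, Int.units_mul_self]; simp
    have hF : (Fin.cons i.succ fun l => i.succ.succAbove ((Equiv.mulLeft i.cycleRange) σ l) :
        Fin (n + 1) → Fin (n + 1)) = ⇑(Perm.decomposeFin.symm (i.succ, σ)) := by
      rw [hcons]
      congr 1
      funext l
      simp [Fin.succAbove_cycleRange]
    rw [hF, Perm.decomposeFin.symm_sign, if_neg (Fin.succ_ne_zero i)]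
    simp only [Equiv.coe_mulLeft, Perm.sign_mul, Units.val_mul, Int.cast_mul, Units.val_neg,
      Units.val_one, Int.cast_neg, Int.cast_one]
    linear_combination (-((Perm.sign σ : ℤ) : ℂ) * F ⇑(Perm.decomposeFin.symm (i.succ, σ))) * hs

/-- The position `2i + 2`. -/
def evPos (i : Fin m) : Fin (2 * m + 2) := ⟨2 * i + 2, by omega⟩

/-- The position `2i + 3`. -/
def odPos (i : Fin m) : Fin (2 * m + 2) := ⟨2 * i + 3, by omega⟩

/-- The coefficient of `ν ∧ α ∧ β_1 ∧ ⋯ ∧ β_m` (up to the factor `2^m`) for a covector `ν`, `α` and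
two-forms `β_i` given by their values on a basis. -/
def topSum (ν α : Fin (2 * m + 2) → ℂ) (β : Fin m → Fin (2 * m + 2) → Fin (2 * m + 2) → ℂ) : ℂ :=
  ∑ τ : Perm (Fin (2 * m + 2)), ((Perm.sign τ : ℤ) : ℂ) *
    (ν (τ 0) * α (τ 1) * ∏ i, β i (τ (evPos i)) (τ (odPos i)))

/-- The alternating sum over `i` in `boundaryDensity` is the Laplace expansion in the slot of the
conormal. The density thus becomes the single full antisymmetrisation of ν ⊗ α ⊗ β^m, to which top
degree exterior algebra applies. -/
theorem boundaryDensity_wedgePow (φ : Cn m → ℝ) (ζ : Cn m) (α : Cn m → ℂ) (β : Cn m → Cn m → ℂ) :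
    boundaryDensity φ ζ (wedgePow α β) = (1 / 2 ^ m) *
      topSum (fun x => (conormal φ ζ (realBasis x) : ℂ)) (fun x => α (realBasis x))
        (fun _ x y => β (realBasis x) (realBasis y)) := by
  rw [topSum, boundaryDensity, sum_perm_succ (fun τ => (conormal φ ζ (realBasis (τ 0)) : ℂ) *
    α (realBasis (τ 1)) * ∏ i, β (realBasis (τ (evPos i))) (realBasis (τ (odPos i)))), Finset.mul_sum]
  refine Finset.sum_congr rfl fun i _ => ?_
  simp only [wedgePow, Finset.mul_sum]
  refine Finset.sum_congr rfl fun σ _ => ?_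
  have h0 : (Fin.cons i fun l => i.succAbove (σ l) : Fin (2 * m + 2) → Fin (2 * m + 2)) 0 = i := rfl
  have h1 : (Fin.cons i fun l => i.succAbove (σ l) : Fin (2 * m + 2) → Fin (2 * m + 2)) 1
    = i.succAbove (σ ⟨0, by omega⟩) := rfl
  have h2 : ∀ j : Fin m, (Fin.cons i fun l => i.succAbove (σ l) :
    Fin (2 * m + 2) → Fin (2 * m + 2)) (evPos j) = i.succAbove (σ ⟨2 * j + 1, by omega⟩) :=
    fun j => rfl
  have h3 : ∀ j : Fin m, (Fin.cons i fun l => i.succAbove (σ l) :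
    Fin (2 * m + 2) → Fin (2 * m + 2)) (odPos j) = i.succAbove (σ ⟨2 * j + 2, by omega⟩) :=
    fun j => rfl
  simp only [h0, h1, h2, h3]
  ring

theorem topSum_update_add (ν α : Fin (2 * m + 2) → ℂ)
    (β : Fin m → Fin (2 * m + 2) → Fin (2 * m + 2) → ℂ) (j : Fin m)
    (a b : Fin (2 * m + 2) → Fin (2 * m + 2) → ℂ) :
    topSum ν α (Function.update β j (fun x y => a x y + b x y)) =
      topSum ν α (Function.update β j a) + topSum ν α (Function.update β j b) := by
  simp only [topSum, ← Finset.sum_add_distrib]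
  refine Finset.sum_congr rfl fun τ _ => ?_
  have key : ∀ c : Fin (2 * m + 2) → Fin (2 * m + 2) → ℂ,
      ∏ i, Function.update β j c i (τ (evPos i)) (τ (odPos i)) =
        c (τ (evPos j)) (τ (odPos j)) *
          ∏ i ∈ Finset.univ.erase j, β i (τ (evPos i)) (τ (odPos i)) := by
    intro c
    rw [← Finset.mul_prod_erase _ _ (Finset.mem_univ j), Function.update_self]
    congr 1
    refine Finset.prod_congr rfl fun i hi => ?_
    rw [Function.update_of_ne (Finset.ne_of_mem_erase hi)]
  rw [key, key, key]
  ring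

/-- Composition with a transposition reverses the sign of the permutation while the summand is
unchanged, so the sum equals its negative. -/
theorem topSum_eq_zero_of_swap (ν α : Fin (2 * m + 2) → ℂ)
    (β : Fin m → Fin (2 * m + 2) → Fin (2 * m + 2) → ℂ) (p : Fin (2 * m + 2)) (hp : 1 ≠ p)
    (h : ∀ τ : Perm (Fin (2 * m + 2)),
      (ν ((τ * swap 1 p) 0) * α ((τ * swap 1 p) 1) *
        ∏ i, β i ((τ * swap 1 p) (evPos i)) ((τ * swap 1 p) (odPos i))) =
      (ν (τ 0) * α (τ 1) * ∏ i, β i (τ (evPos i)) (τ (odPos i)))) :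
    topSum ν α β = 0 := by
  have h1 : topSum ν α β = -topSum ν α β := by
    conv_lhs => rw [topSum, ← Equiv.sum_comp (Equiv.mulRight (swap 1 p))]
    rw [topSum, ← Finset.sum_neg_distrib]
    refine Finset.sum_congr rfl fun τ _ => ?_
    rw [Equiv.coe_mulRight, h τ, Perm.sign_mul, Perm.sign_swap hp]
    push_cast
    ring
  exact self_eq_neg.1 h1

/-- Here `α` occurs twice, in slot 1 and in one slot of the `j`-th two-form; exchanging these two
slots leaves each summand invariant. -/
theorem topSum_update_wedge (ν α γ : Fin (2 * m + 2) → ℂ)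
    (β : Fin m → Fin (2 * m + 2) → Fin (2 * m + 2) → ℂ) (j : Fin m) :
    topSum ν α (Function.update β j (fun x y => γ x * α y)) = 0 ∧
      topSum ν α (Function.update β j (fun x y => α x * γ y)) = 0 := by
  have key : ∀ (τ : Perm (Fin (2 * m + 2))) (c : Fin (2 * m + 2) → Fin (2 * m + 2) → ℂ),
      ∏ i, Function.update β j c i (τ (evPos i)) (τ (odPos i)) =
        c (τ (evPos j)) (τ (odPos j)) *
          ∏ i ∈ Finset.univ.erase j, β i (τ (evPos i)) (τ (odPos i)) := by
    intro τ c
    rw [← Finset.mul_prod_erase _ _ (Finset.mem_univ j), Function.update_self]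
    congr 1
    refine Finset.prod_congr rfl fun i hi => ?_
    rw [Function.update_of_ne (Finset.ne_of_mem_erase hi)]
  have e1 : (1 : Fin (2 * m + 2)) = ⟨1, by omega⟩ := rfl
  have hprod : ∀ (p : Fin (2 * m + 2)) (_ : p = evPos j ∨ p = odPos j)
      (τ : Perm (Fin (2 * m + 2))),
      ∏ i ∈ Finset.univ.erase j, β i ((τ * swap 1 p) (evPos i)) ((τ * swap 1 p) (odPos i)) =
      ∏ i ∈ Finset.univ.erase j, β i (τ (evPos i)) (τ (odPos i)) := by
    intro p hp τ
    refine Finset.prod_congr rfl fun i hi => ?_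
    have hij : (i : ℕ) ≠ j := fun h => Finset.ne_of_mem_erase hi (Fin.ext h)
    rw [Perm.mul_apply, Perm.mul_apply, swap_apply_of_ne_of_ne, swap_apply_of_ne_of_ne]
    all_goals
      rcases hp with rfl | rfl <;> simp only [e1, evPos, odPos, ne_eq, Fin.mk.injEq] <;> omega
  have h0 : ∀ p : Fin (2 * m + 2), (p = evPos j ∨ p = odPos j) → swap 1 p 0 = 0 := by
    intro p hp
    rw [swap_apply_of_ne_of_ne]
    all_goals
      rcases hp with rfl | rfl <;> rw [ne_eq, Fin.ext_iff] <;> simp [evPos, odPos]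
  constructor
  · refine topSum_eq_zero_of_swap _ _ _ (odPos j) (by simp [e1, odPos, -Fin.mk_one]) fun τ => ?_
    have hev : swap 1 (odPos j) (evPos j) = evPos j := by
      rw [swap_apply_of_ne_of_ne] <;> simp [e1, evPos, odPos, -Fin.mk_one]
    rw [key, key, hprod _ (Or.inr rfl)]
    simp only [Perm.mul_apply, swap_apply_left, swap_apply_right, hev, h0 _ (Or.inr rfl)]
    ring
  · refine topSum_eq_zero_of_swap _ _ _ (evPos j) (by simp [e1, evPos, -Fin.mk_one]) fun τ => ?_
    have hod : swap 1 (evPos j) (odPos j) = odPos j := by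
      rw [swap_apply_of_ne_of_ne] <;> simp [e1, evPos, odPos, -Fin.mk_one]
    rw [key, key, hprod _ (Or.inl rfl)]
    simp only [Perm.mul_apply, swap_apply_left, swap_apply_right, hod, h0 _ (Or.inl rfl)]
    ring

/-- Adding a multiple `γ ∧ α` of `α` to `β` does not change `ν ∧ α ∧ β^m`. -/
theorem topSum_add_wedge (ν α γ : Fin (2 * m + 2) → ℂ) (β : Fin (2 * m + 2) → Fin (2 * m + 2) → ℂ) :
    topSum ν α (fun _ x y => β x y + (γ x * α y - γ y * α x)) = topSum ν α (fun _ => β) := by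
  classical
  have step : ∀ (β' : Fin m → Fin (2 * m + 2) → Fin (2 * m + 2) → ℂ) (j : Fin m),
      topSum ν α (Function.update β' j (fun x y => β x y + (γ x * α y - γ y * α x))) =
        topSum ν α (Function.update β' j β) := by
    intro β' j
    rw [topSum_update_add ν α β' j β (fun x y => γ x * α y - γ y * α x)]
    have h2 : (fun x y => γ x * α y - γ y * α x) =
      fun x y => γ x * α y + α x * (fun y => -γ y) y := by
      funext x y; ring
    rw [h2, topSum_update_add ν α β' j (fun x y => γ x * α y) (fun x y => α x * (fun y => -γ y) y),
      (topSum_update_wedge ν α γ β' j).1, (topSum_update_wedge ν α (fun y => -γ y) β' j).2]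
    ring
  -- The `m` factors are replaced one at a time; `s` is the set of positions where the extra wedge
  -- is still present.
  have hind : ∀ s : Finset (Fin m), topSum ν α (fun i => if i ∈ s then
      (fun x y => β x y + (γ x * α y - γ y * α x)) else β) = topSum ν α (fun _ => β) := by
    intro s
    induction s using Finset.induction_on with
    | empty => simp
    | insert a s ha ih =>
      rw [← ih]
      have h1 : (fun i => if i ∈ insert a s then
          (fun x y => β x y + (γ x * α y - γ y * α x)) else β) =
          Function.update (fun i => if i ∈ s then
          (fun x y => β x y + (γ x * α y - γ y * α x)) else β) a
            (fun x y => β x y + (γ x * α y - γ y * α x)) := by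
        funext i
        by_cases hi : i = a
        · subst hi; simp
        · simp [hi]
      have h2 : (fun i => if i ∈ s then
          (fun x y => β x y + (γ x * α y - γ y * α x)) else β) =
          Function.update (fun i => if i ∈ s then
          (fun x y => β x y + (γ x * α y - γ y * α x)) else β) a β := by
        funext i
        by_cases hi : i = a
        · subst hi; simp [ha]
        · simp [hi]
      rw [h1, step, ← h2]
  have := hind Finset.univ
  simpa using this

theorem topSum_smul (ν α : Fin (2 * m + 2) → ℂ) (β : Fin (2 * m + 2) → Fin (2 * m + 2) → ℂ)
    (c : ℂ) : topSum ν (fun x => c * α x) (fun _ x y => c * β x y) =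
      c ^ (m + 1) * topSum ν α (fun _ => β) := by
  simp only [topSum, Finset.mul_sum]
  refine Finset.sum_congr rfl fun τ _ => ?_
  rw [Finset.prod_mul_distrib, Finset.prod_const, Finset.card_univ, Fintype.card_fin]
  ring

/-- For `W = s / S`, the form `W ∧ (∂̄W)^m` is `S^{-(m+1)} s ∧ (∂̄s)^m`. -/
theorem boundaryDensity_omegaZero_div (φ : Cn m → ℝ) {ζ : Cn m} {w s : Cn m → Fin (m + 1) → ℂ}
    {S : Cn m → ℂ} (hw : ∀ᶠ η in nhds ζ, ∀ j, w η j = s η j / S η)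
    (hs : ∀ j, DifferentiableAt ℝ (fun η => s η j) ζ)
    (hS : DifferentiableAt ℝ S ζ) (h0 : S ζ ≠ 0) :
    boundaryDensity φ ζ (omegaZero w ζ) =
      (1 / (2 * Real.pi * I) ^ (m + 1)) * (1 / 2 ^ m) * ((S ζ)⁻¹ ^ (m + 1) *
      topSum (fun x => (conormal φ ζ (realBasis x) : ℂ)) (fun x => oneForm (s ζ) (realBasis x))
        (fun _ x y => dbarForm s ζ (realBasis x) (realBasis y))) := by
  have h1 : boundaryDensity φ ζ (omegaZero w ζ) = (1 / (2 * Real.pi * I) ^ (m + 1)) *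
      boundaryDensity φ ζ (wedgePow (oneForm (w ζ)) (dbarForm w ζ)) := by
    simp only [boundaryDensity, omegaZero, Finset.mul_sum]
    exact Finset.sum_congr rfl fun i _ => by ring
  have hα : ∀ v, oneForm (w ζ) v = (S ζ)⁻¹ * oneForm (s ζ) v := by
    intro v
    simp only [oneForm, Finset.mul_sum]
    refine Finset.sum_congr rfl fun j _ => ?_
    rw [hw.self_of_nhds j]; ring
  have hd : ∀ j u, dbar (fun η => w η j) ζ u = (S ζ)⁻¹ * dbar (fun η => s η j) ζ u
      - (S ζ)⁻¹ ^ 2 * s ζ j * dbar S ζ u := by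
    intro j u
    have h2 := ((HasDbarAt.of_differentiableAt (hs j)).mul
      ((HasDbarAt.of_differentiableAt hS).inv h0))
    have h3 : (fun η => w η j) =ᶠ[nhds ζ] fun η => s η j * (S η)⁻¹ := by
      filter_upwards [hw] with η hη
      rw [hη j, div_eq_mul_inv]
    rw [(h2.congr_of_eventuallyEq h3).dbar_eq u]
    rw [inv_pow]
    ring
  -- Quotient rule: ∂̄(s/S) = S⁻¹ (∂̄s - S⁻¹ ∂̄S ∧ s). The second term is a wedge with s, which
  -- `topSum_add_wedge` discards, so derivatives of S never reach the kernel.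
  have hβ : ∀ u v, dbarForm w ζ u v = (S ζ)⁻¹ * (dbarForm s ζ u v +
      ((-(S ζ)⁻¹ * dbar S ζ u) * oneForm (s ζ) v - (-(S ζ)⁻¹ * dbar S ζ v) * oneForm (s ζ) u)) := by
    intro u v
    simp only [dbarForm, hd, oneForm, Finset.mul_sum, ← Finset.sum_add_distrib,
      ← Finset.sum_sub_distrib]
    exact Finset.sum_congr rfl fun j _ => by ring
  rw [h1, boundaryDensity_wedgePow, mul_assoc, mul_assoc]
  congr 2
  simp only [hα, hβ]
  rw [topSum_smul _ (fun x => oneForm (s ζ) (realBasis x))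
    (fun x y => dbarForm s ζ (realBasis x) (realBasis y) +
      ((-(S ζ)⁻¹ * dbar S ζ (realBasis x)) * oneForm (s ζ) (realBasis y)
        - (-(S ζ)⁻¹ * dbar S ζ (realBasis y)) * oneForm (s ζ) (realBasis x)))]
  rw [topSum_add_wedge _ (fun x => oneForm (s ζ) (realBasis x))
    (fun x => -(S ζ)⁻¹ * dbar S ζ (realBasis x))
    (fun x y => dbarForm s ζ (realBasis x) (realBasis y))]

end CauchyFantappie

end

noncomputable section

namespace CauchyFantappie

open MeasureTheory Set Complex Equiv

variable {m : ℕ}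

/-! ### Adapted bases -/

/-- The enumeration `(j, a) ↦ 2j + a`. -/
def pairEquiv (m : ℕ) : Fin (m + 1) × Fin 2 ≃ Fin (2 * m + 2) :=
  finProdFinEquiv.trans (finCongr (by ring))

theorem pairEquiv_val (j : Fin (m + 1)) (a : Fin 2) :
    ((pairEquiv m (j, a) : Fin (2 * m + 2)) : ℕ) = a + 2 * j := by
  simp [pairEquiv]

theorem pairEquiv_zero_zero : pairEquiv m (0, 0) = 0 := by
  apply Fin.ext; rw [pairEquiv_val]; simp

theorem pairEquiv_zero_one : pairEquiv m (0, 1) = 1 := by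
  apply Fin.ext; rw [pairEquiv_val]; simp

theorem pairEquiv_succ_zero (i : Fin m) : pairEquiv m (i.succ, 0) = evPos i := by
  apply Fin.ext; rw [pairEquiv_val]; simp [evPos]; ring

theorem pairEquiv_succ_one (i : Fin m) : pairEquiv m (i.succ, 1) = odPos i := by
  apply Fin.ext; rw [pairEquiv_val]; simp [odPos]; ring

theorem prod_positions {M : Type*} [CommMonoid M] (F : Fin (2 * m + 2) → M) :
    ∏ x, F x = F 0 * F 1 * ∏ i : Fin m, (F (evPos i) * F (odPos i)) := by
  rw [← Equiv.prod_comp (pairEquiv m), Fintype.prod_prod_type, Fin.prod_univ_succ]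
  simp only [Fin.prod_univ_two, pairEquiv_zero_zero, pairEquiv_zero_one, pairEquiv_succ_zero,
    pairEquiv_succ_one]

/-- The real basis `e_0, i e_0, e_1, i e_1, …` attached to a unitary basis. -/
def adaptedBasis (e : OrthonormalBasis (Fin (m + 1)) ℂ (Cn m)) :
    Module.Basis (Fin (2 * m + 2)) ℝ (Cn m) :=
  (Complex.basisOneI.smulTower e.toBasis).reindex ((Equiv.prodComm _ _).trans (pairEquiv m))

theorem adaptedBasis_pairEquiv (e : OrthonormalBasis (Fin (m + 1)) ℂ (Cn m)) (j : Fin (m + 1))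
    (a : Fin 2) : adaptedBasis e (pairEquiv m (j, a)) = (![1, I] a : ℂ) • e j := by
  have : ((Equiv.prodComm (Fin 2) (Fin (m + 1))).trans (pairEquiv m)).symm (pairEquiv m (j, a))
      = (a, j) := by
    simp
  rw [adaptedBasis, Module.Basis.reindex_apply, this, Module.Basis.smulTower_apply]
  simp

theorem adaptedBasis_repr (e : OrthonormalBasis (Fin (m + 1)) ℂ (Cn m)) (v : Cn m)
    (j : Fin (m + 1)) (a : Fin 2) : (adaptedBasis e).repr v (pairEquiv m (j, a)) =
      ![(inner ℂ (e j) v).re, (inner ℂ (e j) v).im] a := by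
  have : ((Equiv.prodComm (Fin 2) (Fin (m + 1))).trans (pairEquiv m)).symm (pairEquiv m (j, a))
      = (a, j) := by
    simp
  rw [adaptedBasis, Module.Basis.repr_reindex_apply, this, Module.Basis.smulTower_repr]
  simp [OrthonormalBasis.repr_apply_apply]

theorem norm_vec_one_I (a : Fin 2) : ‖(![1, I] a : ℂ)‖ = 1 := by
  fin_cases a <;> simp

theorem norm_adaptedBasis (e : OrthonormalBasis (Fin (m + 1)) ℂ (Cn m)) (x : Fin (2 * m + 2)) :
    ‖adaptedBasis e x‖ = 1 := by
  obtain ⟨⟨j, a⟩, rfl⟩ := (pairEquiv m).surjective x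
  rw [adaptedBasis_pairEquiv, norm_smul, norm_vec_one_I, one_mul, e.norm_eq_one]

theorem norm_realBasis (x : Fin (2 * m + 2)) : ‖(realBasis x : Cn m)‖ = 1 := by
  rw [realBasis, PiLp.norm_single]
  split_ifs <;> simp

/-- All matrix entries are at most 1 in modulus, and the Leibniz formula has `(2m+2)!` terms. A
crude bound is enough, since the determinant only affects constants. -/
theorem abs_det_adaptedBasis_le (e : OrthonormalBasis (Fin (m + 1)) ℂ (Cn m)) :
    |(adaptedBasis e).det realBasis| ≤ (2 * m + 2).factorial := by
  rw [Module.Basis.det_apply]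
  have h := Matrix.det_le (A := (adaptedBasis e).toMatrix realBasis) (abv := AbsoluteValue.abs)
    (x := (1 : ℝ)) fun i j => ?_
  · simpa using h
  · obtain ⟨⟨k, a⟩, rfl⟩ := (pairEquiv m).surjective i
    rw [Module.Basis.toMatrix_apply, adaptedBasis_repr]
    have h1 : ‖inner ℂ (e k) (realBasis j)‖ ≤ 1 := by
      refine (norm_inner_le_norm _ _).trans ?_
      rw [e.norm_eq_one, norm_realBasis, one_mul]
    fin_cases a
    · exact (abs_re_le_norm _).trans h1
    · exact (abs_im_le_norm _).trans h1

/-! ### Change of basis -/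

/-- Every position belongs to exactly one of the factors, so the product is linear in each vector.
Naming the linear map yields additivity and homogeneity of `preForm` together. -/
theorem exists_linear_update (ν α : Cn m →ₗ[ℝ] ℂ) (β : Cn m →ₗ[ℝ] Cn m →ₗ[ℝ] ℂ)
    (v : Fin (2 * m + 2) → Cn m) (x : Fin (2 * m + 2)) :
    ∃ L : Cn m →ₗ[ℝ] ℂ, ∀ a, ν (Function.update v x a 0) * α (Function.update v x a 1) *
      ∏ i : Fin m, β (Function.update v x a (evPos i)) (Function.update v x a (odPos i)) = L a := by
  obtain ⟨⟨j, b⟩, rfl⟩ := (pairEquiv m).surjective x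
  have n1 : ∀ i : Fin m, evPos i ≠ 0 := fun i => by
    rw [← pairEquiv_zero_zero, ← pairEquiv_succ_zero]; simp [Fin.succ_ne_zero]
  have n2 : ∀ i : Fin m, odPos i ≠ 0 := fun i => by
    rw [← pairEquiv_zero_zero, ← pairEquiv_succ_one]; simp
  have n3 : ∀ i : Fin m, evPos i ≠ 1 := fun i => by
    rw [← pairEquiv_zero_one, ← pairEquiv_succ_zero]; simp
  have n4 : ∀ i : Fin m, odPos i ≠ 1 := fun i => by
    rw [← pairEquiv_zero_one, ← pairEquiv_succ_one]; simp [Fin.succ_ne_zero]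
  have n5 : ∀ i j : Fin m, evPos i ≠ odPos j := fun i j => by
    rw [← pairEquiv_succ_zero, ← pairEquiv_succ_one]; simp
  have n6 : (1 : Fin (2 * m + 2)) ≠ 0 := by
    rw [← pairEquiv_zero_one, ← pairEquiv_zero_zero]; simp
  have n7 : ∀ i j : Fin m, i ≠ j → evPos i ≠ evPos j := fun i j h => by
    rw [← pairEquiv_succ_zero, ← pairEquiv_succ_zero]; simpa using h
  have n8 : ∀ i j : Fin m, i ≠ j → odPos i ≠ odPos j := fun i j h => by
    rw [← pairEquiv_succ_one, ← pairEquiv_succ_one]; simpa using h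
  revert b
  refine Fin.cases ?_ (fun j => ?_) j
  · rw [Fin.forall_fin_two]
    constructor
    · rw [pairEquiv_zero_zero]
      refine ⟨(α (v 1) * ∏ i : Fin m, β (v (evPos i)) (v (odPos i))) • ν, fun a => ?_⟩
      simp only [Function.update_self, Function.update_of_ne n6, Function.update_of_ne (n1 _),
        Function.update_of_ne (n2 _), LinearMap.smul_apply, smul_eq_mul]
      ring
    · rw [pairEquiv_zero_one]
      refine ⟨(ν (v 0) * ∏ i : Fin m, β (v (evPos i)) (v (odPos i))) • α, fun a => ?_⟩
      simp only [Function.update_self, Function.update_of_ne n6.symm, Function.update_of_ne (n3 _),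
        Function.update_of_ne (n4 _), LinearMap.smul_apply, smul_eq_mul]
      ring
  · rw [Fin.forall_fin_two]
    constructor
    · rw [pairEquiv_succ_zero]
      refine ⟨(ν (v 0) * α (v 1) * ∏ i ∈ Finset.univ.erase j, β (v (evPos i)) (v (odPos i))) •
        β.flip (v (odPos j)), fun a => ?_⟩
      rw [← Finset.mul_prod_erase _ _ (Finset.mem_univ j)]
      have : ∏ i ∈ Finset.univ.erase j, β (Function.update v (evPos j) a (evPos i))
          (Function.update v (evPos j) a (odPos i)) =
          ∏ i ∈ Finset.univ.erase j, β (v (evPos i)) (v (odPos i)) := by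
        refine Finset.prod_congr rfl fun i hi => ?_
        rw [Function.update_of_ne (n7 i j (Finset.ne_of_mem_erase hi)),
          Function.update_of_ne (n5 j i).symm]
      rw [this]
      simp only [Function.update_self, Function.update_of_ne (n1 _).symm,
        Function.update_of_ne (n3 _).symm, Function.update_of_ne (n5 _ _).symm,
        LinearMap.smul_apply, smul_eq_mul, LinearMap.flip_apply]
      ring
    · rw [pairEquiv_succ_one]
      refine ⟨(ν (v 0) * α (v 1) * ∏ i ∈ Finset.univ.erase j, β (v (evPos i)) (v (odPos i))) •
        β (v (evPos j)), fun a => ?_⟩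
      rw [← Finset.mul_prod_erase _ _ (Finset.mem_univ j)]
      have : ∏ i ∈ Finset.univ.erase j, β (Function.update v (odPos j) a (evPos i))
          (Function.update v (odPos j) a (odPos i)) =
          ∏ i ∈ Finset.univ.erase j, β (v (evPos i)) (v (odPos i)) := by
        refine Finset.prod_congr rfl fun i hi => ?_
        rw [Function.update_of_ne (n8 i j (Finset.ne_of_mem_erase hi)),
          Function.update_of_ne (n5 i j)]
      rw [this]
      simp only [Function.update_self, Function.update_of_ne (n2 _).symm,
        Function.update_of_ne (n4 _).symm, Function.update_of_ne (n5 _ _),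
        LinearMap.smul_apply, smul_eq_mul]
      ring

/-- The multilinear map `ν ⊗ α ⊗ β ⊗ ⋯ ⊗ β`. -/
def preForm (ν α : Cn m →ₗ[ℝ] ℂ) (β : Cn m →ₗ[ℝ] Cn m →ₗ[ℝ] ℂ) :
    MultilinearMap ℝ (fun _ : Fin (2 * m + 2) => Cn m) ℂ where
  toFun v := ν (v 0) * α (v 1) * ∏ i : Fin m, β (v (evPos i)) (v (odPos i))
  map_update_add' {dec} v x a b := by
    have : dec = instDecidableEqFin _ := Subsingleton.elim _ _
    subst this
    obtain ⟨L, hL⟩ := exists_linear_update ν α β v x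
    rw [hL, hL, hL, map_add]
  map_update_smul' {dec} v x c a := by
    have : dec = instDecidableEqFin _ := Subsingleton.elim _ _
    subst this
    obtain ⟨L, hL⟩ := exists_linear_update ν α β v x
    rw [hL, hL, map_smul]

theorem topSum_eq_alternatization (ν α : Cn m →ₗ[ℝ] ℂ) (β : Cn m →ₗ[ℝ] Cn m →ₗ[ℝ] ℂ)
    (v : Fin (2 * m + 2) → Cn m) :
    topSum (fun x => ν (v x)) (fun x => α (v x)) (fun _ x y => β (v x) (v y)) =
      MultilinearMap.alternatization (preForm ν α β) v := by
  rw [MultilinearMap.alternatization_apply, topSum]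
  refine Finset.sum_congr rfl fun τ _ => ?_
  rw [Units.smul_def, zsmul_eq_mul]
  rfl

/-- The real and imaginary parts are real alternating forms of top degree, hence multiples of the
determinant. -/
theorem alternating_eq_det_mul (f : Cn m [⋀^Fin (2 * m + 2)]→ₗ[ℝ] ℂ)
    (b : Module.Basis (Fin (2 * m + 2)) ℝ (Cn m)) (v : Fin (2 * m + 2) → Cn m) :
    f v = (b.det v : ℂ) * f b := by
  have h1 := (reLm.compAlternatingMap f).eq_smul_basis_det b
  have h2 := (imLm.compAlternatingMap f).eq_smul_basis_det b
  have h1' := congrArg (fun g => g v) h1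
  have h2' := congrArg (fun g => g v) h2
  simp at h1' h2'
  apply Complex.ext
  · rw [h1']; simp [mul_comm]
  · rw [h2']; simp [mul_comm]

theorem topSum_eq_det_mul (ν α : Cn m →ₗ[ℝ] ℂ) (β : Cn m →ₗ[ℝ] Cn m →ₗ[ℝ] ℂ)
    (b : Module.Basis (Fin (2 * m + 2)) ℝ (Cn m)) (v : Fin (2 * m + 2) → Cn m) :
    topSum (fun x => ν (v x)) (fun x => α (v x)) (fun _ x y => β (v x) (v y)) =
      (b.det v : ℂ) * topSum (fun x => ν (b x)) (fun x => α (b x)) (fun _ x y => β (b x) (b y)) := by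
  rw [topSum_eq_alternatization, topSum_eq_alternatization, alternating_eq_det_mul _ b]

/-- `oneForm` as a linear map. -/
def oneFormLM (a : Fin (m + 1) → ℂ) : Cn m →ₗ[ℝ] ℂ where
  toFun := oneForm a
  map_add' u v := by simp [oneForm, mul_add, Finset.sum_add_distrib]
  map_smul' c v := by
    simp only [oneForm, RingHom.id_apply, real_smul, Finset.mul_sum, PiLp.smul_apply]
    exact Finset.sum_congr rfl fun j _ => by ring

theorem dbar_add (f : Cn m → ℂ) (z u v : Cn m) : dbar f z (u + v) = dbar f z u + dbar f z v := by
  rw [dbar_eq_conjPart, dbar_eq_conjPart, dbar_eq_conjPart, conjPart_add]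

theorem dbar_real_smul (f : Cn m → ℂ) (z v : Cn m) (c : ℝ) :
    dbar f z (c • v) = c * dbar f z v := by
  rw [dbar_eq_conjPart, dbar_eq_conjPart, ← Complex.coe_smul, conjPart_smul, conj_ofReal]

/-- `dbarForm` as a bilinear map. -/
def dbarFormLM (w : Cn m → Fin (m + 1) → ℂ) (ζ : Cn m) : Cn m →ₗ[ℝ] Cn m →ₗ[ℝ] ℂ :=
  LinearMap.mk₂ ℝ (dbarForm w ζ)
    (fun u u' v => by
      simp only [dbarForm, dbar_add, PiLp.add_apply, ← Finset.sum_add_distrib]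
      exact Finset.sum_congr rfl fun j _ => by ring)
    (fun c u v => by
      simp only [dbarForm, dbar_real_smul, PiLp.smul_apply, real_smul, Finset.mul_sum]
      exact Finset.sum_congr rfl fun j _ => by ring)
    (fun u v v' => by
      simp only [dbarForm, dbar_add, PiLp.add_apply, ← Finset.sum_add_distrib]
      exact Finset.sum_congr rfl fun j _ => by ring)
    (fun c u v => by
      simp only [dbarForm, dbar_real_smul, PiLp.smul_apply, real_smul, Finset.mul_sum]
      exact Finset.sum_congr rfl fun j _ => by ring)

/-- The conormal as a linear map. -/
def conormalLM (φ : Cn m → ℝ) (ζ : Cn m) : Cn m →ₗ[ℝ] ℂ :=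
  Complex.ofRealLI.toLinearMap ∘ₗ ((‖fderiv ℝ φ ζ‖⁻¹ • fderiv ℝ φ ζ : Cn m →L[ℝ] ℝ) : Cn m →ₗ[ℝ] ℝ)

theorem conormalLM_apply (φ : Cn m → ℝ) (ζ v : Cn m) : conormalLM φ ζ v = (conormal φ ζ v : ℂ) := by
  simp [conormalLM, conormal, div_eq_inv_mul]

theorem topSum_cf_eq_det_mul (φ : Cn m → ℝ) (w : Cn m → Fin (m + 1) → ℂ) (ζ : Cn m)
    (b : Module.Basis (Fin (2 * m + 2)) ℝ (Cn m)) (v : Fin (2 * m + 2) → Cn m) :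
    topSum (fun x => (conormal φ ζ (v x) : ℂ)) (fun x => oneForm (w ζ) (v x))
        (fun _ x y => dbarForm w ζ (v x) (v y)) = (b.det v : ℂ) *
    topSum (fun x => (conormal φ ζ (b x) : ℂ)) (fun x => oneForm (w ζ) (b x))
        (fun _ x y => dbarForm w ζ (b x) (b y)) := by
  have := topSum_eq_det_mul (conormalLM φ ζ) (oneFormLM (w ζ)) (dbarFormLM w ζ) b v
  simp only [conormalLM_apply] at this
  exact this

/-! ### Bounds -/

/-- In each term of the antisymmetrisation every basis index occurs exactly once, so the weights
always multiply to the full product `∏ x, W x`, whatever the permutation. Anisotropic bounds can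
therefore be inserted entry by entry, with no case distinction on which vectors are paired. -/
theorem norm_topSum_le {ν α : Fin (2 * m + 2) → ℂ}
    {β : Fin m → Fin (2 * m + 2) → Fin (2 * m + 2) → ℂ} {W : Fin (2 * m + 2) → ℝ} {a b : ℝ}
    {c : Fin m → ℝ} (hν : ∀ x, ‖ν x‖ ≤ a * W x) (hα : ∀ x, ‖α x‖ ≤ b * W x)
    (hβ : ∀ i x y, ‖β i x y‖ ≤ c i * (W x * W y)) :
    ‖topSum ν α β‖ ≤ (2 * m + 2).factorial * (a * b * ∏ i, c i) * ∏ x, W x := by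
  have hτ : ∀ τ : Perm (Fin (2 * m + 2)), ‖((Perm.sign τ : ℤ) : ℂ) *
      (ν (τ 0) * α (τ 1) * ∏ i, β i (τ (evPos i)) (τ (odPos i)))‖ ≤
      (a * b * ∏ i, c i) * ∏ x, W x := by
    intro τ
    have hs : ‖((Perm.sign τ : ℤ) : ℂ)‖ = 1 := by
      rcases Int.units_eq_one_or (Perm.sign τ) with h | h <;> simp [h]
    rw [norm_mul, hs, one_mul, norm_mul, norm_mul, norm_prod]
    have h1 : ∏ x, W x = W (τ 0) * W (τ 1) * ∏ i, (W (τ (evPos i)) * W (τ (odPos i))) := by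
      rw [← Equiv.prod_comp τ, prod_positions]
    rw [h1]
    calc _ ≤ (a * W (τ 0)) * (b * W (τ 1)) * ∏ i, (c i * (W (τ (evPos i)) * W (τ (odPos i)))) := by
          have ha := hν (τ 0)
          have hb := hα (τ 1)
          gcongr with i
          · exact mul_nonneg ((norm_nonneg _).trans ha) ((norm_nonneg _).trans hb)
          · exact (norm_nonneg _).trans ha
          · exact hβ i _ _
      _ = _ := by rw [Finset.prod_mul_distrib]; ring
  calc _ ≤ ∑ τ : Perm (Fin (2 * m + 2)), (a * b * ∏ i, c i) * ∏ x, W x := by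
        exact (norm_sum_le _ _).trans (Finset.sum_le_sum fun τ _ => hτ τ)
    _ = _ := by
      rw [Finset.sum_const, Finset.card_univ, Fintype.card_perm, Fintype.card_fin, nsmul_eq_mul]
      ring

theorem hasDbarAt_topSum (ν : Fin (2 * m + 2) → ℂ) {α : Cn m → Fin (2 * m + 2) → ℂ}
    {β : Cn m → Fin m → Fin (2 * m + 2) → Fin (2 * m + 2) → ℂ} {z : Cn m}
    {α' : Cn m → Fin (2 * m + 2) → ℂ}
    {β' : Cn m → Fin m → Fin (2 * m + 2) → Fin (2 * m + 2) → ℂ}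
    (hα : ∀ x, HasDbarAt (fun z => α z x) (fun w => α' w x) z)
    (hβ : ∀ i x y, HasDbarAt (fun z => β z i x y) (fun w => β' w i x y) z) :
    HasDbarAt (fun z => topSum ν (α z) (β z)) (fun w => topSum ν (α' w) (β z) +
      ∑ j, topSum ν (α z) (Function.update (β z) j (β' w j))) z := by
  have h := HasDbarAt.sum (Finset.univ : Finset (Perm (Fin (2 * m + 2)))) fun τ _ =>
    ((((hα (τ 1)).const_mul (ν (τ 0))).mul (HasDbarAt.prod Finset.univ
      fun i _ => hβ i (τ (evPos i)) (τ (odPos i)))).const_mul ((Perm.sign τ : ℤ) : ℂ))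
  refine HasDbarAt.congr_deriv h fun w => ?_
  have h2 : ∀ j, topSum ν (α z) (Function.update (β z) j (β' w j)) =
      ∑ τ : Perm (Fin (2 * m + 2)), ((Perm.sign τ : ℤ) : ℂ) * (ν (τ 0) * α z (τ 1) *
        ((∏ i ∈ Finset.univ.erase j, β z i (τ (evPos i)) (τ (odPos i))) *
          β' w j (τ (evPos j)) (τ (odPos j)))) := by
    intro j
    rw [topSum]
    refine Finset.sum_congr rfl fun τ _ => ?_
    rw [← Finset.mul_prod_erase _ _ (Finset.mem_univ j), Function.update_self]
    have : ∏ i ∈ Finset.univ.erase j,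
        Function.update (β z) j (β' w j) i (τ (evPos i)) (τ (odPos i)) =
        ∏ i ∈ Finset.univ.erase j, β z i (τ (evPos i)) (τ (odPos i)) := by
      refine Finset.prod_congr rfl fun i hi => ?_
      rw [Function.update_of_ne (Finset.ne_of_mem_erase hi)]
    rw [this]
    ring
  simp only [h2]
  rw [Finset.sum_comm, topSum, ← Finset.sum_add_distrib]
  refine Finset.sum_congr rfl fun τ _ => ?_
  simp only [mul_add, Finset.mul_sum]

/-! ### Nonvanishing of the top power of a symplectic form -/

/-- The standard antisymmetric form on two indices. -/
def sympl (a b : Fin 2) : ℤ := (b : ℤ) - (a : ℤ)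

/-- Such a permutation is a permutation of the pairs composed with a permutation inside each pair.
The former acts identically on two copies of `Fin n` and so has sign 1; inside a pair, `sympl` is
the sign. -/
theorem sign_eq_prod_sympl {n : ℕ} (τ : Perm (Fin n × Fin 2))
    (h : ∀ j, (τ (j, 0)).1 = (τ (j, 1)).1) :
    ((Perm.sign τ : ℤˣ) : ℤ) = ∏ j, sympl (τ (j, 0)).2 (τ (j, 1)).2 := by
  have hfst : ∀ j a, (τ (j, a)).1 = (τ (j, 0)).1 := fun j a => by
    fin_cases a
    · rfl
    · exact (h j).symm
  have hne : ∀ j, (τ (j, 0)).2 ≠ (τ (j, 1)).2 := fun j hj => by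
    have := τ.injective (Prod.ext (h j) hj)
    simp at this
  let s : Fin n → Perm (Fin 2) := fun j => swap 0 (τ (j, 0)).2
  have hs0 : ∀ j, s j 0 = (τ (j, 0)).2 := fun j => swap_apply_left _ _
  have hs1 : ∀ j, s j 1 = (τ (j, 1)).2 := fun j => by
    have h1 := hne j
    have h2 : s j 1 ≠ s j 0 := (s j).injective.ne (by simp)
    rw [hs0] at h2
    generalize (τ (j, 0)).2 = a at *
    generalize (τ (j, 1)).2 = b at *
    generalize s j 1 = c at *
    omega
  have hs : ∀ j a, s j a = (τ (j, a)).2 := fun j a => by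
    fin_cases a
    · exact hs0 j
    · exact hs1 j
  have hinj : Function.Injective fun j => (τ (j, 0)).1 := by
    intro j k hjk
    obtain ⟨a, ha⟩ := (s j).surjective (τ (k, 0)).2
    have : τ (j, a) = τ (k, 0) := by
      apply Prod.ext
      · rw [hfst]; exact hjk
      · rw [← hs, ha]
    exact congrArg Prod.fst (τ.injective this)
  let π : Perm (Fin n) := Equiv.ofBijective _ (Finite.injective_iff_bijective.1 hinj)
  have hτ : τ = prodCongrLeft (fun _ => π) * prodCongrRight s := by
    ext x : 1
    obtain ⟨j, a⟩ := x
    apply Prod.ext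
    · simp [Perm.mul_apply, prodCongrRight, hfst j a, π]
    · simp [Perm.mul_apply, prodCongrRight, hs]
  have hsgn : ∀ j, ((Perm.sign (s j) : ℤˣ) : ℤ) = sympl (τ (j, 0)).2 (τ (j, 1)).2 := by
    intro j
    have h1 := hne j
    simp only [s]
    generalize (τ (j, 0)).2 = a at *
    generalize (τ (j, 1)).2 = b at *
    revert h1
    revert a b
    decide
  conv_lhs => rw [hτ]
  rw [Perm.sign_mul, Perm.sign_prodCongrLeft, Perm.sign_prodCongrRight, Fin.prod_univ_two,
    Int.units_mul_self, one_mul]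
  push_cast
  exact Finset.prod_congr rfl fun j _ => hsgn j

/-- There is no cancellation. A nonzero term must fix 0 and 1 and map pairs to pairs; its sign then
equals the product of the symplectic signs of its entries, so all nonzero terms have the same value
`κ`, and the identity is one of them. -/
theorem topSum_symplectic_ne_zero {ν α : Fin (2 * m + 2) → ℂ}
    {β : Fin (2 * m + 2) → Fin (2 * m + 2) → ℂ} {c : ℂ} (hc : c ≠ 0)
    (hν0 : ν 0 ≠ 0) (hν : ∀ x, x ≠ 0 → ν x = 0) (hα1 : α 1 ≠ 0)
    (hα : ∀ x, x ≠ 0 → x ≠ 1 → α x = 0)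
    (hβ : ∀ j a l b, β (pairEquiv m (j, a)) (pairEquiv m (l, b)) =
      if j = l then c * (sympl a b : ℂ) else 0) :
    topSum ν α (fun _ => β) ≠ 0 := by
  classical
  set κ : ℂ := ν 0 * α 1 * c ^ m with hκ
  have hκ0 : κ ≠ 0 := by positivity
  let good : Perm (Fin (2 * m + 2)) → Prop := fun τ => ((Perm.sign τ : ℤ) : ℂ) *
    (ν (τ 0) * α (τ 1) * ∏ i, β (τ (evPos i)) (τ (odPos i))) ≠ 0
  have hterm : ∀ τ : Perm (Fin (2 * m + 2)), good τ → ((Perm.sign τ : ℤ) : ℂ) *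
      (ν (τ 0) * α (τ 1) * ∏ i, β (τ (evPos i)) (τ (odPos i))) = κ := by
    intro τ hτ
    have h1 := right_ne_zero_of_mul hτ
    have h2 := right_ne_zero_of_mul h1
    have h3 := left_ne_zero_of_mul h1
    have h4 : τ 0 = 0 := by
      by_contra h; exact left_ne_zero_of_mul h3 (hν _ h)
    have h5 : τ 1 = 1 := by
      by_contra h
      refine right_ne_zero_of_mul h3 (hα _ ?_ h)
      intro h6
      have h7 : τ 1 = τ 0 := by rw [h6, h4]
      have h8 : (1 : Fin (2 * m + 2)) = 0 := τ.injective h7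
      rw [← pairEquiv_zero_one, ← pairEquiv_zero_zero] at h8
      simp at h8
    let τ' : Perm (Fin (m + 1) × Fin 2) := (pairEquiv m).permCongr.symm τ
    have hτ' : ∀ x, pairEquiv m (τ' x) = τ (pairEquiv m x) := fun x => by
      simp [τ']
    have hsign : Perm.sign τ' = Perm.sign τ := by
      simp only [τ', Equiv.permCongr_symm]
      exact Perm.sign_permCongr _ _
    have hval : ∀ i : Fin m, β (τ (evPos i)) (τ (odPos i)) =
        if (τ' (i.succ, 0)).1 = (τ' (i.succ, 1)).1 then
          c * (sympl (τ' (i.succ, 0)).2 (τ' (i.succ, 1)).2 : ℂ) else 0 := fun i => by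
      rw [← pairEquiv_succ_zero, ← pairEquiv_succ_one, ← hτ', ← hτ', ← hβ]
    have e0 : τ' (0, 0) = (0, 0) := by
      apply (pairEquiv m).injective; rw [hτ', pairEquiv_zero_zero, h4]
    have e1 : τ' (0, 1) = (0, 1) := by
      apply (pairEquiv m).injective; rw [hτ', pairEquiv_zero_one, h5]
    have hpair : ∀ i : Fin m, (τ' (i.succ, 0)).1 = (τ' (i.succ, 1)).1 := by
      intro i
      by_contra h
      exact (Finset.prod_ne_zero_iff.1 h2 i (Finset.mem_univ i)) (by rw [hval, if_neg h])
    have hall : ∀ j, (τ' (j, 0)).1 = (τ' (j, 1)).1 := by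
      refine Fin.cases ?_ hpair
      rw [e0, e1]
    have hs := sign_eq_prod_sympl τ' hall
    rw [hsign, Fin.prod_univ_succ, e0, e1] at hs
    simp only [hval, hpair, if_true]
    rw [Finset.prod_mul_distrib, Finset.prod_const, Finset.card_univ, Fintype.card_fin, h4, h5]
    have hs' : ((Perm.sign τ : ℤ) : ℂ) =
        ∏ i : Fin m, (sympl (τ' (i.succ, 0)).2 (τ' (i.succ, 1)).2 : ℂ) := by
      rw [hs]; simp [sympl]
    rw [← hs']
    have hsq : ((Perm.sign τ : ℤ) : ℂ) * ((Perm.sign τ : ℤ) : ℂ) = 1 := by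
      rw [← Int.cast_mul, ← Units.val_mul, Int.units_mul_self]; simp
    rw [hκ]
    linear_combination (ν 0 * α 1 * c ^ m) * hsq
  have hsum : topSum ν α (fun _ => β) = ((Finset.univ.filter good).card : ℂ) * κ := by
    rw [topSum, ← nsmul_eq_mul, ← Finset.sum_const, Finset.sum_filter]
    refine Finset.sum_congr rfl fun τ _ => ?_
    by_cases h : good τ
    · rw [if_pos h, hterm τ h]
    · rw [if_neg h]
      exact not_not.1 h
  have hone : good 1 := by
    have hval : ∀ i : Fin m, β (evPos i) (odPos i) = c := fun i => by
      rw [← pairEquiv_succ_zero, ← pairEquiv_succ_one, hβ, if_pos rfl]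
      simp [sympl]
    simp only [good, Perm.sign_one, Perm.one_apply, hval]
    simp only [Units.val_one, Int.cast_one, one_mul, Finset.prod_const]
    positivity
  rw [hsum]
  refine mul_ne_zero (Nat.cast_ne_zero.2 ?_) hκ0
  exact Finset.card_ne_zero_of_mem (Finset.mem_filter.2 ⟨Finset.mem_univ _, hone⟩)

end CauchyFantappie

end

noncomputable section

namespace CauchyFantappie

open MeasureTheory Set Complex

variable {m : ℕ}

/-! ### Defining functions -/

theorem IsDefiningFunction.eq_zero_of_mem_frontier {k : ℕ∞} {D U : Set (Cn m)} {φ : Cn m → ℝ}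
    (h : IsDefiningFunction k D U φ) (hD : IsOpen D) {ζ : Cn m} (hζ : ζ ∈ frontier D) :
    φ ζ = 0 := by
  have hU := h.frontier_subset hζ
  have hc : ContinuousAt φ ζ :=
    (h.contDiffOn.continuousOn ζ hU).continuousAt (h.isOpen.mem_nhds hU)
  apply le_antisymm
  · have hcl : ζ ∈ closure (D ∩ U) := by
      rw [inter_comm]
      exact h.isOpen.inter_closure ⟨hU, frontier_subset_closure hζ⟩
    have hmem : φ ζ ∈ closure (φ '' (D ∩ U)) := mem_closure_image hc hcl
    have hsub : φ '' (D ∩ U) ⊆ Iic 0 := by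
      rintro _ ⟨x, hx, rfl⟩
      rw [h.inter_eq] at hx
      exact hx.2.le
    exact (closure_minimal hsub isClosed_Iic) hmem
  · by_contra hlt
    have : ζ ∈ D ∩ U := by
      rw [h.inter_eq]; exact ⟨hU, not_le.1 hlt⟩
    rw [hD.frontier_eq] at hζ
    exact hζ.2 this.1

theorem IsDefiningFunction.nonpos_of_mem_closure {k : ℕ∞} {D U : Set (Cn m)} {φ : Cn m → ℝ}
    (h : IsDefiningFunction k D U φ) (hD : IsOpen D) {z : Cn m} (hz : z ∈ closure D)
    (hU : z ∈ U) : φ z ≤ 0 := by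
  by_cases hzD : z ∈ D
  · have : z ∈ D ∩ U := ⟨hzD, hU⟩
    rw [h.inter_eq] at this
    exact this.2.le
  · exact (h.eq_zero_of_mem_frontier hD (by rw [hD.frontier_eq]; exact ⟨hz, hzD⟩)).le

theorem contDiff_exp_norm_sq (C : ℝ) : ContDiff ℝ ∞ fun z : Cn m => Real.exp (-C * ‖z‖ ^ 2) := by
  have h : ContDiff ℝ ∞ fun z : Cn m => ‖z‖ ^ 2 := by
    simp only [EuclideanSpace.norm_sq_eq]
    refine ContDiff.sum fun i _ => ?_
    have : ContDiff ℝ ∞ fun z : ℂ => ‖z‖ ^ 2 := contDiff_norm_sq ℝ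
    refine this.comp ?_
    exact ((EuclideanSpace.proj (𝕜 := ℂ) i).restrictScalars ℝ).contDiff
  exact Real.contDiff_exp.comp (contDiff_const.mul h)

theorem contDiffAt_of_isDefiningFunction {k : ℕ∞} (hk : 3 ≤ k) {D U : Set (Cn m)} {φ : Cn m → ℝ}
    (h : IsDefiningFunction k D U φ) {ζ : Cn m} (hζ : ζ ∈ U) : ContDiffAt ℝ 3 φ ζ :=
  (h.contDiffOn.contDiffAt (h.isOpen.mem_nhds hζ)).of_le (show ((3 : ℕ∞) : ℕ∞ω) ≤ k from WithTop.coe_le_coe.2 hk)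

theorem modDef_fderiv {φ : Cn m → ℝ} (C : ℝ) {ζ : Cn m} (hφ : DifferentiableAt ℝ φ ζ) :
    fderiv ℝ (modDef φ C) ζ = φ ζ • fderiv ℝ (fun z : Cn m => Real.exp (-C * ‖z‖ ^ 2)) ζ
      + Real.exp (-C * ‖ζ‖ ^ 2) • fderiv ℝ φ ζ := by
  have h2 : DifferentiableAt ℝ (fun z : Cn m => Real.exp (-C * ‖z‖ ^ 2)) ζ :=
    ((contDiff_exp_norm_sq C).differentiable (by simp)) ζ
  exact fderiv_mul hφ h2

theorem modDef_isDefiningFunction {k : ℕ∞} (hk : 3 ≤ k) {D U : Set (Cn m)} {φ : Cn m → ℝ}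
    (hD : IsOpen D) (h : IsDefiningFunction k D U φ) (C : ℝ) :
    IsDefiningFunction 3 D U (modDef φ C) where
  isOpen := h.isOpen
  frontier_subset := h.frontier_subset
  contDiffOn := by
    have h1 : ContDiffOn ℝ 3 φ U := h.contDiffOn.of_le (show ((3 : ℕ∞) : ℕ∞ω) ≤ k from WithTop.coe_le_coe.2 hk)
    have h2 : ContDiff ℝ 3 fun z : Cn m => Real.exp (-C * ‖z‖ ^ 2) :=
      (contDiff_exp_norm_sq C).of_le (show ((3 : ℕ∞) : ℕ∞ω) ≤ ((⊤ : ℕ∞) : ℕ∞ω) from WithTop.coe_le_coe.2 le_top)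
    exact h1.mul h2.contDiffOn
  inter_eq := by
    rw [h.inter_eq]
    ext z
    simp only [mem_ofPred_eq, modDef]
    have := Real.exp_pos (-C * ‖z‖ ^ 2)
    rw [mul_neg_iff]
    constructor
    · rintro ⟨h1, h2⟩
      exact ⟨h1, Or.inr ⟨h2, this⟩⟩
    · rintro ⟨h1, h2 | h2⟩
      · exact absurd h2.2 (not_lt.2 this.le)
      · exact ⟨h1, h2.1⟩
  fderiv_ne_zero ζ hζ := by
    rw [modDef_fderiv C ((contDiffAt_of_isDefiningFunction hk h
      (h.frontier_subset hζ)).differentiableAt (by simp)), h.eq_zero_of_mem_frontier hD hζ,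
      zero_smul, zero_add]
    exact smul_ne_zero (Real.exp_pos _).ne' (h.fderiv_ne_zero ζ hζ)

/-- On bD the covector dr is a positive multiple of dφ. A density defined through φ may thus be
analysed with r throughout. -/
theorem conormal_modDef {k : ℕ∞} (hk : 3 ≤ k) {D U : Set (Cn m)} {φ : Cn m → ℝ}
    (hD : IsOpen D) (h : IsDefiningFunction k D U φ) (C : ℝ) {ζ : Cn m} (hζ : ζ ∈ frontier D)
    (v : Cn m) : conormal (modDef φ C) ζ v = conormal φ ζ v := by
  rw [conormal, conormal, modDef_fderiv C ((contDiffAt_of_isDefiningFunction hk h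
      (h.frontier_subset hζ)).differentiableAt (by simp)), h.eq_zero_of_mem_frontier hD hζ,
      zero_smul, zero_add, norm_smul, smul_apply, smul_eq_mul, Real.norm_eq_abs,
      abs_of_pos (Real.exp_pos _)]
  exact mul_div_mul_left _ _ (Real.exp_pos _).ne'

/-- For r = φψ with φ = 0 at ζ, the second derivative is ψ D²φ plus the symmetric product of dφ and
dψ. A complex tangent vector t satisfies dφ(t) = dφ(it) = 0, so the product disappears from the Levi
form. No sign or size of C is required. -/
theorem modDef_isLeviPseudoconvex {k : ℕ∞} (hk : 3 ≤ k) {D U : Set (Cn m)} {φ : Cn m → ℝ}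
    (hD : IsOpen D) (h : IsDefiningFunction k D U φ) (hp : IsLeviPseudoconvex D φ) (C : ℝ) :
    IsLeviPseudoconvex D (modDef φ C) := by
  intro ζ hζ t ht
  have hU := h.frontier_subset hζ
  have hc := contDiffAt_of_isDefiningFunction hk h hU
  have h0 := h.eq_zero_of_mem_frontier hD hζ
  have hc' := contDiffAt_of_isDefiningFunction le_rfl (modDef_isDefiningFunction hk hD h C) hU
  set ψ : Cn m → ℝ := fun z => Real.exp (-C * ‖z‖ ^ 2) with hψ
  have hψs : ContDiff ℝ ∞ ψ := contDiff_exp_norm_sq C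
  have hψpos : 0 < ψ ζ := Real.exp_pos _
  have hψ1 : DifferentiableAt ℝ ψ ζ := (hψs.differentiable (by simp)) ζ
  have hψ2 : DifferentiableAt ℝ (fderiv ℝ ψ) ζ :=
    ((hψs.fderiv_right (m := ∞) (by simp)).differentiable (by simp)) ζ
  have hφ1 := hc.differentiableAt (by simp)
  have hφ2 := (eventually_differentiableAt_fderiv hc).self_of_nhds
  have he : fderiv ℝ (modDef φ C) =ᶠ[nhds ζ] fun η => φ η • fderiv ℝ ψ η + ψ η • fderiv ℝ φ η := by
    filter_upwards [eventually_differentiableAt_of_contDiffAt hc] with η hη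
    exact modDef_fderiv C hη
  have hB := (((hφ1.hasFDerivAt.smul hψ2.hasFDerivAt).add
    (hψ1.hasFDerivAt.smul hφ2.hasFDerivAt)).congr_of_eventuallyEq he).fderiv
  rw [sum_wirt_cplx (hc'.differentiableAt (by simp)), modDef_fderiv C hφ1, h0, zero_smul,
    zero_add] at ht
  have hdel : del (fderiv ℝ φ ζ) t = 0 := by
    have h1 : del (ψ ζ • fderiv ℝ φ ζ) t = ψ ζ * del (fderiv ℝ φ ζ) t := by
      simp only [del, smul_apply, smul_eq_mul]; push_cast; ring
    rw [h1] at ht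
    exact (mul_eq_zero.1 ht).resolve_left (by exact_mod_cast hψpos.ne')
  have ht1 : fderiv ℝ φ ζ t = 0 := by
    rw [← two_re_del, hdel]; simp
  have ht2 : fderiv ℝ φ ζ (I • t) = 0 := by
    rw [← two_re_del, del_smul, hdel]; simp
  have hφL := hp ζ hζ t (by rw [sum_wirt_cplx hφ1, hdel])
  rw [leviForm_eq (eventually_differentiableAt_of_contDiffAt hc) hφ2] at hφL
  rw [leviForm_eq (eventually_differentiableAt_of_contDiffAt hc')
    (eventually_differentiableAt_fderiv hc').self_of_nhds, hB]
  have key : ∀ B : Cn m →L[ℝ] Cn m →L[ℝ] ℝ, (hermPart B t t).re =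
      (1 / 4) * (B t t + B (I • t) (I • t)) := fun B => by simp [hermPart]
  rw [key] at hφL ⊢
  simp only [h0, zero_smul, zero_add, add_apply, smul_apply, smul_eq_mul,
    ContinuousLinearMap.smulRight_apply, ht1, ht2, mul_zero, add_zero]
  have : 0 ≤ ψ ζ * ((1 / 4) * (fderiv ℝ (fderiv ℝ φ) ζ t t +
    fderiv ℝ (fderiv ℝ φ) ζ (I • t) (I • t))) := mul_nonneg hψpos.le hφL
  linarith

/-! ### Uniform bounds near the boundary -/

/-- Uniform `C³` bounds for `r` on balls of radius `ρ` around the points of `Γ`. -/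
structure UniformBounds (r : Cn m → ℝ) (Γ : Set (Cn m)) (ρ A c : ℝ) : Prop where
  rho_pos : 0 < ρ
  one_le : 1 ≤ A
  c_pos : 0 < c
  contDiffAt : ∀ p ∈ Γ, ∀ x ∈ Metric.ball p ρ, ContDiffAt ℝ 3 r x
  bound_one : ∀ p ∈ Γ, ∀ x ∈ Metric.ball p ρ, ‖fderiv ℝ r x‖ ≤ A
  bound_two : ∀ p ∈ Γ, ∀ x ∈ Metric.ball p ρ, ‖fderiv ℝ (fderiv ℝ r) x‖ ≤ A
  bound_three : ∀ p ∈ Γ, ∀ x ∈ Metric.ball p ρ, ‖fderiv ℝ (fderiv ℝ (fderiv ℝ r)) x‖ ≤ A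
  lower : ∀ p ∈ Γ, c ≤ ‖fderiv ℝ r p‖

/-- Compactness, applied to a closed thickening of bD inside U for the derivatives up to order three
and to bD itself for the lower bound on |dr|. -/
theorem exists_uniformBounds {D U : Set (Cn m)} {r : Cn m → ℝ} (hDb : Bornology.IsBounded D)
    (h : IsDefiningFunction 3 D U r) :
    ∃ ρ A c, UniformBounds r (frontier D) ρ A c ∧ ∀ p ∈ frontier D, Metric.ball p ρ ⊆ U := by
  have hcomp : IsCompact (frontier D) :=
    Metric.isCompact_of_isClosed_isBounded isClosed_frontier
      (hDb.closure.subset frontier_subset_closure)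
  obtain ⟨ρ, hρ, hsub⟩ := hcomp.exists_cthickening_subset_open h.isOpen h.frontier_subset
  have hK : IsCompact (Metric.cthickening ρ (frontier D)) := hcomp.cthickening
  have hball : ∀ p ∈ frontier D, Metric.ball p ρ ⊆ Metric.cthickening ρ (frontier D) := by
    intro p hp x hx
    exact Metric.mem_cthickening_of_dist_le x p ρ _ hp (Metric.mem_ball.1 hx).le
  have h3 : ContDiffOn ℝ 3 r U := h.contDiffOn
  have d1 : ContDiffOn ℝ 2 (fderiv ℝ r) U := h3.fderiv_of_isOpen h.isOpen (by norm_num)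
  have d2 : ContDiffOn ℝ 1 (fderiv ℝ (fderiv ℝ r)) U := d1.fderiv_of_isOpen h.isOpen (by norm_num)
  have d3 : ContDiffOn ℝ 0 (fderiv ℝ (fderiv ℝ (fderiv ℝ r))) U :=
    d2.fderiv_of_isOpen h.isOpen (by norm_num)
  obtain ⟨A1, hA1⟩ := hK.exists_bound_of_continuousOn (d1.continuousOn.mono hsub)
  obtain ⟨A2, hA2⟩ := hK.exists_bound_of_continuousOn (d2.continuousOn.mono hsub)
  obtain ⟨A3, hA3⟩ := hK.exists_bound_of_continuousOn (d3.continuousOn.mono hsub)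
  obtain ⟨c, hc, hcl⟩ : ∃ c > 0, ∀ p ∈ frontier D, c ≤ ‖fderiv ℝ r p‖ := by
    rcases (frontier D).eq_empty_or_nonempty with he | hne
    · exact ⟨1, one_pos, by simp [he]⟩
    · obtain ⟨p, hp, hmin⟩ := hcomp.exists_isMinOn hne
        (d1.continuousOn.mono h.frontier_subset).norm
      exact ⟨_, norm_pos_iff.2 (h.fderiv_ne_zero p hp), fun q hq => hmin hq⟩
  refine ⟨ρ, max 1 (max A1 (max A2 A3)), c, ⟨hρ, le_max_left _ _, hc, ?_, ?_, ?_, ?_, hcl⟩, ?_⟩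
  · intro p hp x hx
    exact h3.contDiffAt (h.isOpen.mem_nhds (hsub (hball p hp hx)))
  · intro p hp x hx
    exact (hA1 x (hball p hp hx)).trans (by simp)
  · intro p hp x hx
    exact (hA2 x (hball p hp hx)).trans (by simp)
  · intro p hp x hx
    exact (hA3 x (hball p hp hx)).trans (by simp)
  · exact fun p hp => (hball p hp).trans hsub

namespace UniformBounds

variable {r : Cn m → ℝ} {Γ : Set (Cn m)} {ρ A c : ℝ}

theorem nonneg (h : UniformBounds r Γ ρ A c) : 0 ≤ A := zero_le_one.trans h.one_le

theorem lip_zero (h : UniformBounds r Γ ρ A c) {p x y : Cn m} (hp : p ∈ Γ)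
    (hx : x ∈ Metric.ball p ρ) (hy : y ∈ Metric.ball p ρ) : |r y - r x| ≤ A * ‖y - x‖ :=
  (convex_ball p ρ).norm_image_sub_le_of_norm_fderiv_le
    (fun z hz => (h.contDiffAt p hp z hz).differentiableAt (by simp))
    (fun z hz => h.bound_one p hp z hz) hx hy

theorem lip_one (h : UniformBounds r Γ ρ A c) {p x y : Cn m} (hp : p ∈ Γ)
    (hx : x ∈ Metric.ball p ρ) (hy : y ∈ Metric.ball p ρ) :
    ‖fderiv ℝ r y - fderiv ℝ r x‖ ≤ A * ‖y - x‖ :=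
  (convex_ball p ρ).norm_image_sub_le_of_norm_fderiv_le
    (fun z hz => (eventually_differentiableAt_fderiv (h.contDiffAt p hp z hz)).self_of_nhds)
    (fun z hz => h.bound_two p hp z hz) hx hy

theorem lip_two (h : UniformBounds r Γ ρ A c) {p x y : Cn m} (hp : p ∈ Γ)
    (hx : x ∈ Metric.ball p ρ) (hy : y ∈ Metric.ball p ρ) :
    ‖fderiv ℝ (fderiv ℝ r) y - fderiv ℝ (fderiv ℝ r) x‖ ≤ A * ‖y - x‖ :=
  (convex_ball p ρ).norm_image_sub_le_of_norm_fderiv_le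
    (fun z hz => (contDiffAt_fderiv_fderiv (h.contDiffAt p hp z hz)).differentiableAt (by simp))
    (fun z hz => h.bound_three p hp z hz) hx hy

theorem closedBall_subset {p x : Cn m} (hx : x ∈ Metric.ball p ρ) :
    Metric.closedBall p ‖x - p‖ ⊆ Metric.ball p ρ := by
  rw [mem_ball_iff_norm] at hx
  exact Metric.closedBall_subset_ball hx

theorem taylor_zero (h : UniformBounds r Γ ρ A c) {p x : Cn m} (hp : p ∈ Γ)
    (hx : x ∈ Metric.ball p ρ) :
    |r x - r p - fderiv ℝ r p (x - p)| ≤ A * ‖x - p‖ ^ 2 := by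
  have hpb : p ∈ Metric.ball p ρ := Metric.mem_ball_self h.rho_pos
  have := (convex_closedBall p ‖x - p‖).norm_image_sub_le_of_norm_hasFDerivWithin_le'
    (f := r) (f' := fderiv ℝ r) (φ := fderiv ℝ r p) (C := A * ‖x - p‖)
    (fun y hy => ((h.contDiffAt p hp y (closedBall_subset hx hy)).differentiableAt
      (by simp)).hasFDerivAt.hasFDerivWithinAt)
    (fun y hy => (h.lip_one hp hpb (closedBall_subset hx hy)).trans (by
      have := mem_closedBall_iff_norm.1 hy
      have := h.nonneg
      gcongr))
    (Metric.mem_closedBall_self (norm_nonneg _)) (mem_closedBall_iff_norm.2 le_rfl)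
  rw [Real.norm_eq_abs] at this
  exact this.trans (le_of_eq (by ring))

theorem taylor_one (h : UniformBounds r Γ ρ A c) {p x : Cn m} (hp : p ∈ Γ)
    (hx : x ∈ Metric.ball p ρ) :
    ‖fderiv ℝ r x - fderiv ℝ r p - fderiv ℝ (fderiv ℝ r) p (x - p)‖ ≤ A * ‖x - p‖ ^ 2 := by
  have hpb : p ∈ Metric.ball p ρ := Metric.mem_ball_self h.rho_pos
  have := (convex_closedBall p ‖x - p‖).norm_image_sub_le_of_norm_hasFDerivWithin_le'
    (f := fderiv ℝ r) (f' := fderiv ℝ (fderiv ℝ r)) (φ := fderiv ℝ (fderiv ℝ r) p)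
    (C := A * ‖x - p‖)
    (fun y hy => (eventually_differentiableAt_fderiv (h.contDiffAt p hp y
      (closedBall_subset hx hy))).self_of_nhds.hasFDerivAt.hasFDerivWithinAt)
    (fun y hy => (h.lip_two hp hpb (closedBall_subset hx hy)).trans (by
      have := mem_closedBall_iff_norm.1 hy
      have := h.nonneg
      gcongr))
    (Metric.mem_closedBall_self (norm_nonneg _)) (mem_closedBall_iff_norm.2 le_rfl)
  exact this.trans (le_of_eq (by ring))

theorem taylor_two (h : UniformBounds r Γ ρ A c) {p x : Cn m} (hp : p ∈ Γ)
    (hx : x ∈ Metric.ball p ρ) :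
    |r x - (r p + fderiv ℝ r p (x - p) + (1 / 2) * fderiv ℝ (fderiv ℝ r) p (x - p) (x - p))|
      ≤ A * ‖x - p‖ ^ 3 := by
  set B := fderiv ℝ (fderiv ℝ r) p with hB
  have hsymm := fderiv_fderiv_symm (h.contDiffAt p hp p (Metric.mem_ball_self h.rho_pos))
  -- By symmetry of `B`, the derivative of the second order remainder is the first order remainder
  -- of `fderiv ℝ r`, already bounded in `taylor_one`. The mean value inequality gives the constant
  -- `A` instead of the sharp one, which does not matter.
  have hg : ∀ y ∈ Metric.ball p ρ, HasFDerivAt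
      (fun y => r y - fderiv ℝ r p (y - p) - (1 / 2) * B (y - p) (y - p))
      (fderiv ℝ r y - fderiv ℝ r p - B (y - p)) y := by
    intro y hy
    have h1 : HasFDerivAt r (fderiv ℝ r y) y :=
      ((h.contDiffAt p hp y hy).differentiableAt (by simp)).hasFDerivAt
    have h2 : HasFDerivAt (fun y => fderiv ℝ r p (y - p)) (fderiv ℝ r p) y :=
      (fderiv ℝ r p).hasFDerivAt.comp y ((hasFDerivAt_id y).sub_const p)
    have h3 : HasFDerivAt (fun y => B (y - p)) B y :=
      B.hasFDerivAt.comp y ((hasFDerivAt_id y).sub_const p)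
    have h4 := h3.clm_apply ((hasFDerivAt_id y).sub_const p)
    refine ((h1.sub h2).sub (h4.const_mul (1 / 2))).congr_fderiv ?_
    ext u
    have : B u (y - p) = B (y - p) u := hsymm u (y - p)
    rw [map_sub (B u), map_sub B, sub_apply] at this
    simp
    linarith
  have := (convex_closedBall p ‖x - p‖).norm_image_sub_le_of_norm_hasFDerivWithin_le
    (f := fun y => r y - fderiv ℝ r p (y - p) - (1 / 2) * B (y - p) (y - p))
    (f' := fun y => fderiv ℝ r y - fderiv ℝ r p - B (y - p)) (C := A * ‖x - p‖ ^ 2)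
    (fun y hy => (hg y (closedBall_subset hx hy)).hasFDerivWithinAt)
    (fun y hy => (h.taylor_one hp (closedBall_subset hx hy)).trans (by
      have := mem_closedBall_iff_norm.1 hy
      have := h.nonneg
      gcongr))
    (Metric.mem_closedBall_self (norm_nonneg _)) (mem_closedBall_iff_norm.2 le_rfl)
  rw [Real.norm_eq_abs] at this
  simp only [sub_self, map_zero, mul_zero, sub_zero] at this
  refine le_trans (le_of_eq ?_) (this.trans (le_of_eq (by ring)))
  congr 1
  ring

end UniformBounds

/-! ### Unitary bases adapted to the Levi form -/

/-- The Riesz vector of ∂T, normalised, is the complex normal. On its orthogonal complement, which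
is the kernel of ∂T, the hermitian part of `B` is diagonalised by the spectral theorem, and
positivity there makes the eigenvalues nonnegative. The bound on ‖T‖ holds because T = 2 Re ∂T. -/
theorem exists_adapted_unitary_basis {T : Cn m →L[ℝ] ℝ} (hT : T ≠ 0)
    {B : Cn m →L[ℝ] Cn m →L[ℝ] ℝ} (hB : ∀ u v, B u v = B v u)
    (hpos : ∀ t, del T t = 0 → 0 ≤ (hermPart B t t).re) :
    ∃ (e : OrthonormalBasis (Fin (m + 1)) ℂ (Cn m)) (a : ℝ) (l : Fin m → ℝ),
      ‖T‖ ≤ 2 * a ∧ (∀ v, del T v = a * inner ℂ (e 0) v) ∧ (∀ j, 0 ≤ l j) ∧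
      ∀ j k, hermPart B (e j.succ) (e k.succ) = if j = k then (l j : ℂ) else 0 := by
  set a : Cn m := (InnerProductSpace.toDual ℂ (Cn m)).symm (delLM T).toContinuousLinearMap with ha
  have hav : ∀ v, inner ℂ a v = del T v := fun v => by
    rw [ha, InnerProductSpace.toDual_symm_apply]; rfl
  have hTa : ‖T‖ ≤ 2 * ‖a‖ := by
    refine T.opNorm_le_bound (by positivity) fun v => ?_
    rw [← two_re_del, ← hav, norm_mul, Real.norm_eq_abs, Real.norm_eq_abs, abs_two, mul_assoc]
    have := (abs_re_le_norm (inner ℂ a v)).trans (norm_inner_le_norm a v)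
    gcongr
  have ha0 : 0 < ‖a‖ := by
    have := norm_pos_iff.2 hT
    linarith
  set N : Cn m := (‖a‖⁻¹ : ℂ) • a with hN
  have hN1 : ‖N‖ = 1 := by
    rw [hN, norm_smul, norm_inv, norm_real, norm_norm]
    exact inv_mul_cancel₀ ha0.ne'
  have hNv : ∀ v, del T v = ‖a‖ * inner ℂ N v := fun v => by
    rw [hN, inner_smul_left, ← hav, map_inv₀, conj_ofReal]
    have : (‖a‖ : ℂ) ≠ 0 := by exact_mod_cast ha0.ne'
    field_simp
  set W := (ℂ ∙ N)ᗮ with hW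
  have hWdim : Module.finrank ℂ W = m := by
    have hN0 : N ≠ 0 := by
      intro h; rw [h, norm_zero] at hN1; exact zero_ne_one hN1
    have h1 : Fact (Module.finrank ℂ (Cn m) = m + 1) := ⟨by simp⟩
    exact Submodule.finrank_orthogonal_span_singleton hN0
  set e0 := stdOrthonormalBasis ℂ W with he0
  -- The operator representing the Levi form on `W`: ⟨v, S u⟩ is `hermPart B u v`.
  let S : W →ₗ[ℂ] W :=
    { toFun := fun u => ∑ k, hermPart B u (e0 k : Cn m) • e0 k
      map_add' := fun u v => by
        simp only [Submodule.coe_add, hermPart_add_left, add_smul, Finset.sum_add_distrib]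
      map_smul' := fun c u => by
        simp only [Submodule.coe_smul, hermPart_smul_left, mul_smul, Finset.smul_sum,
          RingHom.id_apply] }
  have hS : ∀ u v : W, inner ℂ v (S u) = hermPart B u v := by
    intro u v
    have h1 : (v : Cn m) = ∑ k, inner ℂ (e0 k) v • (e0 k : Cn m) := by
      conv_lhs => rw [← e0.sum_repr' v]
      simp
    have h2 : inner ℂ v (S u) = ∑ k, hermPart B u (e0 k : Cn m) * inner ℂ v (e0 k) := by
      simp only [S, LinearMap.coe_mk, AddHom.coe_mk, inner_sum, inner_smul_right]
    rw [h2]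
    conv_rhs => rw [h1]
    rw [hermPart_sum_right]
    refine Finset.sum_congr rfl fun k _ => ?_
    rw [inner_conj_symm, mul_comm]
  have hSsymm : S.IsSymmetric := by
    intro u v
    rw [hS, ← inner_conj_symm, hS, hermPart_conj_symm hB]
  set b := hSsymm.eigenvectorBasis hWdim with hb
  have hbW : ∀ j, inner ℂ N (b j : Cn m) = 0 := fun j =>
    Submodule.mem_orthogonal_singleton_iff_inner_right.1 (b j).2
  let f : Fin (m + 1) → Cn m := Fin.cons N fun j => (b j : Cn m)
  have hf : Orthonormal ℂ f := by
    constructor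
    · refine Fin.cases hN1 fun j => ?_
      exact b.norm_eq_one j
    · intro i j
      refine Fin.cases ?_ (fun i => ?_) i
      · refine Fin.cases (fun h => absurd rfl h) (fun j _ => ?_) j
        exact hbW j
      · refine Fin.cases (fun _ => ?_) (fun j h => ?_) j
        · change inner ℂ (b i : Cn m) N = 0
          rw [← inner_conj_symm, hbW, map_zero]
        · have hij : i ≠ j := fun h' => h (congrArg Fin.succ h')
          exact b.orthonormal.2 hij
  have hcard : Fintype.card (Fin (m + 1)) = Module.finrank ℂ (Cn m) := by simp
  let e := (basisOfOrthonormalOfCardEqFinrank hf hcard).toOrthonormalBasis (by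
    rw [coe_basisOfOrthonormalOfCardEqFinrank]; exact hf)
  have hef : ∀ i, e i = f i := fun i => by
    simp only [e, Module.Basis.coe_toOrthonormalBasis, coe_basisOfOrthonormalOfCardEqFinrank]
  refine ⟨e, ‖a‖, hSsymm.eigenvalues hWdim, hTa, ?_, ?_, ?_⟩
  · intro v
    rw [hef 0]
    exact hNv v
  · intro j
    have h1 := hpos (b j) (by rw [hNv, hbW, mul_zero])
    rw [← hS, hSsymm.apply_eigenvectorBasis hWdim j, inner_smul_right] at h1
    have h2 : inner ℂ (b j) (b j) = 1 := by
      rw [inner_self_eq_norm_sq_to_K, b.norm_eq_one]; simp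
    rw [← hb, h2] at h1
    simpa using h1
  · intro j k
    rw [hef, hef]
    change hermPart B (b j : Cn m) (b k : Cn m) = _
    rw [← hS, hSsymm.apply_eigenvectorBasis hWdim j, inner_smul_right, ← hb]
    by_cases h : j = k
    · subst h
      rw [if_pos rfl]
      have h2 : inner ℂ (b j) (b j) = 1 := by
        rw [inner_self_eq_norm_sq_to_K, b.norm_eq_one]; simp
      rw [h2]; simp
    · rw [if_neg h, b.orthonormal.2 (Ne.symm h), mul_zero]

end CauchyFantappie

end

noncomputable section

namespace CauchyFantappie

open MeasureTheory Set Complex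

variable {m : ℕ}

/-! ### Estimates for the support function -/

/-- The unitary basis `e` at `p` is adapted to `r`: `e 0` spans the complex normal, and the other
vectors diagonalize the Levi form on the complex tangent space. -/
structure IsAdapted (r : Cn m → ℝ) (p : Cn m) (e : OrthonormalBasis (Fin (m + 1)) ℂ (Cn m)) (a : ℝ)
    (l : Fin m → ℝ) : Prop where
  norm_le : ‖fderiv ℝ r p‖ ≤ 2 * a
  del_eq : ∀ v, del (fderiv ℝ r p) v = a * inner ℂ (e 0) v
  nonneg : ∀ j, 0 ≤ l j
  herm_eq : ∀ j k, hermPart (fderiv ℝ (fderiv ℝ r) p) (e j.succ) (e k.succ) =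
    if j = k then (l j : ℂ) else 0

theorem exists_isAdapted {D U : Set (Cn m)} {r : Cn m → ℝ} (h : IsDefiningFunction 3 D U r)
    (hpsc : IsLeviPseudoconvex D r) {p : Cn m} (hp : p ∈ frontier D) :
    ∃ e a l, IsAdapted r p e a l := by
  have hc := contDiffAt_of_isDefiningFunction le_rfl h (h.frontier_subset hp)
  obtain ⟨e, a, l, h1, h2, h3, h4⟩ := exists_adapted_unitary_basis (h.fderiv_ne_zero p hp)
    (fderiv_fderiv_symm hc) (fun t ht => by
      have := hpsc p hp t (by rw [sum_wirt_cplx (hc.differentiableAt (by simp)), ht])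
      rwa [leviForm_eq (eventually_differentiableAt_of_contDiffAt hc)
        (eventually_differentiableAt_fderiv hc).self_of_nhds] at this)
  exact ⟨e, a, l, h1, h2, h3, h4⟩

theorem suppFun_eq {r : Cn m → ℝ} {ζ : Cn m} (h : ContDiffAt ℝ 3 r ζ) (h0 : r ζ = 0) (K : ℝ)
    (z : Cn m) : suppFun r K ζ z = del (fderiv ℝ r ζ) (ζ - z)
      - (1 / 2) * holPart (fderiv ℝ (fderiv ℝ r) ζ) (ζ - z) (ζ - z)
      + ((K * ‖ζ - z‖ ^ 3 : ℝ) : ℂ) := by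
  rw [suppFun, leviPoly_eq (eventually_differentiableAt_of_contDiffAt h)
    (eventually_differentiableAt_fderiv h).self_of_nhds, h0]
  simp

theorem norm_inner_basis_le (e : OrthonormalBasis (Fin (m + 1)) ℂ (Cn m)) (j : Fin (m + 1))
    (t : Cn m) : ‖inner ℂ (e j) t‖ ≤ ‖t‖ := by
  have := norm_inner_le_norm (𝕜 := ℂ) (e j) t
  rwa [e.norm_eq_one, one_mul] at this

/-- The Levi form at `p` in adapted coordinates. -/
theorem IsAdapted.re_hermPart_ge {r : Cn m → ℝ} {p : Cn m}
    {e : OrthonormalBasis (Fin (m + 1)) ℂ (Cn m)} {a : ℝ} {l : Fin m → ℝ}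
    (ad : IsAdapted r p e a l) {A : ℝ} (hA : ‖fderiv ℝ (fderiv ℝ r) p‖ ≤ A) (t : Cn m) :
    ∑ j, l j * ‖inner ℂ (e j.succ) t‖ ^ 2 - 3 * A * ‖t‖ * ‖inner ℂ (e 0) t‖ ≤
      (hermPart (fderiv ℝ (fderiv ℝ r) p) t t).re := by
  set B := fderiv ℝ (fderiv ℝ r) p with hB
  set t0 := inner ℂ (e 0) t with ht0
  set t' := ∑ j : Fin m, inner ℂ (e j.succ) t • e j.succ with ht'
  have ht : t = t0 • e 0 + t' := by
    conv_lhs => rw [← e.sum_repr' t]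
    rw [Fin.sum_univ_succ]
  have hA0 : 0 ≤ A := (norm_nonneg _).trans hA
  have ht'n : ‖t'‖ ≤ 2 * ‖t‖ := by
    have : t' = t - t0 • e 0 := by rw [ht]; simp
    rw [this]
    refine (norm_sub_le _ _).trans ?_
    rw [norm_smul, e.norm_eq_one, mul_one]
    have := norm_inner_basis_le e 0 t
    linarith
  have h1 : hermPart B t' t' = ((∑ j, l j * ‖inner ℂ (e j.succ) t‖ ^ 2 : ℝ) : ℂ) := by
    rw [ht', hermPart_sum_left]
    push_cast
    refine Finset.sum_congr rfl fun j _ => ?_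
    rw [hermPart_sum_right]
    have herm : ∀ k, hermPart B (e j.succ) (e k.succ) = if j = k then (l j : ℂ) else 0 :=
      ad.herm_eq j
    simp only [herm]
    rw [Finset.sum_eq_single j (fun k _ hk => by rw [if_neg hk.symm, mul_zero]) (by simp),
      if_pos rfl, ← Complex.conj_mul']
    ring
  -- The purely tangential term is the diagonal sum. Both remaining terms carry a factor `t0`, and
  -- their bounds add up to the `3 * A` of the statement.
  have h2 : hermPart B t t = hermPart B t' t' + (starRingEnd ℂ) t0 * hermPart B t' (e 0)
      + t0 * hermPart B (e 0) t := by
    conv_lhs => rw [ht]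
    rw [hermPart_add_left, hermPart_smul_left, ← ht, add_comm]
    congr 1
    conv_lhs => rw [ht]
    rw [hermPart_add_right, hermPart_smul_right]
    ring
  have h3 : ‖(starRingEnd ℂ) t0 * hermPart B t' (e 0)‖ ≤ 2 * A * ‖t‖ * ‖t0‖ := by
    rw [norm_mul, RCLike.norm_conj]
    have := norm_hermPart_le B t' (e 0)
    rw [e.norm_eq_one, mul_one] at this
    calc _ ≤ ‖t0‖ * (A * (2 * ‖t‖)) := by
          gcongr
          exact this.trans (by gcongr)
      _ = _ := by ring
  have h4 : ‖t0 * hermPart B (e 0) t‖ ≤ A * ‖t‖ * ‖t0‖ := by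
    rw [norm_mul]
    have := norm_hermPart_le B (e 0) t
    rw [e.norm_eq_one, mul_one] at this
    calc _ ≤ ‖t0‖ * (A * ‖t‖) := by
          gcongr
          exact this.trans (by gcongr)
      _ = _ := by ring
  have h5 := (abs_le.1 ((abs_re_le_norm _).trans h3)).1
  have h6 := (abs_le.1 ((abs_re_le_norm _).trans h4)).1
  rw [h2, h1, add_re, add_re, ofReal_re]
  linarith

namespace UniformBounds

variable {r : Cn m → ℝ} {Γ : Set (Cn m)} {ρ A c : ℝ}

theorem le_two_mul (h : UniformBounds r Γ ρ A c) {p : Cn m} (hp : p ∈ Γ)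
    {e : OrthonormalBasis (Fin (m + 1)) ℂ (Cn m)} {a : ℝ} {l : Fin m → ℝ}
    (ad : IsAdapted r p e a l) : c ≤ 2 * a := (h.lower p hp).trans ad.norm_le

/-- The basic lower bound for the real part of the support function. -/
theorem two_re_suppFun_ge (h : UniformBounds r Γ ρ A c) {p ζ z : Cn m} (hp : p ∈ Γ) (hζ : ζ ∈ Γ)
    (h0 : r ζ = 0) {e : OrthonormalBasis (Fin (m + 1)) ℂ (Cn m)} {a : ℝ} {l : Fin m → ℝ}
    (ad : IsAdapted r p e a l) (hτ : 2 * ‖ζ - z‖ < ρ) (hζp : ‖ζ - p‖ ≤ 2 * ‖ζ - z‖) {K : ℝ}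
    (hK : 3 * A + 24 * A ^ 2 / c + 1 ≤ 2 * K) (hKτ : K * ‖ζ - z‖ ≤ 1) :
    -r z + ∑ j, l j * ‖inner ℂ (e j.succ) (ζ - z)‖ ^ 2 + ‖ζ - z‖ ^ 3
      - 6 * A / c * ‖ζ - z‖ * ‖suppFun r K ζ z‖ ≤ 2 * (suppFun r K ζ z).re := by
  set t := ζ - z with ht
  set τ := ‖t‖ with hτd
  have hτ0 : 0 ≤ τ := norm_nonneg _
  have hρ := h.rho_pos
  have hA := h.nonneg
  have hA1 := h.one_le
  have hc := h.c_pos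
  have hζb : ζ ∈ Metric.ball p ρ := mem_ball_iff_norm.2 (by linarith)
  have hζb' : ζ ∈ Metric.ball ζ ρ := Metric.mem_ball_self hρ
  have hpb : p ∈ Metric.ball p ρ := Metric.mem_ball_self hρ
  have hzb : z ∈ Metric.ball ζ ρ := mem_ball_iff_norm'.2 (by linarith)
  have hcd := h.contDiffAt ζ hζ ζ hζb'
  set Φ := suppFun r K ζ z with hΦ
  have hΦe : Φ = del (fderiv ℝ r ζ) t - (1 / 2) * holPart (fderiv ℝ (fderiv ℝ r) ζ) t t
      + ((K * τ ^ 3 : ℝ) : ℂ) := suppFun_eq hcd h0 K z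
  have hre : 2 * Φ.re = fderiv ℝ r ζ t - (holPart (fderiv ℝ (fderiv ℝ r) ζ) t t).re
      + 2 * K * τ ^ 3 := by
    rw [hΦe, add_re, sub_re, ofReal_re, ← two_re_del]
    simp
    ring
  have htay := h.taylor_two hζ hzb
  -- Expanding `r` at `ζ` and splitting the second derivative into holomorphic and hermitian parts:
  -- -r(z) equals dr(t) - Re hol(t,t) - Re herm(t,t) up to A τ³. The first two terms are those of 2
  -- Re Φ, so 2 Re Φ is -r(z) plus the Levi form at `ζ`, plus 2Kτ³, with a cubic error.
  have hzt : z - ζ = -t := by rw [ht]; simp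
  rw [hzt, map_neg, map_neg, map_neg, neg_apply, neg_neg, norm_neg, h0,
    bilin_self_eq t] at htay
  have hlev : |(hermPart (fderiv ℝ (fderiv ℝ r) ζ) t t).re
      - (hermPart (fderiv ℝ (fderiv ℝ r) p) t t).re| ≤ 2 * A * τ ^ 3 := by
    rw [← sub_re, ← hermPart_sub]
    refine (abs_re_le_norm _).trans ((norm_hermPart_le _ _ _).trans ?_)
    have h1 := h.lip_two hp hpb hζb
    calc _ ≤ (A * (2 * τ)) * τ * τ := by
          gcongr
          exact h1.trans (by gcongr)
      _ = _ := by ring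
  have hherm := ad.re_hermPart_ge (h.bound_two p hp p hpb) t
  -- The normal component of `t` is the leading term of Φ, hence is controlled by |Φ| up to O(τ²).
  -- Mixed terms of the Levi form then cost only τ|Φ| and τ³; no strict positivity of the Levi form
  -- is needed.
  have hdel : a * ‖inner ℂ (e 0) t‖ ≤ ‖Φ‖ + 4 * A * τ ^ 2 := by
    have ha0 : 0 ≤ a := by have := h.le_two_mul hp ad; linarith
    have h1 : a * ‖inner ℂ (e 0) t‖ = ‖del (fderiv ℝ r p) t‖ := by
      rw [ad.del_eq, norm_mul, norm_real, Real.norm_eq_abs, abs_of_nonneg ha0]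
    have h2 : ‖del (fderiv ℝ r ζ) t - del (fderiv ℝ r p) t‖ ≤ 2 * A * τ ^ 2 := by
      rw [← del_sub_left]
      refine (norm_del_le _ _).trans ?_
      have h1 := h.lip_one hp hpb hζb
      calc _ ≤ (A * (2 * τ)) * τ := by
            gcongr
            exact h1.trans (by gcongr)
        _ = _ := by ring
    have h3 : del (fderiv ℝ r p) t = Φ + (1 / 2) * holPart (fderiv ℝ (fderiv ℝ r) ζ) t t
        - ((K * τ ^ 3 : ℝ) : ℂ) - (del (fderiv ℝ r ζ) t - del (fderiv ℝ r p) t) := by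
      rw [hΦe]; ring
    have h4 : ‖(1 / 2) * holPart (fderiv ℝ (fderiv ℝ r) ζ) t t‖ ≤ (1 / 2) * (A * τ ^ 2) := by
      rw [norm_mul]
      have := norm_holPart_le (fderiv ℝ (fderiv ℝ r) ζ) t t
      have h5 := h.bound_two ζ hζ ζ hζb'
      calc _ ≤ ‖(1 / 2 : ℂ)‖ * (A * ‖t‖ * ‖t‖) := by
            gcongr
            exact this.trans (by gcongr)
        _ = _ := by norm_num; ring
    have hK0 : 0 ≤ K := by
      have : 0 ≤ 24 * A ^ 2 / c := by positivity
      linarith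
    have h5 : ‖((K * τ ^ 3 : ℝ) : ℂ)‖ ≤ A * τ ^ 2 := by
      rw [norm_real, Real.norm_eq_abs, abs_of_nonneg (by positivity)]
      calc K * τ ^ 3 = (K * τ) * τ ^ 2 := by ring
        _ ≤ A * τ ^ 2 := by gcongr; linarith
    rw [h1, h3]
    refine (norm_sub_le _ _).trans ?_
    have h6 := norm_sub_le (Φ + (1 / 2) * holPart (fderiv ℝ (fderiv ℝ r) ζ) t t)
      ((K * τ ^ 3 : ℝ) : ℂ)
    have h7 := norm_add_le Φ ((1 / 2) * holPart (fderiv ℝ (fderiv ℝ r) ζ) t t)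
    have h8 : 0 ≤ A * τ ^ 2 := by positivity
    linarith
  have ht0 : ‖inner ℂ (e 0) t‖ ≤ 2 / c * (‖Φ‖ + 4 * A * τ ^ 2) := by
    have hca := h.le_two_mul hp ad
    rw [div_mul_eq_mul_div, le_div_iff₀ hc]
    nlinarith [norm_nonneg (inner ℂ (e 0) t)]
  have hfin : 3 * A * τ * ‖inner ℂ (e 0) t‖ ≤ 6 * A / c * τ * ‖Φ‖ + 24 * A ^ 2 / c * τ ^ 3 := by
    calc _ ≤ 3 * A * τ * (2 / c * (‖Φ‖ + 4 * A * τ ^ 2)) := by gcongr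
      _ = _ := by ring
  -- Budget for the cubic terms: `A` from Taylor's formula, `2 * A` from moving the Levi form from
  -- `ζ` to `p`, `24 * A ^ 2 / c` from the mixed terms. The remaining 1 is the cube in the
  -- conclusion.
  have hKτ3 : (3 * A + 24 * A ^ 2 / c + 1) * τ ^ 3 ≤ 2 * K * τ ^ 3 := by gcongr
  have h1 := (abs_le.1 htay).1
  have h1' := (abs_le.1 htay).2
  have h2 := (abs_le.1 hlev).1
  linarith

/-- Consequence: a lower bound for the modulus. -/
theorem norm_suppFun_ge (h : UniformBounds r Γ ρ A c) {p ζ z : Cn m} (hp : p ∈ Γ) (hζ : ζ ∈ Γ)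
    (h0 : r ζ = 0) {e : OrthonormalBasis (Fin (m + 1)) ℂ (Cn m)} {a : ℝ} {l : Fin m → ℝ}
    (ad : IsAdapted r p e a l) (hτ : 2 * ‖ζ - z‖ < ρ) (hζp : ‖ζ - p‖ ≤ 2 * ‖ζ - z‖) {K : ℝ}
    (hK : 3 * A + 24 * A ^ 2 / c + 1 ≤ 2 * K) (hKτ : K * ‖ζ - z‖ ≤ 1)
    (hAτ : 6 * A / c * ‖ζ - z‖ ≤ 1) :
    -r z + ∑ j, l j * ‖inner ℂ (e j.succ) (ζ - z)‖ ^ 2 + ‖ζ - z‖ ^ 3 ≤ 3 * ‖suppFun r K ζ z‖ := by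
  have h1 := h.two_re_suppFun_ge hp hζ h0 ad hτ hζp hK hKτ
  have h2 := re_le_norm (suppFun r K ζ z)
  have h3 : 6 * A / c * ‖ζ - z‖ * ‖suppFun r K ζ z‖ ≤ 1 * ‖suppFun r K ζ z‖ := by gcongr
  linarith

theorem lip_linear (h : UniformBounds r Γ ρ A c) {p x y : Cn m} (hp : p ∈ Γ) {ρ' : ℝ}
    (hρ' : ρ' ≤ ρ) (hx : x ∈ Metric.ball p ρ') (hy : y ∈ Metric.ball p ρ') :
    |r y - r x - fderiv ℝ r p (y - x)| ≤ A * ρ' * ‖y - x‖ := by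
  have hsub : Metric.ball p ρ' ⊆ Metric.ball p ρ := Metric.ball_subset_ball hρ'
  exact (convex_ball p ρ').norm_image_sub_le_of_norm_hasFDerivWithin_le'
    (f := r) (f' := fderiv ℝ r) (φ := fderiv ℝ r p) (C := A * ρ')
    (fun w hw => ((h.contDiffAt p hp w (hsub hw)).differentiableAt
      (by simp)).hasFDerivAt.hasFDerivWithinAt)
    (fun w hw => (h.lip_one hp (Metric.mem_ball_self h.rho_pos) (hsub hw)).trans (by
      have := (mem_ball_iff_norm.1 hw).le
      have := h.nonneg
      gcongr)) hx hy

end UniformBounds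

theorem fderiv_normal {r : Cn m → ℝ} {p : Cn m}
    {e : OrthonormalBasis (Fin (m + 1)) ℂ (Cn m)} {a : ℝ} {l : Fin m → ℝ}
    (ad : IsAdapted r p e a l) (v : Cn m) :
    fderiv ℝ r p v = 2 * a * (inner ℂ (e 0) v).re := by
  rw [← two_re_del, ad.del_eq]; simp; ring

theorem inner_e_self (e : OrthonormalBasis (Fin (m + 1)) ℂ (Cn m)) (j : Fin (m + 1)) :
    inner ℂ (e j) (e j) = 1 := by
  rw [inner_self_eq_norm_sq_to_K, e.norm_eq_one]; simp

/-- Otherwise the interiors of `D` and of its complement would disconnect the segment. -/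
theorem exists_mem_segment_frontier {E : Type*} [NormedAddCommGroup E] [NormedSpace ℝ E]
    {D : Set E} {z w : E} (hz : z ∈ D) (hw : w ∉ D) : ∃ x ∈ segment ℝ z w, x ∈ frontier D := by
  by_contra! hcon
  have hcov : segment ℝ z w ⊆ interior D ∪ interior Dᶜ := fun x hx => by
    have := hcon x hx
    rw [frontier, mem_sdiff, not_and_not_right] at this
    by_cases hxc : x ∈ closure D
    · exact Or.inl (this hxc)
    · exact Or.inr (by rwa [interior_compl])
  have hz' : z ∈ interior D := (hcov (left_mem_segment ℝ z w)).resolve_right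
    fun h => interior_subset h hz
  have hw' : w ∈ interior Dᶜ := (hcov (right_mem_segment ℝ z w)).resolve_left
    fun h => hw (interior_subset h)
  obtain ⟨x, -, hx1, hx2⟩ := (convex_segment z w).isPreconnected _ _ isOpen_interior
    isOpen_interior hcov ⟨z, left_mem_segment ℝ z w, hz'⟩ ⟨w, right_mem_segment ℝ z w, hw'⟩
  exact interior_subset hx2 (interior_subset hx1)

/-- The distance to the boundary is controlled by the defining function. -/
theorem UniformBounds.infDist_le {D U : Set (Cn m)} {r : Cn m → ℝ} {ρ A c : ℝ}
    (h : UniformBounds r (frontier D) ρ A c) (hdef : IsDefiningFunction 3 D U r)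
    (hU : ∀ p ∈ frontier D, Metric.ball p ρ ⊆ U) {p z : Cn m} (hp : p ∈ frontier D)
    {e : OrthonormalBasis (Fin (m + 1)) ℂ (Cn m)} {a : ℝ} {l : Fin m → ℝ}
    (ad : IsAdapted r p e a l) (hz : z ∈ D) {ρ' : ℝ} (hρ' : ρ' ≤ ρ) (hAρ : 2 * A * ρ' ≤ c)
    (hd : ‖z - p‖ = Metric.infDist z (frontier D)) (hdρ : 2 * ‖z - p‖ < ρ') :
    c / 4 * Metric.infDist z (frontier D) ≤ -r z := by
  set d := Metric.infDist z (frontier D) with hdd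
  have hd0 : 0 ≤ d := Metric.infDist_nonneg
  by_contra hlt
  push Not at hlt
  -- Along `e 0` the function `r` grows at rate at least c - c/2. If -r(z) were below c d/4, this
  -- point at distance d/2 would lie outside `D`, and the segment to it would meet the boundary
  -- closer to `z` than `d`.
  set w := z + ((d / 2 : ℝ) : ℂ) • e 0 with hw
  have hwz : w - z = ((d / 2 : ℝ) : ℂ) • e 0 := by rw [hw]; simp
  have hwn : ‖w - z‖ = d / 2 := by
    rw [hwz, norm_smul, e.norm_eq_one, mul_one, norm_real, Real.norm_eq_abs,
      abs_of_nonneg (by positivity)]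
  have hzb : z ∈ Metric.ball p ρ' := mem_ball_iff_norm.2 (by linarith)
  have hwb : w ∈ Metric.ball p ρ' := mem_ball_iff_norm.2 (by
    have : w - p = (w - z) + (z - p) := by abel
    rw [this]
    refine (norm_add_le _ _).trans_lt ?_
    linarith)
  have h1 := (abs_le.1 (h.lip_linear hp hρ' hzb hwb)).1
  have h2 : fderiv ℝ r p (w - z) = 2 * a * (d / 2) := by
    rw [fderiv_normal ad, hwz, inner_smul_right, inner_e_self, mul_one, ofReal_re]
  have hca := h.le_two_mul hp ad
  rw [h2, hwn] at h1
  have hwpos : 0 < r w := by nlinarith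
  have hwD : w ∉ D := fun hwD => by
    have : w ∈ D ∩ U := ⟨hwD, hU p hp (Metric.ball_subset_ball hρ' hwb)⟩
    rw [hdef.inter_eq] at this
    exact absurd this.2 (not_lt.2 hwpos.le)
  obtain ⟨x, hxs, hxf⟩ := exists_mem_segment_frontier hz hwD
  have h3 : d ≤ dist z x := Metric.infDist_le_dist_of_mem hxf
  have h4 : dist z x ≤ dist z w := by
    rw [dist_comm z x, dist_comm z w]
    exact (convex_closedBall z (dist w z)).segment_subset
      (Metric.mem_closedBall_self dist_nonneg) (Metric.mem_closedBall.2 le_rfl) hxs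
  rw [dist_comm z w, dist_eq_norm w z, hwn] at h4
  have hd00 : d = 0 := by linarith
  rw [hd00] at hlt h1
  have : w = z := by
    rw [← sub_eq_zero, hwz, hd00]; simp
  exact hwD (this ▸ hz)

/-! ### Coordinates on the boundary -/

/-- Coordinates near `p`: the imaginary part of the support function, and the complex tangential
components of `ζ - z`. -/
def coordMap (r : Cn m → ℝ) (K : ℝ) (e : OrthonormalBasis (Fin (m + 1)) ℂ (Cn m)) (z ζ : Cn m) :
    Option (Fin m × Fin 2) → ℝ
  | none => (suppFun r K ζ z).im
  | some (j, a) => ![(inner ℂ (e j.succ) (ζ - z)).re, (inner ℂ (e j.succ) (ζ - z)).im] a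

theorem norm_le_sum_inner (e : OrthonormalBasis (Fin (m + 1)) ℂ (Cn m)) (h : Cn m) :
    ‖h‖ ≤ ‖inner ℂ (e 0) h‖ + ∑ j : Fin m, ‖inner ℂ (e j.succ) h‖ := by
  conv_lhs => rw [← e.sum_repr' h]
  refine (norm_sum_le _ _).trans (le_of_eq ?_)
  rw [Fin.sum_univ_succ]
  simp [norm_smul, e.norm_eq_one]

theorem abs_cube_sub_le {x y R : ℝ} (hx : 0 ≤ x) (hy : 0 ≤ y) (hxR : x ≤ R) (hyR : y ≤ R) :
    |x ^ 3 - y ^ 3| ≤ 3 * R ^ 2 * |x - y| := by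
  have : x ^ 3 - y ^ 3 = (x ^ 2 + x * y + y ^ 2) * (x - y) := by ring
  rw [this, abs_mul, abs_of_nonneg (by positivity)]
  gcongr
  nlinarith

/-- On Γ the function r is constant, so the real part of a⟨e_0, H⟩ is small compared with H = ζ -
ζ'. Its imaginary part is the increment of Im Φ up to a small multiple of |H|, and the tangential
components of H are coordinate differences. The total error 20 A ρ' |H| is at most (c/4)|H| and is
absorbed on the left. -/
theorem UniformBounds.antilipschitz_coordMap {r : Cn m → ℝ} {Γ : Set (Cn m)} {ρ A c : ℝ}
    (h : UniformBounds r Γ ρ A c) (hr0 : ∀ ζ ∈ Γ, r ζ = 0) {p z : Cn m} (hp : p ∈ Γ)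
    {e : OrthonormalBasis (Fin (m + 1)) ℂ (Cn m)} {a : ℝ} {l : Fin m → ℝ}
    (ad : IsAdapted r p e a l) {ρ' K : ℝ} (hρ' : ρ' ≤ ρ) (hρ1 : ρ' ≤ 1) (hK : 0 ≤ K)
    (hKρ : K * ρ' ≤ 1) (hAρ : 80 * A * ρ' ≤ c) (hz : z ∈ Metric.ball p ρ') {ζ ζ' : Cn m}
    (hζ : ζ ∈ Γ) (hζb : ζ ∈ Metric.ball p ρ') (hζ' : ζ' ∈ Γ) (hζ'b : ζ' ∈ Metric.ball p ρ') :
    dist ζ ζ' ≤ (4 / c + 4 * m) * dist (coordMap r K e z ζ) (coordMap r K e z ζ') := by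
  set H := ζ - ζ' with hH
  set t := ζ - z with ht
  set t' := ζ' - z with ht'
  have hA := h.nonneg
  have hA1 := h.one_le
  have hc := h.c_pos
  have hρ0 : 0 < ρ' := (norm_nonneg _).trans_lt (mem_ball_iff_norm.1 hz)
  have hsub : Metric.ball p ρ' ⊆ Metric.ball p ρ := Metric.ball_subset_ball hρ'
  have hpb : p ∈ Metric.ball p ρ := Metric.mem_ball_self h.rho_pos
  have hca := h.le_two_mul hp ad
  have ha0 : 0 ≤ a := by linarith
  have nz := mem_ball_iff_norm.1 hz
  have nζ := mem_ball_iff_norm.1 hζb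
  have nζ' := mem_ball_iff_norm.1 hζ'b
  have ntt : ‖t‖ ≤ 2 * ρ' := by
    have : t = (ζ - p) - (z - p) := by rw [ht]; abel
    rw [this]; exact (norm_sub_le _ _).trans (by linarith)
  have ntt' : ‖t'‖ ≤ 2 * ρ' := by
    have : t' = (ζ' - p) - (z - p) := by rw [ht']; abel
    rw [this]; exact (norm_sub_le _ _).trans (by linarith)
  have htH : t = t' + H := by rw [ht, ht', hH]; abel
  -- the real normal component
  have h1 : |2 * (a * inner ℂ (e 0) H).re| ≤ A * ρ' * ‖H‖ := by
    have := h.lip_linear hp hρ' hζ'b hζb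
    rw [hr0 ζ hζ, hr0 ζ' hζ', sub_zero, zero_sub, abs_neg, ← two_re_del, ad.del_eq] at this
    exact this
  -- the imaginary normal component
  set ΔΦ := suppFun r K ζ z - suppFun r K ζ' z with hΔ
  have h2 : ‖ΔΦ - a * inner ℂ (e 0) H‖ ≤ 19 * A * ρ' * ‖H‖ := by
    set T := fderiv ℝ r
    set B := fderiv ℝ (fderiv ℝ r)
    have e1 : suppFun r K ζ z = _ := suppFun_eq (h.contDiffAt p hp ζ (hsub hζb)) (hr0 ζ hζ) K z
    have e2 : suppFun r K ζ' z = _ := suppFun_eq (h.contDiffAt p hp ζ' (hsub hζ'b)) (hr0 ζ' hζ') K z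
    have e3 : ΔΦ - a * inner ℂ (e 0) H = del (T ζ - T p) H + del (T ζ - T ζ') t'
        - (1 / 2) * (holPart (B ζ) H t + holPart (B ζ) t' H + holPart (B ζ - B ζ') t' t')
        + ((K * (‖t‖ ^ 3 - ‖t'‖ ^ 3) : ℝ) : ℂ) := by
      have e4 : del (T ζ) t = del (T ζ) t' + del (T ζ) H := by rw [htH, del_add]
      have e5 : holPart (B ζ) t t = holPart (B ζ) H t + holPart (B ζ) t' H + holPart (B ζ) t' t' := by
        conv_lhs => rw [htH, holPart_add_left, ← htH]
        rw [add_assoc, add_comm, ← holPart_add_right, add_comm H t', ← htH]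
      rw [hΔ, e1, e2, ← ad.del_eq, del_sub_left, del_sub_left, holPart_sub]
      change del (T ζ) t - 1 / 2 * holPart (B ζ) t t + _
        - (del (T ζ') t' - 1 / 2 * holPart (B ζ') t' t' + _) - _ = _
      rw [e4, e5]
      push_cast
      ring
    have f1 : ‖del (T ζ - T p) H‖ ≤ A * ρ' * ‖H‖ := by
      refine (norm_del_le _ _).trans ?_
      gcongr
      refine (h.lip_one hp hpb (hsub hζb)).trans (by gcongr)
    have f2 : ‖del (T ζ - T ζ') t'‖ ≤ 2 * (A * ρ' * ‖H‖) := by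
      refine (norm_del_le _ _).trans ?_
      calc _ ≤ (A * ‖H‖) * (2 * ρ') := by
            gcongr
            exact h.lip_one hp (hsub hζ'b) (hsub hζb)
        _ = _ := by ring
    have hBζ := h.bound_two p hp ζ (hsub hζb)
    have f3 : ‖holPart (B ζ) H t‖ ≤ 2 * (A * ρ' * ‖H‖) := by
      refine (norm_holPart_le _ _ _).trans ?_
      calc _ ≤ A * ‖H‖ * (2 * ρ') := by gcongr
        _ = _ := by ring
    have f4 : ‖holPart (B ζ) t' H‖ ≤ 2 * (A * ρ' * ‖H‖) := by
      refine (norm_holPart_le _ _ _).trans ?_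
      calc _ ≤ A * (2 * ρ') * ‖H‖ := by gcongr
        _ = _ := by ring
    have f5 : ‖holPart (B ζ - B ζ') t' t'‖ ≤ 4 * (A * ρ' * ‖H‖) := by
      refine (norm_holPart_le _ _ _).trans ?_
      calc _ ≤ (A * ‖H‖) * (2 * ρ') * (2 * ρ') := by
            gcongr
            exact h.lip_two hp (hsub hζ'b) (hsub hζb)
        _ = 4 * (A * ρ' * ‖H‖) * ρ' := by ring
        _ ≤ 4 * (A * ρ' * ‖H‖) * 1 := by gcongr
        _ = _ := by ring
    -- One factor `ρ'` is spent on `K * ρ' ≤ 1`, so the final antilipschitz constant does not depend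
    -- on `K`.
    have f6 : ‖((K * (‖t‖ ^ 3 - ‖t'‖ ^ 3) : ℝ) : ℂ)‖ ≤ 12 * (A * ρ' * ‖H‖) := by
      rw [norm_real, Real.norm_eq_abs, abs_mul, abs_of_nonneg hK]
      have g1 := abs_cube_sub_le (norm_nonneg t) (norm_nonneg t') ntt ntt'
      have g2 : |‖t‖ - ‖t'‖| ≤ ‖H‖ := by
        have : H = t - t' := by rw [htH]; abel
        rw [this]; exact abs_norm_sub_norm_le t t'
      calc _ ≤ K * (3 * (2 * ρ') ^ 2 * ‖H‖) := by
            gcongr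
            exact g1.trans (by gcongr)
        _ = (K * ρ') * (12 * (ρ' * ‖H‖)) := by ring
        _ ≤ A * (12 * (ρ' * ‖H‖)) := by gcongr; linarith
        _ = _ := by ring
    rw [e3]
    have g1 := norm_add_le (del (T ζ - T p) H + del (T ζ - T ζ') t'
        - (1 / 2) * (holPart (B ζ) H t + holPart (B ζ) t' H + holPart (B ζ - B ζ') t' t'))
        ((K * (‖t‖ ^ 3 - ‖t'‖ ^ 3) : ℝ) : ℂ)
    have g2 := norm_sub_le (del (T ζ - T p) H + del (T ζ - T ζ') t')
      ((1 / 2) * (holPart (B ζ) H t + holPart (B ζ) t' H + holPart (B ζ - B ζ') t' t'))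
    have g3 := norm_add_le (del (T ζ - T p) H) (del (T ζ - T ζ') t')
    have g4 : ‖(1 / 2) * (holPart (B ζ) H t + holPart (B ζ) t' H + holPart (B ζ - B ζ') t' t')‖
        ≤ 4 * (A * ρ' * ‖H‖) := by
      rw [norm_mul]
      have g5 := norm_add_le (holPart (B ζ) H t + holPart (B ζ) t' H) (holPart (B ζ - B ζ') t' t')
      have g6 := norm_add_le (holPart (B ζ) H t) (holPart (B ζ) t' H)
      have : ‖(1 / 2 : ℂ)‖ = 1 / 2 := by norm_num
      rw [this]
      linarith
    linarith
  set dd := dist (coordMap r K e z ζ) (coordMap r K e z ζ') with hdd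
  have hdd0 : 0 ≤ dd := dist_nonneg
  have h3 : |ΔΦ.im| ≤ dd := by
    have := dist_le_pi_dist (coordMap r K e z ζ) (coordMap r K e z ζ') none
    rw [Real.dist_eq] at this
    simpa [coordMap, hΔ] using this
  have h4 : |(a * inner ℂ (e 0) H).im| ≤ dd + 19 * A * ρ' * ‖H‖ := by
    have g := (abs_im_le_norm _).trans h2
    rw [sub_im] at g
    have g1 := abs_le.1 g
    have g2 := abs_le.1 h3
    exact abs_le.2 ⟨by linarith, by linarith⟩
  have h5 : a * ‖inner ℂ (e 0) H‖ ≤ dd + 20 * A * ρ' * ‖H‖ := by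
    have g : a * ‖inner ℂ (e 0) H‖ = ‖(a : ℂ) * inner ℂ (e 0) H‖ := by
      rw [norm_mul, norm_real, Real.norm_eq_abs, abs_of_nonneg ha0]
    rw [g]
    refine (norm_le_abs_re_add_abs_im _).trans ?_
    rw [abs_mul, abs_two] at h1
    have := abs_nonneg ((a : ℂ) * inner ℂ (e 0) H).re
    linarith
  have h6 : ‖inner ℂ (e 0) H‖ ≤ 2 / c * dd + (1 / 2) * ‖H‖ := by
    have g1 : c / 2 * ‖inner ℂ (e 0) H‖ ≤ dd + c / 4 * ‖H‖ := by
      have g2 : 20 * A * ρ' * ‖H‖ ≤ c / 4 * ‖H‖ := by gcongr; linarith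
      have g3 : c / 2 * ‖inner ℂ (e 0) H‖ ≤ a * ‖inner ℂ (e 0) H‖ := by gcongr; linarith
      linarith
    have g4 : 2 / c * dd + (1 / 2) * ‖H‖ = 2 / c * (dd + c / 4 * ‖H‖) := by field_simp; ring
    rw [g4]
    calc _ = 2 / c * (c / 2 * ‖inner ℂ (e 0) H‖) := by field_simp
      _ ≤ _ := by gcongr
  have h7 : ∀ j : Fin m, ‖inner ℂ (e j.succ) H‖ ≤ 2 * dd := by
    intro j
    have e1 : inner ℂ (e j.succ) H = inner ℂ (e j.succ) t - inner ℂ (e j.succ) t' := by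
      rw [← inner_sub_right, htH]; simp
    have g0 := dist_le_pi_dist (coordMap r K e z ζ) (coordMap r K e z ζ') (some (j, 0))
    have g1 := dist_le_pi_dist (coordMap r K e z ζ) (coordMap r K e z ζ') (some (j, 1))
    rw [Real.dist_eq] at g0 g1
    simp only [coordMap, Matrix.cons_val_zero, Matrix.cons_val_one] at g0 g1
    rw [← ht, ← ht', ← sub_re, ← e1] at g0
    rw [← ht, ← ht', ← sub_im, ← e1] at g1
    refine (norm_le_abs_re_add_abs_im _).trans ?_
    linarith
  have h8 := norm_le_sum_inner e H
  have h9 : ∑ j : Fin m, ‖inner ℂ (e j.succ) H‖ ≤ m * (2 * dd) := by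
    refine (Finset.sum_le_sum fun j _ => h7 j).trans ?_
    simp
  rw [dist_eq_norm, ← hH]
  have h10 : (4 / c + 4 * m) * dd = 2 * (2 / c * dd + m * (2 * dd)) := by ring
  rw [h10]
  linarith

end CauchyFantappie

end

noncomputable section

namespace CauchyFantappie

open MeasureTheory Set Complex

variable {m : ℕ}

/-! ### Pointwise estimate of the `∂̄`-derivative of the kernel near the diagonal -/

/-- Leibniz rule under the weights: differentiating `α` costs nothing, while differentiating one of
the `m` factors `β` costs `1 + M`. -/
theorem norm_dbar_topSum_le {ν α α' : Fin (2 * m + 2) → ℂ}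
    {β β' : Fin m → Fin (2 * m + 2) → Fin (2 * m + 2) → ℂ} {W : Fin (2 * m + 2) → ℝ} {a b c M : ℝ}
    (hν : ∀ x, ‖ν x‖ ≤ a * W x) (hα : ∀ x, ‖α x‖ ≤ b * W x) (hα' : ∀ x, ‖α' x‖ ≤ b * W x)
    (hβ : ∀ i x y, ‖β i x y‖ ≤ c * (W x * W y))
    (hβ' : ∀ i x y, ‖β' i x y‖ ≤ c * (1 + M) * (W x * W y)) :
    ‖topSum ν α' β + ∑ j, topSum ν α (Function.update β j (β' j))‖ ≤
      (2 * m + 2).factorial * (a * b * c ^ m) * (1 + m * (1 + M)) * ∏ x, W x := by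
  have h1 := norm_topSum_le hν hα' hβ
  rw [Finset.prod_const, Finset.card_univ, Fintype.card_fin] at h1
  have h2 : ∀ j : Fin m, ‖topSum ν α (Function.update β j (β' j))‖ ≤
      (2 * m + 2).factorial * (a * b * (c ^ m * (1 + M))) * ∏ x, W x := by
    intro j
    have h3 := norm_topSum_le (β := Function.update β j (β' j))
      (c := fun i => c * (if i = j then (1 + M) else 1)) hν hα (fun i x y => by
        by_cases hij : i = j
        · subst hij
          simpa using hβ' i x y
        · simpa [Function.update_of_ne hij, hij] using hβ i x y)
    rwa [Finset.prod_mul_distrib, Finset.prod_const, Finset.card_univ, Fintype.card_fin,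
      Finset.prod_ite_eq' Finset.univ j, if_pos (Finset.mem_univ j)] at h3
  refine (norm_add_le _ _).trans ((add_le_add h1 ((norm_sum_le _ _).trans
    (Finset.sum_le_sum fun j _ => h2 j))).trans (le_of_eq ?_))
  rw [Finset.sum_const, Finset.card_univ, Fintype.card_fin, nsmul_eq_mul]
  ring

/-- The `∂̄`-derivative of `S⁻ⁿ T`. -/
theorem exists_hasDbarAt_kernel {S : Cn m → ℂ} {d T' : Cn m → ℂ} {T : Cn m → ℂ} {z : Cn m}
    (hS : HasDbarAt S d z) (h0 : S z ≠ 0) (hT : HasDbarAt T T' z) :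
    HasDbarAt (fun z => (S z)⁻¹ ^ (m + 1) * T z)
      (fun w => (m + 1) * (S z)⁻¹ ^ m * (-(S z ^ 2)⁻¹ * d w) * T z
        + (S z)⁻¹ ^ (m + 1) * T' w) z :=
  ((hS.inv h0).pow m).mul hT

section Near

variable {r : Cn m → ℝ} {Γ : Set (Cn m)} {ρ A c : ℝ} {p ζ z : Cn m}
  {e : OrthonormalBasis (Fin (m + 1)) ℂ (Cn m)} {a : ℝ} {l : Fin m → ℝ}

/-- At `p` itself the form ∂r annihilates the tangential vectors; away from `p` it changes at a
Lipschitz rate. -/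
theorem UniformBounds.norm_del_tangential_le (h : UniformBounds r Γ ρ A c) (hp : p ∈ Γ)
    (ad : IsAdapted r p e a l) (hζ : ζ ∈ Metric.ball p ρ) {κ : ℂ} (hκ : ‖κ‖ = 1) (j : Fin m) :
    ‖del (fderiv ℝ r ζ) (κ • e j.succ)‖ ≤ A * ‖ζ - p‖ := by
  have h0 : del (fderiv ℝ r p) (κ • e j.succ) = 0 := by
    rw [ad.del_eq, inner_smul_right, e.inner_eq_zero (Fin.succ_ne_zero j).symm, mul_zero, mul_zero]
  have h1 : del (fderiv ℝ r ζ) (κ • e j.succ)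
      = del (fderiv ℝ r ζ - fderiv ℝ r p) (κ • e j.succ) := by rw [del_sub_left, h0, sub_zero]
  rw [h1]
  refine (norm_del_le _ _).trans ?_
  rw [norm_smul, hκ, e.norm_eq_one, mul_one, mul_one]
  exact h.lip_one hp (Metric.mem_ball_self h.rho_pos) hζ

theorem norm_del_le_of_norm_eq_one {T : Cn m →L[ℝ] ℝ} (hT : ‖T‖ ≤ A) {v : Cn m} (hv : ‖v‖ = 1) :
    ‖del T v‖ ≤ A := by
  have := norm_del_le T v
  rw [hv, mul_one] at this
  exact this.trans hT

theorem norm_oneForm_gCoeff_le (hc : ContDiffAt ℝ 3 r ζ) (hA : ‖fderiv ℝ (fderiv ℝ r) ζ‖ ≤ A)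
    {K : ℝ} (hK : 0 ≤ K) (hKτ : K * ‖ζ - z‖ ≤ 1) (hA1 : 1 ≤ A) {v : Cn m} (hv : ‖v‖ = 1) :
    ‖oneForm (gCoeff r K ζ z) v‖ ≤ ‖del (fderiv ℝ r ζ) v‖ + 2 * A * ‖ζ - z‖ := by
  rw [oneForm_gCoeff_eq (eventually_differentiableAt_of_contDiffAt hc)
      (eventually_differentiableAt_fderiv hc).self_of_nhds]
  have h1 := norm_holPart_le (fderiv ℝ (fderiv ℝ r) ζ) v (ζ - z)
  rw [hv, mul_one] at h1
  have h1' : ‖holPart (fderiv ℝ (fderiv ℝ r) ζ) v (ζ - z)‖ ≤ A * ‖ζ - z‖ := h1.trans (by gcongr)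
  have h2 : ‖((K * ‖ζ - z‖ : ℝ) : ℂ) * inner ℂ (ζ - z) v‖ ≤ A * ‖ζ - z‖ := by
    rw [norm_mul, norm_real, Real.norm_eq_abs, abs_of_nonneg (by positivity)]
    have := norm_inner_le (ζ - z) v
    rw [hv, mul_one] at this
    calc _ ≤ 1 * ‖ζ - z‖ := by gcongr
      _ ≤ _ := by gcongr
  refine (norm_add_le _ _).trans ?_
  have h3 := norm_sub_le (del (fderiv ℝ r ζ) v)
    ((1 / 2) * holPart (fderiv ℝ (fderiv ℝ r) ζ) v (ζ - z))
  have h4 : ‖(1 / 2) * holPart (fderiv ℝ (fderiv ℝ r) ζ) v (ζ - z)‖ ≤ 1 / 2 * (A * ‖ζ - z‖) := by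
    rw [norm_mul]
    have : ‖(1 / 2 : ℂ)‖ = 1 / 2 := by norm_num
    rw [this]; gcongr
  have : 0 ≤ A * ‖ζ - z‖ := by positivity
  linarith

theorem UniformBounds.norm_gDbar_le (h : UniformBounds r Γ ρ A c) (hp : p ∈ Γ)
    (hζ : ζ ∈ Metric.ball p ρ) (hζp : ‖ζ - p‖ ≤ 2 * ‖ζ - z‖) (hne : ζ ≠ z) {K : ℝ} (hK : 0 ≤ K)
    {u v : Cn m} (hu : ‖u‖ = 1) (hv : ‖v‖ = 1) :
    ‖gDbar r K ζ z u v‖ ≤ ‖hermPart (fderiv ℝ (fderiv ℝ r) p) v u‖ + (3 * A + 2 * K) * ‖ζ - z‖ := by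
  have hA := h.nonneg
  have hτ : 0 < ‖ζ - z‖ := norm_pos_iff.2 (sub_ne_zero.2 hne)
  have h1 : ‖hermPart (fderiv ℝ (fderiv ℝ r) ζ) v u‖ ≤
      ‖hermPart (fderiv ℝ (fderiv ℝ r) p) v u‖ + 2 * A * ‖ζ - z‖ := by
    have e1 : hermPart (fderiv ℝ (fderiv ℝ r) ζ) v u = hermPart (fderiv ℝ (fderiv ℝ r) p) v u
        + hermPart (fderiv ℝ (fderiv ℝ r) ζ - fderiv ℝ (fderiv ℝ r) p) v u := by
      rw [hermPart_sub]; ring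
    rw [e1]
    refine (norm_add_le _ _).trans ?_
    have := norm_hermPart_le (fderiv ℝ (fderiv ℝ r) ζ - fderiv ℝ (fderiv ℝ r) p) v u
    rw [hu, hv, mul_one, mul_one] at this
    have h2 := h.lip_two hp (Metric.mem_ball_self h.rho_pos) hζ
    have h3 : A * ‖ζ - p‖ ≤ A * (2 * ‖ζ - z‖) := by gcongr
    linarith
  have h2 : ‖(1 / 2) * thirdPart (fderiv ℝ (fderiv ℝ (fderiv ℝ r)) ζ) u v (ζ - z)‖ ≤
      (1 / 2) * (A * ‖ζ - z‖) := by
    have := norm_thirdPart_le (fderiv ℝ (fderiv ℝ (fderiv ℝ r)) ζ) u v (ζ - z)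
    rw [hu, hv, mul_one, mul_one] at this
    rw [norm_mul]
    have h3 : ‖(1 / 2 : ℂ)‖ = 1 / 2 := by norm_num
    rw [h3]
    gcongr
    exact this.trans (by gcongr; exact h.bound_three p hp ζ hζ)
  have h3 : ‖(K : ℂ) * (‖ζ - z‖ * inner ℂ u v
      + inner ℂ u (ζ - z) * inner ℂ (ζ - z) v / (2 * ‖ζ - z‖))‖ ≤ 2 * K * ‖ζ - z‖ := by
    rw [norm_mul, norm_real, Real.norm_eq_abs, abs_of_nonneg hK]
    have g1 := norm_inner_le u v
    have g2 := norm_inner_le u (ζ - z)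
    have g3 := norm_inner_le (ζ - z) v
    rw [hu, hv] at g1
    rw [hu] at g2
    rw [hv] at g3
    have g4 : ‖(‖ζ - z‖ : ℂ) * inner ℂ u v‖ ≤ ‖ζ - z‖ := by
      rw [norm_mul, norm_real, norm_norm]
      calc _ ≤ ‖ζ - z‖ * (1 * 1) := by gcongr
        _ = _ := by ring
    have g5 : ‖inner ℂ u (ζ - z) * inner ℂ (ζ - z) v / (2 * ‖ζ - z‖)‖ ≤ ‖ζ - z‖ := by
      rw [norm_div, norm_mul, norm_mul, norm_real, norm_norm, div_le_iff₀ (by simpa using hτ)]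
      have : ‖(2 : ℂ)‖ = 2 := by norm_num
      rw [this]
      calc _ ≤ (1 * ‖ζ - z‖) * (‖ζ - z‖ * 1) := by gcongr
        _ ≤ _ := by nlinarith
    calc _ ≤ K * (‖ζ - z‖ + ‖ζ - z‖) := by
          gcongr
          exact (norm_add_le _ _).trans (add_le_add g4 g5)
      _ = _ := by ring
  rw [gDbar]
  refine (norm_add_le _ _).trans ?_
  have h4 := norm_sub_le (hermPart (fderiv ℝ (fderiv ℝ r) ζ) v u)
    ((1 / 2) * thirdPart (fderiv ℝ (fderiv ℝ (fderiv ℝ r)) ζ) u v (ζ - z))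
  have : 0 ≤ A * ‖ζ - z‖ := by positivity
  linarith

theorem IsAdapted.eigenvalue_le (ad : IsAdapted r p e a l) (hA : ‖fderiv ℝ (fderiv ℝ r) p‖ ≤ A)
    (j : Fin m) : l j ≤ A := by
  have h1 := norm_hermPart_le (fderiv ℝ (fderiv ℝ r) p) (e j.succ) (e j.succ)
  rw [ad.herm_eq, if_pos rfl, e.norm_eq_one, mul_one, mul_one, norm_real, Real.norm_eq_abs,
    abs_of_nonneg (ad.nonneg j)] at h1
  exact h1.trans hA

theorem IsAdapted.norm_hermPart_tangential (ad : IsAdapted r p e a l) {κ κ' : ℂ} (hκ : ‖κ‖ = 1)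
    (hκ' : ‖κ'‖ = 1) (j k : Fin m) :
    ‖hermPart (fderiv ℝ (fderiv ℝ r) p) (κ • e j.succ) (κ' • e k.succ)‖ =
      if j = k then l j else 0 := by
  rw [hermPart_smul_left, hermPart_smul_right, ad.herm_eq, norm_mul, norm_mul, hκ, RCLike.norm_conj,
    hκ', one_mul, one_mul]
  split_ifs
  · rw [norm_real, Real.norm_eq_abs, abs_of_nonneg (ad.nonneg j)]
  · simp

/-- The squared distances in complex tangential directions are controlled by the support
function. -/
theorem UniformBounds.sq_mul_eigenvalue_le (h : UniformBounds r Γ ρ A c) (hp : p ∈ Γ)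
    (ad : IsAdapted r p e a l) {d σ : ℝ} (hd0 : 0 ≤ d) (hdτ : d ≤ ‖ζ - z‖) (hτ1 : ‖ζ - z‖ ≤ 1)
    (hσ : c / 4 * d + ∑ j, l j * ‖inner ℂ (e j.succ) (ζ - z)‖ ^ 2 + ‖ζ - z‖ ^ 3 ≤ 3 * σ)
    (j : Fin m) : (d + ‖inner ℂ (e j.succ) (ζ - z)‖) ^ 2 * (l j + ‖ζ - z‖) ≤
      (24 * (A + 1) / c + 12) * σ := by
  set τ := ‖ζ - z‖ with hτ
  set y := ‖inner ℂ (e j.succ) (ζ - z)‖ with hy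
  have hy0 : 0 ≤ y := norm_nonneg _
  have hyτ : y ≤ τ := norm_inner_basis_le e _ _
  have hτ0 : 0 ≤ τ := norm_nonneg _
  have hc := h.c_pos
  have hA := h.nonneg
  have hl := ad.nonneg j
  have hlA := ad.eigenvalue_le (h.bound_two p hp p (Metric.mem_ball_self h.rho_pos)) j
  -- After (d + y)² ≤ 2(d² + y²), each summand of `hσ` pays for one piece: the Levi sum for l_j y²,
  -- the cube for τ y² since y ≤ τ, and the term linear in `d` for d² (l_j + τ).
  have h1 : l j * y ^ 2 ≤ ∑ j, l j * ‖inner ℂ (e j.succ) (ζ - z)‖ ^ 2 :=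
    Finset.single_le_sum (f := fun j => l j * ‖inner ℂ (e j.succ) (ζ - z)‖ ^ 2)
      (fun i _ => mul_nonneg (ad.nonneg i) (sq_nonneg _)) (Finset.mem_univ j)
  have h2 : τ * y ^ 2 ≤ τ ^ 3 := by
    calc τ * y ^ 2 ≤ τ * τ ^ 2 := by gcongr
      _ = _ := by ring
  have hly : 0 ≤ l j * y ^ 2 := by positivity
  have hcd : 0 ≤ c / 4 * d := by positivity
  have hτ3 : 0 ≤ τ ^ 3 := by positivity
  have h3 : d ≤ 12 / c * σ := by
    have : c / 4 * d ≤ 3 * σ := by linarith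
    calc d = 4 / c * (c / 4 * d) := by field_simp
      _ ≤ 4 / c * (3 * σ) := by gcongr
      _ = _ := by ring
  have h4 : d ^ 2 * (l j + τ) ≤ (A + 1) * (12 / c * σ) := by
    calc d ^ 2 * (l j + τ) ≤ (d * 1) * (A + 1) := by
          rw [sq]; gcongr; exact hdτ.trans hτ1
      _ = (A + 1) * d := by ring
      _ ≤ _ := by gcongr
  have h5 : (d + y) ^ 2 * (l j + τ) ≤ 2 * (d ^ 2 + y ^ 2) * (l j + τ) := by
    gcongr
    nlinarith [sq_nonneg (d - y)]
  have h6 : (24 * (A + 1) / c + 12) * σ = 2 * ((A + 1) * (12 / c * σ)) + 12 * σ := by ring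
  rw [h6]
  nlinarith

end Near

end CauchyFantappie

end

/-! ### Weights for the adapted basis. -/

noncomputable section

namespace CauchyFantappie

open MeasureTheory Set Complex

variable {m : ℕ}

/-- The numerator of the kernel with respect to an adapted basis. -/
def nearTop (r : Cn m → ℝ) (K : ℝ) (e : OrthonormalBasis (Fin (m + 1)) ℂ (Cn m)) (ζ z : Cn m) : ℂ :=
  topSum (fun x => (conormal r ζ (adaptedBasis e x) : ℂ))
    (fun x => oneForm (gCoeff r K ζ z) (adaptedBasis e x))
    (fun _ x y => gDbar r K ζ z (adaptedBasis e x) (adaptedBasis e y)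
      - gDbar r K ζ z (adaptedBasis e y) (adaptedBasis e x))

/-- Weights of the adapted basis vectors: `w₀` for the complex normal directions, `w j` for the
others. -/
def pairWeight (w₀ : ℝ) (w : Fin m → ℝ) (x : Fin (2 * m + 2)) : ℝ :=
  (Fin.cons w₀ w : Fin (m + 1) → ℝ) ((pairEquiv m).symm x).1

theorem prod_pairWeight (w₀ : ℝ) (w : Fin m → ℝ) :
    ∏ x, pairWeight w₀ w x = w₀ ^ 2 * ∏ j, w j ^ 2 := by
  rw [← Equiv.prod_comp (pairEquiv m), Fintype.prod_prod_type, Fin.prod_univ_succ]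
  simp [pairWeight, sq]

theorem forall_basis {P : Cn m → ℝ → Prop} (e : OrthonormalBasis (Fin (m + 1)) ℂ (Cn m)) {w₀ : ℝ}
    {w : Fin m → ℝ} (h0 : ∀ κ : ℂ, ‖κ‖ = 1 → P (κ • e 0) w₀)
    (hs : ∀ κ : ℂ, ‖κ‖ = 1 → ∀ j : Fin m, P (κ • e j.succ) (w j)) (x : Fin (2 * m + 2)) :
    P (adaptedBasis e x) (pairWeight w₀ w x) := by
  obtain ⟨⟨j, b⟩, rfl⟩ := (pairEquiv m).surjective x
  rw [adaptedBasis_pairEquiv, pairWeight, Equiv.symm_apply_apply]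
  refine Fin.cases ?_ (fun j => ?_) j
  · exact h0 _ (norm_vec_one_I b)
  · exact hs _ (norm_vec_one_I b) j

theorem norm_smul_basis (e : OrthonormalBasis (Fin (m + 1)) ℂ (Cn m)) {κ : ℂ} (hκ : ‖κ‖ = 1)
    (j : Fin (m + 1)) : ‖κ • e j‖ = 1 := by
  rw [norm_smul, hκ, e.norm_eq_one, mul_one]

section Near

variable {r : Cn m → ℝ} {Γ : Set (Cn m)} {ρ A c : ℝ} {p ζ z : Cn m}
  {e : OrthonormalBasis (Fin (m + 1)) ℂ (Cn m)} {a : ℝ} {l : Fin m → ℝ}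

theorem abs_conormal_le (h : fderiv ℝ r ζ ≠ 0) {v : Cn m} (hv : ‖v‖ = 1) : |conormal r ζ v| ≤ 1 := by
  have h0 : 0 < ‖fderiv ℝ r ζ‖ := norm_pos_iff.2 h
  rw [conormal, abs_div, abs_norm, div_le_one h0]
  have := (fderiv ℝ r ζ).le_opNorm v
  rwa [hv, mul_one, Real.norm_eq_abs] at this

/-- In the complex normal directions the conormal is at most 1 = q · q⁻¹. On tangential vectors it
is O(|ζ - p|) = O(q²), and one factor q is at most w_j. -/
theorem UniformBounds.conormal_weight_le (h : UniformBounds r Γ ρ A c) (hp : p ∈ Γ) (hζ : ζ ∈ Γ)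
    (ad : IsAdapted r p e a l) (hζp : ζ ∈ Metric.ball p ρ) {q : ℝ} {w : Fin m → ℝ} (hq : 0 < q)
    (hζq : ‖ζ - p‖ ≤ 2 * q ^ 2) (hw : ∀ j, q ≤ w j) (x : Fin (2 * m + 2)) :
    ‖(conormal r ζ (adaptedBasis e x) : ℂ)‖ ≤ (1 + 4 * A / c) * q * pairWeight q⁻¹ w x := by
  have hc := h.c_pos
  have hA := h.nonneg
  have hAc : 0 ≤ 4 * A / c := by positivity
  have hlow := h.lower ζ hζ
  have hne : fderiv ℝ r ζ ≠ 0 := fun h0 => by rw [h0, norm_zero] at hlow; linarith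
  refine forall_basis (P := fun v y => ‖(conormal r ζ v : ℂ)‖ ≤ (1 + 4 * A / c) * q * y) e
    (fun κ hκ => ?_) (fun κ hκ j => ?_) x
  · rw [norm_real, mul_assoc, mul_inv_cancel₀ hq.ne', mul_one]
    exact (abs_conormal_le hne (norm_smul_basis e hκ 0)).trans (by linarith)
  · rw [norm_real, Real.norm_eq_abs, conormal, abs_div, abs_norm, ← two_re_del, abs_mul, abs_two]
    have h1 := (abs_re_le_norm _).trans (h.norm_del_tangential_le hp ad hζp hκ j)
    have h2 : A * ‖ζ - p‖ ≤ A * (2 * q ^ 2) := by gcongr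
    have hwj := hq.le.trans (hw j)
    rw [div_le_iff₀ (hc.trans_le hlow)]
    calc _ ≤ 2 * (A * (2 * q ^ 2)) := by linarith
      _ = (4 * A / c) * q * q * c := by field_simp; ring
      _ ≤ (1 + 4 * A / c) * q * w j * ‖fderiv ℝ r ζ‖ := by
        gcongr
        · linarith
        · exact hw j

/-- Same mechanism as for the conormal: g differs from ∂r by O(|ζ - z|) = O(q²), so it is bounded in
the normal directions and O(q²) in the tangential ones. -/
theorem UniformBounds.oneForm_weight_le (h : UniformBounds r Γ ρ A c) (hp : p ∈ Γ)
    (ad : IsAdapted r p e a l) (hζp : ζ ∈ Metric.ball p ρ) {q K : ℝ} {w : Fin m → ℝ}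
    (hK : 0 ≤ K) (hq : 0 < q) (hτ : ‖ζ - z‖ = q ^ 2) (hq1 : q ≤ 1) (hKτ : K * q ^ 2 ≤ 1)
    (hζq : ‖ζ - p‖ ≤ 2 * q ^ 2) (hw : ∀ j, q ≤ w j) (x : Fin (2 * m + 2)) :
    ‖oneForm (gCoeff r K ζ z) (adaptedBasis e x)‖ ≤ (4 * A + 2 * K) * q * pairWeight q⁻¹ w x := by
  have hA1 := h.one_le
  have hA := h.nonneg
  have hcd := h.contDiffAt p hp ζ hζp
  have hb1 := h.bound_one p hp ζ hζp
  have hb2 := h.bound_two p hp ζ hζp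
  refine forall_basis (P := fun v y => ‖oneForm (gCoeff r K ζ z) v‖ ≤ (4 * A + 2 * K) * q * y) e
    (fun κ hκ => ?_) (fun κ hκ j => ?_) x
  · have h1 := norm_oneForm_gCoeff_le (z := z) hcd hb2 hK (by rwa [hτ]) hA1
      (norm_smul_basis e hκ 0)
    have h2 := norm_del_le_of_norm_eq_one hb1 (norm_smul_basis e hκ 0)
    rw [mul_assoc, mul_inv_cancel₀ hq.ne', mul_one]
    rw [hτ] at h1
    have h3 : 2 * A * q ^ 2 ≤ 2 * A * 1 := by gcongr; exact pow_le_one₀ hq.le hq1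
    linarith
  · have h1 := norm_oneForm_gCoeff_le (z := z) hcd hb2 hK (by rwa [hτ]) hA1
      (norm_smul_basis e hκ j.succ)
    have h2 := h.norm_del_tangential_le hp ad hζp hκ j
    have h3 : A * ‖ζ - p‖ ≤ A * (2 * q ^ 2) := by gcongr
    rw [hτ] at h1
    calc _ ≤ (4 * A) * q * q := by linarith
      _ ≤ (4 * A + 2 * K) * q * w j := by
        gcongr
        · linarith
        · exact hw j

/-- An entry involving a normal vector is O(1), and its two weights multiply to at least q⁻¹ q = 1.
A tangential entry is the Levi matrix at p, which is diagonal, plus O(q²): on the diagonal l_j + q²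
≤ w_j², and off it q² ≤ w_j w_k. -/
theorem UniformBounds.gDbar_weight_le (h : UniformBounds r Γ ρ A c) (hp : p ∈ Γ)
    (ad : IsAdapted r p e a l) (hζp : ζ ∈ Metric.ball p ρ) {q K : ℝ} {w : Fin m → ℝ}
    (hK : 0 ≤ K) (hq : 0 < q) (hτ : ‖ζ - z‖ = q ^ 2) (hq1 : q ≤ 1)
    (hζq : ‖ζ - p‖ ≤ 2 * q ^ 2) (hw : ∀ j, q ≤ w j) (hwl : ∀ j, l j + q ^ 2 ≤ w j ^ 2)
    (x y : Fin (2 * m + 2)) :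
    ‖gDbar r K ζ z (adaptedBasis e x) (adaptedBasis e y)‖ ≤
      (4 * A + 2 * K) * (pairWeight q⁻¹ w x * pairWeight q⁻¹ w y) := by
  have hA1 := h.one_le
  have hA := h.nonneg
  have hne : ζ ≠ z := fun h0 => by
    rw [h0, sub_self, norm_zero] at hτ
    exact hq.ne' (pow_eq_zero_iff two_ne_zero |>.1 hτ.symm)
  have hζp' : ‖ζ - p‖ ≤ 2 * ‖ζ - z‖ := by rwa [hτ]
  have hb2 := h.bound_two p hp p (Metric.mem_ball_self h.rho_pos)
  have hq2 : q ^ 2 ≤ 1 := pow_le_one₀ hq.le hq1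
  have hqi : q * q⁻¹ = 1 := mul_inv_cancel₀ hq.ne'
  have hqi1 : 1 ≤ q⁻¹ := (one_le_inv₀ hq).2 hq1
  have gen : ∀ u v : Cn m, ‖u‖ = 1 → ‖v‖ = 1 → ∀ s, 1 ≤ s →
      ‖gDbar r K ζ z u v‖ ≤ (4 * A + 2 * K) * s := by
    intro u v hu hv s hs
    have h1 := h.norm_gDbar_le hp hζp hζp' hne hK hu hv
    have h2 := norm_hermPart_le (fderiv ℝ (fderiv ℝ r) p) v u
    rw [hu, hv, mul_one, mul_one] at h2
    rw [hτ] at h1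
    have h3 : (3 * A + 2 * K) * q ^ 2 ≤ (3 * A + 2 * K) * 1 := by gcongr
    calc _ ≤ (4 * A + 2 * K) * 1 := by linarith
      _ ≤ _ := by gcongr
  refine forall_basis (P := fun v s => ‖gDbar r K ζ z (adaptedBasis e x) v‖ ≤
    (4 * A + 2 * K) * (pairWeight q⁻¹ w x * s)) e (fun κ' hκ' => ?_) (fun κ' hκ' k => ?_) y
  · refine forall_basis (P := fun v s => ‖gDbar r K ζ z v (κ' • e 0)‖ ≤
      (4 * A + 2 * K) * (s * q⁻¹)) e (fun κ hκ => ?_) (fun κ hκ j => ?_) x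
    · exact gen _ _ (norm_smul_basis e hκ _) (norm_smul_basis e hκ' _) _ (by nlinarith)
    · refine gen _ _ (norm_smul_basis e hκ _) (norm_smul_basis e hκ' _) _ ?_
      rw [← hqi]
      gcongr
      exact hw j
  · refine forall_basis (P := fun v s => ‖gDbar r K ζ z v (κ' • e k.succ)‖ ≤
      (4 * A + 2 * K) * (s * w k)) e (fun κ hκ => ?_) (fun κ hκ j => ?_) x
    · refine gen _ _ (norm_smul_basis e hκ _) (norm_smul_basis e hκ' _) _ ?_
      rw [← hqi, mul_comm]
      gcongr
      exact hw k
    · have h1 := h.norm_gDbar_le hp hζp hζp' hne hK (norm_smul_basis e hκ j.succ)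
        (norm_smul_basis e hκ' k.succ)
      rw [ad.norm_hermPart_tangential hκ' hκ, hτ] at h1
      refine h1.trans ?_
      have hwq : q ^ 2 ≤ w j * w k := by
        rw [sq]
        exact mul_le_mul (hw j) (hw k) hq.le (hq.le.trans (hw j))
      have hh : (if k = j then l k else 0) + q ^ 2 ≤ w j * w k := by
        split_ifs with hjk
        · subst hjk; rw [← sq]; exact hwl k
        · linarith
      have hl0 : 0 ≤ if k = j then l k else 0 := by
        split_ifs
        · exact ad.nonneg k
        · exact le_rfl
      have h5 : (3 * A + 2 * K) * q ^ 2 + (if k = j then l k else 0) ≤ (3 * A + 2 * K) *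
          ((if k = j then l k else 0) + q ^ 2) := by nlinarith
      calc _ ≤ (3 * A + 2 * K) * ((if k = j then l k else 0) + q ^ 2) := by linarith
        _ ≤ (4 * A + 2 * K) * (w j * w k) := by
          gcongr
          · linarith

/-- The z-derivative of an entry of ∂̄g is only bounded, while two tangential weights may multiply
to less than 1. The factor M makes up for this deficit. -/
theorem one_le_pairWeight_mul {q M : ℝ} {w : Fin m → ℝ} (hq : 0 < q) (hq1 : q ≤ 1)
    (hw : ∀ j, q ≤ w j) (hM : 0 ≤ M) (hMw : ∀ j, 1 ≤ M * (q * w j)) (x y : Fin (2 * m + 2)) :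
    1 ≤ (1 + M) * (pairWeight q⁻¹ w x * pairWeight q⁻¹ w y) := by
  have hqi : q * q⁻¹ = 1 := mul_inv_cancel₀ hq.ne'
  have hqi1 : 1 ≤ q⁻¹ := (one_le_inv₀ hq).2 hq1
  have key : ∀ j k : Fin (m + 1), 1 ≤ (1 + M) *
      ((Fin.cons q⁻¹ w : Fin (m + 1) → ℝ) j * (Fin.cons q⁻¹ w : Fin (m + 1) → ℝ) k) := by
    have hge : ∀ s : ℝ, 1 ≤ s → 1 ≤ (1 + M) * s := fun s hs => by nlinarith
    intro j k
    refine Fin.cases ?_ (fun j => ?_) j <;> refine Fin.cases ?_ (fun k => ?_) k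
    · simp only [Fin.cons_zero]
      exact hge _ (by nlinarith)
    · simp only [Fin.cons_zero, Fin.cons_succ]
      refine hge _ ?_
      rw [← hqi, mul_comm]
      gcongr
      exact hw k
    · simp only [Fin.cons_zero, Fin.cons_succ]
      refine hge _ ?_
      rw [← hqi]
      gcongr
      exact hw j
    · simp only [Fin.cons_succ]
      refine (hMw k).trans ?_
      have := hq.le.trans (hw k)
      have := hq.le.trans (hw j)
      gcongr
      · linarith
      · exact hw j
  exact key _ _

end Near

/-- With s = σ^{1/3} one has τ ≤ 2s. The derivatives of the power of Φ, of g and of ∂̄g cost τ²/σ, a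
constant, and √(τ/σ), each of which is O(s⁻¹). -/
theorem dbar_kernel_arith {σ τ A B s : ℝ} (hs : 0 < s) (hsσ : s ^ 3 = σ) (hτ : 0 ≤ τ)
    (hτσ : τ ^ 3 ≤ 3 * σ) (hσA : σ ≤ 3 * A) (hA : 1 ≤ A) (hB : 1 ≤ B) {k₁ k₂ k₃ : ℝ}
    (h1 : 0 ≤ k₁) (h2 : 0 ≤ k₂) (h3 : 0 ≤ k₃) :
    k₁ * (τ ^ 2 / σ) + k₂ + k₃ * (2 * √τ / √(B * σ)) ≤ (4 * k₁ + 3 * A * k₂ + 4 * k₃) * s⁻¹ := by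
  have hσ : 0 < σ := hsσ ▸ pow_pos hs 3
  have hτs : τ ≤ 2 * s := by
    refine le_of_pow_le_pow_left₀ three_ne_zero (by positivity) ?_
    calc τ ^ 3 ≤ 3 * σ := hτσ
      _ ≤ (2 * s) ^ 3 := by rw [mul_pow, hsσ]; linarith
  have hsA : s ≤ 3 * A := by
    refine le_of_pow_le_pow_left₀ three_ne_zero (by positivity) ?_
    rw [hsσ]
    refine hσA.trans (le_self_pow₀ (by linarith) three_ne_zero)
  have e1 : τ ^ 2 / σ ≤ 4 * s⁻¹ := by
    rw [div_le_iff₀ hσ, ← hsσ]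
    calc τ ^ 2 ≤ (2 * s) ^ 2 := by gcongr
      _ = _ := by field_simp; norm_num
  have e2 : 1 ≤ 3 * A * s⁻¹ := by
    rw [← div_eq_mul_inv, le_div_iff₀ hs]; linarith
  have e3 : 2 * √τ / √(B * σ) ≤ 4 * s⁻¹ := by
    rw [div_le_iff₀ (Real.sqrt_pos.2 (by positivity))]
    have : √τ ≤ √((2 * s⁻¹) ^ 2 * (B * σ)) := by
      refine Real.sqrt_le_sqrt ?_
      calc τ ≤ 2 * s := hτs
        _ ≤ 4 * s := by linarith
        _ = (2 * s⁻¹) ^ 2 * (1 * s ^ 3) := by field_simp; norm_num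
        _ ≤ _ := by rw [hsσ]; gcongr
    rw [Real.sqrt_mul (by positivity), Real.sqrt_sq (by positivity)] at this
    linarith
  calc _ ≤ k₁ * (4 * s⁻¹) + k₂ * (3 * A * s⁻¹) + k₃ * (4 * s⁻¹) := by
        gcongr
        nlinarith
    _ = _ := by ring

theorem dbar_kernel_identity {σ τ : ℝ} (hσ : σ ≠ 0) (hτ : τ ≠ 0) (m : ℕ) (k N ab c B P M : ℝ) :
    (m + 1) * σ⁻¹ ^ m * ((σ ^ 2)⁻¹ * (k * τ ^ 2)) * (N * (ab * τ * c) * (τ⁻¹ * (B * σ ^ m * P)))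
      + σ⁻¹ ^ (m + 1) * (N * (ab * τ * c) * (1 + m * (1 + M)) * (τ⁻¹ * (B * σ ^ m * P))) =
    N * (ab * c) * B * P * σ⁻¹ * ((m + 1) * k * (τ ^ 2 / σ) + (1 + m) + m * M) := by
  have e2 : σ⁻¹ ^ m * σ ^ m = 1 := by rw [← mul_pow, inv_mul_cancel₀ hσ, one_pow]
  have e3 : τ * τ⁻¹ = 1 := mul_inv_cancel₀ hτ
  have e4 : (σ ^ 2)⁻¹ = σ⁻¹ * σ⁻¹ := by rw [sq, mul_inv]
  rw [e4, pow_succ, div_eq_mul_inv]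
  linear_combination (N * ab * c * B * P * σ⁻¹ *
    ((m + 1) * k * (τ ^ 2 * σ⁻¹) + (1 + m) + m * M)) * (τ * τ⁻¹ * e2 + e3)

/-- The estimate of the `∂̄`-derivative of the kernel near the diagonal. -/
theorem UniformBounds.exists_dbar_nearKernel_bound {r : Cn m → ℝ} {Γ : Set (Cn m)} {ρ A c : ℝ}
    (h : UniformBounds r Γ ρ A c) {K : ℝ} (hK : 3 * A + 24 * A ^ 2 / c + 1 ≤ 2 * K) :
    ∃ C : ℝ, 0 ≤ C ∧ ∀ (p ζ z : Cn m) (e : OrthonormalBasis (Fin (m + 1)) ℂ (Cn m)) (a : ℝ)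
      (l : Fin m → ℝ) (d : ℝ), p ∈ Γ → ζ ∈ Γ → r ζ = 0 → IsAdapted r p e a l → 0 < d →
      d ≤ ‖ζ - z‖ → c / 4 * d ≤ -r z → 2 * ‖ζ - z‖ < ρ → ‖ζ - p‖ ≤ 2 * ‖ζ - z‖ → ‖ζ - z‖ ≤ 1 →
      K * ‖ζ - z‖ ≤ 1 → 6 * A / c * ‖ζ - z‖ ≤ 1 →
      ∃ k' : Cn m → ℂ, HasDbarAt (fun z => (suppFun r K ζ z)⁻¹ ^ (m + 1) * nearTop r K e ζ z) k' z ∧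
        ∀ w, ‖w‖ ≤ 1 → ‖k' w‖ ≤ C * ((∏ j : Fin m, ((d + ‖inner ℂ (e j.succ) (ζ - z)‖) ^ 2)⁻¹) *
          ‖suppFun r K ζ z‖ ^ (-(4 / 3) : ℝ)) := by
  have hA := h.nonneg
  have hA1 := h.one_le
  have hc := h.c_pos
  have hK0 : 0 ≤ K := by
    have : 0 ≤ 24 * A ^ 2 / c := by positivity
    linarith
  set B : ℝ := 24 * (A + 1) / c + 12 with hB
  have hB1 : 1 ≤ B := by
    have : 0 ≤ 24 * (A + 1) / c := by positivity
    linarith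
  set N : ℝ := ((2 * m + 2).factorial : ℝ) with hN
  set a₀ : ℝ := 1 + 4 * A / c with ha₀
  have ha₀0 : 0 ≤ a₀ := by positivity
  set b₀ : ℝ := 4 * A + 2 * K with hb₀
  have hb₀0 : 0 ≤ b₀ := by positivity
  set Q : ℝ := N * (a₀ * b₀ * (2 * b₀) ^ m) * B ^ m with hQ
  have hQ0 : 0 ≤ Q := by positivity
  refine ⟨Q * (4 * ((m + 1) * (2 * K)) + 3 * A * (1 + m) + 4 * m), by positivity, ?_⟩
  intro p ζ z e a l d hp hζ h0 ad hd hdτ hdr hτρ hζp hτ1 hKτ hAτ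
  set τ := ‖ζ - z‖ with hτd
  have hτ : 0 < τ := hd.trans_le hdτ
  have hzζ : z ≠ ζ := fun h' => by rw [hτd, h', sub_self, norm_zero] at hτ; exact hτ.false
  set σ := ‖suppFun r K ζ z‖ with hσd
  have hlow := h.norm_suppFun_ge hp hζ h0 ad hτρ hζp hK hKτ hAτ
  rw [← hσd, ← hτd] at hlow
  have hlow' : c / 4 * d + ∑ j, l j * ‖inner ℂ (e j.succ) (ζ - z)‖ ^ 2 + τ ^ 3 ≤ 3 * σ := by
    linarith
  have hsum0 : 0 ≤ ∑ j, l j * ‖inner ℂ (e j.succ) (ζ - z)‖ ^ 2 :=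
    Finset.sum_nonneg fun i _ => mul_nonneg (ad.nonneg i) (sq_nonneg _)
  have hcd : 0 < c / 4 * d := by positivity
  have hτ3 : τ ^ 3 ≤ 3 * σ := by linarith
  have hσ : 0 < σ := by
    have : 0 < τ ^ 3 := by positivity
    linarith
  have hΦ0 : suppFun r K ζ z ≠ 0 := norm_pos_iff.1 hσ
  have hζb : ζ ∈ Metric.ball p ρ := mem_ball_iff_norm.2 (by linarith)
  have hcdiff := h.contDiffAt p hp ζ hζb
  have hσA : σ ≤ 3 * A := by
    rw [hσd, suppFun_eq hcdiff h0]
    refine (norm_add_le _ _).trans ?_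
    have g1 := norm_sub_le (del (fderiv ℝ r ζ) (ζ - z))
      ((1 / 2) * holPart (fderiv ℝ (fderiv ℝ r) ζ) (ζ - z) (ζ - z))
    have g2 : ‖del (fderiv ℝ r ζ) (ζ - z)‖ ≤ A := by
      refine (norm_del_le _ _).trans ?_
      have := h.bound_one p hp ζ hζb
      calc _ ≤ A * 1 := by gcongr
        _ = A := mul_one A
    have g3 : ‖(1 / 2) * holPart (fderiv ℝ (fderiv ℝ r) ζ) (ζ - z) (ζ - z)‖ ≤ A := by
      have g4 := norm_holPart_le (fderiv ℝ (fderiv ℝ r) ζ) (ζ - z) (ζ - z)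
      have := h.bound_two p hp ζ hζb
      have g5 : ‖(1 / 2 : ℂ)‖ ≤ 1 := by norm_num
      rw [norm_mul]
      calc _ ≤ 1 * (A * 1 * 1) := by
            gcongr
            exact g4.trans (by gcongr)
        _ = A := by ring
    have g4 : ‖((K * ‖ζ - z‖ ^ 3 : ℝ) : ℂ)‖ ≤ A := by
      rw [norm_real, Real.norm_eq_abs, abs_of_nonneg (by positivity), ← hτd]
      calc K * τ ^ 3 = (K * τ) * τ ^ 2 := by ring
        _ ≤ 1 * 1 := by gcongr; exact pow_le_one₀ hτ.le hτ1
        _ ≤ A := by linarith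
    linarith
  set q := √τ with hq
  have hq0 : 0 < q := Real.sqrt_pos.2 hτ
  have hq2 : q ^ 2 = τ := Real.sq_sqrt hτ.le
  have hq1 : q ≤ 1 := by rw [hq]; exact Real.sqrt_le_one.2 hτ1
  set Dj : Fin m → ℝ := fun j => d + ‖inner ℂ (e j.succ) (ζ - z)‖ with hDj
  have hDj0 : ∀ j, 0 < Dj j := fun j => add_pos_of_pos_of_nonneg hd (norm_nonneg _)
  -- The smallest weight that `sq_mul_eigenvalue_le` guarantees to satisfy l_j + τ ≤ w_j²; `q` is
  -- the square root of τ, so that q ≤ w_j follows.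
  set w : Fin m → ℝ := fun j => √(B * σ) / Dj j with hw
  have hw0 : ∀ j, 0 < w j := fun j => div_pos (Real.sqrt_pos.2 (by positivity)) (hDj0 j)
  have hw2 : ∀ j, w j ^ 2 = B * σ * ((Dj j) ^ 2)⁻¹ := fun j => by
    rw [hw]; simp only
    rw [div_pow, Real.sq_sqrt (by positivity), div_eq_mul_inv]
  have hwl : ∀ j, l j + q ^ 2 ≤ w j ^ 2 := fun j => by
    rw [hw2, hq2, ← div_eq_mul_inv, le_div_iff₀ (pow_pos (hDj0 j) 2), mul_comm]
    exact h.sq_mul_eigenvalue_le hp ad hd.le hdτ hτ1 hlow' j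
  have hwq : ∀ j, q ≤ w j := fun j => by
    refine le_of_pow_le_pow_left₀ two_ne_zero (hw0 j).le ?_
    have := hwl j
    have := ad.nonneg j
    linarith
  -- Chosen so that M q w_j = 2τ / (d + |t_j|), which is at least 1 because both d and |t_j| are at
  -- most τ.
  set M := 2 * √τ / √(B * σ) with hM
  have hM0 : 0 ≤ M := by positivity
  have hMw : ∀ j, 1 ≤ M * (q * w j) := fun j => by
    have e1 : M * (q * w j) = 2 * q ^ 2 / Dj j := by
      have : 0 < √(B * σ) := Real.sqrt_pos.2 (by positivity)
      have := hDj0 j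
      simp only [hM, hw]
      rw [← hq]
      field_simp
    rw [e1, le_div_iff₀ (hDj0 j), hq2, one_mul]
    have := norm_inner_basis_le e j.succ (ζ - z)
    simp only [hDj]
    linarith
  have hζq : ‖ζ - p‖ ≤ 2 * q ^ 2 := by rwa [hq2]
  have hKq : K * q ^ 2 ≤ 1 := by rwa [hq2]
  set W := pairWeight q⁻¹ w with hW
  set b := adaptedBasis e with hb
  have hWone : ∀ x y, 1 ≤ (1 + M) * (W x * W y) :=
    one_le_pairWeight_mul hq0 hq1 hwq hM0 hMw
  -- Since ∂̄_z g is O(τ), this puts it under the same weighted bound as g itself.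
  have hWq : ∀ x, τ ≤ q * W x := fun x => by
    refine forall_basis (P := fun _ y => τ ≤ q * y) e (fun κ _ => ?_) (fun κ _ j => ?_) x
    · rw [mul_inv_cancel₀ hq0.ne']; exact hτ1
    · rw [← hq2, sq]; gcongr; exact hwq j
  have hνb := h.conormal_weight_le hp hζ ad hζb hq0 hζq hwq
  have hαb := h.oneForm_weight_le hp ad hζb hK0 hq0 hq2.symm hq1 hKq hζq hwq
  have hβb := h.gDbar_weight_le hp ad hζb hK0 hq0 hq2.symm hq1 hζq hwq hwl
  rw [← hW] at hνb hαb hβb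
  have hβb' : ∀ (i : Fin m) (x y : Fin (2 * m + 2)), ‖gDbar r K ζ z (b x) (b y)
      - gDbar r K ζ z (b y) (b x)‖ ≤ (2 * b₀) * (W x * W y) := fun _ x y => by
    have e1 := hβb x y
    have e2 := hβb y x
    refine (norm_sub_le _ _).trans ?_
    rw [mul_comm (W y)] at e2
    linarith
  choose α' hα' hα'b using fun x => exists_hasDbarAt_oneForm_gCoeff hcdiff K hzζ (b x)
  choose β' hβ' hβ'b using fun x y => exists_hasDbarAt_gDbar (r := r) K hzζ (b x) (b y)
  have hT := hasDbarAt_topSum (fun x => (conormal r ζ (b x) : ℂ))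
    (α := fun z x => oneForm (gCoeff r K ζ z) (b x))
    (β := fun z (_ : Fin m) x y => gDbar r K ζ z (b x) (b y) - gDbar r K ζ z (b y) (b x))
    (α' := fun w x => α' x w) (β' := fun w _ x y => β' x y w - β' y x w) hα'
    (fun _ x y => (hβ' x y).sub (hβ' y x))
  obtain ⟨Φ', hΦ', hΦ'b⟩ := exists_hasDbarAt_suppFun r ζ K hzζ
  refine ⟨_, exists_hasDbarAt_kernel hΦ' hΦ0 hT, fun v hv => ?_⟩
  have hb1 : ∀ x, ‖b x‖ = 1 := norm_adaptedBasis e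
  have hT0 : ‖nearTop r K e ζ z‖ ≤ N * (a₀ * q * (b₀ * q) * (2 * b₀) ^ m) * ∏ x, W x := by
    have := norm_topSum_le hνb hαb hβb'
    rwa [Finset.prod_const, Finset.card_univ, Fintype.card_fin] at this
  have hα'q : ∀ x, ‖α' x v‖ ≤ b₀ * q * W x := fun x => by
    refine (hα'b x v).trans ?_
    rw [hb1, abs_of_nonneg hK0, mul_one]
    have hqW := hτ.le.trans (hWq x)
    calc 2 * K * ‖ζ - z‖ * ‖v‖ ≤ 2 * K * (q * W x) * 1 := by gcongr; exact hWq x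
      _ ≤ b₀ * (q * W x) * 1 := by
        gcongr
        linarith
      _ = _ := by ring
  have hβ'q : ∀ (i : Fin m) (x y : Fin (2 * m + 2)),
      ‖β' x y v - β' y x v‖ ≤ (2 * b₀) * (1 + M) * (W x * W y) := fun _ x y => by
    have e1 : ∀ x y, ‖β' x y v‖ ≤ 2 * K := fun x y => by
      refine (hβ'b x y v).trans ?_
      rw [hb1, hb1, abs_of_nonneg hK0, mul_one, mul_one]
      exact mul_le_of_le_one_right (by positivity) hv
    have e2 := hWone x y
    calc _ ≤ 2 * b₀ * 1 := by
          have := norm_sub_le (β' x y v) (β' y x v)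
          have := e1 x y
          have := e1 y x
          linarith
      _ ≤ 2 * b₀ * ((1 + M) * (W x * W y)) := by gcongr
      _ = _ := by ring
  have hT1 := norm_dbar_topSum_le hνb hαb hα'q hβb' hβ'q
  -- Here `τ⁻¹` cancels the factor q² coming from the conormal and from g, and σ^m cancels all but
  -- one of the m + 1 powers of Φ⁻¹. What is left is σ⁻¹ ∏ (d + |t_j|)^{-2} times the cost of the
  -- derivative.
  have hPW : ∏ x, W x = τ⁻¹ * ((B * σ) ^ m * ∏ j, (Dj j ^ 2)⁻¹) := by
    rw [hW, prod_pairWeight, inv_pow, hq2]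
    simp only [hw2]
    rw [Finset.prod_mul_distrib, Finset.prod_const, Finset.card_univ, Fintype.card_fin]
  set P := ∏ j, (Dj j ^ 2)⁻¹ with hP
  have hP0 : 0 ≤ P := Finset.prod_nonneg fun j _ => by positivity
  set s := σ ^ (1 / 3 : ℝ) with hs
  have hs0 : 0 < s := Real.rpow_pos_of_pos hσ _
  have hs3 : s ^ 3 = σ := by
    rw [hs, ← Real.rpow_natCast, ← Real.rpow_mul hσ.le]; norm_num
  have hs4 : σ ^ (-(4 / 3) : ℝ) = σ⁻¹ * s⁻¹ := by
    rw [hs, ← Real.rpow_neg hσ.le, ← Real.rpow_neg_one σ, ← Real.rpow_add hσ]; norm_num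
  have harith := dbar_kernel_arith hs0 hs3 hτ.le hτ3 hσA hA1 hB1
    (k₁ := (m + 1) * (2 * K)) (k₂ := 1 + m) (k₃ := m) (by positivity) (by positivity) (by positivity)
  have f1 : ‖((m : ℂ) + 1) * (suppFun r K ζ z)⁻¹ ^ m * (-(suppFun r K ζ z ^ 2)⁻¹ * Φ' v) *
      nearTop r K e ζ z‖ ≤ (m + 1) * σ⁻¹ ^ m * ((σ ^ 2)⁻¹ * (2 * K * τ ^ 2)) *
        (N * (a₀ * q * (b₀ * q) * (2 * b₀) ^ m) * ∏ x, W x) := by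
    have e1 : ‖(m : ℂ) + 1‖ = m + 1 := by exact_mod_cast Complex.norm_natCast (m + 1)
    have e2 : ‖Φ' v‖ ≤ 2 * K * τ ^ 2 := by
      refine (hΦ'b v).trans ?_
      rw [abs_of_nonneg hK0]
      exact mul_le_of_le_one_right (by positivity) hv
    rw [norm_mul, norm_mul, norm_mul, norm_mul, norm_neg, norm_inv, norm_pow, norm_pow, norm_inv, e1,
      ← hσd]
    gcongr
  have f2 : ‖(suppFun r K ζ z)⁻¹ ^ (m + 1) * (topSum (fun x => (conormal r ζ (b x) : ℂ))
      (fun x => α' x v) (fun _ x y => gDbar r K ζ z (b x) (b y) - gDbar r K ζ z (b y) (b x)) +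
      ∑ j, topSum (fun x => (conormal r ζ (b x) : ℂ)) (fun x => oneForm (gCoeff r K ζ z) (b x))
        (Function.update (fun _ x y => gDbar r K ζ z (b x) (b y) - gDbar r K ζ z (b y) (b x)) j
          (fun x y => β' x y v - β' y x v)))‖ ≤ σ⁻¹ ^ (m + 1) *
      (N * (a₀ * q * (b₀ * q) * (2 * b₀) ^ m) * (1 + m * (1 + M)) * ∏ x, W x) := by
    rw [norm_mul, norm_pow, norm_inv, ← hσd]
    gcongr
  refine (norm_add_le _ _).trans ((add_le_add f1 f2).trans ?_)
  have hfin : (m + 1) * σ⁻¹ ^ m * ((σ ^ 2)⁻¹ * (2 * K * τ ^ 2)) *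
        (N * (a₀ * q * (b₀ * q) * (2 * b₀) ^ m) * ∏ x, W x) + σ⁻¹ ^ (m + 1) *
      (N * (a₀ * q * (b₀ * q) * (2 * b₀) ^ m) * (1 + m * (1 + M)) * ∏ x, W x) =
      Q * P * σ⁻¹ * ((m + 1) * (2 * K) * (τ ^ 2 / σ) + (1 + m) + m * M) := by
    have e1 : a₀ * q * (b₀ * q) = a₀ * b₀ * τ := by rw [← hq2]; ring
    rw [hPW, e1, hQ, mul_pow B σ]
    exact dbar_kernel_identity hσ.ne' hτ.ne' m _ _ _ _ _ _ _
  rw [hfin, hs4]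
  calc _ ≤ Q * P * σ⁻¹ * ((4 * ((m + 1) * (2 * K)) + 3 * A * (1 + m) + 4 * m) * s⁻¹) := by gcongr
    _ = _ := by ring

end CauchyFantappie

end

noncomputable section

namespace CauchyFantappie

open MeasureTheory Set Complex

variable {m : ℕ}

/-! ### Kernels which are smooth off the diagonal -/

/-- The kernel `k(ζ, z)` is, off the diagonal of `Γ × Z`, a smooth function of `z` and of continuous
functions of `ζ`. -/
def IsSmoothKernel (Γ Z : Set (Cn m)) (k : Cn m → Cn m → ℂ) : Prop :=
  ∃ (V : Type) (_ : NormedAddCommGroup V) (_ : NormedSpace ℝ V) (P : Cn m → V)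
    (O : Set (V × Cn m)) (G : V × Cn m → ℂ), ContinuousOn P Γ ∧ IsOpen O ∧ ContDiffOn ℝ ∞ G O ∧
    ∀ ζ ∈ Γ, ∀ z ∈ Z, z ≠ ζ → (P ζ, z) ∈ O ∧ k ζ z = G (P ζ, z)

namespace IsSmoothKernel

variable {Γ Z : Set (Cn m)} {k k₁ k₂ : Cn m → Cn m → ℂ}

theorem congr (h : IsSmoothKernel Γ Z k) (hk : ∀ ζ ∈ Γ, ∀ z ∈ Z, z ≠ ζ → k₁ ζ z = k ζ z) :
    IsSmoothKernel Γ Z k₁ := by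
  obtain ⟨V, i1, i2, P, O, G, hP, hO, hG, h⟩ := h
  exact ⟨V, i1, i2, P, O, G, hP, hO, hG, fun ζ hζ z hz hne =>
    ⟨(h ζ hζ z hz hne).1, (hk ζ hζ z hz hne).trans (h ζ hζ z hz hne).2⟩⟩

theorem of_continuousOn {c : Cn m → ℂ} (hc : ContinuousOn c Γ) :
    IsSmoothKernel Γ Z (fun ζ _ => c ζ) :=
  ⟨ℂ, inferInstance, inferInstance, c, univ, Prod.fst, hc, isOpen_univ, contDiff_fst.contDiffOn,
    fun _ _ _ _ _ => ⟨mem_univ _, rfl⟩⟩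

protected theorem const (c : ℂ) : IsSmoothKernel Γ Z (fun _ _ => c) :=
  of_continuousOn continuousOn_const

theorem of_contDiffOn {G : Cn m × Cn m → ℂ} (hG : ContDiffOn ℝ ∞ G {q | q.1 ≠ q.2}) :
    IsSmoothKernel Γ Z (fun ζ z => G (ζ, z)) :=
  ⟨Cn m, inferInstance, inferInstance, id, {q | q.1 ≠ q.2}, G, continuousOn_id,
    isOpen_ne_fun continuous_fst continuous_snd, hG, fun _ _ _ _ hne => ⟨hne.symm, rfl⟩⟩

theorem of_sub {g : Cn m → ℂ} (hg : ContDiffOn ℝ ∞ g {t | t ≠ 0}) :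
    IsSmoothKernel Γ Z (fun ζ z => g (ζ - z)) :=
  of_contDiffOn (G := fun q => g (q.1 - q.2))
    (hg.comp (contDiff_fst.sub contDiff_snd).contDiffOn fun _ hq => sub_ne_zero.2 hq)

/-- Two kernels with different parameter maps are brought together over the product of the parameter
spaces; the algebraic operations then follow by choosing `F`. -/
theorem comp₂ {F : ℂ × ℂ → ℂ} (hF : ContDiff ℝ ∞ F) (h₁ : IsSmoothKernel Γ Z k₁)
    (h₂ : IsSmoothKernel Γ Z k₂) : IsSmoothKernel Γ Z (fun ζ z => F (k₁ ζ z, k₂ ζ z)) := by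
  obtain ⟨V₁, i1, i2, P₁, O₁, G₁, hP₁, hO₁, hG₁, h₁⟩ := h₁
  obtain ⟨V₂, j1, j2, P₂, O₂, G₂, hP₂, hO₂, hG₂, h₂⟩ := h₂
  set π₁ : (V₁ × V₂) × Cn m → V₁ × Cn m := fun q => (q.1.1, q.2) with hπ₁
  set π₂ : (V₁ × V₂) × Cn m → V₂ × Cn m := fun q => (q.1.2, q.2) with hπ₂
  have c₁ : ContDiff ℝ ∞ π₁ := (contDiff_fst.comp contDiff_fst).prodMk contDiff_snd
  have c₂ : ContDiff ℝ ∞ π₂ := (contDiff_snd.comp contDiff_fst).prodMk contDiff_snd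
  refine ⟨V₁ × V₂, inferInstance, inferInstance, fun ζ => (P₁ ζ, P₂ ζ), π₁ ⁻¹' O₁ ∩ π₂ ⁻¹' O₂,
    fun q => F (G₁ (π₁ q), G₂ (π₂ q)), hP₁.prodMk hP₂,
    (hO₁.preimage c₁.continuous).inter (hO₂.preimage c₂.continuous), ?_, ?_⟩
  · exact hF.comp_contDiffOn ((hG₁.comp c₁.contDiffOn fun q hq => hq.1).prodMk
      (hG₂.comp c₂.contDiffOn fun q hq => hq.2))
  · intro ζ hζ z hz hne
    obtain ⟨a1, a2⟩ := h₁ ζ hζ z hz hne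
    obtain ⟨b1, b2⟩ := h₂ ζ hζ z hz hne
    exact ⟨⟨a1, b1⟩, by simp only [a2, b2, hπ₁, hπ₂]⟩

protected theorem add (h₁ : IsSmoothKernel Γ Z k₁) (h₂ : IsSmoothKernel Γ Z k₂) :
    IsSmoothKernel Γ Z (fun ζ z => k₁ ζ z + k₂ ζ z) :=
  comp₂ (F := fun q => q.1 + q.2) (contDiff_fst.add contDiff_snd) h₁ h₂

protected theorem sub (h₁ : IsSmoothKernel Γ Z k₁) (h₂ : IsSmoothKernel Γ Z k₂) :
    IsSmoothKernel Γ Z (fun ζ z => k₁ ζ z - k₂ ζ z) :=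
  comp₂ (F := fun q => q.1 - q.2) (contDiff_fst.sub contDiff_snd) h₁ h₂

protected theorem mul (h₁ : IsSmoothKernel Γ Z k₁) (h₂ : IsSmoothKernel Γ Z k₂) :
    IsSmoothKernel Γ Z (fun ζ z => k₁ ζ z * k₂ ζ z) :=
  comp₂ (F := fun q => q.1 * q.2) (contDiff_fst.mul contDiff_snd) h₁ h₂

protected theorem sum {ι : Type*} (s : Finset ι) {k : ι → Cn m → Cn m → ℂ}
    (h : ∀ i ∈ s, IsSmoothKernel Γ Z (k i)) : IsSmoothKernel Γ Z (fun ζ z => ∑ i ∈ s, k i ζ z) := by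
  classical
  induction s using Finset.induction_on with
  | empty => simpa using IsSmoothKernel.const 0
  | insert a s ha ih =>
    simp only [Finset.sum_insert ha]
    exact (h a (by simp)).add (ih fun i hi => h i (Finset.mem_insert_of_mem hi))

protected theorem prod {ι : Type*} (s : Finset ι) {k : ι → Cn m → Cn m → ℂ}
    (h : ∀ i ∈ s, IsSmoothKernel Γ Z (k i)) : IsSmoothKernel Γ Z (fun ζ z => ∏ i ∈ s, k i ζ z) := by
  classical
  induction s using Finset.induction_on with
  | empty => simpa using IsSmoothKernel.const 1
  | insert a s ha ih =>
    simp only [Finset.prod_insert ha]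
    exact (h a (by simp)).mul (ih fun i hi => h i (Finset.mem_insert_of_mem hi))

protected theorem pow (h : IsSmoothKernel Γ Z k) (n : ℕ) :
    IsSmoothKernel Γ Z (fun ζ z => k ζ z ^ n) := by
  simpa using IsSmoothKernel.prod (Finset.range n) (fun _ _ => h)

protected theorem inv (h : IsSmoothKernel Γ Z k) (h0 : ∀ ζ ∈ Γ, ∀ z ∈ Z, z ≠ ζ → k ζ z ≠ 0) :
    IsSmoothKernel Γ Z (fun ζ z => (k ζ z)⁻¹) := by
  obtain ⟨V, i1, i2, P, O, G, hP, hO, hG, h⟩ := h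
  refine ⟨V, i1, i2, P, O ∩ G ⁻¹' {0}ᶜ, fun q => (G q)⁻¹, hP,
    hG.continuousOn.isOpen_inter_preimage hO isOpen_compl_singleton, ?_, ?_⟩
  · exact (hG.mono inter_subset_left).inv fun q hq => hq.2
  · intro ζ hζ z hz hne
    obtain ⟨a1, a2⟩ := h ζ hζ z hz hne
    exact ⟨⟨a1, by have := h0 ζ hζ z hz hne; rwa [a2] at this⟩, congrArg _ a2⟩

theorem topSum {ν α : Fin (2 * m + 2) → Cn m → Cn m → ℂ}
    {β : Fin (2 * m + 2) → Fin (2 * m + 2) → Cn m → Cn m → ℂ}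
    (hν : ∀ x, IsSmoothKernel Γ Z (ν x)) (hα : ∀ x, IsSmoothKernel Γ Z (α x))
    (hβ : ∀ x y, IsSmoothKernel Γ Z (β x y)) :
    IsSmoothKernel Γ Z (fun ζ z => CauchyFantappie.topSum (fun x => ν x ζ z) (fun x => α x ζ z)
      (fun _ x y => β x y ζ z)) := by
  unfold CauchyFantappie.topSum
  exact IsSmoothKernel.sum _ fun τ _ => (IsSmoothKernel.const _).mul
    (((hν _).mul (hα _)).mul (IsSmoothKernel.prod _ fun i _ => hβ _ _))

end IsSmoothKernel

/-! ### Integral operators with smooth kernels -/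

section Operator

variable {D : Set (Cn m)} {k : Cn m → Cn m → ℂ} {μ : Measure (Cn m)} {f : Cn m → ℂ}

theorem ne_of_mem_of_mem_frontier (hD : IsOpen D) {z ζ : Cn m} (hz : z ∈ D) (hζ : ζ ∈ frontier D) :
    z ≠ ζ := fun h => by
  rw [hD.frontier_eq] at hζ
  exact hζ.2 (h ▸ hz)

/-- Adjoining the values of f to the parameter map makes f(ζ) k(ζ, z) a parametric integrand of the
same type. For z in the open set D the diagonal is never met, so the theorems on parametric
integrals apply. -/
theorem IsSmoothKernel.integral_properties (hk : IsSmoothKernel (frontier D) (closure D) k)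
    (hD : IsOpen D) (hΓ : IsCompact (frontier D)) (hμ : μ (frontier D) ≠ ⊤)
    (hf : ContinuousOn f (frontier D)) :
    (∀ z ∈ D, IntegrableOn (fun ζ => f ζ * k ζ z) (frontier D) μ) ∧
    ContDiffOn ℝ ∞ (fun z => ∫ ζ in frontier D, f ζ * k ζ z ∂μ) D ∧
    ∀ z ∈ D, ∀ w, dbar (fun z => ∫ ζ in frontier D, f ζ * k ζ z ∂μ) z w =
      ∫ ζ in frontier D, f ζ * dbar (k ζ) z w ∂μ := by
  obtain ⟨V, i1, i2, P, O, G, hP, hO, hG, h⟩ := hk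
  set Γ := frontier D with hΓd
  have hm : MeasurableSet Γ := isClosed_frontier.measurableSet
  set π : (ℂ × V) × Cn m → V × Cn m := fun q => (q.1.2, q.2) with hπ
  have cπ : ContDiff ℝ ∞ π := (contDiff_snd.comp contDiff_fst).prodMk contDiff_snd
  set G' : (ℂ × V) × Cn m → ℂ := fun q => q.1.1 * G (π q) with hG'
  have hG's : ContDiffOn ℝ ∞ G' (π ⁻¹' O) :=
    (contDiff_fst.comp contDiff_fst).contDiffOn.mul (hG.comp cπ.contDiffOn fun q hq => hq)
  have hO' : IsOpen (π ⁻¹' O) := hO.preimage cπ.continuous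
  set P' : Cn m → ℂ × V := fun ζ => (f ζ, P ζ) with hP'
  have hP's : ContinuousOn P' Γ := hf.prodMk hP
  have hmem : ∀ ζ ∈ Γ, ∀ z ∈ D, (P' ζ, z) ∈ π ⁻¹' O := fun ζ hζ z hz =>
    (h ζ hζ z (subset_closure hz) (ne_of_mem_of_mem_frontier hD hz hζ)).1
  have heq : ∀ ζ ∈ Γ, ∀ z ∈ D, k ζ z = G (P ζ, z) := fun ζ hζ z hz =>
    (h ζ hζ z (subset_closure hz) (ne_of_mem_of_mem_frontier hD hz hζ)).2
  have hTeq : ∀ z ∈ D, ∫ ζ in Γ, f ζ * k ζ z ∂μ = ∫ ζ in Γ, G' (P' ζ, z) ∂μ := fun z hz =>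
    setIntegral_congr_fun hm fun ζ hζ => by simp only [hG', hπ, hP', heq ζ hζ z hz]
  refine ⟨fun z hz => ?_, ?_, fun z hz w => ?_⟩
  · refine IntegrableOn.congr_fun (f := fun ζ => G' (P' ζ, z)) ?_ (fun ζ hζ => by
      simp only [hG', hπ, hP', heq ζ hζ z hz]) hm
    exact (continuousOn_comp_param hP's hG's.continuousOn
      (fun x hx => hmem x hx z hz)).integrableOn_of_subset_isCompact hΓ hm subset_rfl hμ
  · exact (contDiffOn_setIntegral_param hΓ hμ hP's hO' hD hmem hG's).congr hTeq
  · have hd := hasFDerivAt_setIntegral_param hΓ hμ hP's hO' hG's hD hmem hz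
    have hd' : HasFDerivAt (fun z => ∫ ζ in Γ, f ζ * k ζ z ∂μ)
        (∫ x in Γ, partialSnd G' (P' x, z) ∂μ) z :=
      hd.congr_of_eventuallyEq (by filter_upwards [hD.mem_nhds hz] with z' hz' using hTeq z' hz')
    have hint : IntegrableOn (fun x => partialSnd G' (P' x, z)) Γ μ :=
      (continuousOn_comp_param hP's (contDiffOn_partialSnd hO' hG's).continuousOn
      (fun x hx => hmem x hx z hz)).integrableOn_of_subset_isCompact hΓ hm subset_rfl hμ
    rw [dbar_eq_conjPart, hd'.fderiv, conjPart, ContinuousLinearMap.integral_apply hint,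
      ContinuousLinearMap.integral_apply hint, ← integral_const_mul, ← integral_add
      (hint.apply_continuousLinearMap _) ((hint.apply_continuousLinearMap _).const_mul _),
      ← integral_const_mul]
    refine setIntegral_congr_fun hm fun ζ hζ => ?_
    have h1 := hasFDerivAt_partialSnd hO' hG's (hmem ζ hζ z hz)
    have h2 : HasFDerivAt (fun z => f ζ * k ζ z) (partialSnd G' (P' ζ, z)) z :=
      h1.congr_of_eventuallyEq (by
        filter_upwards [hD.mem_nhds hz] with z' hz'
        simp only [hG', hπ, hP', heq ζ hζ z' hz'])
    have h3 : DifferentiableAt ℝ (k ζ) z :=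
      (hasFDerivAt_partialSnd hO hG (hmem ζ hζ z hz)).differentiableAt.congr_of_eventuallyEq (by
        filter_upwards [hD.mem_nhds hz] with z' hz'
        exact heq ζ hζ z' hz')
    have h4 := ((HasDbarAt.of_differentiableAt h3).const_mul (f ζ)).dbar_eq w
    rw [dbar_eq_conjPart, h2.fderiv, conjPart] at h4
    exact h4

/-- Off the diagonal the `∂̄`-derivatives of the kernel are bounded. -/
theorem IsSmoothKernel.exists_dbar_bound (hk : IsSmoothKernel (frontier D) (closure D) k)
    (hD : IsOpen D) (hDb : Bornology.IsBounded D) {ρ : ℝ} (hρ : 0 < ρ) :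
    ∃ C : ℝ, 0 ≤ C ∧ ∀ ζ ∈ frontier D, ∀ z ∈ D, ρ ≤ ‖ζ - z‖ → ∀ w, ‖w‖ ≤ 1 →
      ‖dbar (k ζ) z w‖ ≤ C := by
  obtain ⟨V, i1, i2, P, O, G, hP, hO, hG, h⟩ := hk
  have hcl : IsCompact (closure D) :=
    Metric.isCompact_of_isClosed_isBounded isClosed_closure hDb.closure
  have hΓ : IsCompact (frontier D) := hcl.of_isClosed_subset isClosed_frontier
    frontier_subset_closure
  -- Compactness needs `closure D`; this is why kernels are required to be smooth off the diagonal
  -- up to the boundary.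
  have hT : IsCompact ((frontier D ×ˢ closure D) ∩ {q : Cn m × Cn m | ρ ≤ ‖q.1 - q.2‖}) :=
    (hΓ.prod hcl).inter_right (isClosed_le continuous_const (by fun_prop))
  have hne : ∀ q : Cn m × Cn m, ρ ≤ ‖q.1 - q.2‖ → q.2 ≠ q.1 := fun q hq h => by
    rw [h, sub_self, norm_zero] at hq; linarith
  obtain ⟨C, hC0, hC⟩ := exists_bound_param hP (contDiffOn_partialSnd hO hG).continuousOn hT
    (fun q hq => hq.1.1) (fun q hq => (h q.1 hq.1.1 q.2 hq.1.2 (hne q hq.2)).1)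
  refine ⟨C, hC0, fun ζ hζ z hz hρz w hw => ?_⟩
  have hb := hC (ζ, z) ⟨⟨hζ, subset_closure hz⟩, hρz⟩
  have h1 := hasFDerivAt_partialSnd hO hG
    (h ζ hζ z (subset_closure hz) (ne_of_mem_of_mem_frontier hD hz hζ)).1
  have h2 : HasFDerivAt (k ζ) (partialSnd G (P ζ, z)) z := h1.congr_of_eventuallyEq (by
    filter_upwards [hD.mem_nhds hz] with z' hz'
    exact (h ζ hζ z' (subset_closure hz') (ne_of_mem_of_mem_frontier hD hz' hζ)).2)
  rw [dbar_eq_conjPart, h2.fderiv, conjPart, norm_mul]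
  have h3 : ∀ w, ‖w‖ ≤ 1 → ‖partialSnd G (P ζ, z) w‖ ≤ C := fun w hw =>
    ((partialSnd G (P ζ, z)).le_opNorm w).trans (by
      calc _ ≤ C * 1 := by gcongr
        _ = C := mul_one C)
  have h4 := norm_add_le (partialSnd G (P ζ, z) w) (I * partialSnd G (P ζ, z) (I • w))
  rw [norm_mul, norm_I, one_mul] at h4
  have h5 := h3 w hw
  have h6 := h3 (I • w) (by rwa [norm_smul, norm_I, one_mul])
  have h7 : ‖(1 / 2 : ℂ)‖ = 1 / 2 := by norm_num
  rw [h7]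
  linarith

theorem norm_le_supNorm (hΓ : IsCompact (frontier D)) (hf : ContinuousOn f (frontier D)) {ζ : Cn m}
    (hζ : ζ ∈ frontier D) : ‖f ζ‖ ≤ supNorm D f :=
  le_csSup (hΓ.bddAbove_image hf.norm) (mem_image_of_mem _ hζ)

theorem supNorm_nonneg : 0 ≤ supNorm D f := by
  apply Real.sSup_nonneg
  rintro _ ⟨ζ, -, rfl⟩
  exact norm_nonneg _

theorem dbarNorm_le {g : Cn m → ℂ} {z : Cn m} {B : ℝ} (hB : 0 ≤ B)
    (h : ∀ w, ‖w‖ ≤ 1 → ‖dbar g z w‖ ≤ B) : dbarNorm g z ≤ (m + 1) * B := by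
  have h1 : ∀ k, ‖wirtBar k g z‖ ≤ B := fun k => by
    rw [wirtBar_eq_dbar]
    exact h _ (by simp)
  rw [dbarNorm]
  refine Real.sqrt_le_iff.2 ⟨by positivity, ?_⟩
  calc ∑ k, ‖wirtBar k g z‖ ^ 2 ≤ ∑ _k : Fin (m + 1), B ^ 2 :=
        Finset.sum_le_sum fun k _ => by gcongr; exact h1 k
    _ = (m + 1) * B ^ 2 := by simp
    _ ≤ ((m + 1) * B) ^ 2 := by
      have : (0 : ℝ) ≤ m := by positivity
      nlinarith [sq_nonneg B, mul_nonneg this (sq_nonneg B), mul_nonneg (mul_nonneg this this) (sq_nonneg B)]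

theorem norm_dbar_le_dbarNorm {g : Cn m → ℂ} {z w : Cn m} (hw : ‖w‖ ≤ 1) :
    ‖dbar g z w‖ ≤ dbarNorm g z := by
  have h1 : ‖dbar g z w‖ ≤ ∑ k, ‖wirtBar k g z‖ * ‖w k‖ := by
    rw [dbar]
    refine (norm_sum_le _ _).trans (le_of_eq ?_)
    simp
  have h2 := Real.sum_mul_le_sqrt_mul_sqrt Finset.univ (fun k => ‖wirtBar k g z‖) (fun k => ‖w k‖)
  rw [← EuclideanSpace.norm_eq] at h2
  refine h1.trans (h2.trans ?_)
  exact mul_le_of_le_one_right (Real.sqrt_nonneg _) hw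

/-- The estimate for the operator follows from an integral estimate of the kernel near the
diagonal. -/
theorem IsSmoothKernel.dbarEstimate (hk : IsSmoothKernel (frontier D) (closure D) k)
    (hD : IsOpen D) (hDb : Bornology.IsBounded D) (hne : (frontier D).Nonempty)
    (hμ : μ (frontier D) ≠ ⊤) {δ ρ C : ℝ}
    (hδ : δ < 1) (hρ : 0 < ρ) (hC : 0 ≤ C)
    (hnear : ∀ z ∈ D, Metric.infDist z (frontier D) < ρ → ∀ w, ‖w‖ ≤ 1 →
      ∫⁻ ζ in frontier D ∩ Metric.ball z ρ, ENNReal.ofReal ‖dbar (k ζ) z w‖ ∂μ ≤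
        ENNReal.ofReal (C * Metric.infDist z (frontier D) ^ (δ - 1))) :
    DbarEstimate D (fun f z => ∫ ζ in frontier D, f ζ * k ζ z ∂μ) δ := by
  have hΓ : IsCompact (frontier D) := (Metric.isCompact_of_isClosed_isBounded isClosed_closure
    hDb.closure).of_isClosed_subset isClosed_frontier frontier_subset_closure
  obtain ⟨C₁, hC₁, hfar⟩ := hk.exists_dbar_bound hD hDb hρ
  obtain ⟨ζ₀, hζ₀⟩ := hne
  obtain ⟨R, hR⟩ := hDb.subset_closedBall ζ₀
  have hd0 : ∀ z ∈ D, 0 < Metric.infDist z (frontier D) := fun z hz =>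
    (isClosed_frontier.notMem_iff_infDist_pos ⟨ζ₀, hζ₀⟩).1 fun h =>
      ne_of_mem_of_mem_frontier hD hz h rfl
  have hdR : ∀ z ∈ D, Metric.infDist z (frontier D) ≤ max R 1 := fun z hz =>
    (Metric.infDist_le_dist_of_mem hζ₀).trans ((Metric.mem_closedBall.1 (hR hz)).trans
      (le_max_left _ _))
  set M := μ.real (frontier D) with hM
  set C₂ := C₁ * M * (max R 1) ^ (1 - δ) with hC₂
  have hR1 : 0 < max R 1 := lt_of_lt_of_le one_pos (le_max_right _ _)
  have hM0 : 0 ≤ M := measureReal_nonneg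
  have hC₂0 : 0 ≤ C₂ := by positivity
  refine ⟨(m + 1) * (C + C₂), fun f hf z hz => ?_⟩
  set d := Metric.infDist z (frontier D) with hd
  have hdp : 0 < d := hd0 z hz
  have hN := supNorm_nonneg (D := D) (f := f)
  have hdpow : 0 ≤ d ^ (δ - 1) := Real.rpow_nonneg hdp.le _
  -- As δ < 1 and `d` is bounded on `D`, the power d^{δ-1} is bounded below, so the bounded far
  -- contribution fits under it.
  have hfarint : C₁ * M ≤ C₂ * d ^ (δ - 1) := by
    have e1 : (1 : ℝ) ≤ (max R 1) ^ (1 - δ) * d ^ (δ - 1) := by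
      have : d ^ (δ - 1) = (d ^ (1 - δ))⁻¹ := by rw [← Real.rpow_neg hdp.le]; ring_nf
      rw [this, ← div_eq_mul_inv, one_le_div (Real.rpow_pos_of_pos hdp _)]
      exact Real.rpow_le_rpow hdp.le (hdR z hz) (by linarith)
    calc C₁ * M = C₁ * M * 1 := by ring
      _ ≤ C₁ * M * ((max R 1) ^ (1 - δ) * d ^ (δ - 1)) := by gcongr
      _ = _ := by rw [hC₂]; ring
  have hmain : ∀ w, ‖w‖ ≤ 1 →
      ‖dbar (fun z => ∫ ζ in frontier D, f ζ * k ζ z ∂μ) z w‖ ≤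
        supNorm D f * ((C + C₂) * d ^ (δ - 1)) := by
    intro w hw
    rw [(hk.integral_properties hD hΓ hμ hf).2.2 z hz w]
    have hm : MeasurableSet (frontier D) := isClosed_frontier.measurableSet
    have hL : ∫⁻ ζ in frontier D, ENNReal.ofReal ‖dbar (k ζ) z w‖ ∂μ ≤
        ENNReal.ofReal ((C + C₂) * d ^ (δ - 1)) := by
      rw [← lintegral_inter_add_sdiff _ _ (Metric.isOpen_ball (x := z) (ε := ρ)).measurableSet]
      have g1 : ∫⁻ ζ in frontier D ∩ Metric.ball z ρ, ENNReal.ofReal ‖dbar (k ζ) z w‖ ∂μ ≤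
          ENNReal.ofReal (C * d ^ (δ - 1)) := by
        by_cases hdρ : d < ρ
        · exact hnear z hz hdρ w hw
        · have : frontier D ∩ Metric.ball z ρ = ∅ := by
            ext ζ
            simp only [mem_inter_iff, Metric.mem_ball, mem_empty_iff_false, iff_false, not_and,
              not_lt]
            intro hζ
            rw [dist_comm]
            exact (not_lt.1 hdρ).trans (Metric.infDist_le_dist_of_mem hζ)
          rw [this]; simp
      have g2 : ∫⁻ ζ in frontier D \ Metric.ball z ρ, ENNReal.ofReal ‖dbar (k ζ) z w‖ ∂μ ≤
          ENNReal.ofReal (C₂ * d ^ (δ - 1)) := by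
        calc _ ≤ ∫⁻ _ζ in frontier D \ Metric.ball z ρ, ENNReal.ofReal C₁ ∂μ := by
              refine setLIntegral_mono measurable_const fun ζ hζ => ?_
              refine ENNReal.ofReal_le_ofReal (hfar ζ hζ.1 z hz ?_ w hw)
              simpa [dist_eq_norm] using hζ.2
          _ = ENNReal.ofReal C₁ * μ (frontier D \ Metric.ball z ρ) := by simp
          _ ≤ ENNReal.ofReal C₁ * μ (frontier D) := by gcongr; exact sdiff_subset
          _ = ENNReal.ofReal (C₁ * M) := by
            rw [ENNReal.ofReal_mul hC₁, hM, Measure.real, ENNReal.ofReal_toReal hμ]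
          _ ≤ _ := ENNReal.ofReal_le_ofReal hfarint
      refine (add_le_add g1 g2).trans ?_
      rw [← ENNReal.ofReal_add (by positivity) (by positivity), add_mul]
    rw [← ENNReal.ofReal_le_ofReal_iff (by positivity), ofReal_norm]
    calc _ ≤ ∫⁻ ζ in frontier D, ‖f ζ * dbar (k ζ) z w‖ₑ ∂μ := enorm_integral_le_lintegral_enorm _
      _ ≤ ∫⁻ ζ in frontier D, ENNReal.ofReal (supNorm D f) * ENNReal.ofReal ‖dbar (k ζ) z w‖ ∂μ := by
        refine setLIntegral_mono' hm fun ζ hζ => ?_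
        rw [enorm_mul, ofReal_norm]
        gcongr
        rw [← ofReal_norm]
        exact ENNReal.ofReal_le_ofReal (norm_le_supNorm hΓ hf hζ)
      _ = ENNReal.ofReal (supNorm D f) * ∫⁻ ζ in frontier D, ENNReal.ofReal ‖dbar (k ζ) z w‖ ∂μ :=
        lintegral_const_mul' _ _ ENNReal.ofReal_ne_top
      _ ≤ ENNReal.ofReal (supNorm D f) * ENNReal.ofReal ((C + C₂) * d ^ (δ - 1)) := by gcongr
      _ = _ := (ENNReal.ofReal_mul hN).symm
  calc _ ≤ (m + 1) * (supNorm D f * ((C + C₂) * d ^ (δ - 1))) := dbarNorm_le (by positivity) hmain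
    _ = _ := by ring

end Operator

end CauchyFantappie

end

noncomputable section

namespace CauchyFantappie

open MeasureTheory Set Complex

variable {m : ℕ}

/-! ### Smoothness of the kernels -/

section Jets

variable {r : Cn m → ℝ} {ζ : Cn m}

theorem continuousAt_fderiv (h : ContDiffAt ℝ 3 r ζ) : ContinuousAt (fderiv ℝ r) ζ :=
  (contDiffAt_fderiv h).continuousAt

theorem continuousAt_fderiv_fderiv (h : ContDiffAt ℝ 3 r ζ) :
    ContinuousAt (fderiv ℝ (fderiv ℝ r)) ζ := (contDiffAt_fderiv_fderiv h).continuousAt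

theorem continuousAt_fderiv_fderiv_fderiv (h : ContDiffAt ℝ 3 r ζ) :
    ContinuousAt (fderiv ℝ (fderiv ℝ (fderiv ℝ r))) ζ :=
  ((contDiffAt_fderiv_fderiv h).fderiv_right (m := 0) (by norm_num)).continuousAt

theorem continuousAt_ofReal_clm {F : Type*} [TopologicalSpace F] {T : F → Cn m →L[ℝ] ℝ} {x : F}
    (hT : ContinuousAt T x) (v : Cn m) : ContinuousAt (fun y => ((T y v : ℝ) : ℂ)) x :=
  continuous_ofReal.continuousAt.comp (hT.clm_apply continuousAt_const)

theorem continuousAt_del {F : Type*} [TopologicalSpace F] {T : F → Cn m →L[ℝ] ℝ} {x : F}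
    (hT : ContinuousAt T x) (v : Cn m) : ContinuousAt (fun y => del (T y) v) x :=
  ((continuousAt_ofReal_clm hT v).sub ((continuousAt_ofReal_clm hT (I • v)).const_mul I)).const_mul _

theorem continuousAt_holPart {F : Type*} [TopologicalSpace F] {B : F → Cn m →L[ℝ] Cn m →L[ℝ] ℝ}
    {x : F} (hB : ContinuousAt B x) (u v : Cn m) : ContinuousAt (fun y => holPart (B y) u v) x := by
  have h : ∀ u v, ContinuousAt (fun y => ((B y u v : ℝ) : ℂ)) x := fun u v =>
    continuousAt_ofReal_clm (hB.clm_apply continuousAt_const) v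
  exact (((h u v).sub (h (I • u) (I • v))).sub
    (((h (I • u) v).add (h u (I • v))).const_mul I)).const_mul _

theorem continuousAt_hermPart {F : Type*} [TopologicalSpace F] {B : F → Cn m →L[ℝ] Cn m →L[ℝ] ℝ}
    {x : F} (hB : ContinuousAt B x) (u v : Cn m) : ContinuousAt (fun y => hermPart (B y) u v) x := by
  have h : ∀ u v, ContinuousAt (fun y => ((B y u v : ℝ) : ℂ)) x := fun u v =>
    continuousAt_ofReal_clm (hB.clm_apply continuousAt_const) v
  exact (((h u v).add (h (I • u) (I • v))).sub
    (((h (I • u) v).sub (h u (I • v))).const_mul I)).const_mul _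

theorem continuousAt_thirdPart (h : ContDiffAt ℝ 3 r ζ) (u v t : Cn m) : ContinuousAt
    (fun η => thirdPart (fderiv ℝ (fderiv ℝ (fderiv ℝ r)) η) u v t) ζ := by
  have h1 : ∀ u, ContinuousAt (fun η => fderiv ℝ (fderiv ℝ (fderiv ℝ r)) η u) ζ := fun u =>
    (continuousAt_fderiv_fderiv_fderiv h).clm_apply continuousAt_const
  exact ((continuousAt_holPart (h1 u) v t).add
    ((continuousAt_holPart (h1 (I • u)) v t).const_mul I)).const_mul _

theorem continuousAt_wirt (h : ContDiffAt ℝ 3 r ζ) (j : Fin (m + 1)) :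
    ContinuousAt (fun η => wirt j (cplx r) η) ζ :=
  (continuousAt_del (continuousAt_fderiv h) _).congr_of_eventuallyEq
    ((eventually_differentiableAt_of_contDiffAt h).mono fun _ hη => wirt_cplx hη j)

theorem continuousAt_wirt_wirt (h : ContDiffAt ℝ 3 r ζ) (j k : Fin (m + 1)) :
    ContinuousAt (fun η => wirt j (wirt k (cplx r)) η) ζ := by
  refine (continuousAt_holPart (continuousAt_fderiv_fderiv h) (EuclideanSpace.single j 1)
    (EuclideanSpace.single k 1)).congr_of_eventuallyEq ?_
  filter_upwards [(eventually_differentiableAt_of_contDiffAt h).eventually_nhds,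
    eventually_differentiableAt_fderiv h] with η h1 h2 using wirt_wirt_cplx h1 h2 j k

theorem continuousAt_conormal (h : ContDiffAt ℝ 3 r ζ) (h0 : fderiv ℝ r ζ ≠ 0) (v : Cn m) :
    ContinuousAt (fun η => (conormal r η v : ℂ)) ζ :=
  continuous_ofReal.continuousAt.comp (((continuousAt_fderiv h).clm_apply continuousAt_const).div
    (continuousAt_fderiv h).norm (norm_ne_zero_iff.2 h0))

theorem continuousAt_suppFun (h : ContDiffAt ℝ 3 r ζ) (K : ℝ) (z : Cn m) :
    ContinuousAt (fun η => suppFun r K η z) ζ := by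
  have hp : ∀ j : Fin (m + 1), ContinuousAt (fun η : Cn m => η j - z j) ζ := fun j => by fun_prop
  refine ((ContinuousAt.sub ?_ ?_).sub (continuous_ofReal.continuousAt.comp h.continuousAt)).add ?_
  · exact tendsto_finsetSum _ fun j _ => (continuousAt_wirt h j).mul (hp j)
  · exact (tendsto_finsetSum _ fun j _ => tendsto_finsetSum _ fun k _ =>
      ((continuousAt_wirt_wirt h j k).mul (hp j)).mul (hp k)).const_mul _
  · fun_prop

end Jets

/-- The decomposition of Φ_K + r(ζ) along ζ - z; the cubic term splits because |ζ - z|² is the sum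
of conj(ζ_j - z_j)(ζ_j - z_j). It transfers regularity from g to Φ_K. -/
theorem sum_gCoeff_mul (r : Cn m → ℝ) (K : ℝ) (ζ z : Cn m) :
    suppFun r K ζ z = ∑ j, gCoeff r K ζ z j * (ζ j - z j) - (r ζ : ℂ) := by
  have h1 : (((K * ‖ζ - z‖ ^ 3 : ℝ)) : ℂ) = ∑ j, ((K * ‖ζ - z‖ : ℝ) : ℂ) *
      (starRingEnd ℂ) (ζ j - z j) * (ζ j - z j) := by
    have h2 : ((‖ζ - z‖ ^ 2 : ℝ) : ℂ) = ∑ j, (starRingEnd ℂ) (ζ j - z j) * (ζ j - z j) := by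
      rw [EuclideanSpace.norm_sq_eq, ofReal_sum]
      refine Finset.sum_congr rfl fun j _ => ?_
      rw [Complex.conj_mul', ofReal_pow]
      rfl
    simp only [mul_assoc]
    rw [← Finset.mul_sum, ← h2]
    push_cast
    ring
  rw [suppFun, h1, leviPoly]
  simp only [gCoeff, add_mul, sub_mul, Finset.sum_add_distrib, Finset.sum_sub_distrib]
  have h3 : (1 / 2 : ℂ) * ∑ j, ∑ k, wirt j (wirt k (cplx r)) ζ * (ζ j - z j) * (ζ k - z k) =
      ∑ j, (1 / 2) * (∑ k, wirt j (wirt k (cplx r)) ζ * (ζ k - z k)) * (ζ j - z j) := by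
    rw [Finset.mul_sum]
    refine Finset.sum_congr rfl fun j _ => ?_
    rw [Finset.mul_sum, Finset.mul_sum, Finset.sum_mul]
    exact Finset.sum_congr rfl fun k _ => by ring
  rw [h3]
  ring

theorem differentiableAt_suppFun {r : Cn m → ℝ} {ζ : Cn m} (h : ContDiffAt ℝ 3 r ζ) (K : ℝ)
    {z : Cn m} (hz : ζ ≠ z) : DifferentiableAt ℝ (fun η => suppFun r K η z) ζ := by
  simp only [sum_gCoeff_mul]
  refine DifferentiableAt.sub (DifferentiableAt.fun_sum fun j _ =>
    (differentiableAt_gCoeff h K hz j).mul ?_) ?_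
  · exact ((EuclideanSpace.proj (𝕜 := ℂ) j).restrictScalars ℝ).differentiableAt.sub_const _
  · exact ofRealCLM.differentiableAt.comp ζ (h.differentiableAt (by simp))

/-- `∂̄_ζ s_j(u)`. -/
def sDbar (r : Cn m → ℝ) (K : ℝ) (χ : ℝ → ℝ) (ζ z : Cn m) (j : Fin (m + 1)) (u : Cn m) : ℂ :=
  ((deriv χ ‖ζ - z‖ : ℝ) : ℂ) * (inner ℂ u (ζ - z) / (2 * ‖ζ - z‖)) * gCoeff r K ζ z j
    + (χ ‖ζ - z‖ : ℂ) * gDbar r K ζ z u (EuclideanSpace.single j 1)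
    + ((0 - ((deriv χ ‖ζ - z‖ : ℝ) : ℂ) * (inner ℂ u (ζ - z) / (2 * ‖ζ - z‖))) *
      (starRingEnd ℂ) (ζ j - z j) + (1 - (χ ‖ζ - z‖ : ℂ)) * (starRingEnd ℂ) (u j))

theorem conj_eq_inner_single (v : Cn m) (j : Fin (m + 1)) :
    (starRingEnd ℂ) (v j) = inner ℂ v (EuclideanSpace.single j 1) := by
  rw [EuclideanSpace.inner_single_right, one_mul]

theorem hasDbarAt_cutoff {χ : ℝ → ℝ} (hχ : ContDiff ℝ ∞ χ) {ζ z : Cn m} (hz : ζ ≠ z) :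
    HasDbarAt (fun η => (χ ‖η - z‖ : ℂ))
      (fun u => ((deriv χ ‖ζ - z‖ : ℝ) : ℂ) * (inner ℂ u (ζ - z) / (2 * ‖ζ - z‖))) ζ :=
  (HasDbarAt.norm_sub_right hz).of_real_comp
    ((hχ.differentiable (by simp)).differentiableAt.hasDerivAt)

theorem hasDbarAt_smallS {r : Cn m → ℝ} {ζ : Cn m} (h : ContDiffAt ℝ 3 r ζ) (K : ℝ) {χ : ℝ → ℝ}
    (hχ : ContDiff ℝ ∞ χ) {z : Cn m} (hz : ζ ≠ z) (j : Fin (m + 1)) :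
    HasDbarAt (fun η => smallS r K χ η z j) (sDbar r K χ ζ z j) ζ := by
  have h1 := hasDbarAt_cutoff hχ hz
  have h2 := hasDbarAt_oneForm_gCoeff h K hz (EuclideanSpace.single j 1)
  simp only [oneForm_single] at h2
  have h3 : HasDbarAt (fun η : Cn m => (starRingEnd ℂ) (η j - z j))
      (fun u => (starRingEnd ℂ) (u j)) ζ := by
    have := HasDbarAt.inner_sub_right (z := ζ) z (EuclideanSpace.single j (1 : ℂ))
    simp only [← conj_eq_inner_single] at this
    exact this
  exact (h1.mul h2).add (((HasDbarAt.const 1).sub h1).mul h3)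

theorem differentiableAt_bigS {r : Cn m → ℝ} {ζ : Cn m} (h : ContDiffAt ℝ 3 r ζ) (K : ℝ)
    {χ : ℝ → ℝ} (hχ : ContDiff ℝ ∞ χ) {z : Cn m} (hz : ζ ≠ z) :
    DifferentiableAt ℝ (fun η => bigS r K χ η z) ζ := by
  have h1 := (hasDbarAt_cutoff hχ hz).differentiableAt
  have h2 := (HasDbarAt.norm_sub_right hz).differentiableAt
  exact (h1.mul (differentiableAt_suppFun h K hz)).add
    (((differentiableAt_const 1).sub h1).mul (h2.pow 2))

/-- The coefficient of the Cauchy–Fantappiè kernel with respect to surface measure. -/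
def cfKernel (φ : Cn m → ℝ) (w : Cn m → Cn m → Fin (m + 1) → ℂ) (ζ z : Cn m) : ℂ :=
  boundaryDensity φ ζ (omegaZero (fun η => w η z) ζ)

/-- The numerical factor in the Cauchy–Fantappiè kernel. -/
def cfFactor (m : ℕ) : ℂ := (1 / (2 * Real.pi * I) ^ (m + 1)) * (1 / 2 ^ m)

/-- Valid with the cut-off present, hence off the whole diagonal. The ζ-derivatives have been
carried out, leaving an algebraic expression whose dependence on z is visibly smooth. -/
theorem cfKernel_genW (φ : Cn m → ℝ) {r : Cn m → ℝ} {ζ : Cn m} (h : ContDiffAt ℝ 3 r ζ) (K : ℝ)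
    {χ : ℝ → ℝ} (hχ : ContDiff ℝ ∞ χ) {z : Cn m} (hz : ζ ≠ z) (h0 : bigS r K χ ζ z ≠ 0) :
    cfKernel φ (genW r K χ) ζ z = cfFactor m * ((bigS r K χ ζ z)⁻¹ ^ (m + 1) *
      topSum (fun x => (conormal φ ζ (realBasis x) : ℂ))
        (fun x => ∑ j, smallS r K χ ζ z j * (realBasis x : Cn m) j)
        (fun _ x y => ∑ j, (sDbar r K χ ζ z j (realBasis x) * (realBasis y : Cn m) j
          - sDbar r K χ ζ z j (realBasis y) * (realBasis x : Cn m) j))) := by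
  rw [cfKernel, boundaryDensity_omegaZero_div φ (w := fun η => genW r K χ η z)
    (s := fun η => smallS r K χ η z) (S := fun η => bigS r K χ η z)
    (Filter.Eventually.of_forall fun η j => rfl)
    (fun j => (hasDbarAt_smallS h K hχ hz j).differentiableAt) (differentiableAt_bigS h K hχ hz) h0]
  simp only [dbarForm, oneForm, fun j u => (hasDbarAt_smallS h K hχ hz j).dbar_eq u]
  rfl

section Smooth

variable {Γ Z : Set (Cn m)}

theorem isSmoothKernel_coord (j : Fin (m + 1)) : IsSmoothKernel Γ Z (fun ζ z => ζ j - z j) :=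
  IsSmoothKernel.of_sub (g := fun t => t j)
    ((EuclideanSpace.proj (𝕜 := ℂ) j).restrictScalars ℝ).contDiff.contDiffOn

theorem isSmoothKernel_inner_left (v : Cn m) :
    IsSmoothKernel Γ Z (fun ζ z => inner ℂ (ζ - z) v) :=
  IsSmoothKernel.of_sub (g := fun t => inner ℂ t v)
    (contDiff_id.inner ℂ contDiff_const).contDiffOn

theorem isSmoothKernel_inner_right (v : Cn m) :
    IsSmoothKernel Γ Z (fun ζ z => inner ℂ v (ζ - z)) :=
  IsSmoothKernel.of_sub (g := fun t => inner ℂ v t)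
    (contDiff_const.inner ℂ contDiff_id).contDiffOn

theorem isSmoothKernel_conj_coord (j : Fin (m + 1)) :
    IsSmoothKernel Γ Z (fun ζ z => (starRingEnd ℂ) (ζ j - z j)) := by
  refine (isSmoothKernel_inner_left (EuclideanSpace.single j 1)).congr fun ζ _ z _ _ => ?_
  rw [← conj_eq_inner_single]; rfl

theorem isSmoothKernel_radial {g : ℝ → ℝ} (hg : ContDiff ℝ ∞ g) :
    IsSmoothKernel Γ Z (fun ζ z => (g ‖ζ - z‖ : ℂ)) := by
  refine IsSmoothKernel.of_sub (g := fun t => (g ‖t‖ : ℂ)) ?_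
  refine ofRealCLM.contDiff.comp_contDiffOn (hg.comp_contDiffOn fun t ht => ?_)
  exact (contDiffAt_norm ℂ ht).contDiffWithinAt.restrict_scalars ℝ

variable {r : Cn m → ℝ}

theorem isSmoothKernel_of_continuousAt {c : Cn m → ℂ} (h : ∀ ζ ∈ Γ, ContinuousAt c ζ) :
    IsSmoothKernel Γ Z (fun ζ _ => c ζ) :=
  IsSmoothKernel.of_continuousOn fun ζ hζ => (h ζ hζ).continuousWithinAt

theorem isSmoothKernel_norm : IsSmoothKernel Γ Z (fun ζ z => (‖ζ - z‖ : ℂ)) :=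
  isSmoothKernel_radial contDiff_id

theorem isSmoothKernel_gCoeff (h : ∀ ζ ∈ Γ, ContDiffAt ℝ 3 r ζ) (K : ℝ) (j : Fin (m + 1)) :
    IsSmoothKernel Γ Z (fun ζ z => gCoeff r K ζ z j) := by
  refine IsSmoothKernel.add (IsSmoothKernel.sub ?_ (IsSmoothKernel.mul (.const _)
    (IsSmoothKernel.sum _ fun k _ => IsSmoothKernel.mul ?_ (isSmoothKernel_coord k))))
    (IsSmoothKernel.mul ?_ (isSmoothKernel_conj_coord j))
  · exact isSmoothKernel_of_continuousAt fun ζ hζ => continuousAt_wirt (h ζ hζ) j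
  · exact isSmoothKernel_of_continuousAt fun ζ hζ => continuousAt_wirt_wirt (h ζ hζ) j k
  · exact isSmoothKernel_radial (g := fun t => K * t) (contDiff_const.mul contDiff_id)

theorem isSmoothKernel_suppFun (h : ∀ ζ ∈ Γ, ContDiffAt ℝ 3 r ζ) (K : ℝ) :
    IsSmoothKernel Γ Z (fun ζ z => suppFun r K ζ z) := by
  simp only [sum_gCoeff_mul]
  exact (IsSmoothKernel.sum _ fun j _ => (isSmoothKernel_gCoeff h K j).mul
    (isSmoothKernel_coord j)).sub (isSmoothKernel_of_continuousAt fun ζ hζ =>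
      continuous_ofReal.continuousAt.comp (h ζ hζ).continuousAt)

theorem norm_sub_ofReal_ne_zero {ζ z : Cn m} (h : z ≠ ζ) : (‖ζ - z‖ : ℂ) ≠ 0 :=
  ofReal_ne_zero.2 (norm_ne_zero_iff.2 (sub_ne_zero.2 h.symm))

/-- The variable ζ enters through ζ - z and through derivatives of r up to order three, which are
continuous and no better. This is why only continuity in ζ is built into `IsSmoothKernel`. -/
theorem isSmoothKernel_gDbar (h : ∀ ζ ∈ Γ, ContDiffAt ℝ 3 r ζ) (K : ℝ) (u v : Cn m) :
    IsSmoothKernel Γ Z (fun ζ z => gDbar r K ζ z u v) := by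
  refine IsSmoothKernel.add (IsSmoothKernel.sub ?_ (IsSmoothKernel.mul (.const _) ?_))
    (IsSmoothKernel.mul (.const _) (IsSmoothKernel.add (isSmoothKernel_norm.mul (.const _)) ?_))
  · exact isSmoothKernel_of_continuousAt fun ζ hζ =>
      continuousAt_hermPart (continuousAt_fderiv_fderiv (h ζ hζ)) v u
  · simp only [← thirdLM_apply]
    simp only [fun ζ z => linearMap_eq_sum (thirdLM (fderiv ℝ (fderiv ℝ (fderiv ℝ r)) ζ) u v) (ζ - z)]
    refine IsSmoothKernel.sum _ fun k _ => IsSmoothKernel.mul ?_ (isSmoothKernel_coord k)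
    exact isSmoothKernel_of_continuousAt fun ζ hζ => continuousAt_thirdPart (h ζ hζ) u v _
  · simp only [div_eq_mul_inv]
    exact ((isSmoothKernel_inner_right u).mul (isSmoothKernel_inner_left v)).mul
      (((IsSmoothKernel.const 2).mul isSmoothKernel_norm).inv fun ζ _ z _ hne =>
        mul_ne_zero two_ne_zero (norm_sub_ofReal_ne_zero hne))

variable {χ : ℝ → ℝ}

theorem isSmoothKernel_smallS (h : ∀ ζ ∈ Γ, ContDiffAt ℝ 3 r ζ) (K : ℝ) (hχ : ContDiff ℝ ∞ χ)
    (j : Fin (m + 1)) : IsSmoothKernel Γ Z (fun ζ z => smallS r K χ ζ z j) :=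
  ((isSmoothKernel_radial hχ).mul (isSmoothKernel_gCoeff h K j)).add
    (((IsSmoothKernel.const 1).sub (isSmoothKernel_radial hχ)).mul (isSmoothKernel_conj_coord j))

theorem isSmoothKernel_bigS (h : ∀ ζ ∈ Γ, ContDiffAt ℝ 3 r ζ) (K : ℝ) (hχ : ContDiff ℝ ∞ χ) :
    IsSmoothKernel Γ Z (fun ζ z => bigS r K χ ζ z) :=
  ((isSmoothKernel_radial hχ).mul (isSmoothKernel_suppFun h K)).add
    (((IsSmoothKernel.const 1).sub (isSmoothKernel_radial hχ)).mul (isSmoothKernel_norm.pow 2))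

theorem isSmoothKernel_sDbar (h : ∀ ζ ∈ Γ, ContDiffAt ℝ 3 r ζ) (K : ℝ) (hχ : ContDiff ℝ ∞ χ)
    (j : Fin (m + 1)) (u : Cn m) : IsSmoothKernel Γ Z (fun ζ z => sDbar r K χ ζ z j u) := by
  have hχ' : ContDiff ℝ ∞ (deriv χ) := (contDiff_infty_iff_deriv.1 hχ).2
  have h1 : IsSmoothKernel Γ Z (fun ζ z => ((deriv χ ‖ζ - z‖ : ℝ) : ℂ) *
      (inner ℂ u (ζ - z) / (2 * ‖ζ - z‖))) := by
    simp only [div_eq_mul_inv]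
    exact (isSmoothKernel_radial hχ').mul ((isSmoothKernel_inner_right u).mul
      (((IsSmoothKernel.const 2).mul isSmoothKernel_norm).inv fun ζ _ z _ hne =>
        mul_ne_zero two_ne_zero (norm_sub_ofReal_ne_zero hne)))
  exact ((h1.mul (isSmoothKernel_gCoeff h K j)).add ((isSmoothKernel_radial hχ).mul
    (isSmoothKernel_gDbar h K u _))).add ((((IsSmoothKernel.const 0).sub h1).mul
    (isSmoothKernel_conj_coord j)).add (((IsSmoothKernel.const 1).sub (isSmoothKernel_radial hχ)).mul
    (.const _)))

theorem isSmoothKernel_genW {φ : Cn m → ℝ} (hφ : ∀ ζ ∈ Γ, ContDiffAt ℝ 3 φ ζ)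
    (hφ0 : ∀ ζ ∈ Γ, fderiv ℝ φ ζ ≠ 0) (h : ∀ ζ ∈ Γ, ContDiffAt ℝ 3 r ζ) (K : ℝ)
    (hχ : ContDiff ℝ ∞ χ) (h0 : ∀ ζ ∈ Γ, ∀ z ∈ Z, z ≠ ζ → bigS r K χ ζ z ≠ 0) :
    IsSmoothKernel Γ Z (cfKernel φ (genW r K χ)) := by
  refine IsSmoothKernel.congr ?_ fun ζ hζ z hz hne =>
    cfKernel_genW φ (h ζ hζ) K hχ hne.symm (h0 ζ hζ z hz hne)
  refine (IsSmoothKernel.const _).mul ((((isSmoothKernel_bigS h K hχ).inv h0).pow _).mul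
    (IsSmoothKernel.topSum (fun x => ?_) (fun x => ?_) (fun x y => ?_)))
  · exact isSmoothKernel_of_continuousAt fun ζ hζ => continuousAt_conormal (hφ ζ hζ) (hφ0 ζ hζ) _
  · exact IsSmoothKernel.sum _ fun j _ => (isSmoothKernel_smallS h K hχ j).mul (.const _)
  · exact IsSmoothKernel.sum _ fun j _ => ((isSmoothKernel_sDbar h K hχ j _).mul (.const _)).sub
      ((isSmoothKernel_sDbar h K hχ j _).mul (.const _))

end Smooth

/-! ### The Bochner–Martinelli kernel -/

theorem norm_sub_sq_differentiableAt (ζ z : Cn m) :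
    DifferentiableAt ℝ (fun η : Cn m => (‖η - z‖ : ℂ) ^ 2) ζ := by
  have h := (HasDbarAt.norm_sub_sq (z := ζ) z).differentiableAt
  simp only [norm_sub_rev z, ofReal_pow] at h
  exact h

/-- The real basis `∂/∂x_j, ∂/∂y_j` is the one adapted to the standard unitary basis. -/
theorem realBasis_eq : (realBasis : Fin (2 * m + 2) → Cn m) =
    adaptedBasis (EuclideanSpace.basisFun (Fin (m + 1)) ℂ) := by
  funext x
  obtain ⟨⟨j, b⟩, rfl⟩ := (pairEquiv m).surjective x
  rw [adaptedBasis_pairEquiv, EuclideanSpace.basisFun_apply, realBasis]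
  have hj : (⟨(pairEquiv m (j, b) : ℕ) / 2, by omega⟩ : Fin (m + 1)) = j := by
    apply Fin.ext
    simp only [pairEquiv_val]
    omega
  rw [hj, pairEquiv_val]
  fin_cases b
  · simp
  · simp [← single_I_eq, Nat.add_mod]

theorem det_adaptedBasis_ne_zero (e : OrthonormalBasis (Fin (m + 1)) ℂ (Cn m)) :
    (adaptedBasis e).det realBasis ≠ 0 := by
  rw [realBasis_eq]
  exact ((adaptedBasis e).isUnit_det _).ne_zero

/-- The numerator of the Bochner–Martinelli kernel, for a conormal `ν`. -/
def bmTop (e : OrthonormalBasis (Fin (m + 1)) ℂ (Cn m)) (ν : Cn m →L[ℝ] ℝ) (t : Cn m) : ℂ :=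
  topSum (fun x => (ν (adaptedBasis e x) : ℂ)) (fun x => inner ℂ t (adaptedBasis e x))
    (fun _ x y => inner ℂ (adaptedBasis e x) (adaptedBasis e y)
      - inner ℂ (adaptedBasis e y) (adaptedBasis e x))

/-- The conormal as a continuous linear form. -/
def conormalCLM (φ : Cn m → ℝ) (ζ : Cn m) : Cn m →L[ℝ] ℝ := ‖fderiv ℝ φ ζ‖⁻¹ • fderiv ℝ φ ζ

theorem conormalCLM_apply (φ : Cn m → ℝ) (ζ v : Cn m) : conormalCLM φ ζ v = conormal φ ζ v := by
  simp [conormalCLM, conormal, div_eq_inv_mul]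

/-- The unitary basis is arbitrary: the standard one serves for smoothness in z, one adapted to the
boundary for the estimates and for sharpness. -/
theorem cfKernel_genBM (φ : Cn m → ℝ) {ζ z : Cn m} (hz : ζ ≠ z)
    (e : OrthonormalBasis (Fin (m + 1)) ℂ (Cn m)) :
    cfKernel φ genBM ζ z = cfFactor m * ((adaptedBasis e).det realBasis : ℂ) *
      (((‖ζ - z‖ : ℂ) ^ 2)⁻¹ ^ (m + 1) * bmTop e (conormalCLM φ ζ) (ζ - z)) := by
  have h3 : ∀ j, HasDbarAt (fun η : Cn m => (starRingEnd ℂ) (η j - z j))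
      (fun u => (starRingEnd ℂ) (u j)) ζ := fun j => by
    have := HasDbarAt.inner_sub_right (z := ζ) z (EuclideanSpace.single j (1 : ℂ))
    simp only [← conj_eq_inner_single] at this
    exact this
  have hd : ∀ u v, dbarForm (fun (η : Cn m) j => (starRingEnd ℂ) (η j - z j)) ζ u v =
      inner ℂ u v - inner ℂ v u := fun u v => by
    simp only [dbarForm, fun j u => (h3 j).dbar_eq u, PiLp.inner_apply, RCLike.inner_apply,
      Finset.sum_sub_distrib, mul_comm]
  have ho : ∀ v, oneForm (fun j => (starRingEnd ℂ) (ζ j - z j)) v = inner ℂ (ζ - z) v := fun v => by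
    simp only [oneForm, PiLp.inner_apply, RCLike.inner_apply, PiLp.sub_apply, mul_comm]
  rw [cfKernel, boundaryDensity_omegaZero_div φ (w := fun η => genBM η z)
    (s := fun η j => (starRingEnd ℂ) (η j - z j)) (S := fun η => (‖η - z‖ : ℂ) ^ 2)
    (Filter.Eventually.of_forall fun η j => rfl) (fun j => (h3 j).differentiableAt)
    (norm_sub_sq_differentiableAt ζ z) (pow_ne_zero 2 (norm_sub_ofReal_ne_zero hz.symm)),
    topSum_cf_eq_det_mul φ (fun (η : Cn m) j => (starRingEnd ℂ) (η j - z j)) ζ (adaptedBasis e)]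
  simp only [hd, ho]
  rw [bmTop, cfFactor]
  simp only [conormalCLM_apply]
  ring

theorem isSmoothKernel_genBM {Γ Z : Set (Cn m)} {φ : Cn m → ℝ} (hφ : ∀ ζ ∈ Γ, ContDiffAt ℝ 3 φ ζ)
    (hφ0 : ∀ ζ ∈ Γ, fderiv ℝ φ ζ ≠ 0) : IsSmoothKernel Γ Z (cfKernel φ genBM) := by
  refine IsSmoothKernel.congr ?_ fun ζ hζ z hz hne => cfKernel_genBM φ hne.symm
    (EuclideanSpace.basisFun (Fin (m + 1)) ℂ)
  refine (IsSmoothKernel.const _).mul ((((isSmoothKernel_norm.pow 2).inv fun ζ _ z _ hne =>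
    pow_ne_zero 2 (norm_sub_ofReal_ne_zero hne)).pow _).mul
    (IsSmoothKernel.topSum (fun x => ?_) (fun x => isSmoothKernel_inner_left _) (fun x y => .const _)))
  simp only [conormalCLM_apply]
  exact isSmoothKernel_of_continuousAt fun ζ hζ => continuousAt_conormal (hφ ζ hζ) (hφ0 ζ hζ) _

/-! ### The kernel near the diagonal -/

/-- The strict inequality |ζ - z| < ε/2 makes the cut-off equal to 1 for all nearby ζ as well, so it
disappears before ∂̄_ζ is taken. -/
theorem cfKernel_genW_near (φ : Cn m → ℝ) {r : Cn m → ℝ} {ζ : Cn m} (h : ContDiffAt ℝ 3 r ζ)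
    (hν : ∀ v, conormal φ ζ v = conormal r ζ v) (K : ℝ) {χ : ℝ → ℝ} {ε : ℝ} (hχ : IsCutoff ε χ)
    {z : Cn m} (hz : ζ ≠ z) (hτ : ‖ζ - z‖ < ε / 2) (h0 : suppFun r K ζ z ≠ 0)
    (e : OrthonormalBasis (Fin (m + 1)) ℂ (Cn m)) :
    cfKernel φ (genW r K χ) ζ z = cfFactor m * ((adaptedBasis e).det realBasis : ℂ) *
      ((suppFun r K ζ z)⁻¹ ^ (m + 1) * nearTop r K e ζ z) := by
  have hev : ∀ᶠ η in nhds ζ, ∀ j, genW r K χ η z j = gCoeff r K η z j / suppFun r K η z := by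
    have : ∀ᶠ η in nhds ζ, ‖η - z‖ < ε / 2 :=
      (continuous_id.sub continuous_const).norm.continuousAt.eventually_lt continuousAt_const hτ
    filter_upwards [this] with η hη j
    simp [genW, smallS, bigS, hχ.eq_one _ hη.le]
  rw [cfKernel, boundaryDensity_omegaZero_div φ (w := fun η => genW r K χ η z)
    (s := fun η => gCoeff r K η z) (S := fun η => suppFun r K η z) hev
    (differentiableAt_gCoeff h K hz) (differentiableAt_suppFun h K hz) h0,
    topSum_cf_eq_det_mul φ (fun η => gCoeff r K η z) ζ (adaptedBasis e)]
  simp only [dbarForm_gCoeff h K hz, hν]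
  rw [nearTop, cfFactor]
  ring

end CauchyFantappie

end

noncomputable section

namespace CauchyFantappie

open MeasureTheory Set Complex

variable {m : ℕ}

/-! ### Integral estimates on the boundary -/

/-- A radius below which all local estimates hold. -/
structure IsGoodRadius (ρ A c K ρ' : ℝ) : Prop where
  pos : 0 < ρ'
  le_rho : ρ' ≤ ρ
  le_one : ρ' ≤ 1
  mul_le_one : K * ρ' ≤ 1
  mul_le : 80 * A * ρ' ≤ c

theorem exists_isGoodRadius {ρ A c K b : ℝ} (hρ : 0 < ρ) (hA : 1 ≤ A) (hc : 0 < c) (hK : 0 < K)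
    (hb : 0 < b) : ∃ ρ' ≤ b, IsGoodRadius ρ A c K ρ' := by
  have hA0 : 0 < A := by linarith
  refine ⟨min b (min ρ (min 1 (min (1 / K) (c / (80 * A))))), min_le_left _ _, ?_⟩
  have e1 := min_le_right b (min ρ (min 1 (min (1 / K) (c / (80 * A)))))
  have e2 := e1.trans (min_le_right _ _)
  have e3 := e2.trans (min_le_right _ _)
  refine ⟨by positivity, e1.trans (min_le_left _ _), e2.trans (min_le_left _ _), ?_, ?_⟩
  · have := e3.trans (min_le_left _ _)
    rwa [le_div_iff₀ hK, mul_comm] at this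
  · have := e3.trans (min_le_right _ _)
    rwa [le_div_iff₀ (by positivity), mul_comm] at this

/-- A bounded domain with a pseudoconvex defining function, and uniform bounds for the latter. -/
structure PscData (D U : Set (Cn m)) (r : Cn m → ℝ) (ρ A c : ℝ) : Prop where
  isOpen : IsOpen D
  nonempty : D.Nonempty
  isBounded : Bornology.IsBounded D
  isDef : IsDefiningFunction 3 D U r
  psc : IsLeviPseudoconvex D r
  bounds : UniformBounds r (frontier D) ρ A c
  ball_subset : ∀ p ∈ frontier D, Metric.ball p ρ ⊆ U

namespace PscData

variable {D U : Set (Cn m)} {r : Cn m → ℝ} {ρ A c K ρ' : ℝ}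

theorem isCompact_frontier (h : PscData D U r ρ A c) : IsCompact (frontier D) :=
  (Metric.isCompact_of_isClosed_isBounded isClosed_closure
    h.isBounded.closure).of_isClosed_subset isClosed_frontier frontier_subset_closure

theorem frontier_nonempty (h : PscData D U r ρ A c) : (frontier D).Nonempty := by
  obtain ⟨z, hz⟩ := h.nonempty
  obtain ⟨w, hw⟩ : ∃ w, w ∉ D := by
    by_contra! hcon
    have : D = univ := eq_univ_of_forall hcon
    exact NormedSpace.unbounded_univ ℝ (Cn m) (this ▸ h.isBounded)
  obtain ⟨x, -, hx⟩ := exists_mem_segment_frontier hz hw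
  exact ⟨x, hx⟩

theorem eq_zero (h : PscData D U r ρ A c) {ζ : Cn m} (hζ : ζ ∈ frontier D) : r ζ = 0 :=
  h.isDef.eq_zero_of_mem_frontier h.isOpen hζ

theorem contDiffAt (h : PscData D U r ρ A c) {ζ : Cn m} (hζ : ζ ∈ frontier D) :
    ContDiffAt ℝ 3 r ζ :=
  h.bounds.contDiffAt ζ hζ ζ (Metric.mem_ball_self h.bounds.rho_pos)

theorem continuousOn_coordMap (h : PscData D U r ρ A c) (K : ℝ)
    (e : OrthonormalBasis (Fin (m + 1)) ℂ (Cn m)) (z : Cn m) :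
    ContinuousOn (coordMap r K e z) (frontier D) := by
  refine continuousOn_pi.2 fun i ζ hζ => ContinuousAt.continuousWithinAt ?_
  have hin : ∀ j, ContinuousAt (fun ζ => inner ℂ (e j) (ζ - z)) ζ := fun j => by fun_prop
  match i with
  | none => exact continuous_im.continuousAt.comp (continuousAt_suppFun (h.contDiffAt hζ) K z)
  | some (j, 0) => exact continuous_re.continuousAt.comp (hin j.succ)
  | some (j, 1) => exact continuous_im.continuousAt.comp (hin j.succ)

theorem card_index : Fintype.card (Option (Fin m × Fin 2)) = 2 * m + 1 := by
  simp [mul_comm]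

theorem antilipschitz (h : PscData D U r ρ A c) (hg : IsGoodRadius ρ A c K ρ') (hK : 0 ≤ K)
    {p z : Cn m} (hp : p ∈ frontier D) {e : OrthonormalBasis (Fin (m + 1)) ℂ (Cn m)} {a : ℝ}
    {l : Fin m → ℝ} (ad : IsAdapted r p e a l) (hz : z ∈ Metric.ball p ρ') :
    ∀ ζ ∈ frontier D ∩ Metric.ball p ρ', ∀ ζ' ∈ frontier D ∩ Metric.ball p ρ',
      dist ζ ζ' ≤ (Real.toNNReal (4 / c + 4 * m) : ℝ) *
        dist (coordMap r K e z ζ) (coordMap r K e z ζ') := by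
  intro ζ hζ ζ' hζ'
  have hc := h.bounds.c_pos
  rw [Real.coe_toNNReal _ (by positivity)]
  exact h.bounds.antilipschitz_coordMap (fun ζ hζ => h.eq_zero hζ) hp ad hg.le_rho hg.le_one hK
    hg.mul_le_one hg.mul_le hz hζ.1 hζ.2 hζ'.1 hζ'.2

/-- Locally the boundary has antilipschitz coordinates with bounded image, and bD is compact. Any K
would do in the coordinates; K = 1 and z = p are taken. -/
theorem measure_frontier_ne_top (h : PscData D U r ρ A c) : μHE[2 * m + 1] (frontier D) ≠ ⊤ := by
  obtain ⟨ρ', -, hg⟩ := exists_isGoodRadius h.bounds.rho_pos h.bounds.one_le h.bounds.c_pos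
    (one_pos (α := ℝ)) (one_pos (α := ℝ))
  refine (h.isCompact_frontier.measure_lt_top_of_nhdsWithin fun p hp => ?_).ne
  refine ⟨frontier D ∩ Metric.ball p ρ', ?_, ?_⟩
  · exact Filter.inter_mem self_mem_nhdsWithin (mem_nhdsWithin_of_mem_nhds (Metric.ball_mem_nhds p hg.pos))
  · obtain ⟨e, a, l, ad⟩ := exists_isAdapted h.isDef h.psc hp
    refine (euclideanHausdorffMeasure_le_volume_image card_index
      (h.antilipschitz hg zero_le_one hp ad (Metric.mem_ball_self hg.pos))).trans_lt ?_
    have hfin : volume (coordMap r 1 e p '' (frontier D ∩ Metric.ball p ρ')) < ⊤ :=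
      (measure_mono (image_mono inter_subset_left)).trans_lt
        (h.isCompact_frontier.image_of_continuousOn (h.continuousOn_coordMap 1 e p)).measure_lt_top
    exact ENNReal.mul_lt_top (ENNReal.mul_lt_top ENNReal.coe_lt_top
      (ENNReal.pow_lt_top ENNReal.coe_lt_top)) hfin

/-- Pointwise bounds in terms of the coordinates imply integral bounds. -/
theorem exists_near_bound (h : PscData D U r ρ A c) (hg : IsGoodRadius ρ A c K ρ') (hK : 0 ≤ K)
    {q : Option (Fin m × Fin 2) → ℝ} (hq : ∀ i, 1 < q i) {δ : ℝ} (hδ : δ - 1 ≤ ∑ i, (1 - q i))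
    {C₀ : ℝ} (hC₀ : 0 ≤ C₀) :
    ∃ C : ℝ, 0 ≤ C ∧ ∀ (F : Cn m → ℝ), ∀ z ∈ D, Metric.infDist z (frontier D) < ρ' / 2 →
      (∀ p ∈ frontier D, ∀ e a l, IsAdapted r p e a l → ‖z - p‖ = Metric.infDist z (frontier D) →
        ∀ ζ ∈ frontier D, ‖ζ - z‖ < ρ' / 2 → F ζ ≤ C₀ * ∏ i,
          (Metric.infDist z (frontier D) + |coordMap r K e z ζ i|) ^ (-(q i))) →
      ∫⁻ ζ in frontier D ∩ Metric.ball z (ρ' / 2), ENNReal.ofReal (F ζ) ∂(μHE[2 * m + 1]) ≤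
        ENNReal.ofReal (C * Metric.infDist z (frontier D) ^ (δ - 1)) := by
  obtain ⟨C, hC, hint⟩ := exists_setLIntegral_prod_rpow_le (X := Cn m) card_index
    (Real.toNNReal (4 / c + 4 * m)) q hq
  refine ⟨C₀ * C, by positivity, fun F z hz hd hF => ?_⟩
  set d := Metric.infDist z (frontier D) with hdd
  have hd0 : 0 < d := (isClosed_frontier.notMem_iff_infDist_pos h.frontier_nonempty).1 fun hzf =>
      ne_of_mem_of_mem_frontier h.isOpen hz hzf rfl
  obtain ⟨p, hp, hpd⟩ := h.isCompact_frontier.exists_infDist_eq_dist h.frontier_nonempty z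
  have hzp : ‖z - p‖ = d := by rw [hdd, hpd, dist_eq_norm]
  obtain ⟨e, a, l, ad⟩ := exists_isAdapted h.isDef h.psc hp
  have hρ := hg.pos
  have hzb : z ∈ Metric.ball p ρ' := mem_ball_iff_norm.2 (by linarith)
  -- Because `p` is a boundary point nearest to `z` and d < ρ'/2, the domain of integration lies
  -- inside the chart about `p`.
  have hsub : frontier D ∩ Metric.ball z (ρ' / 2) ⊆ frontier D ∩ Metric.ball p ρ' :=
    fun ζ hζ => ⟨hζ.1, by
      have h1 := mem_ball_iff_norm.1 hζ.2
      have h2 : ζ - p = (ζ - z) + (z - p) := by abel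
      rw [mem_ball_iff_norm, h2]
      exact (norm_add_le _ _).trans_lt (by linarith)⟩
  have hmeas : MeasurableSet (frontier D ∩ Metric.ball z (ρ' / 2)) :=
    isClosed_frontier.measurableSet.inter Metric.isOpen_ball.measurableSet
  have hlip := h.antilipschitz hg hK hp ad hzb
  have hmain := hint _ hmeas (coordMap r K e z)
    ((h.continuousOn_coordMap K e z).mono inter_subset_left)
    (fun x hx y hy => hlip x (hsub hx) y (hsub hy)) d hd0
  calc _ ≤ ∫⁻ ζ in frontier D ∩ Metric.ball z (ρ' / 2), ENNReal.ofReal C₀ * ENNReal.ofReal (∏ i,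
          (d + |coordMap r K e z ζ i|) ^ (-(q i))) ∂(μHE[2 * m + 1]) := by
        refine setLIntegral_mono' hmeas fun ζ hζ => ?_
        rw [← ENNReal.ofReal_mul hC₀]
        exact ENNReal.ofReal_le_ofReal (hF p hp e a l ad hzp ζ hζ.1 (mem_ball_iff_norm.1 hζ.2))
    _ = ENNReal.ofReal C₀ * ∫⁻ ζ in frontier D ∩ Metric.ball z (ρ' / 2), ENNReal.ofReal (∏ i,
          (d + |coordMap r K e z ζ i|) ^ (-(q i))) ∂(μHE[2 * m + 1]) :=
      lintegral_const_mul' _ _ ENNReal.ofReal_ne_top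
    _ ≤ ENNReal.ofReal C₀ * ENNReal.ofReal (C * d ^ (∑ i, (1 - q i))) := by gcongr
    _ = ENNReal.ofReal (C₀ * C * d ^ (∑ i, (1 - q i))) := by
      rw [← ENNReal.ofReal_mul hC₀, mul_assoc]
    _ ≤ _ := by
      refine ENNReal.ofReal_le_ofReal ?_
      gcongr ?_ * ?_
      refine Real.rpow_le_rpow_of_exponent_ge hd0 ?_ hδ
      have := hg.le_one
      linarith

/-- The function `S` does not vanish off the diagonal. -/
theorem bigS_ne_zero (h : PscData D U r ρ A c) (hg : IsGoodRadius ρ A c K ρ')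
    (hK : 3 * A + 24 * A ^ 2 / c + 1 ≤ 2 * K) {ε : ℝ} (hε : ε ≤ ρ' / 2) {χ : ℝ → ℝ}
    (hχ : IsCutoff ε χ) {ζ z : Cn m} (hζ : ζ ∈ frontier D) (hz : z ∈ closure D) (hne : z ≠ ζ) :
    bigS r K χ ζ z ≠ 0 := by
  have hτ : 0 < ‖ζ - z‖ := norm_pos_iff.2 (sub_ne_zero.2 hne.symm)
  have hA := h.bounds.nonneg
  have hc := h.bounds.c_pos
  have hρ := hg.pos
  have hτc : (‖ζ - z‖ : ℂ) ≠ 0 := norm_sub_ofReal_ne_zero hne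
  intro h0
  rw [bigS] at h0
  by_cases hχ0 : χ ‖ζ - z‖ = 0
  · rw [hχ0] at h0
    simp at h0
    exact hne (sub_eq_zero.1 h0).symm
  have hχpos : 0 < χ ‖ζ - z‖ := lt_of_le_of_ne (hχ.mem_Icc _).1 (Ne.symm hχ0)
  have hτε : ‖ζ - z‖ < 3 / 4 * ε := by
    by_contra hge
    exact hχ0 (hχ.eq_zero _ (not_lt.1 hge))
  have hτρ : 2 * ‖ζ - z‖ < ρ' := by linarith
  have hzr : r z ≤ 0 := h.isDef.nonpos_of_mem_closure h.isOpen hz (h.ball_subset ζ hζ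
    (mem_ball_iff_norm'.2 (by have := hg.le_rho; linarith)))
  obtain ⟨e, a, l, ad⟩ := exists_isAdapted h.isDef h.psc hζ
  have hK0 : 0 ≤ K := by
    have : 0 ≤ 24 * A ^ 2 / c := by positivity
    linarith
  have hKτ : K * ‖ζ - z‖ ≤ 1 := by
    refine le_trans ?_ hg.mul_le_one
    gcongr
    linarith
  have hre := h.bounds.two_re_suppFun_ge hζ hζ (h.eq_zero hζ) ad (hτρ.trans_le hg.le_rho)
    (by simp) hK hKτ
  set Φ := suppFun r K ζ z with hΦ
  have hAτ : 6 * A / c * ‖ζ - z‖ ≤ 1 := by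
    rw [div_mul_eq_mul_div, div_le_one hc]
    refine le_trans ?_ hg.mul_le
    have : A * ‖ζ - z‖ ≤ A * ρ' := by gcongr; linarith
    have : 0 ≤ A * ‖ζ - z‖ := by positivity
    linarith
  set x := χ ‖ζ - z‖ with hx
  -- S = 0 forces Φ to be real and nonpositive, so |Φ| = -Re Φ. With the basis adapted at `ζ`
  -- itself, the lower bound reads 2 Re Φ + |Φ| ≥ |ζ - z|³ > 0, whereas the left side is Re Φ ≤ 0.
  have hΦe : Φ = ((-((1 - x) * ‖ζ - z‖ ^ 2) / x : ℝ) : ℂ) := by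
    have hxc : (x : ℂ) ≠ 0 := ofReal_ne_zero.2 hχpos.ne'
    push_cast
    rw [eq_div_iff hxc]
    linear_combination h0
  have hx1 : x ≤ 1 := (hχ.mem_Icc _).2
  have hneg : -((1 - x) * ‖ζ - z‖ ^ 2) / x ≤ 0 := by
    apply div_nonpos_of_nonpos_of_nonneg _ hχpos.le
    have : 0 ≤ (1 - x) * ‖ζ - z‖ ^ 2 := mul_nonneg (by linarith) (by positivity)
    linarith
  have hΦre : Φ.re ≤ 0 := by rw [hΦe, ofReal_re]; exact hneg
  have hΦn : ‖Φ‖ = -Φ.re := by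
    rw [hΦe, norm_real, ofReal_re, Real.norm_eq_abs, abs_of_nonpos hneg]
  have hsum0 : 0 ≤ ∑ j, l j * ‖inner ℂ (e j.succ) (ζ - z)‖ ^ 2 :=
    Finset.sum_nonneg fun i _ => mul_nonneg (ad.nonneg i) (sq_nonneg _)
  have h1 : 6 * A / c * ‖ζ - z‖ * ‖Φ‖ ≤ 1 * ‖Φ‖ := by gcongr
  have h2 : 0 < ‖ζ - z‖ ^ 3 := by positivity
  linarith

end PscData

end CauchyFantappie

end

noncomputable section

namespace CauchyFantappie

open MeasureTheory Set Complex

variable {m : ℕ}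

/-! ### The estimate for the operator `T^S` -/

/-- The exponent 1 is critical: it would produce logarithms, and the integral estimate asks for
exponents above 1. On a bounded range the exponent may be raised to 1 + η, at the price of d^{-η}
for each coordinate. -/
theorem inv_le_rpow_neg_one_add {y η : ℝ} (hy : 0 < y) (hy2 : y ≤ 2) (hη : 0 ≤ η) :
    y⁻¹ ≤ 2 ^ η * y ^ (-(1 + η)) := by
  have h1 : y⁻¹ = y ^ η * y ^ (-(1 + η)) := by
    rw [← Real.rpow_add hy, ← Real.rpow_neg_one]; ring_nf
  rw [h1]
  gcongr

/-- The exponents attached to the coordinates. -/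
def coordExponent (m : ℕ) (x y : ℝ) : Option (Fin m × Fin 2) → ℝ
  | none => x
  | some _ => y

theorem sum_one_sub_coordExponent (x y : ℝ) :
    ∑ i, (1 - coordExponent m x y i) = (1 - x) + 2 * m * (1 - y) := by
  rw [Fintype.sum_option]
  simp [coordExponent]
  ring

theorem prod_coordMap (r : Cn m → ℝ) (K : ℝ) (e : OrthonormalBasis (Fin (m + 1)) ℂ (Cn m))
    (z ζ : Cn m) (d x y : ℝ) :
    ∏ i, (d + |coordMap r K e z ζ i|) ^ (-(coordExponent m x y i)) =
      (d + |(suppFun r K ζ z).im|) ^ (-x) * ∏ j : Fin m,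
        ((d + |(inner ℂ (e j.succ) (ζ - z)).re|) ^ (-y) *
          (d + |(inner ℂ (e j.succ) (ζ - z)).im|) ^ (-y)) := by
  rw [Fintype.prod_option, Fintype.prod_prod_type]
  simp [coordMap, coordExponent]

/-- Comparison of the pointwise bound with a product over coordinates. -/
theorem pointwise_le_prod {r : Cn m → ℝ} {K d η B : ℝ} (hd : 0 < d)
    {e : OrthonormalBasis (Fin (m + 1)) ℂ (Cn m)} {z ζ : Cn m} (hdτ : d ≤ ‖ζ - z‖)
    (hτ : ‖ζ - z‖ ≤ 1) (hη : 0 ≤ η) (hB : d + |(suppFun r K ζ z).im| ≤ B * ‖suppFun r K ζ z‖)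
    (hB0 : 0 ≤ B) (hσ : 0 < ‖suppFun r K ζ z‖) :
    (∏ j : Fin m, ((d + ‖inner ℂ (e j.succ) (ζ - z)‖) ^ 2)⁻¹) *
        ‖suppFun r K ζ z‖ ^ (-(4 / 3) : ℝ) ≤ (B ^ (4 / 3 : ℝ) * ((2 ^ η) ^ 2) ^ m) *
      ∏ i, (d + |coordMap r K e z ζ i|) ^ (-(coordExponent m (4 / 3) (1 + η) i)) := by
  rw [prod_coordMap]
  set σ := ‖suppFun r K ζ z‖ with hσd
  set v := |(suppFun r K ζ z).im| with hv
  have hv0 : 0 ≤ v := abs_nonneg _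
  have h1 : σ ^ (-(4 / 3) : ℝ) ≤ B ^ (4 / 3 : ℝ) * (d + v) ^ (-(4 / 3) : ℝ) := by
    have e1 : (B * σ) ^ (-(4 / 3) : ℝ) ≤ (d + v) ^ (-(4 / 3) : ℝ) :=
      Real.rpow_le_rpow_of_nonpos (by positivity) hB (by norm_num)
    have hB1 : 0 < B := by
      by_contra hcon
      have : B = 0 := le_antisymm (not_lt.1 hcon) hB0
      rw [this, zero_mul] at hB
      linarith
    rw [Real.mul_rpow hB0 hσ.le] at e1
    calc σ ^ (-(4 / 3) : ℝ) = B ^ (4 / 3 : ℝ) * (B ^ (-(4 / 3) : ℝ) * σ ^ (-(4 / 3) : ℝ)) := by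
          rw [← mul_assoc, ← Real.rpow_add hB1]; simp
      _ ≤ _ := by gcongr
  have h2 : ∀ j : Fin m, ((d + ‖inner ℂ (e j.succ) (ζ - z)‖) ^ 2)⁻¹ ≤ (2 ^ η) ^ 2 *
      ((d + |(inner ℂ (e j.succ) (ζ - z)).re|) ^ (-(1 + η)) *
          (d + |(inner ℂ (e j.succ) (ζ - z)).im|) ^ (-(1 + η))) := by
    intro j
    set t := inner ℂ (e j.succ) (ζ - z) with ht
    have htn : ‖t‖ ≤ 1 := (norm_inner_basis_le e _ _).trans hτ
    have hre := abs_re_le_norm t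
    have him := abs_im_le_norm t
    have hre0 := abs_nonneg t.re
    have him0 := abs_nonneg t.im
    have f1 := inv_le_rpow_neg_one_add (y := d + |t.re|) (by positivity) (by linarith) hη
    have f2 := inv_le_rpow_neg_one_add (y := d + |t.im|) (by positivity) (by linarith) hη
    calc ((d + ‖t‖) ^ 2)⁻¹ ≤ ((d + |t.re|) * (d + |t.im|))⁻¹ := by
          rw [sq]; gcongr
      _ = (d + |t.re|)⁻¹ * (d + |t.im|)⁻¹ := mul_inv _ _
      _ ≤ (2 ^ η * (d + |t.re|) ^ (-(1 + η))) * (2 ^ η * (d + |t.im|) ^ (-(1 + η))) := by gcongr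
      _ = _ := by ring
  have h3 : (∏ j : Fin m, ((d + ‖inner ℂ (e j.succ) (ζ - z)‖) ^ 2)⁻¹) ≤ ((2 ^ η) ^ 2) ^ m *
      ∏ j : Fin m, ((d + |(inner ℂ (e j.succ) (ζ - z)).re|) ^ (-(1 + η)) *
          (d + |(inner ℂ (e j.succ) (ζ - z)).im|) ^ (-(1 + η))) := by
    refine (Finset.prod_le_prod (fun j _ => by positivity) fun j _ => h2 j).trans (le_of_eq ?_)
    rw [Finset.prod_mul_distrib, Finset.prod_const, Finset.card_univ, Fintype.card_fin]
  have h4 : 0 ≤ ∏ j : Fin m, ((d + |(inner ℂ (e j.succ) (ζ - z)).re|) ^ (-(1 + η)) *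
          (d + |(inner ℂ (e j.succ) (ζ - z)).im|) ^ (-(1 + η))) :=
    Finset.prod_nonneg fun j _ => by positivity
  calc _ ≤ (((2 ^ η) ^ 2) ^ m * ∏ j : Fin m, ((d + |(inner ℂ (e j.succ) (ζ - z)).re|) ^ (-(1 + η)) *
          (d + |(inner ℂ (e j.succ) (ζ - z)).im|) ^ (-(1 + η)))) *
        (B ^ (4 / 3 : ℝ) * (d + v) ^ (-(4 / 3) : ℝ)) := by gcongr
    _ = _ := by ring

namespace PscData

variable {D U : Set (Cn m)} {r : Cn m → ℝ} {ρ A c K ρ' : ℝ}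

/-- Elementary consequences of closeness of `ζ` and `z`. -/
theorem near_facts (h : PscData D U r ρ A c) (hg : IsGoodRadius ρ A c K ρ') (hK : 0 ≤ K)
    {p ζ z : Cn m} (hzp : ‖z - p‖ = Metric.infDist z (frontier D)) (hζ : ζ ∈ frontier D)
    (hτ : ‖ζ - z‖ < ρ' / 2) :
    Metric.infDist z (frontier D) ≤ ‖ζ - z‖ ∧ ‖ζ - p‖ ≤ 2 * ‖ζ - z‖ ∧ 2 * ‖ζ - z‖ < ρ ∧
      ‖ζ - z‖ ≤ 1 ∧ K * ‖ζ - z‖ ≤ 1 ∧ 6 * A / c * ‖ζ - z‖ ≤ 1 := by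
  have hd : Metric.infDist z (frontier D) ≤ ‖ζ - z‖ := by
    rw [← dist_eq_norm, dist_comm]; exact Metric.infDist_le_dist_of_mem hζ
  have hA := h.bounds.nonneg
  have hc := h.bounds.c_pos
  have hρ := hg.pos
  have hτ0 := norm_nonneg (ζ - z)
  refine ⟨hd, ?_, ?_, ?_, ?_, ?_⟩
  · have h2 : ζ - p = (ζ - z) + (z - p) := by abel
    rw [h2]
    exact (norm_add_le _ _).trans (by linarith)
  · have := hg.le_rho
    linarith
  · have := hg.le_one
    linarith
  · refine le_trans ?_ hg.mul_le_one
    gcongr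
    linarith
  · rw [div_mul_eq_mul_div, div_le_one hc]
    refine le_trans ?_ hg.mul_le
    have : A * ‖ζ - z‖ ≤ A * ρ' := by gcongr; linarith
    have : 0 ≤ A * ‖ζ - z‖ := by positivity
    linarith

theorem infDist_pos (h : PscData D U r ρ A c) {z : Cn m} (hz : z ∈ D) :
    0 < Metric.infDist z (frontier D) :=
  (isClosed_frontier.notMem_iff_infDist_pos h.frontier_nonempty).1 fun hzf =>
    ne_of_mem_of_mem_frontier h.isOpen hz hzf rfl

theorem le_neg_r (h : PscData D U r ρ A c) (hg : IsGoodRadius ρ A c K ρ') {p z : Cn m}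
    (hp : p ∈ frontier D) {e : OrthonormalBasis (Fin (m + 1)) ℂ (Cn m)} {a : ℝ} {l : Fin m → ℝ}
    (ad : IsAdapted r p e a l) (hz : z ∈ D) (hzp : ‖z - p‖ = Metric.infDist z (frontier D))
    (hd : Metric.infDist z (frontier D) < ρ' / 2) :
    c / 4 * Metric.infDist z (frontier D) ≤ -r z := by
  refine h.bounds.infDist_le h.isDef h.ball_subset hp ad hz hg.le_rho ?_ hzp (by linarith)
  have h1 := hg.mul_le
  have h2 : 0 ≤ A * ρ' := mul_nonneg h.bounds.nonneg hg.pos.le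
  linarith

/-- The pointwise estimate of the kernel near the diagonal. -/
theorem exists_pointwise_genW (h : PscData D U r ρ A c) (hg : IsGoodRadius ρ A c K ρ')
    (hK : 3 * A + 24 * A ^ 2 / c + 1 ≤ 2 * K) {ε : ℝ} (hε : ρ' ≤ ε) {χ : ℝ → ℝ}
    (hχ : IsCutoff ε χ) {φ : Cn m → ℝ}
    (hν : ∀ ζ ∈ frontier D, ∀ v, conormal φ ζ v = conormal r ζ v) {η : ℝ} (hη : 0 ≤ η) :
    ∃ C₀ : ℝ, 0 ≤ C₀ ∧ ∀ z ∈ D, Metric.infDist z (frontier D) < ρ' / 2 → ∀ w, ‖w‖ ≤ 1 →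
      ∀ p ∈ frontier D, ∀ e a l, IsAdapted r p e a l → ‖z - p‖ = Metric.infDist z (frontier D) →
      ∀ ζ ∈ frontier D, ‖ζ - z‖ < ρ' / 2 → ‖dbar (cfKernel φ (genW r K χ) ζ) z w‖ ≤ C₀ * ∏ i,
        (Metric.infDist z (frontier D) + |coordMap r K e z ζ i|) ^
          (-(coordExponent m (4 / 3) (1 + η) i)) := by
  obtain ⟨C, hC, hker⟩ := h.bounds.exists_dbar_nearKernel_bound hK
  have hc := h.bounds.c_pos
  set N : ℝ := ((2 * m + 2).factorial : ℝ) with hN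
  refine ⟨‖cfFactor m‖ * N * (C * ((12 / c + 1) ^ (4 / 3 : ℝ) * ((2 ^ η) ^ 2) ^ m)),
    by positivity, ?_⟩
  intro z hz hdρ w hw p hp e a l ad hzp ζ hζ hτ
  have hK0 : 0 ≤ K := by
    have := h.bounds.nonneg
    have : 0 ≤ 24 * A ^ 2 / c := by positivity
    linarith
  obtain ⟨f1, f2, f3, f4, f5, f6⟩ := h.near_facts hg hK0 hzp hζ hτ
  have hd0 := h.infDist_pos hz
  set d := Metric.infDist z (frontier D) with hdd
  have hdr : c / 4 * d ≤ -r z := h.le_neg_r hg hp ad hz hzp hdρ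
  obtain ⟨k', hk', hk'b⟩ := hker p ζ z e a l d hp hζ (h.eq_zero hζ) ad hd0 f1 hdr f3 f2 f4 f5 f6
  have hzζ : z ≠ ζ := ne_of_mem_of_mem_frontier h.isOpen hz hζ
  have hlow := h.bounds.norm_suppFun_ge hp hζ (h.eq_zero hζ) ad f3 f2 hK f5 f6
  have hsum0 : 0 ≤ ∑ j, l j * ‖inner ℂ (e j.succ) (ζ - z)‖ ^ 2 :=
    Finset.sum_nonneg fun i _ => mul_nonneg (ad.nonneg i) (sq_nonneg _)
  have hτ3 : 0 ≤ ‖ζ - z‖ ^ 3 := by positivity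
  have hcd : 0 < c / 4 * d := by positivity
  have hσ : 0 < ‖suppFun r K ζ z‖ := by linarith
  have hev : cfKernel φ (genW r K χ) ζ =ᶠ[nhds z] fun z =>
      (cfFactor m * ((adaptedBasis e).det realBasis : ℂ)) *
      ((suppFun r K ζ z)⁻¹ ^ (m + 1) * nearTop r K e ζ z) := by
    obtain ⟨d', hd', -⟩ := exists_hasDbarAt_suppFun r ζ K hzζ
    have g1 : ∀ᶠ z' in nhds z, suppFun r K ζ z' ≠ 0 :=
      hd'.differentiableAt.continuousAt.eventually_ne (norm_pos_iff.1 hσ)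
    have g2 : ∀ᶠ z' in nhds z, ‖ζ - z'‖ < ε / 2 :=
      (continuous_const.sub continuous_id).norm.continuousAt.eventually_lt continuousAt_const
        (show ‖ζ - z‖ < ε / 2 by linarith)
    filter_upwards [g1, g2, eventually_ne_nhds hzζ] with z' h1 h2 h3
    exact cfKernel_genW_near φ (h.contDiffAt hζ) (hν ζ hζ) K hχ h3.symm h2 h1 e
  rw [((hk'.const_mul (cfFactor m * ((adaptedBasis e).det realBasis : ℂ))).congr_of_eventuallyEq
    hev).dbar_eq w]
  -- The modulus dominates `d` through Re Φ, since -r(z) is at least c d/4, and trivially dominates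
  -- Im Φ, the first coordinate.
  have hB : d + |(suppFun r K ζ z).im| ≤ (12 / c + 1) * ‖suppFun r K ζ z‖ := by
    have g1 := abs_im_le_norm (suppFun r K ζ z)
    have g0 : c / 4 * d ≤ 3 * ‖suppFun r K ζ z‖ := by linarith
    have g2 : d ≤ 12 / c * ‖suppFun r K ζ z‖ := by
      calc d = 4 / c * (c / 4 * d) := by field_simp
        _ ≤ 4 / c * (3 * ‖suppFun r K ζ z‖) := by gcongr
        _ = _ := by ring
    linarith
  have hpt := pointwise_le_prod (e := e) hd0 f1 f4 hη hB (by positivity) hσ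
  have hdet : ‖((adaptedBasis e).det realBasis : ℂ)‖ ≤ N := by
    rw [norm_real, Real.norm_eq_abs]
    exact abs_det_adaptedBasis_le e
  rw [norm_mul, norm_mul]
  calc _ ≤ ‖cfFactor m‖ * N * (C * ((∏ j : Fin m, ((d + ‖inner ℂ (e j.succ) (ζ - z)‖) ^ 2)⁻¹) *
          ‖suppFun r K ζ z‖ ^ (-(4 / 3) : ℝ))) := by
        gcongr
        exact hk'b w hw
    _ ≤ ‖cfFactor m‖ * N * (C * ((12 / c + 1) ^ (4 / 3 : ℝ) * ((2 ^ η) ^ 2) ^ m *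
        ∏ i, (d + |coordMap r K e z ζ i|) ^ (-(coordExponent m (4 / 3) (1 + η) i)))) := by gcongr
    _ = _ := by ring

theorem isSmoothKernel_genW (h : PscData D U r ρ A c) (hg : IsGoodRadius ρ A c K ρ')
    (hK : 3 * A + 24 * A ^ 2 / c + 1 ≤ 2 * K) {ε : ℝ} (hε : ε ≤ ρ' / 2) {χ : ℝ → ℝ}
    (hχ : IsCutoff ε χ) {φ : Cn m → ℝ} (hφ : ∀ ζ ∈ frontier D, ContDiffAt ℝ 3 φ ζ)
    (hφ0 : ∀ ζ ∈ frontier D, fderiv ℝ φ ζ ≠ 0) :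
    IsSmoothKernel (frontier D) (closure D) (cfKernel φ (genW r K χ)) :=
  CauchyFantappie.isSmoothKernel_genW hφ hφ0 (fun _ hζ => h.contDiffAt hζ) K hχ.contDiff
    fun _ hζ _ hz hne => h.bigS_ne_zero hg hK hε hχ hζ hz hne

/-- The `∂̄`-estimate for the operator `T^S`. -/
theorem dbarEstimate_genW (h : PscData D U r ρ A c) (hg : IsGoodRadius ρ A c K ρ')
    (hK : 3 * A + 24 * A ^ 2 / c + 1 ≤ 2 * K) {ε : ℝ} (hε0 : 0 < ε) (hε : ε ≤ ρ' / 2) {χ : ℝ → ℝ}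
    (hχ : IsCutoff ε χ) {φ : Cn m → ℝ} (hφ : ∀ ζ ∈ frontier D, ContDiffAt ℝ 3 φ ζ)
    (hφ0 : ∀ ζ ∈ frontier D, fderiv ℝ φ ζ ≠ 0)
    (hν : ∀ ζ ∈ frontier D, ∀ v, conormal φ ζ v = conormal r ζ v) {δ : ℝ} (hδ : δ < 2 / 3) :
    DbarEstimate D (cfOperator D φ (genW r K χ)) δ := by
  have hA := h.bounds.one_le
  have hc := h.bounds.c_pos
  have hK0 : 0 < K := by
    have : 0 ≤ 24 * A ^ 2 / c := by positivity
    linarith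
  -- A second radius below ε: within ρ''/2 the cut-off equals 1 and the kernel is that of g / Φ. The
  -- radius ρ' is needed only for the nonvanishing of S, where ε must be small relative to it.
  obtain ⟨ρ'', hρε, hg'⟩ := exists_isGoodRadius h.bounds.rho_pos hA hc hK0 hε0
  -- The total exponent is -1/3 - 2mη, which has to be at least δ - 1. Dividing by 2m + 1 instead of
  -- 2m includes the case m = 0.
  set η : ℝ := (2 / 3 - δ) / (2 * m + 1) with hη
  have hη0 : 0 < η := div_pos (by linarith) (by positivity)
  obtain ⟨C₀, hC₀, hpt⟩ := h.exists_pointwise_genW hg' hK hρε hχ hν hη0.le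
  obtain ⟨C, hC, hnear⟩ := h.exists_near_bound hg' hK0.le
    (q := coordExponent m (4 / 3) (1 + η)) (δ := δ)
    (fun i => by match i with
      | none => norm_num [coordExponent]
      | some _ => simp only [coordExponent]; linarith)
    (by
      rw [sum_one_sub_coordExponent]
      have : (2 * m + 1) * η = 2 / 3 - δ := by rw [hη]; field_simp
      nlinarith) hC₀
  exact (h.isSmoothKernel_genW hg hK hε hχ hφ hφ0).dbarEstimate h.isOpen h.isBounded
    h.frontier_nonempty h.measure_frontier_ne_top (by linarith) (half_pos hg'.pos) hC
    fun z hz hd w hw => hnear _ z hz hd fun p hp e a l ad hzp ζ hζ hτ =>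
      hpt z hz hd w hw p hp e a l ad hzp ζ hζ hτ

end PscData

end CauchyFantappie

end

noncomputable section

namespace CauchyFantappie

open MeasureTheory Set Complex

variable {m : ℕ}

/-! ### The `∂̄`-derivative of the Bochner–Martinelli kernel -/

theorem bmTop_real_smul (e : OrthonormalBasis (Fin (m + 1)) ℂ (Cn m)) (ν : Cn m →L[ℝ] ℝ) (s : ℝ)
    (t : Cn m) : bmTop e ν ((s : ℂ) • t) = s * bmTop e ν t := by
  rw [bmTop, bmTop, topSum, topSum, Finset.mul_sum]
  refine Finset.sum_congr rfl fun τ _ => ?_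
  rw [inner_smul_left, conj_ofReal]
  ring

/-- The `∂̄`-derivative of the Bochner–Martinelli kernel, up to a constant factor. -/
def bmDbar (e : OrthonormalBasis (Fin (m + 1)) ℂ (Cn m)) (w : Cn m) (ν : Cn m →L[ℝ] ℝ)
    (t : Cn m) : ℂ :=
  (m + 1) * ((‖t‖ : ℂ) ^ 2)⁻¹ ^ m * (((‖t‖ : ℂ) ^ 2 * (‖t‖ : ℂ) ^ 2)⁻¹ * inner ℂ w t) * bmTop e ν t
    - ((‖t‖ : ℂ) ^ 2)⁻¹ ^ (m + 1) * bmTop e ν w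

theorem hasDbarAt_bmTop (e : OrthonormalBasis (Fin (m + 1)) ℂ (Cn m)) (ν : Cn m →L[ℝ] ℝ)
    (ζ z : Cn m) : HasDbarAt (fun z => bmTop e ν (ζ - z)) (fun w => -bmTop e ν w) z := by
  have h := hasDbarAt_topSum (fun x => (ν (adaptedBasis e x) : ℂ))
    (α := fun z x => inner ℂ (ζ - z) (adaptedBasis e x))
    (β := fun _ (_ : Fin m) x y => inner ℂ (adaptedBasis e x) (adaptedBasis e y)
      - inner ℂ (adaptedBasis e y) (adaptedBasis e x))
    (α' := fun w x => -inner ℂ w (adaptedBasis e x)) (β' := fun _ _ _ _ => 0) (z := z)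
    (fun x => HasDbarAt.inner_sub_left ζ _) (fun _ _ _ => HasDbarAt.const _)
  refine h.congr_deriv fun w => ?_
  have h1 : ∀ j : Fin m, topSum (fun x => (ν (adaptedBasis e x) : ℂ))
      (fun x => inner ℂ (ζ - z) (adaptedBasis e x)) (Function.update (fun (_ : Fin m) x y =>
        inner ℂ (adaptedBasis e x) (adaptedBasis e y)
        - inner ℂ (adaptedBasis e y) (adaptedBasis e x)) j (fun _ _ => (0 : ℂ))) = 0 := by
    intro j
    rw [topSum]
    refine Finset.sum_eq_zero fun τ _ => ?_
    rw [Finset.prod_eq_zero (Finset.mem_univ j) (by simp)]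
    simp
  rw [Finset.sum_eq_zero fun j _ => h1 j, add_zero, bmTop, topSum, topSum, ← Finset.sum_neg_distrib]
  refine Finset.sum_congr rfl fun τ _ => ?_
  ring

theorem dbar_cfKernel_genBM (φ : Cn m → ℝ) {ζ z : Cn m} (hz : z ≠ ζ)
    (e : OrthonormalBasis (Fin (m + 1)) ℂ (Cn m)) (w : Cn m) :
    dbar (cfKernel φ genBM ζ) z w = cfFactor m * ((adaptedBasis e).det realBasis : ℂ) *
      bmDbar e w (conormalCLM φ ζ) (ζ - z) := by
  have h0 : ((‖ζ - z‖ ^ 2 : ℝ) : ℂ) ≠ 0 := by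
    rw [ofReal_pow]; exact pow_ne_zero 2 (norm_sub_ofReal_ne_zero hz)
  have h1 := (exists_hasDbarAt_kernel (HasDbarAt.norm_sub_sq (z := z) ζ) h0
    (hasDbarAt_bmTop e (conormalCLM φ ζ) ζ z)).const_mul
      (cfFactor m * ((adaptedBasis e).det realBasis : ℂ))
  have hev : cfKernel φ genBM ζ =ᶠ[nhds z] fun z =>
      (cfFactor m * ((adaptedBasis e).det realBasis : ℂ)) *
      ((((‖ζ - z‖ ^ 2 : ℝ) : ℂ))⁻¹ ^ (m + 1) * bmTop e (conormalCLM φ ζ) (ζ - z)) := by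
    filter_upwards [eventually_ne_nhds hz] with z' h3
    rw [cfKernel_genBM φ h3.symm e]
    push_cast
    rfl
  rw [(h1.congr_of_eventuallyEq hev).dbar_eq w, bmDbar]
  push_cast
  ring

/-- `bmTop` is of degree one in t, so both terms have degree -(2m + 2). This permits blowing up at
the scale of the distance to the boundary. -/
theorem bmDbar_smul (e : OrthonormalBasis (Fin (m + 1)) ℂ (Cn m)) (w : Cn m) (ν : Cn m →L[ℝ] ℝ)
    {s : ℝ} (hs : 0 < s) (t : Cn m) :
    bmDbar e w ν ((s : ℂ) • t) = ((s : ℂ) ^ (2 * m + 2))⁻¹ * bmDbar e w ν t := by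
  have hs' : (s : ℂ) ≠ 0 := ofReal_ne_zero.2 hs.ne'
  have h1 : (‖(s : ℂ) • t‖ : ℂ) = s * ‖t‖ := by
    rw [norm_smul, norm_real, Real.norm_eq_abs, abs_of_pos hs, ofReal_mul]
  rw [bmDbar, bmDbar, h1, bmTop_real_smul, inner_smul_right]
  obtain ⟨u, hu⟩ : ∃ u : ℂ, u = (s : ℂ)⁻¹ := ⟨_, rfl⟩
  have e1 : (((s : ℂ) * ‖t‖) ^ 2)⁻¹ = u ^ 2 * ((‖t‖ : ℂ) ^ 2)⁻¹ := by
    rw [mul_pow, mul_inv, hu, inv_pow]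
  have e2 : (((s : ℂ) * ‖t‖) ^ 2 * ((s : ℂ) * ‖t‖) ^ 2)⁻¹ =
      u ^ 4 * ((‖t‖ : ℂ) ^ 2 * (‖t‖ : ℂ) ^ 2)⁻¹ := by
    rw [show ((s : ℂ) * ‖t‖) ^ 2 * ((s : ℂ) * ‖t‖) ^ 2
      = (s : ℂ) ^ 4 * ((‖t‖ : ℂ) ^ 2 * (‖t‖ : ℂ) ^ 2) by ring, mul_inv, hu, inv_pow]
  have e3 : ((s : ℂ) ^ (2 * m + 2))⁻¹ = u ^ (2 * m) * u ^ 2 := by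
    rw [← pow_add, hu, inv_pow]
  have e4 : (s : ℂ) * u = 1 := by rw [hu]; exact mul_inv_cancel₀ hs'
  have e5 : (s : ℂ) ^ 2 * u ^ 4 = u ^ 2 := by
    rw [show (s : ℂ) ^ 2 * u ^ 4 = ((s : ℂ) * u) ^ 2 * u ^ 2 by ring, e4]; ring
  have e6 : u ^ (2 * (m + 1)) = u ^ (2 * m) * u ^ 2 := by rw [← pow_add]; rfl
  rw [e1, e2, e3, mul_pow, mul_pow, ← pow_mul, ← pow_mul, e6]
  linear_combination ((m + 1) * u ^ (2 * m) * ((‖t‖ : ℂ) ^ 2)⁻¹ ^ m *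
    ((‖t‖ : ℂ) ^ 2 * (‖t‖ : ℂ) ^ 2)⁻¹ * inner ℂ w t * bmTop e ν t) * e5

theorem norm_bmTop_le (e : OrthonormalBasis (Fin (m + 1)) ℂ (Cn m)) {ν : Cn m →L[ℝ] ℝ}
    (hν : ‖ν‖ ≤ 1) (t : Cn m) : ‖bmTop e ν t‖ ≤ (2 * m + 2).factorial * 2 ^ m * ‖t‖ := by
  have h := norm_topSum_le (m := m) (ν := fun x => (ν (adaptedBasis e x) : ℂ))
    (α := fun x => inner ℂ t (adaptedBasis e x))
    (β := fun _ x y => inner ℂ (adaptedBasis e x) (adaptedBasis e y)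
      - inner ℂ (adaptedBasis e y) (adaptedBasis e x)) (W := fun _ => 1) (a := 1) (b := ‖t‖)
    (c := fun _ => 2)
    (fun x => by
      rw [norm_real, mul_one]
      have := ν.le_opNorm (adaptedBasis e x)
      rw [norm_adaptedBasis, mul_one] at this
      exact this.trans hν)
    (fun x => by
      have := norm_inner_le t (adaptedBasis e x)
      rwa [norm_adaptedBasis] at this)
    (fun _ x y => by
      have h1 := norm_inner_le (adaptedBasis e x) (adaptedBasis e y)
      have h2 := norm_inner_le (adaptedBasis e y) (adaptedBasis e x)
      rw [norm_adaptedBasis, norm_adaptedBasis] at h1 h2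
      refine (norm_sub_le _ _).trans ?_
      linarith)
  refine h.trans (le_of_eq ?_)
  simp
  ring

theorem norm_bmDbar_le (e : OrthonormalBasis (Fin (m + 1)) ℂ (Cn m)) {ν : Cn m →L[ℝ] ℝ}
    (hν : ‖ν‖ ≤ 1) {w t : Cn m} (hw : ‖w‖ ≤ 1) (ht : t ≠ 0) :
    ‖bmDbar e w ν t‖ ≤ (m + 2) * ((2 * m + 2).factorial * 2 ^ m) * (‖t‖ ^ (2 * m + 2))⁻¹ := by
  set N : ℝ := (2 * m + 2).factorial * 2 ^ m with hN
  have hN0 : 0 ≤ N := by positivity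
  set τ := ‖t‖ with hτ
  have hτ0 : 0 < τ := norm_pos_iff.2 ht
  have h1 := norm_bmTop_le e hν t
  have h2 := norm_bmTop_le e hν w
  rw [← hN] at h1 h2
  have h3 := norm_inner_le w t
  have e1 : ‖(m : ℂ) + 1‖ = m + 1 := by exact_mod_cast Complex.norm_natCast (m + 1)
  rw [bmDbar]
  refine (norm_sub_le _ _).trans ?_
  simp only [norm_mul, norm_pow, norm_inv, norm_real, norm_norm, e1]
  have h4 : (τ ^ (2 * m + 2))⁻¹ = (τ ^ 2)⁻¹ ^ m * (τ ^ 2)⁻¹ := by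
    rw [pow_add, pow_mul, mul_inv, inv_pow]
  calc _ ≤ (m + 1) * (τ ^ 2)⁻¹ ^ m * ((τ ^ 2 * τ ^ 2)⁻¹ * (1 * τ)) * (N * τ)
        + (τ ^ 2)⁻¹ ^ (m + 1) * (N * 1) := by
        gcongr
        · exact h3.trans (by gcongr)
        · exact h2.trans (by gcongr)
    _ = _ := by
      have h5 : (τ ^ 2 * τ ^ 2)⁻¹ * (1 * τ) * τ = (τ ^ 2)⁻¹ := by field_simp
      rw [h4, pow_succ]
      linear_combination (m + 1) * (τ ^ 2)⁻¹ ^ m * N * h5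

theorem conormalCLM_norm_le (φ : Cn m → ℝ) (ζ : Cn m) : ‖conormalCLM φ ζ‖ ≤ 1 := by
  rw [conormalCLM, norm_smul, norm_inv, norm_norm]
  exact inv_mul_le_one

namespace PscData

variable {D U : Set (Cn m)} {r : Cn m → ℝ} {ρ A c K ρ' : ℝ}

/-- All coordinates, and d, are O(|ζ - z|). The isotropic singularity can therefore be shared evenly
among the 2m + 1 coordinates, each receiving an exponent slightly above 1. -/
theorem inv_pow_le_prod_coordMap (h : PscData D U r ρ A c) (hK : 0 ≤ K) {ζ z : Cn m}
    (hζ : ζ ∈ frontier D) (e : OrthonormalBasis (Fin (m + 1)) ℂ (Cn m)) {d : ℝ} (hd : 0 < d)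
    (hdτ : d ≤ ‖ζ - z‖) (hτ : ‖ζ - z‖ ≤ 1) (hKτ : K * ‖ζ - z‖ ≤ 1) :
    (‖ζ - z‖ ^ (2 * m + 2))⁻¹ ≤ (4 * A) ^ (2 * m + 2) * ∏ i,
      (d + |coordMap r K e z ζ i|) ^ (-(((2 * m + 2 : ℕ) : ℝ) / (2 * m + 1 : ℕ))) := by
  set τ := ‖ζ - z‖ with hτd
  have hτ0 : 0 < τ := hd.trans_le hdτ
  have hA := h.bounds.nonneg
  have hA1 := h.bounds.one_le
  have hζb : ζ ∈ Metric.ball ζ ρ := Metric.mem_ball_self h.bounds.rho_pos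
  have hσ : ‖suppFun r K ζ z‖ ≤ 3 * A * τ := by
    rw [suppFun_eq (h.contDiffAt hζ) (h.eq_zero hζ)]
    refine (norm_add_le _ _).trans ?_
    have g1 := norm_sub_le (del (fderiv ℝ r ζ) (ζ - z))
      ((1 / 2) * holPart (fderiv ℝ (fderiv ℝ r) ζ) (ζ - z) (ζ - z))
    have g2 : ‖del (fderiv ℝ r ζ) (ζ - z)‖ ≤ A * τ := by
      refine (norm_del_le _ _).trans ?_
      have := h.bounds.bound_one ζ hζ ζ hζb
      gcongr
    have g3 : ‖(1 / 2) * holPart (fderiv ℝ (fderiv ℝ r) ζ) (ζ - z) (ζ - z)‖ ≤ A * τ := by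
      have g4 := norm_holPart_le (fderiv ℝ (fderiv ℝ r) ζ) (ζ - z) (ζ - z)
      have := h.bounds.bound_two ζ hζ ζ hζb
      have g5 : ‖(1 / 2 : ℂ)‖ ≤ 1 := by norm_num
      rw [norm_mul]
      calc _ ≤ 1 * (A * 1 * τ) := by
            gcongr
            exact g4.trans (by gcongr)
        _ = A * τ := by ring
    have g4 : ‖((K * ‖ζ - z‖ ^ 3 : ℝ) : ℂ)‖ ≤ A * τ := by
      rw [norm_real, Real.norm_eq_abs, abs_of_nonneg (by positivity), ← hτd]
      calc K * τ ^ 3 = (K * τ) * (τ * τ) := by ring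
        _ ≤ 1 * (1 * τ) := by gcongr
        _ ≤ A * τ := by nlinarith
    linarith
  have hcoord : ∀ i, |coordMap r K e z ζ i| ≤ 3 * A * τ := by
    have hin : ∀ j, ‖inner ℂ (e j) (ζ - z)‖ ≤ 3 * A * τ := fun j =>
      (norm_inner_basis_le e j _).trans (by nlinarith)
    intro i
    match i with
    | none => exact (abs_im_le_norm _).trans hσ
    | some (j, 0) => exact (abs_re_le_norm _).trans (hin _)
    | some (j, 1) => exact (abs_im_le_norm _).trans (hin _)
  set q : ℝ := ((2 * m + 2 : ℕ) : ℝ) / (2 * m + 1 : ℕ) with hq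
  have hq0 : 0 ≤ q := by positivity
  have hge : ∏ _i : Option (Fin m × Fin 2), (4 * A * τ) ^ (-q) ≤
      ∏ i, (d + |coordMap r K e z ζ i|) ^ (-q) := by
    refine Finset.prod_le_prod (fun i _ => by positivity) fun i _ => ?_
    refine Real.rpow_le_rpow_of_nonpos (by positivity) ?_ (by linarith)
    have := hcoord i
    nlinarith
  rw [Finset.prod_const, Finset.card_univ, card_index, ← Real.rpow_natCast, ← Real.rpow_mul
    (by positivity)] at hge
  have hqe : -q * ((2 * m + 1 : ℕ) : ℝ) = -((2 * m + 2 : ℕ) : ℝ) := by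
    rw [hq]; field_simp
  rw [hqe, Real.rpow_neg (by positivity), Real.rpow_natCast, mul_pow (4 * A)] at hge
  calc (τ ^ (2 * m + 2))⁻¹ = (4 * A) ^ (2 * m + 2) * ((4 * A) ^ (2 * m + 2) * τ ^ (2 * m + 2))⁻¹ := by
        have : (4 * A) ^ (2 * m + 2) ≠ 0 := by positivity
        field_simp
    _ ≤ _ := by gcongr

/-- The `∂̄`-estimate for the Bochner–Martinelli operator. -/
theorem dbarEstimate_genBM (h : PscData D U r ρ A c) {φ : Cn m → ℝ}
    (hφ : ∀ ζ ∈ frontier D, ContDiffAt ℝ 3 φ ζ) (hφ0 : ∀ ζ ∈ frontier D, fderiv ℝ φ ζ ≠ 0) :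
    DbarEstimate D (cfOperator D φ genBM) 0 := by
  have hA := h.bounds.nonneg
  obtain ⟨ρ', -, hg⟩ := exists_isGoodRadius h.bounds.rho_pos h.bounds.one_le h.bounds.c_pos
    (one_pos (α := ℝ)) (one_pos (α := ℝ))
  set N : ℝ := (2 * m + 2).factorial * 2 ^ m with hN
  -- The exponents 1 - q over 2m + 1 coordinates sum to exactly -1, which is δ - 1 for δ = 0.
  set q : ℝ := ((2 * m + 2 : ℕ) : ℝ) / (2 * m + 1 : ℕ) with hq
  set C₀ : ℝ := ‖cfFactor m‖ * (2 * m + 2).factorial * ((m + 2) * N * (4 * A) ^ (2 * m + 2)) with hC₀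
  obtain ⟨C, hC, hnear⟩ := h.exists_near_bound hg zero_le_one (q := fun _ => q) (δ := 0)
    (C₀ := C₀)
    (fun i => by
      rw [hq, one_lt_div (by positivity)]
      push_cast
      linarith)
    (by
      rw [Finset.sum_const, Finset.card_univ, card_index, nsmul_eq_mul, hq, mul_sub,
        mul_div_cancel₀ _ (by positivity)]
      push_cast
      linarith) (by positivity)
  refine (isSmoothKernel_genBM hφ hφ0).dbarEstimate h.isOpen h.isBounded
    h.frontier_nonempty h.measure_frontier_ne_top (by norm_num) (half_pos hg.pos) hC
    fun z hz hd w hw => hnear _ z hz hd fun p hp e a l ad hzp ζ hζ hτ => ?_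
  obtain ⟨f1, f2, f3, f4, f5, f6⟩ := h.near_facts hg zero_le_one hzp hζ hτ
  have hzζ := ne_of_mem_of_mem_frontier h.isOpen hz hζ
  have hdet : ‖((adaptedBasis e).det realBasis : ℂ)‖ ≤ (2 * m + 2).factorial := by
    rw [norm_real, Real.norm_eq_abs]
    exact abs_det_adaptedBasis_le e
  have h1 := norm_bmDbar_le e (conormalCLM_norm_le φ ζ) hw (sub_ne_zero.2 hzζ.symm)
  have h2 := h.inv_pow_le_prod_coordMap zero_le_one hζ e (h.infDist_pos hz) f1 f4 f5
  rw [dbar_cfKernel_genBM φ hzζ e, norm_mul, norm_mul]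
  calc _ ≤ ‖cfFactor m‖ * (2 * m + 2).factorial * ((m + 2) * N * ((4 * A) ^ (2 * m + 2) * ∏ i,
      (Metric.infDist z (frontier D) + |coordMap r 1 e z ζ i|) ^ (-q))) := by
        gcongr
        exact h1.trans (by gcongr)
    _ = _ := by rw [hC₀]; ring

end PscData

end CauchyFantappie

end

noncomputable section

namespace CauchyFantappie

open MeasureTheory Set Complex

variable {m : ℕ}

/-! ### A lower bound for the Bochner–Martinelli kernel in the normal direction -/

/-- At the unit normal, differentiating the power of |t|² gives the factor m + 1 and differentiating
the numerator gives -1. The result vanishes for n = 1, which is why sharpness requires n ≥ 2. -/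
theorem bmDbar_self (e : OrthonormalBasis (Fin (m + 1)) ℂ (Cn m)) (ν : Cn m →L[ℝ] ℝ) :
    bmDbar e (e 0) ν (e 0) = m * bmTop e ν (e 0) := by
  rw [bmDbar, e.norm_eq_one, inner_e_self]
  simp
  ring

/-- In the basis attached to e the two-form is 2i times the standard symplectic form, the conormal
lives on the first vector, and ⟨e_0, ·⟩ lives on the first two; `topSum_symplectic_ne_zero` applies.
-/
theorem bmTop_normal_ne_zero (e : OrthonormalBasis (Fin (m + 1)) ℂ (Cn m)) {ν : Cn m →L[ℝ] ℝ}
    {b : ℝ} (hb : b ≠ 0) (hν : ∀ v, ν v = b * (inner ℂ (e 0) v).re) : bmTop e ν (e 0) ≠ 0 := by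
  have hin : ∀ j a, inner ℂ (e 0) (adaptedBasis e (pairEquiv m (j, a))) =
      if j = 0 then (![1, I] a : ℂ) else 0 := fun j a => by
    rw [adaptedBasis_pairEquiv, inner_smul_right]
    rcases eq_or_ne j 0 with rfl | hj
    · rw [inner_e_self, if_pos rfl, mul_one]
    · rw [e.inner_eq_zero hj.symm, if_neg hj, mul_zero]
  have h2I : 2 * I ≠ 0 := mul_ne_zero two_ne_zero I_ne_zero
  refine topSum_symplectic_ne_zero h2I ?_ (fun x hx => ?_) ?_ (fun x hx hx1 => ?_)
    (fun j a l b => ?_)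
  · rw [← pairEquiv_zero_zero, hν, hin]
    simpa using hb
  · obtain ⟨⟨j, a⟩, rfl⟩ := (pairEquiv m).surjective x
    rw [hν, hin]
    fin_cases a
    · have : j ≠ 0 := fun hj => hx (by rw [hj]; exact pairEquiv_zero_zero)
      simp [this]
    · split_ifs <;> simp
  · rw [← pairEquiv_zero_one, hin]
    simp
  · obtain ⟨⟨j, a⟩, rfl⟩ := (pairEquiv m).surjective x
    rw [hin, if_neg]
    rintro rfl
    fin_cases a
    · exact hx pairEquiv_zero_zero
    · exact hx1 pairEquiv_zero_one
  · rw [adaptedBasis_pairEquiv, adaptedBasis_pairEquiv, inner_smul_left, inner_smul_right,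
      inner_smul_left, inner_smul_right]
    rcases eq_or_ne j l with rfl | hj
    · rw [inner_e_self, if_pos rfl]
      fin_cases a <;> fin_cases b <;> simp [sympl] <;> ring
    · rw [e.inner_eq_zero hj, e.inner_eq_zero hj.symm, if_neg hj]
      simp

theorem continuous_bmTop (e : OrthonormalBasis (Fin (m + 1)) ℂ (Cn m)) :
    Continuous fun q : (Cn m →L[ℝ] ℝ) × Cn m => bmTop e q.1 q.2 := by
  unfold bmTop topSum
  fun_prop

theorem continuousAt_bmDbar (e : OrthonormalBasis (Fin (m + 1)) ℂ (Cn m)) (w : Cn m)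
    {q : (Cn m →L[ℝ] ℝ) × Cn m} (hq : q.2 ≠ 0) :
    ContinuousAt (fun q : (Cn m →L[ℝ] ℝ) × Cn m => bmDbar e w q.1 q.2) q := by
  have h0 : (‖q.2‖ : ℂ) ^ 2 ≠ 0 := pow_ne_zero 2 (ofReal_ne_zero.2 (norm_ne_zero_iff.2 hq))
  have h1 : ContinuousAt (fun q : (Cn m →L[ℝ] ℝ) × Cn m => (‖q.2‖ : ℂ) ^ 2) q := by fun_prop
  have h2 := (continuous_bmTop e).continuousAt (x := q)
  have h3 : ContinuousAt (fun q : (Cn m →L[ℝ] ℝ) × Cn m => inner ℂ w q.2) q := by fun_prop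
  have h4 : ContinuousAt (fun q : (Cn m →L[ℝ] ℝ) × Cn m => bmTop e q.1 w) q :=
    ((continuous_bmTop e).comp (continuous_fst.prodMk continuous_const)).continuousAt
  exact (((continuousAt_const.mul ((h1.inv₀ h0).pow m)).mul
    (((h1.mul h1).inv₀ (mul_ne_zero h0 h0)).mul h3)).mul h2).sub (((h1.inv₀ h0).pow _).mul h4)

theorem continuousAt_conormalCLM {φ : Cn m → ℝ} {ζ : Cn m} (h : ContDiffAt ℝ 3 φ ζ)
    (h0 : fderiv ℝ φ ζ ≠ 0) : ContinuousAt (conormalCLM φ) ζ :=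
  ((continuousAt_fderiv h).norm.inv₀ (norm_ne_zero_iff.2 h0)).smul (continuousAt_fderiv h)

theorem cfFactor_ne_zero (m : ℕ) : cfFactor m ≠ 0 := by
  have : (2 * Real.pi * I : ℂ) ≠ 0 :=
    mul_ne_zero (mul_ne_zero two_ne_zero (ofReal_ne_zero.2 Real.pi_ne_zero)) I_ne_zero
  rw [cfFactor]
  exact mul_ne_zero (one_div_ne_zero (pow_ne_zero _ this))
    (one_div_ne_zero (pow_ne_zero _ two_ne_zero))

/-! ### The surface measure of small balls -/

/-- The orthogonal projection to the real tangent space at `p`, in coordinates. -/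
def tangentProj (e : OrthonormalBasis (Fin (m + 1)) ℂ (Cn m)) (p ζ : Cn m) :
    Option (Fin m × Fin 2) → ℝ
  | none => (inner ℂ (e 0) (ζ - p)).im
  | some (j, a) => ![(inner ℂ (e j.succ) (ζ - p)).re, (inner ℂ (e j.succ) (ζ - p)).im] a

theorem lipschitzWith_tangentProj (e : OrthonormalBasis (Fin (m + 1)) ℂ (Cn m)) (p : Cn m) :
    LipschitzWith 1 (tangentProj e p) := by
  refine LipschitzWith.mk_one fun x y => ?_
  refine (dist_pi_le_iff dist_nonneg).2 fun i => ?_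
  have hin : ∀ j, ‖inner ℂ (e j) (x - p) - inner ℂ (e j) (y - p)‖ ≤ dist x y := fun j => by
    rw [← inner_sub_right, sub_sub_sub_cancel_right, dist_eq_norm]
    exact norm_inner_basis_le e j _
  match i with
  | none =>
    rw [Real.dist_eq]
    exact (abs_im_le_norm _).trans (hin 0)
  | some (j, 0) =>
    rw [Real.dist_eq]
    exact (abs_re_le_norm _).trans (hin j.succ)
  | some (j, 1) =>
    rw [Real.dist_eq]
    exact (abs_im_le_norm _).trans (hin j.succ)

/-- Every tuple of tangential coordinates is attained, by a vector of comparable norm. -/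
theorem exists_tangentProj_eq (e : OrthonormalBasis (Fin (m + 1)) ℂ (Cn m)) (p : Cn m) {s : ℝ}
    {y : Option (Fin m × Fin 2) → ℝ} (hy : ∀ i, |y i| ≤ s) :
    ∃ v : Cn m, ‖v‖ ≤ (2 * m + 1) * s ∧ (inner ℂ (e 0) v).re = 0 ∧
      ∀ t : ℝ, tangentProj e p (p + v + t • e 0) = y := by
  set q : Fin (m + 1) → ℂ := Fin.cons (y none * I) fun j => y (some (j, 0)) + y (some (j, 1)) * I
    with hq
  set v : Cn m := ∑ i, q i • e i with hv
  have hin : ∀ i, inner ℂ (e i) v = q i := fun i => e.orthonormal.inner_right_fintype q i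
  have hq0 : q 0 = y none * I := by rw [hq, Fin.cons_zero]
  have hqs : ∀ j : Fin m, q j.succ = y (some (j, 0)) + y (some (j, 1)) * I := fun j => by
    rw [hq, Fin.cons_succ]
  refine ⟨v, ?_, ?_, fun t => ?_⟩
  · refine (norm_sum_le _ _).trans ?_
    simp only [norm_smul, e.norm_eq_one, mul_one]
    rw [Fin.sum_univ_succ]
    have h1 : ‖q 0‖ ≤ s := by
      rw [hq0, norm_mul, norm_I, mul_one, norm_real]
      exact hy none
    have h2 : ∀ j : Fin m, ‖q j.succ‖ ≤ 2 * s := fun j => by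
      rw [hqs]
      refine (norm_add_le _ _).trans ?_
      rw [norm_mul, norm_I, mul_one, norm_real, norm_real, Real.norm_eq_abs, Real.norm_eq_abs]
      linarith [hy (some (j, 0)), hy (some (j, 1))]
    have h3 := Finset.sum_le_sum fun j (_ : j ∈ Finset.univ) => h2 j
    rw [Finset.sum_const, Finset.card_univ, Fintype.card_fin, nsmul_eq_mul] at h3
    linarith
  · rw [hin, hq0]; simp
  · have h1 : p + v + t • e 0 - p = v + (t : ℂ) • e 0 := by
      rw [← Complex.coe_smul]; abel
    have h2 : ∀ j : Fin m, inner ℂ (e j.succ) (p + v + t • e 0 - p) =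
        y (some (j, 0)) + y (some (j, 1)) * I := fun j => by
      rw [h1, inner_add_right, inner_smul_right, e.inner_eq_zero (Fin.succ_ne_zero j), mul_zero,
        add_zero, hin, hqs]
    funext i
    match i with
    | none =>
      rw [tangentProj, h1, inner_add_right, inner_smul_right, inner_e_self, hin, hq0]
      simp
    | some (j, 0) => rw [tangentProj, h2]; simp
    | some (j, 1) => rw [tangentProj, h2]; simp

namespace PscData

variable {D U : Set (Cn m)} {r : Cn m → ℝ} {ρ A c : ℝ}

/-- The sign of the defining function near a boundary point, in the normal directions. -/
theorem abs_sub_le_of_mem_ball (h : PscData D U r ρ A c) {p : Cn m} (hp : p ∈ frontier D)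
    {e : OrthonormalBasis (Fin (m + 1)) ℂ (Cn m)} {a : ℝ} {l : Fin m → ℝ}
    (ad : IsAdapted r p e a l) {v : Cn m} (hv : ‖v‖ < ρ) :
    |r (p + v) - 2 * a * (inner ℂ (e 0) v).re| ≤ A * ‖v‖ ^ 2 ∧
      (p + v ∈ D ↔ r (p + v) < 0) := by
  have hb : p + v ∈ Metric.ball p ρ := mem_ball_iff_norm.2 (by simpa using hv)
  refine ⟨?_, fun hD => ?_, fun hr => ?_⟩
  · have := h.bounds.taylor_zero hp hb
    rwa [h.eq_zero hp, add_sub_cancel_left, fderiv_normal ad, sub_zero] at this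
  · have : p + v ∈ D ∩ U := ⟨hD, h.ball_subset p hp hb⟩
    rw [h.isDef.inter_eq] at this
    exact this.2
  · have : p + v ∈ {z ∈ U | r z < 0} := ⟨h.ball_subset p hp hb, hr⟩
    rw [← h.isDef.inter_eq] at this
    exact this.1

/-- Above each point of the cube, a segment in the direction of the real normal runs from inside D
to outside, because r differs from its linear part by less than cR/2. The boundary point it meets
has the prescribed tangential coordinates. -/
theorem cube_subset_image_tangentProj (h : PscData D U r ρ A c) {p : Cn m} (hp : p ∈ frontier D)
    {e : OrthonormalBasis (Fin (m + 1)) ℂ (Cn m)} {a : ℝ} {l : Fin m → ℝ}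
    (ad : IsAdapted r p e a l) {R : ℝ} (hR : 0 < R) (hRρ : R < ρ) (hRA : 2 * A * R < c) :
    Icc (fun _ => -(R / (2 * (2 * m + 1)))) (fun _ => R / (2 * (2 * m + 1))) ⊆
      tangentProj e p '' (frontier D ∩ Metric.closedBall p R) := by
  intro y hy
  have hs : (2 * m + 1) * (R / (2 * (2 * m + 1))) = R / 2 := by field_simp
  obtain ⟨v, hv, hv0, hvy⟩ := exists_tangentProj_eq e p
    (fun i => abs_le.2 ⟨hy.1 i, hy.2 i⟩ : ∀ i, |y i| ≤ R / (2 * (2 * m + 1)))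
  rw [hs] at hv
  have hca := h.bounds.le_two_mul hp ad
  have hA := h.bounds.nonneg
  have hnorm : ∀ t : ℝ, |t| ≤ R / 2 → ‖v + t • e 0‖ ≤ R := fun t ht => by
    refine (norm_add_le _ _).trans ?_
    rw [norm_smul, e.norm_eq_one, mul_one, Real.norm_eq_abs]
    linarith
  have hre : ∀ t : ℝ, (inner ℂ (e 0) (v + t • e 0)).re = t := fun t => by
    rw [← Complex.coe_smul, inner_add_right, inner_smul_right, inner_e_self, add_re, hv0]
    simp
  have hAR : ∀ t : ℝ, |t| ≤ R / 2 → A * ‖v + t • e 0‖ ^ 2 < c * R / 2 := fun t ht => by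
    calc A * ‖v + t • e 0‖ ^ 2 ≤ A * R ^ 2 := by
          gcongr
          exact hnorm t ht
      _ < c * R / 2 := by nlinarith
  have habs : |R / 2| ≤ R / 2 := (abs_of_pos (half_pos hR)).le
  have habs' : |-(R / 2)| ≤ R / 2 := by rw [abs_neg]; exact habs
  obtain ⟨h1, h1'⟩ := h.abs_sub_le_of_mem_ball hp ad ((hnorm _ habs).trans_lt hRρ)
  obtain ⟨h2, h2'⟩ := h.abs_sub_le_of_mem_ball hp ad ((hnorm _ habs').trans_lt hRρ)
  rw [hre] at h1 h2
  have g1 := (abs_le.1 h1).1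
  have g2 := (abs_le.1 h2).2
  have g3 := hAR _ habs
  have g4 := hAR _ habs'
  have hout : p + (v + (R / 2) • e 0) ∉ D := fun hD => by
    have := h1'.1 hD
    nlinarith
  have hinn : p + (v + (-(R / 2)) • e 0) ∈ D := h2'.2 (by nlinarith)
  obtain ⟨x, hxs, hxf⟩ := exists_mem_segment_frontier hinn hout
  have hxb : x ∈ Metric.closedBall p R :=
    (convex_closedBall p R).segment_subset
      (mem_closedBall_iff_norm.2 (by rw [add_sub_cancel_left]; exact hnorm _ habs'))
      (mem_closedBall_iff_norm.2 (by rw [add_sub_cancel_left]; exact hnorm _ habs)) hxs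
  refine ⟨x, ⟨hxf, hxb⟩, ?_⟩
  obtain ⟨s, t, -, -, hst, rfl⟩ := hxs
  obtain rfl : s = 1 - t := by linarith
  -- The point with parameter `t` on the segment has normal coordinate (1 - t)(-R/2) + t R/2.
  rw [← hvy ((2 * t - 1) * (R / 2))]
  congr 1
  module

theorem exists_le_measure_closedBall (h : PscData D U r ρ A c) {p : Cn m} (hp : p ∈ frontier D) :
    ∃ κ > (0 : ℝ), ∃ R₀ > (0 : ℝ), ∀ R, 0 < R → R < R₀ →
      κ * R ^ (2 * m + 1) ≤ (μHE[2 * m + 1]).real (frontier D ∩ Metric.closedBall p R) := by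
  obtain ⟨e, a, l, ad⟩ := exists_isAdapted h.isDef h.psc hp
  have hA := h.bounds.one_le
  have hc := h.bounds.c_pos
  have hH : 0 < (hausdorffFactor (2 * m + 1) : ℝ) :=
    lt_of_le_of_ne (NNReal.coe_nonneg _) (NNReal.coe_ne_zero.2 (hausdorffFactor_ne_zero _)).symm
  refine ⟨hausdorffFactor (2 * m + 1) * ((2 * m + 1 : ℝ)⁻¹) ^ (2 * m + 1), by positivity,
    min ρ (c / (2 * A)), lt_min h.bounds.rho_pos (by positivity), fun R hR hR₀ => ?_⟩
  have hRA : 2 * A * R < c := by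
    have := hR₀.trans_le (min_le_right _ _)
    rwa [lt_div_iff₀ (by positivity), mul_comm] at this
  have h1 := volume_image_le_euclideanHausdorffMeasure (d := 2 * m + 1) card_index
    ((lipschitzWith_tangentProj e p).lipschitzOnWith (s := frontier D ∩ Metric.closedBall p R))
  have h2 := measure_mono (μ := volume) (h.cube_subset_image_tangentProj hp ad hR
    (hR₀.trans_le (min_le_left _ _)) hRA)
  rw [Real.volume_Icc_pi, Finset.prod_const, Finset.card_univ, card_index,
    ← ENNReal.ofReal_pow (by
      have : 0 ≤ R / (2 * (2 * m + 1)) := by positivity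
      linarith)] at h2
  have h3 : (hausdorffFactor (2 * m + 1) : ENNReal) * ENNReal.ofReal
      ((R / (2 * (2 * m + 1)) - -(R / (2 * (2 * m + 1)))) ^ (2 * m + 1)) ≤
      μHE[2 * m + 1] (frontier D ∩ Metric.closedBall p R) := le_trans (by gcongr) h1
  have hfin : μHE[2 * m + 1] (frontier D ∩ Metric.closedBall p R) ≠ ⊤ :=
    measure_ne_top_of_subset inter_subset_left h.measure_frontier_ne_top
  have h4 := ENNReal.toReal_mono hfin h3
  rw [ENNReal.toReal_mul, ENNReal.coe_toReal, sub_neg_eq_add,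
    ENNReal.toReal_ofReal (by positivity)] at h4
  refine le_trans (le_of_eq ?_) h4
  rw [mul_assoc, ← mul_pow]
  congr 2
  field_simp
  ring

end PscData

end CauchyFantappie

end

noncomputable section

namespace CauchyFantappie

open MeasureTheory Set Complex

variable {m : ℕ}

/-! ### Sharpness for the Bochner–Martinelli operator -/

/-- The integral of a complex function that is close to a constant on the support of the weight. -/
theorem le_norm_integral_mul {X : Type*} [MeasurableSpace X] {μ : Measure X} {g : X → ℝ}
    {B : X → ℂ} {M : ℂ} (hg : Integrable g μ) (hgB : Integrable (fun x => (g x : ℂ) * B x) μ)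
    (hB : ∀ᵐ x ∂μ, ‖(g x : ℂ) * B x - g x * M‖ ≤ g x * (‖M‖ / 2)) :
    ‖M‖ / 2 * ∫ x, g x ∂μ ≤ ‖∫ x, (g x : ℂ) * B x ∂μ‖ := by
  have h0 : 0 ≤ ∫ x, g x * (‖M‖ / 2) ∂μ :=
    integral_nonneg_of_ae (hB.mono fun x hx => (norm_nonneg _).trans hx)
  have hgc : Integrable (fun x => (g x : ℂ) * M) μ := hg.ofReal.mul_const M
  have h1 : ‖∫ x, ((g x : ℂ) * B x - g x * M) ∂μ‖ ≤ ∫ x, g x * (‖M‖ / 2) ∂μ :=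
    norm_integral_le_of_norm_le (hg.mul_const _) hB
  rw [integral_sub hgB hgc, integral_mul_const, integral_complex_ofReal] at h1
  rw [integral_mul_const] at h1 h0
  have h2 := norm_sub_norm_le (((∫ x, g x ∂μ : ℝ) : ℂ) * M) (∫ x, (g x : ℂ) * B x ∂μ)
  rw [norm_sub_rev, norm_mul, norm_real, Real.norm_eq_abs] at h2
  have h3 : (∫ x, g x ∂μ) * ‖M‖ ≤ |∫ x, g x ∂μ| * ‖M‖ := by
    gcongr
    exact le_abs_self _
  linarith

/-- The tent function of radius `s` centred at `p`. -/
def tent (p : Cn m) (s : ℝ) (ζ : Cn m) : ℝ := max 0 (1 - ‖ζ - p‖ / s)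

theorem continuous_tent (p : Cn m) (s : ℝ) : Continuous (tent p s) := by
  unfold tent
  fun_prop

theorem tent_nonneg (p : Cn m) (s : ℝ) (ζ : Cn m) : 0 ≤ tent p s ζ := le_max_left _ _

theorem tent_le_one (p : Cn m) {s : ℝ} (hs : 0 < s) (ζ : Cn m) : tent p s ζ ≤ 1 :=
  max_le zero_le_one (by
    have : 0 ≤ ‖ζ - p‖ / s := by positivity
    linarith)

theorem tent_eq_zero {p ζ : Cn m} {s : ℝ} (hs : 0 < s) (h : s ≤ ‖ζ - p‖) : tent p s ζ = 0 :=
  max_eq_left (by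
    have : 1 ≤ ‖ζ - p‖ / s := (one_le_div hs).2 h
    linarith)

theorem half_le_tent {p ζ : Cn m} {s : ℝ} (hs : 0 < s) (h : ‖ζ - p‖ ≤ s / 2) :
    1 / 2 ≤ tent p s ζ :=
  le_max_of_le_right (by
    have : ‖ζ - p‖ / s ≤ 1 / 2 := by
      rw [div_le_iff₀ hs]; linarith
    linarith)

theorem not_forall_le_rpow_mul {b C δ d₀ : ℝ} (hb : 0 < b) (hδ : 0 < δ) (hd₀ : 0 < d₀) :
    ¬ ∀ d, 0 < d → d < d₀ → b ≤ C * d ^ δ := fun h => by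
  have h1 : Filter.Tendsto (fun d : ℝ => C * d ^ δ) (nhdsWithin 0 (Ioi 0)) (nhds (C * 0)) := by
    refine Filter.Tendsto.const_mul C ?_
    have := (Real.continuousAt_rpow_const 0 δ (Or.inr hδ.le)).tendsto
    rw [Real.zero_rpow hδ.ne'] at this
    exact this.mono_left nhdsWithin_le_nhds
  have h2 : ∀ᶠ d in nhdsWithin (0 : ℝ) (Ioi 0), b ≤ C * d ^ δ := by
    filter_upwards [Ioo_mem_nhdsGT hd₀] with d hd using h d hd.1 hd.2
  have h3 := ge_of_tendsto h1 h2
  linarith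

namespace PscData

variable {D U : Set (Cn m)} {r : Cn m → ℝ} {ρ A c : ℝ}

theorem c_le (h : PscData D U r ρ A c) : c ≤ A := by
  obtain ⟨p, hp⟩ := h.frontier_nonempty
  exact (h.bounds.lower p hp).trans (h.bounds.bound_one p hp p
    (Metric.mem_ball_self h.bounds.rho_pos))

/-- Points on the inner normal at a boundary point. -/
theorem inner_normal (h : PscData D U r ρ A c) {p : Cn m} (hp : p ∈ frontier D)
    {e : OrthonormalBasis (Fin (m + 1)) ℂ (Cn m)} {a : ℝ} {l : Fin m → ℝ}
    (ad : IsAdapted r p e a l) {d : ℝ} (hd : 0 < d) (hdρ : 2 * d < ρ) (hdA : 2 * A * d < c) :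
    p + (-d) • e 0 ∈ D ∧ Metric.infDist (p + (-d) • e 0) (frontier D) ≤ d ∧
      c / (2 * A) * d ≤ Metric.infDist (p + (-d) • e 0) (frontier D) := by
  have hA := h.bounds.one_le
  have hc := h.bounds.c_pos
  have hca := h.bounds.le_two_mul hp ad
  have hn : ‖(-d) • e 0‖ = d := by
    rw [norm_smul, e.norm_eq_one, mul_one, Real.norm_eq_abs, abs_neg, abs_of_pos hd]
  have hre : (inner ℂ (e 0) ((-d) • e 0)).re = -d := by
    rw [← Complex.coe_smul, inner_smul_right, inner_e_self]; simp
  obtain ⟨h1, h2⟩ := h.abs_sub_le_of_mem_ball hp ad (v := (-d) • e 0) (by rw [hn]; linarith)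
  rw [hre, hn] at h1
  have hr : r (p + (-d) • e 0) ≤ -(c / 2 * d) := by
    have := (abs_le.1 h1).2
    nlinarith
  set z := p + (-d) • e 0 with hz
  have hzp : ‖z - p‖ = d := by rw [hz, add_sub_cancel_left, hn]
  have hcd : 0 < c / 2 * d := by positivity
  refine ⟨h2.2 (by linarith), ?_, ?_⟩
  · have := Metric.infDist_le_dist_of_mem (x := z) hp
    rwa [dist_eq_norm, hzp] at this
  · refine (Metric.le_infDist h.frontier_nonempty).2 fun ζ hζ => ?_
    rw [dist_eq_norm]
    rcases le_or_gt d ‖z - ζ‖ with hle | hlt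
    · refine le_trans ?_ hle
      have : c / (2 * A) ≤ 1 := by
        rw [div_le_one (by positivity)]
        linarith [h.c_le]
      calc c / (2 * A) * d ≤ 1 * d := by gcongr
        _ = d := one_mul d
    · have hζb : ζ ∈ Metric.ball p ρ := mem_ball_iff_norm.2 (by
        have : ζ - p = (z - p) - (z - ζ) := by abel
        rw [this]
        refine (norm_sub_le _ _).trans_lt ?_
        linarith)
      have hzb : z ∈ Metric.ball p ρ := mem_ball_iff_norm.2 (by linarith)
      -- The value -r(z) is at least c d/2, and `r` vanishes at `ζ` and is `A`-Lipschitz, so `ζ`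
      -- cannot be closer to `z` than c d/(2A).
      have h3 := (abs_le.1 (h.bounds.lip_zero hp hζb hzb)).1
      rw [h.eq_zero hζ] at h3
      rw [div_mul_eq_mul_div, div_le_iff₀ (by positivity)]
      linarith

theorem integrableOn_of_continuousOn (h : PscData D U r ρ A c) {E : Type*} [NormedAddCommGroup E]
    {F : Cn m → E} (hF : ContinuousOn F (frontier D)) :
    IntegrableOn F (frontier D) μHE[2 * m + 1] :=
  hF.integrableOn_of_subset_isCompact h.isCompact_frontier isClosed_frontier.measurableSet
    subset_rfl h.measure_frontier_ne_top

theorem le_integral_tent (h : PscData D U r ρ A c) (p : Cn m) {s : ℝ} (hs : 0 < s) :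
    1 / 2 * (μHE[2 * m + 1]).real (frontier D ∩ Metric.closedBall p (s / 2)) ≤
      ∫ ζ in frontier D, tent p s ζ ∂μHE[2 * m + 1] := by
  have hint := h.integrableOn_of_continuousOn (continuous_tent p s).continuousOn
  set S := frontier D ∩ Metric.closedBall p (s / 2) with hS
  have hSm : MeasurableSet S :=
    isClosed_frontier.measurableSet.inter Metric.isClosed_closedBall.measurableSet
  have hfin : μHE[2 * m + 1] S ≠ ⊤ :=
    measure_ne_top_of_subset inter_subset_left h.measure_frontier_ne_top
  calc _ = ∫ _ζ in S, (1 / 2 : ℝ) ∂μHE[2 * m + 1] := by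
        rw [setIntegral_const, smul_eq_mul, mul_comm]
    _ ≤ ∫ ζ in S, tent p s ζ ∂μHE[2 * m + 1] :=
        setIntegral_mono_on (integrableOn_const hfin) (hint.mono_set inter_subset_left) hSm
          fun ζ hζ => half_le_tent hs (mem_closedBall_iff_norm.1 hζ.2)
    _ ≤ _ := setIntegral_mono_set hint (Filter.Eventually.of_forall fun ζ => tent_nonneg p s ζ)
        (Filter.Eventually.of_forall inter_subset_left)

/-- The `∂̄`-derivative of the Bochner–Martinelli transform of a tent function can be as large as the
inverse of the distance to the boundary. -/
theorem exists_le_dbar_genBM (h : PscData D U r ρ A c) {φ : Cn m → ℝ}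
    (hφ : ∀ ζ ∈ frontier D, ContDiffAt ℝ 3 φ ζ) (hφ0 : ∀ ζ ∈ frontier D, fderiv ℝ φ ζ ≠ 0)
    (hν : ∀ ζ ∈ frontier D, ∀ v, conormal φ ζ v = conormal r ζ v) (hm : 1 ≤ m)
    {p : Cn m} (hp : p ∈ frontier D) {e : OrthonormalBasis (Fin (m + 1)) ℂ (Cn m)} {a : ℝ}
    {l : Fin m → ℝ} (ad : IsAdapted r p e a l) :
    ∃ b > (0 : ℝ), ∃ κ > (0 : ℝ), ∃ d₀ > (0 : ℝ), ∀ d, 0 < d → d < d₀ → p + (-d) • e 0 ∈ D →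
      b * d⁻¹ ≤ ‖dbar (cfOperator D φ genBM fun ζ => (tent p (κ * d) ζ : ℂ))
        (p + (-d) • e 0) (e 0)‖ := by
  have hca := h.bounds.le_two_mul hp ad
  have hc := h.bounds.c_pos
  set ν : Cn m → Cn m →L[ℝ] ℝ := conormalCLM φ with hνd
  set M : ℂ := bmDbar e (e 0) (ν p) (e 0) with hM
  have hM0 : M ≠ 0 := by
    rw [hM, bmDbar_self]
    refine mul_ne_zero (Nat.cast_ne_zero.2 (by omega)) (bmTop_normal_ne_zero e
      (b := 2 * a / ‖fderiv ℝ r p‖) ?_ fun v => ?_)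
    · have := norm_ne_zero_iff.2 (h.isDef.fderiv_ne_zero p hp)
      have : 2 * a ≠ 0 := by linarith
      positivity
    · rw [hνd, conormalCLM_apply, hν p hp, conormal, fderiv_normal ad]
      ring
  have he0 : e 0 ≠ 0 := norm_ne_zero_iff.1 (by rw [e.norm_eq_one]; exact one_ne_zero)
  have hνc : ∀ ζ ∈ frontier D, ContinuousAt ν ζ := fun ζ hζ =>
    continuousAt_conormalCLM (hφ ζ hζ) (hφ0 ζ hζ)
  have hcont : ContinuousAt (fun q : Cn m × Cn m => bmDbar e (e 0) (ν q.1) q.2) (p, e 0) :=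
    ContinuousAt.comp (f := fun q : Cn m × Cn m => (ν q.1, q.2)) (x := (p, e 0))
      (continuousAt_bmDbar e (e 0) (q := (ν p, e 0)) he0)
      (ContinuousAt.prodMk (ContinuousAt.comp (f := Prod.fst) (x := (p, e 0)) (hνc p hp)
        continuousAt_fst) continuousAt_snd)
  -- For ζ within κd of p, the rescaled vector (ζ - z)/d differs from `e 0` by (ζ - p)/d and so is
  -- within κ of it. By continuity the rescaled kernel stays within |M|/2 of its nonzero value M on
  -- the support of the tent, which excludes cancellation.
  obtain ⟨κ, hκ, hκB⟩ := Metric.continuousAt_iff.1 hcont (‖M‖ / 2) (by positivity)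
  obtain ⟨κ₀, hκ₀, R₀, hR₀, hmeas⟩ := h.exists_le_measure_closedBall hp
  obtain ⟨Q, hQ⟩ : ∃ Q : ℂ, Q = cfFactor m * ((adaptedBasis e).det realBasis : ℂ) := ⟨_, rfl⟩
  have hQ0 : Q ≠ 0 := hQ ▸ mul_ne_zero (cfFactor_ne_zero m)
    (ofReal_ne_zero.2 (det_adaptedBasis_ne_zero e))
  refine ⟨‖Q‖ * (‖M‖ / 2 * (1 / 2 * (κ₀ * (κ / 2) ^ (2 * m + 1)))), by positivity, κ, hκ,
    min 1 (R₀ / κ), lt_min one_pos (by positivity), fun d hd hd₀ hz => ?_⟩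
  have hd1 : d < 1 := hd₀.trans_le (min_le_left _ _)
  have hdR : κ * d < R₀ := by
    have := hd₀.trans_le (min_le_right _ _)
    rwa [lt_div_iff₀ hκ, mul_comm] at this
  set z := p + (-d) • e 0 with hzd
  set s := κ * d with hs
  have hs0 : 0 < s := by positivity
  have hker := (isSmoothKernel_genBM (Z := closure D) hφ hφ0).integral_properties h.isOpen
    h.isCompact_frontier h.measure_frontier_ne_top
    (f := fun ζ => (tent p s ζ : ℂ)) (continuous_ofReal.comp (continuous_tent p s)).continuousOn
  have hdb : dbar (cfOperator D φ genBM fun ζ => (tent p s ζ : ℂ)) z (e 0) =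
      ∫ ζ in frontier D, (tent p s ζ : ℂ) * dbar (cfKernel φ genBM ζ) z (e 0) ∂μHE[2 * m + 1] :=
    hker.2.2 z hz (e 0)
  set B : Cn m → ℂ := fun ζ => bmDbar e (e 0) (ν ζ) (((d⁻¹ : ℝ) : ℂ) • (ζ - z)) with hB
  have hdd : ((d : ℝ) : ℂ) ≠ 0 := ofReal_ne_zero.2 hd.ne'
  have hdb' : dbar (cfOperator D φ genBM fun ζ => (tent p s ζ : ℂ)) z (e 0) =
      Q * ((d : ℂ) ^ (2 * m + 2))⁻¹ * ∫ ζ in frontier D, (tent p s ζ : ℂ) * B ζ ∂μHE[2 * m + 1] := by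
    rw [hdb, ← integral_const_mul]
    refine setIntegral_congr_fun isClosed_frontier.measurableSet fun ζ hζ => ?_
    have h1 : ζ - z = (d : ℂ) • (((d⁻¹ : ℝ) : ℂ) • (ζ - z)) := by
      rw [smul_smul, ofReal_inv, mul_inv_cancel₀ hdd, one_smul]
    rw [dbar_cfKernel_genBM φ (ne_of_mem_of_mem_frontier h.isOpen hz hζ) e, h1, bmDbar_smul e _ _ hd]
    simp only [hB, hQ]
    ring
  have hBc : ContinuousOn B (frontier D) := fun ζ hζ => by
    have hne : ((d⁻¹ : ℝ) : ℂ) • (ζ - z) ≠ 0 := smul_ne_zero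
      (ofReal_ne_zero.2 (inv_ne_zero hd.ne'))
      (sub_ne_zero.2 (ne_of_mem_of_mem_frontier h.isOpen hz hζ).symm)
    exact (ContinuousAt.comp (f := fun ζ => (ν ζ, ((d⁻¹ : ℝ) : ℂ) • (ζ - z))) (x := ζ)
      (continuousAt_bmDbar e (e 0) hne)
      ((hνc ζ hζ).prodMk (by fun_prop))).continuousWithinAt
  have hlow : ‖M‖ / 2 * ∫ ζ in frontier D, tent p s ζ ∂μHE[2 * m + 1] ≤
      ‖∫ ζ in frontier D, (tent p s ζ : ℂ) * B ζ ∂μHE[2 * m + 1]‖ := by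
    refine le_norm_integral_mul (h.integrableOn_of_continuousOn (continuous_tent p s).continuousOn)
      (h.integrableOn_of_continuousOn
        ((continuous_ofReal.comp (continuous_tent p s)).continuousOn.mul hBc)) ?_
    refine Filter.Eventually.of_forall fun ζ => ?_
    rw [← mul_sub, norm_mul, norm_real, Real.norm_eq_abs, abs_of_nonneg (tent_nonneg p s ζ)]
    rcases le_or_gt s ‖ζ - p‖ with hle | hlt
    · rw [tent_eq_zero hs0 hle, zero_mul, zero_mul]
    · refine mul_le_mul_of_nonneg_left ?_ (tent_nonneg p s ζ)
      have h1 : dist (ζ, ((d⁻¹ : ℝ) : ℂ) • (ζ - z)) (p, e 0) < κ := by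
        rw [Prod.dist_eq]
        refine max_lt ?_ ?_
        · rw [dist_eq_norm]
          refine hlt.trans_le ?_
          rw [hs]
          nlinarith
        · have h2 : ((d⁻¹ : ℝ) : ℂ) • (ζ - z) - e 0 = d⁻¹ • (ζ - p) := by
            have h3 : ζ - z = (ζ - p) + d • e 0 := by rw [hzd]; module
            rw [h3, Complex.coe_smul, smul_add, smul_smul, inv_mul_cancel₀ hd.ne', one_smul,
              add_sub_cancel_right]
          rw [dist_eq_norm, h2, norm_smul, norm_inv, Real.norm_eq_abs, abs_of_pos hd,
            inv_mul_lt_iff₀ hd, mul_comm]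
          exact hlt
      have h2 := hκB h1
      rw [dist_eq_norm] at h2
      exact h2.le
  have htent := h.le_integral_tent p hs0
  have hme := hmeas (s / 2) (half_pos hs0) (by linarith)
  rw [hdb', norm_mul, norm_mul, norm_inv, norm_pow, norm_real, Real.norm_eq_abs, abs_of_pos hd]
  -- The kernel has size d^{-(2m+2)} on a boundary piece of measure about d^{2m+1}, which leaves
  -- d⁻¹.
  calc _ = ‖Q‖ * (d ^ (2 * m + 2))⁻¹ * (‖M‖ / 2 * (1 / 2 * (κ₀ * (s / 2) ^ (2 * m + 1)))) := by
        have h5 : (s / 2) ^ (2 * m + 1) = (κ / 2) ^ (2 * m + 1) * d ^ (2 * m + 1) := by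
          rw [← mul_pow, hs]; ring
        have h6 : (d ^ (2 * m + 2))⁻¹ * d ^ (2 * m + 1) = d⁻¹ := by
          rw [show 2 * m + 2 = (2 * m + 1) + 1 from rfl, pow_succ]
          field_simp
        rw [h5, ← h6]
        ring
    _ ≤ ‖Q‖ * (d ^ (2 * m + 2))⁻¹ * (‖M‖ / 2 *
        ∫ ζ in frontier D, tent p s ζ ∂μHE[2 * m + 1]) := by
        gcongr
        exact le_trans (by gcongr) htent
    _ ≤ _ := by gcongr

/-- In dimension at least two, the Bochner–Martinelli operator satisfies no `∂̄`-estimate of positive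
order. -/
theorem not_dbarEstimate_genBM (h : PscData D U r ρ A c) {φ : Cn m → ℝ}
    (hφ : ∀ ζ ∈ frontier D, ContDiffAt ℝ 3 φ ζ) (hφ0 : ∀ ζ ∈ frontier D, fderiv ℝ φ ζ ≠ 0)
    (hν : ∀ ζ ∈ frontier D, ∀ v, conormal φ ζ v = conormal r ζ v) (hm : 1 ≤ m)
    {δ : ℝ} (hδ : 0 < δ) : ¬ DbarEstimate D (cfOperator D φ genBM) δ := by
  rintro ⟨C, hC⟩
  obtain ⟨p, hp⟩ := h.frontier_nonempty
  obtain ⟨e, a, l, ad⟩ := exists_isAdapted h.isDef h.psc hp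
  obtain ⟨b, hb, κ, hκ, d₀, hd₀, hlow⟩ := h.exists_le_dbar_genBM hφ hφ0 hν hm hp ad
  have hA := h.bounds.one_le
  have hc := h.bounds.c_pos
  -- Lowering δ to at most 1 keeps the exponent δ' - 1 nonpositive, so the lower bound for dist(z,
  -- bD) can be inserted. The estimate weakens in the right direction because this distance is below
  -- 1.
  set δ' := min δ 1 with hδ'
  have hδ'0 : 0 < δ' := lt_min hδ one_pos
  have hδ'1 : δ' - 1 ≤ 0 := sub_nonpos.2 (min_le_right _ _)
  set d₁ := min (min d₀ 1) (min (ρ / 2) (c / (2 * A))) with hd₁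
  have hd₁0 : 0 < d₁ := lt_min (lt_min hd₀ one_pos)
    (lt_min (half_pos h.bounds.rho_pos) (by positivity))
  refine not_forall_le_rpow_mul (C := |C| * (c / (2 * A)) ^ (δ' - 1)) hb hδ'0 hd₁0
    fun d hd hdd => ?_
  have g1 : d < d₀ := hdd.trans_le ((min_le_left _ _).trans (min_le_left _ _))
  have g2 : d < 1 := hdd.trans_le ((min_le_left _ _).trans (min_le_right _ _))
  have g3 : 2 * d < ρ := by
    have := hdd.trans_le ((min_le_right _ _).trans (min_le_left _ _))
    linarith
  have g4 : 2 * A * d < c := by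
    have := hdd.trans_le ((min_le_right _ _).trans (min_le_right _ _))
    rwa [lt_div_iff₀ (by positivity), mul_comm] at this
  obtain ⟨hz, hz1, hz2⟩ := h.inner_normal hp ad hd g3 g4
  set z := p + (-d) • e 0 with hzd
  set t := Metric.infDist z (frontier D) with ht
  have ht0 : 0 < t := h.infDist_pos hz
  have hf : ContinuousOn (fun ζ => (tent p (κ * d) ζ : ℂ)) (frontier D) :=
    (continuous_ofReal.comp (continuous_tent p _)).continuousOn
  have hsup : supNorm D (fun ζ => (tent p (κ * d) ζ : ℂ)) ≤ 1 := by
    refine csSup_le (h.frontier_nonempty.image _) ?_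
    rintro _ ⟨ζ, -, rfl⟩
    simp only [norm_real, Real.norm_eq_abs]
    rw [abs_of_nonneg (tent_nonneg _ _ _)]
    exact tent_le_one p (by positivity) ζ
  have h1 := hC _ hf z hz
  have h2 := (hlow d hd g1 hz).trans (norm_dbar_le_dbarNorm (e.norm_eq_one 0).le)
  have h3 : t ^ (δ - 1) ≤ (c / (2 * A)) ^ (δ' - 1) * d ^ (δ' - 1) := by
    rw [← Real.mul_rpow (by positivity) hd.le]
    refine (Real.rpow_le_rpow_of_exponent_ge ht0 (hz1.trans g2.le)
      (sub_le_sub_right (min_le_left δ 1) 1)).trans ?_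
    exact Real.rpow_le_rpow_of_nonpos (by positivity) hz2 hδ'1
  have h4 : C * supNorm D (fun ζ => (tent p (κ * d) ζ : ℂ)) ≤ |C| * 1 := by
    have := supNorm_nonneg (D := D) (f := fun ζ => (tent p (κ * d) ζ : ℂ))
    calc _ ≤ |C| * supNorm D (fun ζ => (tent p (κ * d) ζ : ℂ)) := by
          gcongr
          exact le_abs_self C
      _ ≤ _ := by gcongr
  have h5 : b * d⁻¹ ≤ |C| * 1 * ((c / (2 * A)) ^ (δ' - 1) * d ^ (δ' - 1)) :=
    h2.trans (h1.trans (mul_le_mul h4 h3 (Real.rpow_nonneg ht0.le _) (by positivity)))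
  rw [← div_eq_mul_inv, div_le_iff₀ hd] at h5
  refine h5.trans (le_of_eq ?_)
  rw [Real.rpow_sub_one hd.ne']
  field_simp

end PscData

end CauchyFantappie

end

/-! ### Proof of the theorem. -/

theorem theorem9 (m : ℕ) (k : ℕ∞) (hk : 3 ≤ k)
    (D U : Set (Cn m)) (φ : Cn m → ℝ)
    (hDo : IsOpen D) (hDc : IsConnected D) (hDb : Bornology.IsBounded D)
    (hφ : IsDefiningFunction k D U φ)
    (hpsc : IsLeviPseudoconvex D φ) :
    (∃ C₀ > (0 : ℝ), ∀ C ≥ C₀, ∃ K₀ > (0 : ℝ), ∀ K ≥ K₀, ∃ ε₀ > (0 : ℝ),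
      ∀ ε : ℝ, 0 < ε → ε ≤ ε₀ → ∀ χ : ℝ → ℝ, IsCutoff ε χ →
        (∀ ζ ∈ frontier D, ∀ z ∈ closure D, z ≠ ζ →
          bigS (modDef φ C) K χ ζ z ≠ 0) ∧
        (∀ f : Cn m → ℂ, ContinuousOn f (frontier D) →
          (∀ z ∈ D, MeasureTheory.IntegrableOn
            (cfIntegrand φ
              (genW (modDef φ C) K χ) f z)
            (frontier D) μHE[2 * m + 1]) ∧
          ContDiffOn ℝ ∞
            (cfOperator D φ
              (genW (modDef φ C) K χ) f) D) ∧
        ∀ δ : ℝ, δ < 2 / 3 →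
          DbarEstimate D
            (cfOperator D φ
              (genW (modDef φ C) K χ)) δ) ∧
    (DbarEstimate D
        (cfOperator D φ genBM) 0 ∧
      (1 ≤ m → ∀ δ : ℝ, 0 < δ →
        ¬ DbarEstimate D
          (cfOperator D φ genBM) δ)) := by
  have hφ3 : ∀ ζ ∈ frontier D, ContDiffAt ℝ 3 φ ζ := fun ζ hζ =>
    contDiffAt_of_isDefiningFunction hk hφ (hφ.frontier_subset hζ)
  have hφ0 : ∀ ζ ∈ frontier D, fderiv ℝ φ ζ ≠ 0 := hφ.fderiv_ne_zero
  have hdata : ∀ C : ℝ, ∃ ρ A c, PscData D U (modDef φ C) ρ A c := fun C => by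
    have hdef := modDef_isDefiningFunction hk hDo hφ C
    obtain ⟨ρ, A, c, hb, hU⟩ := exists_uniformBounds hDb hdef
    exact ⟨ρ, A, c, hDo, hDc.nonempty, hDb, hdef, modDef_isLeviPseudoconvex hk hDo hφ hpsc C, hb, hU⟩
  have hν : ∀ C : ℝ, ∀ ζ ∈ frontier D, ∀ v, conormal φ ζ v = conormal (modDef φ C) ζ v :=
    fun C ζ hζ v => (conormal_modDef hk hDo hφ C hζ v).symm
  -- The threshold 1 for C is arbitrary: the Levi form of r is semidefinite on the complex tangent
  -- space for every C, and the remaining terms are absorbed by K and by |Φ|.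
  refine ⟨⟨1, one_pos, fun C _ => ?_⟩, ?_⟩
  · obtain ⟨ρ, A, c, h⟩ := hdata C
    have hA := h.bounds.one_le
    have hc := h.bounds.c_pos
    -- The cubic budget of `two_re_suppFun_ge`, with a factor 2 to spare. `A` and `c` depend on C
    -- through r.
    refine ⟨3 * A + 24 * A ^ 2 / c + 1, by positivity, fun K hK => ?_⟩
    have hK0 : 0 < K := lt_of_lt_of_le (by positivity) hK
    have hK2 : 3 * A + 24 * A ^ 2 / c + 1 ≤ 2 * K := by linarith
    obtain ⟨ρ', -, hg⟩ := exists_isGoodRadius h.bounds.rho_pos hA hc hK0 (one_pos (α := ℝ))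
    refine ⟨ρ' / 2, half_pos hg.pos, fun ε hε0 hε χ hχ => ⟨fun ζ hζ z hz hne =>
      h.bigS_ne_zero hg hK2 hε hχ hζ hz hne, fun f hf => ?_, fun δ hδ =>
      h.dbarEstimate_genW hg hK2 hε0 hε hχ hφ3 hφ0 (hν C) hδ⟩⟩
    have hker := (h.isSmoothKernel_genW hg hK2 hε hχ hφ3 hφ0).integral_properties h.isOpen
      h.isCompact_frontier h.measure_frontier_ne_top hf
    exact ⟨hker.1, hker.2.1⟩
  -- The Bochner–Martinelli kernel does not involve r; the value C = 1 merely supplies some defining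
  -- function with uniform bounds, whose conormal is that of φ.
  · obtain ⟨ρ, A, c, h⟩ := hdata 1
    exact ⟨h.dbarEstimate_genBM hφ3 hφ0, fun hm δ hδ =>
      h.not_dbarEstimate_genBM hφ3 hφ0 (hν 1) hm hδ⟩
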